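/- **Setting.** Fix a first-order vocabulary (with equality) whose function and predicate symbols are encoded as finite data, a non-empty class $\mathcal S$ of structures with non-empty universe, a countably infinite set of variables, and a constraint language $\mathit{Con}$: a set of first-order formulae (*constraints*) that contains all equations and is closed under the Boolean connectives and under substitution of terms for free variables. $\Gamma\models\varphi$ means that every structure of $\mathcal S$ and every variable assignment satisfying all formulae of $\Gamma$ satisfies $\varphi$; $\mathrm{fv}$ denotes sets of free variables. **Horn clauses.** A Horn clause is $C\wedge B_1\wedge\dots\wedge B_n\to H$ with $C\in\mathit{Con}$, each $B_i$ an application $p(\bar t)$ of an uninterpreted relation symbol to terms, and $H$ such an application or $\mathit{false}$. A syntactic solution of a finite set $\mathcal{HC}$ of clauses maps every $n$-ary relation symbol $p$ to a constraint with free variables among $x_1,\dots,x_n$ such that replacing every $p(\bar t)$ by $\mathit{sol}(p)[\bar t]$ turns each clause into a formula whose universal closure holds in all structures of $\mathcal S$. $\mathcal{HC}$ is *recursion-free* if the relation "$p$ is in the head and $q$ in the body of some clause" is acyclic. A finite recursion-free set is *linear* if each body contains at most one relation symbol application; *body-disjoint* if each relation symbol is in the body of at most one clause and occurs at most once in every clause;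 *tree-like* if it is body-disjoint and each relation symbol is in the head of at most one clause. **Interpolation problems** (all formulae, including the interpolants, are constraints). - *Binary*, $A\wedge B$: find $I$ with $A\models I$, $B\models\neg I$, $\mathrm{fv}(I)\subseteq\mathrm{fv}(A)\cap\mathrm{fv}(B)$. - *Inductive sequence*, $T_1\wedge\dots\wedge T_n$: find $I_0=\mathit{true},I_1,\dots,I_n=\mathit{false}$ with $I_{i-1}\wedge T_i\models I_i$ and $\mathrm{fv}(I_i)\subseteq\mathrm{fv}(T_1,\dots,T_i)\cap\mathrm{fv}(T_{i+1},\dots,T_n)$. - *Tree*: given a finite directed tree $(V,E)$ with node labels $\phi$, find $I:V\to\mathit{Con}$ with $I(\mathrm{root})=\mathit{false}$, $\phi(v)\wedge\bigwedge_{(v,w)\in E}I(w)\models I(v)$, and every variable of $I(v)$ free both in some $\phi(w)$ with $E^*(v,w)$ and in some $\phi(w')$ with $\neg E^*(v,w')$. - *Restricted DAG*: given a finite (weakly) connected DAG $(V,E)$ with nodes $\mathit{en},\mathit{ex}\in V$, node labels $\mathcal L_V$ and edge labels $\mathcal L_E$, find $I:V\to\mathit{Con}$ with $I(\mathit{en})=\mathit{true}$,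 $I(\mathit{ex})=\mathit{false}$, $I(v)\wedge\mathcal L_V(v)\wedge\mathcal L_E(v,w)\models I(w)\wedge\mathcal L_V(w)$ for $(v,w)\in E$, and $\mathrm{fv}(I(v))\subseteq\bigcup_{(a,v)\in E}\mathrm{fv}(\mathcal L_E(a,v))\cap\bigcup_{(v,a)\in E}\mathrm{fv}(\mathcal L_E(v,a))$. - *Disjunctive*: given a formula $\varphi$ built by $\wedge,\vee$ from constraints, and a set $P$ of positions of $\varphi$ lying only underneath these $\wedge,\vee$, find $I:P\to\mathit{Con}$ such that for every $p\in P$ the subformula $\varphi{\downarrow}p$, with the topmost positions of $P$ strictly below $p$ replaced by their $I$-values, entails $I(p)$; $\varphi$ with its topmost positions of $P$ replaced by their $I$-values entails $\mathit{false}$; and $\mathrm{fv}(I(p))\subseteq\mathrm{fv}(\varphi{\downarrow}p)\cap\mathrm{fv}(\varphi[\mathit{true}]_p)$. **Theorem.** Pair the forms of interpolation with fragments of recursion-free Horn clauses as follows: 1. binary interpolation: pairs of clauses $A\to p(\bar x)$, $B\wedge p(\bar x)\to\mathit{false}$, where $\bar x$ lists $\mathrm{fv}(A)\cap\mathrm{fv}(B)$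 without repetition; 2. inductive interpolant sequences: linear tree-like sets; 3. tree interpolants: tree-like sets; 4. restricted DAG interpolants: linear sets; 5. disjunctive interpolants: body-disjoint sets. For each line, the following hold. - *Interpolation to Horn clauses.* There is a polynomial-time computable map $f$ from interpolation problems of the form to sets of clauses in the fragment such that $f(x)$ is syntactically solvable whenever $x$ has an interpolant, and a polynomial-time computable map that turns $x$ and any syntactic solution of $f(x)$ into an interpolant of $x$. - *Horn clauses to interpolation.* There is a polynomial-time computable map $f$ from sets of clauses in the fragment to finite sequences of interpolation problems of the form such that all problems in $f(\mathcal{HC})$ have interpolants whenever $\mathcal{HC}$ is syntactically solvable, and a polynomial-time computable map that turns $\mathcal{HC}$ and any sequence of interpolants for the problems in $f(\mathcal{HC})$ into a syntactic solution of $\mathcal{HC}$. Polynomial time is measured in the size of the input (for the maps on solutions: instance and solution together). -/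

import Mathlib

universe u v w

namespace HornInterp

/-! ### Machine model: programs on binary trees with a step count -/

/-- Finite binary trees: the data that programs work on.  They also serve as the countably
infinite supply of names (of first-order variables, relation symbols and graph nodes). -/
inductive Data : Type
  | nil : Data
  | cons : Data → Data → Data
  deriving DecidableEq

namespace Data

/-- The number of nodes of a tree. -/
def size : Data → ℕ
  | nil => 1
  | cons a b => size a + size b + 1

/-- Unary numerals. -/
def ofNat : ℕ → Data
  | 0 => nil
  | n + 1 => cons nil (ofNat n)

/-- The length of the right spine; a left inverse of `ofNat`. -/
def toNat : Data → ℕ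
  | nil => 0
  | cons _ b => toNat b + 1

def head : Data → Data
  | nil => nil
  | cons a _ => a

def tail : Data → Data
  | nil => nil
  | cons _ b => b

/-- Equality test of the two components of a pair; `nil` stands for "false". -/
def eqTest : Data → Data
  | nil => nil
  | cons a b => if a = b then cons nil nil else nil

/-- Lists as right-nested pairs. -/
def ofList : List Data → Data
  | [] => nil
  | a :: l => cons a (ofList l)

end Data

/-- A first-order functional programming language on binary trees.  A program maps one tree to
one tree.  `call` is a recursive call of the body of the innermost enclosing `fix` (of the whole
program, if there is none). -/
inductive Prog : Type
  | inp : Prog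
  | nil : Prog
  | hd : Prog
  | tl : Prog
  | eq : Prog
  | pair : Prog → Prog → Prog
  | comp : Prog → Prog → Prog
  | ite : Prog → Prog → Prog → Prog
  | fix : Prog → Prog
  | call : Prog

/-- Call-by-value evaluation with cost.  `Run b p x y t`: where `call` refers to `b`, the program
`p` maps the input `x` to the output `y` in time `t`.  An operation that reads a tree is charged
the size of that tree, every other operation one unit.  There is no value when the evaluation does
not terminate. -/
inductive Run : Prog → Prog → Data → Data → ℕ → Prop
  | inp (b x) : Run b Prog.inp x x (x.size + 1)
  | nil (b x) : Run b Prog.nil x Data.nil 1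
  | hd (b x) : Run b Prog.hd x x.head (x.size + 1)
  | tl (b x) : Run b Prog.tl x x.tail (x.size + 1)
  | eq (b x) : Run b Prog.eq x x.eqTest (x.size + 1)
  | pair {b f g x y z s t} : Run b f x y s → Run b g x z t →
      Run b (Prog.pair f g) x (Data.cons y z) (s + t + 1)
  | comp {b f g x y z s t} : Run b f x y s → Run b g y z t →
      Run b (Prog.comp g f) x z (s + t + 1)
  | ite_false {b c f g x y s t} : Run b c x Data.nil s → Run b g x y t →
      Run b (Prog.ite c f g) x y (s + t + 1)
  | ite_true {b c f g x u w y s t} : Run b c x (Data.cons u w) s → Run b f x y t →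
      Run b (Prog.ite c f g) x y (s + t + 1)
  | fix {b p x y t} : Run p p x y t → Run b (Prog.fix p) x y (t + 1)
  | call {b x y t} : Run b b x y t → Run b Prog.call x y (t + 1)

/-- `f` is computed, on the inputs satisfying `dom` and with respect to the encodings `ea` and
`eb`, by a program whose running time is polynomial in the size of the encoded input. -/
def PolyTimeOn {α β : Type*} (dom : α → Prop) (ea : α → Data) (eb : β → Data) (f : α → β) : Prop :=
  ∃ (p : Prog) (q : Polynomial ℕ), ∀ a, dom a →
    ∃ t ≤ q.eval (ea a).size, Run p p (ea a) (eb (f a)) t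

/-! ### Search problems and polynomial reductions -/

/-- A search problem: given an instance, find one of its solutions. -/
structure SearchProblem where
  Inst : Type u
  Ans : Type u
  encInst : Inst → Data
  encAns : Ans → Data
  /-- the well-formed instances -/
  IsInst : Inst → Prop
  /-- `Sol x y`: `y` is a solution of `x` -/
  Sol : Inst → Ans → Prop

/-- Polynomial reduction of a search problem `P` to a search problem `Q`: an instance `x` of `P` is
translated in polynomial time to an instance `f x` of `Q`, which is solvable whenever `x` is, and
every solution of `f x` is translated in polynomial time to a solution of `x`. -/
def PolyReduces (P Q : SearchProblem) : Prop :=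
  ∃ (f : P.Inst → Q.Inst) (g : P.Inst × Q.Ans → P.Ans),
    PolyTimeOn P.IsInst P.encInst Q.encInst f ∧
    PolyTimeOn (fun a => P.IsInst a.1 ∧ Q.Sol (f a.1) a.2)
      (fun a => Data.cons (P.encInst a.1) (Q.encAns a.2)) P.encAns g ∧
    ∀ x, P.IsInst x →
      Q.IsInst (f x) ∧
      ((∃ y, P.Sol x y) → ∃ z, Q.Sol (f x) z) ∧
      ∀ z, Q.Sol (f x) z → P.Sol x (g (x, z))

/-- Polynomial reduction of a search problem `P` to solving a sequence of instances of `Q`. -/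
def PolyReducesToSeq (P Q : SearchProblem) : Prop :=
  ∃ (f : P.Inst → List Q.Inst) (g : P.Inst × List Q.Ans → P.Ans),
    PolyTimeOn P.IsInst P.encInst (fun l => Data.ofList (l.map Q.encInst)) f ∧
    PolyTimeOn (fun a => P.IsInst a.1 ∧ List.Forall₂ Q.Sol (f a.1) a.2)
      (fun a => Data.cons (P.encInst a.1) (Data.ofList (a.2.map Q.encAns))) P.encAns g ∧
    ∀ x, P.IsInst x →
      (∀ q ∈ f x, Q.IsInst q) ∧
      ((∃ y, P.Sol x y) → ∀ q ∈ f x, ∃ z, Q.Sol q z) ∧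
      ∀ zs, List.Forall₂ Q.Sol (f x) zs → P.Sol x (g (x, zs))

/-! ### Constraints -/

section

/-- A structure with non-empty universe, interpreting the vocabulary `L`. -/
structure Interp (L : FirstOrder.Language.{u, v}) where
  U : Type w
  str : L.Structure U
  nonempty : Nonempty U

/-- First-order formulae over `L` (with equality) and the variables `Data`. -/
abbrev Fml (L : FirstOrder.Language.{u, v}) := L.Formula Data

/-- First-order terms over `L` and the variables `Data`. -/
abbrev Trm (L : FirstOrder.Language.{u, v}) := L.Term Data

variable {L : FirstOrder.Language.{u, v}}

/-- The free variables of a formula. -/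
def fv (φ : Fml L) : Set Data := ↑(FirstOrder.Language.BoundedFormula.freeVarFinset φ)

/-- Truth of a formula in a structure under a variable assignment. -/
def Interp.Sat (M : Interp.{u, v, w} L) (φ : Fml L) (a : Data → M.U) : Prop :=
  letI := M.str
  φ.Realize a

/-- Entailment over a class `S` of structures. -/
def Entails (S : Set (Interp.{u, v, w} L)) (Γ : Set (Fml L)) (φ : Fml L) : Prop :=
  ∀ M ∈ S, ∀ a : Data → M.U, (∀ ψ ∈ Γ, M.Sat ψ a) → M.Sat φ a

/-- A constraint language: a set of formulae that has equations and is closed under the Boolean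
connectives (all of them are given by falsity and implication) and under substitution of terms
for free variables. -/
structure ConstraintLanguage (L : FirstOrder.Language.{u, v}) where
  carrier : Set (Fml L)
  falsum_mem : (⊥ : Fml L) ∈ carrier
  imp_mem : ∀ φ ∈ carrier, ∀ ψ ∈ carrier, (φ.imp ψ : Fml L) ∈ carrier
  equal_mem : ∀ s t : Trm L, (s.equal t : Fml L) ∈ carrier
  subst_mem : ∀ φ ∈ carrier, ∀ σ : Data → Trm L,
    (FirstOrder.Language.BoundedFormula.subst φ σ : Fml L) ∈ carrier

/-- An encoding of the symbols of the vocabulary as data. -/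
structure SymbolCoding (L : FirstOrder.Language.{u, v}) where
  func : ∀ n, L.Functions n → Data
  rel : ∀ n, L.Relations n → Data
  func_injective : ∀ n, Function.Injective (func n)
  rel_injective : ∀ n, Function.Injective (rel n)

/-- Look-up in a finite table of formulae (default: falsity). -/
def table {κ : Type*} [DecidableEq κ] (l : List (κ × Fml L)) (k : κ) : Fml L :=
  (l.lookup k).getD ⊥

/-! ### Encoding of syntax -/

/-- Terms with free variables `Data` and bound variables `Fin n`. -/
def encTermAux (c : SymbolCoding L) {n : ℕ} : L.Term (Data ⊕ Fin n) → Data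
  | .var (.inl x) => .cons (.ofNat 0) x
  | .var (.inr k) => .cons (.ofNat 1) (.ofNat k)
  | .func (l := l) f ts =>
      .cons (.ofNat 2) (.cons (c.func l f) (.ofList (List.ofFn fun i => encTermAux c (ts i))))

def encBounded (c : SymbolCoding L) : ∀ {n : ℕ}, L.BoundedFormula Data n → Data
  | _, .falsum => .cons (.ofNat 0) .nil
  | _, .equal s t => .cons (.ofNat 1) (.cons (encTermAux c s) (encTermAux c t))
  | _, .rel (l := l) R ts =>
      .cons (.ofNat 2) (.cons (c.rel l R) (.ofList (List.ofFn fun i => encTermAux c (ts i))))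
  | _, .imp φ ψ => .cons (.ofNat 3) (.cons (encBounded c φ) (encBounded c ψ))
  | _, .all φ => .cons (.ofNat 4) (encBounded c φ)

def encFml (c : SymbolCoding L) (φ : Fml L) : Data := encBounded c φ

def encTrm (c : SymbolCoding L) : Trm L → Data
  | .var x => .cons (.ofNat 0) x
  | .func (l := l) f ts =>
      .cons (.ofNat 2) (.cons (c.func l f) (.ofList (List.ofFn fun i => encTrm c (ts i))))

def encFmlList (c : SymbolCoding L) (l : List (Fml L)) : Data := .ofList (l.map (encFml c))

def encTable (c : SymbolCoding L) {κ : Type*} (e : κ → Data) (l : List (κ × Fml L)) : Data :=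
  .ofList (l.map fun a => .cons (e a.1) (encFml c a.2))

/-! ### Horn clauses -/

/-- Uninterpreted relation symbols, of fixed arity. -/
structure RelSym : Type where
  name : Data
  arity : ℕ
  deriving DecidableEq

/-- An application of a relation symbol to terms. -/
structure Atom (L : FirstOrder.Language.{u, v}) where
  name : Data
  args : List (Trm L)

def Atom.sym (a : Atom L) : RelSym := ⟨a.name, a.args.length⟩

/-- A Horn clause `constraint ∧ body → head`; the head `none` stands for `false`. -/
structure Clause (L : FirstOrder.Language.{u, v}) where
  constraint : Fml L
  body : List (Atom L)
  head : Option (Atom L)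

def Clause.bodySyms (h : Clause L) : List RelSym := h.body.map Atom.sym

def Clause.headSyms (h : Clause L) : List RelSym := h.head.toList.map Atom.sym

/-- `sol` maps every relation symbol of arity `n` to a constraint with free variables among the
formal parameters `x₀, …, xₙ₋₁`, which are the variables `Data.ofNat 0, …, Data.ofNat (n - 1)`. -/
def IsAssignment (Con : ConstraintLanguage L) (sol : RelSym → Fml L) : Prop :=
  ∀ p, sol p ∈ Con.carrier ∧ fv (sol p) ⊆ {x | ∃ i < p.arity, x = Data.ofNat i}

/-- `sol(p)[t̄]` for an atom `p(t̄)`: the terms `t̄` are substituted for the formal parameters. -/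
def Atom.inst (sol : RelSym → Fml L) (a : Atom L) : Fml L :=
  FirstOrder.Language.BoundedFormula.subst (sol a.sym) fun x => a.args.getD x.toNat (FirstOrder.Language.Term.var x)

/-- The instantiation `sol(h)` of a clause. -/
def Clause.inst (sol : RelSym → Fml L) (h : Clause L) : Fml L :=
  FirstOrder.Language.BoundedFormula.imp
    (h.constraint ⊓ (h.body.map (Atom.inst sol)).foldr (· ⊓ ·) ⊤)
    (h.head.elim ⊥ (Atom.inst sol))

/-- `sol` is a syntactic solution of the set of clauses: the universal closure of the instantiation
of every clause holds in every structure of `S`. -/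
def IsSyntacticSolution (S : Set (Interp.{u, v, w} L)) (Con : ConstraintLanguage L)
    (HC : List (Clause L)) (sol : RelSym → Fml L) : Prop :=
  IsAssignment Con sol ∧
    ∀ M ∈ S, ∀ h ∈ HC, ∀ a : Data → M.U, M.Sat (h.inst sol) a

/-- The dependence relation: `p` is in the head and `q` in the body of some clause. -/
def DependsOn (HC : List (Clause L)) (p q : RelSym) : Prop :=
  ∃ h ∈ HC, p ∈ h.headSyms ∧ q ∈ h.bodySyms

def RecursionFree (HC : List (Clause L)) : Prop :=
  ∀ p, ¬ Relation.TransGen (DependsOn HC) p p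

/-! Finite sets of clauses are presented by lists (repetitions count as different clauses). -/

/-- Every body contains at most one relation symbol (one occurrence). -/
def IsLinear (HC : List (Clause L)) : Prop :=
  ∀ h ∈ HC, h.body.length ≤ 1

/-- Every relation symbol is in the body of at most one clause, and at most once in a clause. -/
def IsBodyDisjoint (HC : List (Clause L)) : Prop :=
  HC.Pairwise (fun h h' => ∀ p ∈ h.bodySyms, p ∉ h'.bodySyms) ∧
    ∀ h ∈ HC, (h.headSyms ++ h.bodySyms).Nodup

/-- Every relation symbol is in the head of at most one clause. -/
def IsHeadDisjoint (HC : List (Clause L)) : Prop :=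
  HC.Pairwise fun h h' => ∀ p ∈ h.headSyms, p ∉ h'.headSyms

def IsTreeLike (HC : List (Clause L)) : Prop := IsBodyDisjoint HC ∧ IsHeadDisjoint HC

def IsLinearTreeLike (HC : List (Clause L)) : Prop := IsLinear HC ∧ IsTreeLike HC

/-- A pair of clauses `A → p(x̄)`, `B ∧ p(x̄) → false`, where `x̄` lists the common free variables
of `A` and `B`. -/
def IsInterpolationPair (HC : List (Clause L)) : Prop :=
  ∃ (A B : Fml L) (p : Data) (xs : List Data), xs.Nodup ∧ {x | x ∈ xs} = fv A ∩ fv B ∧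
    HC = [⟨A, [], some ⟨p, xs.map FirstOrder.Language.Term.var⟩⟩,
          ⟨B, [⟨p, xs.map FirstOrder.Language.Term.var⟩], none⟩]

def encAtom (c : SymbolCoding L) (a : Atom L) : Data :=
  .cons a.name (.ofList (a.args.map (encTrm c)))

def encClause (c : SymbolCoding L) (h : Clause L) : Data :=
  .cons (encFml c h.constraint)
    (.cons (.ofList (h.body.map (encAtom c))) (.ofList (h.head.toList.map (encAtom c))))

/-- Syntactic solving of finite recursion-free sets of Horn clauses in the given fragment.  A
solution is presented as a finite table. -/
def hornSolving (c : SymbolCoding L) (S : Set (Interp.{u, v, w} L)) (Con : ConstraintLanguage L)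
    (fragment : List (Clause L) → Prop) : SearchProblem where
  Inst := List (Clause L)
  Ans := List (RelSym × Fml L)
  encInst HC := .ofList (HC.map (encClause c))
  encAns := encTable c fun p => .cons p.name (.ofNat p.arity)
  IsInst HC := (∀ h ∈ HC, h.constraint ∈ Con.carrier) ∧ RecursionFree HC ∧ fragment HC
  Sol HC sol := IsSyntacticSolution S Con HC (table sol)

/-! ### Forms of Craig interpolation -/

/-- Binary interpolation: a problem `A ∧ B` and its Craig interpolants. -/
def binaryInterpolation (c : SymbolCoding L) (S : Set (Interp.{u, v, w} L))
    (Con : ConstraintLanguage L) : SearchProblem where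
  Inst := Fml L × Fml L
  Ans := Fml L
  encInst P := .cons (encFml c P.1) (encFml c P.2)
  encAns := encFml c
  IsInst P := P.1 ∈ Con.carrier ∧ P.2 ∈ Con.carrier
  Sol P I := I ∈ Con.carrier ∧ Entails S {P.1} I ∧ Entails S {P.2} (FirstOrder.Language.BoundedFormula.not I) ∧
    fv I ⊆ fv P.1 ∩ fv P.2

/-- The free variables of a list of formulae. -/
def fvs (l : List (Fml L)) : Set Data := {x | ∃ φ ∈ l, x ∈ fv φ}

/-- Inductive sequences of interpolants `I₀, …, Iₙ` for `T₁ ∧ ⋯ ∧ Tₙ`. -/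
def sequenceInterpolation (c : SymbolCoding L) (S : Set (Interp.{u, v, w} L))
    (Con : ConstraintLanguage L) : SearchProblem where
  Inst := List (Fml L)
  Ans := List (Fml L)
  encInst := encFmlList c
  encAns := encFmlList c
  IsInst T := ∀ φ ∈ T, φ ∈ Con.carrier
  Sol T I := I.length = T.length + 1 ∧ (∀ φ ∈ I, φ ∈ Con.carrier) ∧
    I.getD 0 ⊥ = ⊤ ∧ I.getD T.length ⊥ = ⊥ ∧
    (∀ i < T.length, Entails S {I.getD i ⊥, T.getD i ⊥} (I.getD (i + 1) ⊥)) ∧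
    ∀ i ≤ T.length, fv (I.getD i ⊥) ⊆ fvs (T.take i) ∩ fvs (T.drop i)

/-- A finite directed graph with a root and nodes labelled by formulae. -/
structure TreeProblem (L : FirstOrder.Language.{u, v}) where
  nodes : List (Data × Fml L)
  edges : List (Data × Data)
  root : Data

namespace TreeProblem

def V (P : TreeProblem L) : List Data := P.nodes.map Prod.fst

/-- `w` is a direct child of `v`. -/
def E (P : TreeProblem L) (v w : Data) : Prop := (v, w) ∈ P.edges

/-- `w` is a descendant of `v`, or `v` itself. -/
def Below (P : TreeProblem L) (v w : Data) : Prop := Relation.ReflTransGen P.E v w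

def label (P : TreeProblem L) (v : Data) : Fml L := table P.nodes v

/-- The graph is a directed tree: no edge enters the root, every other node has exactly one parent
and every node is reachable from the root. -/
def IsTree (P : TreeProblem L) : Prop :=
  P.V.Nodup ∧ P.edges.Nodup ∧ (∀ v w, P.E v w → v ∈ P.V ∧ w ∈ P.V) ∧
    P.root ∈ P.V ∧ (∀ v, ¬ P.E v P.root) ∧ (∀ w ∈ P.V, w ≠ P.root → ∃! v, P.E v w) ∧
    ∀ w ∈ P.V, P.Below P.root w

structure IsInterpolant (S : Set (Interp.{u, v, w} L)) (Con : ConstraintLanguage L)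
    (P : TreeProblem L) (I : Data → Fml L) : Prop where
  mem : ∀ v ∈ P.V, I v ∈ Con.carrier
  root : I P.root = ⊥
  entails : ∀ v ∈ P.V, Entails S ({P.label v} ∪ {ψ | ∃ w, P.E v w ∧ ψ = I w}) (I v)
  vars : ∀ v ∈ P.V, ∀ x ∈ fv (I v),
    (∃ w ∈ P.V, P.Below v w ∧ x ∈ fv (P.label w)) ∧
      ∃ w ∈ P.V, ¬ P.Below v w ∧ x ∈ fv (P.label w)

end TreeProblem

/-- Tree interpolation. -/
def treeInterpolation (c : SymbolCoding L) (S : Set (Interp.{u, v, w} L))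
    (Con : ConstraintLanguage L) : SearchProblem where
  Inst := TreeProblem L
  Ans := List (Data × Fml L)
  encInst P := .cons (encTable c id P.nodes)
    (.cons (.ofList (P.edges.map fun e => .cons e.1 e.2)) P.root)
  encAns := encTable c id
  IsInst P := P.IsTree ∧ ∀ v ∈ P.V, P.label v ∈ Con.carrier
  Sol P I := P.IsInterpolant S Con (table I)

/-- A finite directed graph with an entry and an exit node and with nodes and edges labelled by
formulae. -/
structure DagProblem (L : FirstOrder.Language.{u, v}) where
  nodes : List (Data × Fml L)
  edges : List ((Data × Data) × Fml L)
  en : Data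
  ex : Data

namespace DagProblem

def V (P : DagProblem L) : List Data := P.nodes.map Prod.fst

def E (P : DagProblem L) (v w : Data) : Prop := (v, w) ∈ P.edges.map Prod.fst

def labelV (P : DagProblem L) (v : Data) : Fml L := table P.nodes v

def labelE (P : DagProblem L) (v w : Data) : Fml L := table P.edges (v, w)

/-- The graph is acyclic and (weakly) connected, and it contains the entry and the exit node. -/
def IsConnectedDag (P : DagProblem L) : Prop :=
  P.V.Nodup ∧ (P.edges.map Prod.fst).Nodup ∧ (∀ v w, P.E v w → v ∈ P.V ∧ w ∈ P.V) ∧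
    P.en ∈ P.V ∧ P.ex ∈ P.V ∧ (∀ v, ¬ Relation.TransGen P.E v v) ∧
    ∀ v ∈ P.V, ∀ w ∈ P.V, Relation.EqvGen P.E v w

/-- Restricted DAG interpolants. -/
structure IsInterpolant (S : Set (Interp.{u, v, w} L)) (Con : ConstraintLanguage L)
    (P : DagProblem L) (I : Data → Fml L) : Prop where
  mem : ∀ v ∈ P.V, I v ∈ Con.carrier
  entry : I P.en = ⊤
  exit : I P.ex = ⊥
  entails : ∀ v w, P.E v w →
    Entails S {I v ⊓ P.labelV v ⊓ P.labelE v w} (I w ⊓ P.labelV w)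
  vars : ∀ v ∈ P.V, ∀ x ∈ fv (I v),
    (∃ a, P.E a v ∧ x ∈ fv (P.labelE a v)) ∧ ∃ a, P.E v a ∧ x ∈ fv (P.labelE v a)

end DagProblem

/-- Restricted DAG interpolation. -/
def dagInterpolation (c : SymbolCoding L) (S : Set (Interp.{u, v, w} L))
    (Con : ConstraintLanguage L) : SearchProblem where
  Inst := DagProblem L
  Ans := List (Data × Fml L)
  encInst P := .cons (encTable c id P.nodes)
    (.cons (encTable c (fun e => .cons e.1 e.2) P.edges) (.cons P.en P.ex))
  encAns := encTable c id
  IsInst P := P.IsConnectedDag ∧ (∀ v ∈ P.V, P.labelV v ∈ Con.carrier) ∧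
    ∀ v w, P.E v w → P.labelE v w ∈ Con.carrier
  Sol P I := P.IsInterpolant S Con (table I)

/-- And/or-trees: formulae built from constraints by conjunction and disjunction, in which some of
the positions are selected, by giving them a name. -/
inductive AndOr (L : FirstOrder.Language.{u, v}) where
  | leaf : Option Data → Fml L → AndOr L
  | and : Option Data → AndOr L → AndOr L → AndOr L
  | or : Option Data → AndOr L → AndOr L → AndOr L

namespace AndOr

/-- The name of the topmost position, if it is selected. -/
def mark : AndOr L → Option Data
  | leaf m _ => m
  | and m _ _ => m
  | or m _ _ => m

/-- The subformulae at all positions. -/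
def subs : AndOr L → List (AndOr L)
  | leaf m φ => [leaf m φ]
  | and m s t => and m s t :: (subs s ++ subs t)
  | or m s t => or m s t :: (subs s ++ subs t)

/-- The names of the selected positions. -/
def marks (t : AndOr L) : List Data := t.subs.filterMap mark

/-- The constraints at the leaves. -/
def leaves : AndOr L → List (Fml L)
  | leaf _ φ => [φ]
  | and _ s t => leaves s ++ leaves t
  | or _ s t => leaves s ++ leaves t

def vars (t : AndOr L) : Set Data := fvs t.leaves

/-- The formula in which the topmost selected positions are replaced by their labels in `I`. -/
def plug (I : Data → Fml L) : AndOr L → Fml L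
  | leaf m φ => m.elim φ I
  | and m s t => m.elim (plug I s ⊓ plug I t) I
  | or m s t => m.elim (plug I s ⊔ plug I t) I

/-- The same replacement for the topmost selected positions strictly below the root. -/
def plugBelow (I : Data → Fml L) : AndOr L → Fml L
  | leaf _ φ => φ
  | and _ s t => plug I s ⊓ plug I t
  | or _ s t => plug I s ⊔ plug I t

/-- Replacement of the subformula at the position `p` by `true`. -/
def cut (p : Data) : AndOr L → AndOr L
  | leaf m φ => if m = some p then leaf none ⊤ else leaf m φ
  | and m s t => if m = some p then leaf none ⊤ else and m (cut p s) (cut p t)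
  | or m s t => if m = some p then leaf none ⊤ else or m (cut p s) (cut p t)

/-- Disjunctive interpolants: one label for every selected position, such that every selected
subformula, with the labels of its direct selected descendants in place, entails its own label;
the whole formula, with the topmost labels in place, is unsatisfiable; and a label only has
variables common to its subformula and the rest of the formula. -/
structure IsInterpolant (S : Set (Interp.{u, v, w} L)) (Con : ConstraintLanguage L)
    (φ : AndOr L) (I : Data → Fml L) : Prop where
  mem : ∀ p ∈ φ.marks, I p ∈ Con.carrier
  entails : ∀ s ∈ φ.subs, ∀ p, s.mark = some p → Entails S {s.plugBelow I} (I p)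
  top : Entails S {φ.plug I} ⊥
  vars : ∀ s ∈ φ.subs, ∀ p, s.mark = some p → fv (I p) ⊆ s.vars ∩ (φ.cut p).vars

def encMark (m : Option Data) : Data := .ofList m.toList

def enc (c : SymbolCoding L) : AndOr L → Data
  | leaf m φ => .cons (.ofNat 0) (.cons (encMark m) (encFml c φ))
  | and m s t => .cons (.ofNat 1) (.cons (encMark m) (.cons (enc c s) (enc c t)))
  | or m s t => .cons (.ofNat 2) (.cons (encMark m) (.cons (enc c s) (enc c t)))

end AndOr

/-- Disjunctive interpolation. -/
def disjunctiveInterpolation (c : SymbolCoding L) (S : Set (Interp.{u, v, w} L))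
    (Con : ConstraintLanguage L) : SearchProblem where
  Inst := AndOr L
  Ans := List (Data × Fml L)
  encInst := AndOr.enc c
  encAns := encTable c id
  IsInst φ := φ.marks.Nodup ∧ ∀ ψ ∈ φ.leaves, ψ ∈ Con.carrier
  Sol φ I := φ.IsInterpolant S Con (table I)

end

end HornInterp

open HornInterp

/-! An interpolant and a solution of Horn clauses are objects of the same kind: a family of
formulae, linked by entailments, with a bound on the free variables of each member. The proof makes
this literal through an intermediate problem, the solving of flat clauses (`Flat`, `flatSolving`).
There every relation symbol carries a fixed list of argument variables, a solution assigns to it a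
constraint over these variables, and validity of a clause is an entailment without any substitution.

From interpolation to clauses: every place that needs an interpolant becomes a symbol, the variables
allowed in the interpolant become its arguments, and every required entailment becomes a clause
(`sequence_reduces_flat`, `tree_reduces_flat`, `dag_reduces_flat`, `disjunctive_reduces_flat`).
`flat_reduces_horn` then exchanges argument variables for formal parameters.

From clauses to interpolation: `horn_reduces_normal` normalises the clauses. Arguments of atoms are
moved into equations with fresh argument variables, the remaining variables of different clauses are
separated (`Flat.Apart`), and trivial clauses make every symbol occur in a head and in a body
(`Flat.Complete`). The variables common to the two sides of a symbol are then exactly its argument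
variables. On the one hand, each argument variable occurs in every clause that contains the symbol,
hence on both sides. On the other hand, a variable shared by two clauses is an argument of a symbol
that they share (`Flat.Apart.local`), and the shape of the fragment leaves only the symbol in
question.

Normalised clauses are next read as interpolation problems: chains of clauses as sequences
(`flat_reduces_sequence`), the clauses below one with head `false` as a tree (`flat_reduces_tree`),
linear clauses as a graph with nodes for symbols and for clauses (`flat_reduces_dag`), and
body-disjoint clauses as the and/or-tree obtained by unfolding them (`flat_reduces_disjunctive`).
The unfolding stays of polynomial size because a symbol occurs in one body only, so no clause is
copied twice (`Flat.esize_unfolding_le`). The binary form needs no normalisation, since its pairs of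
clauses already have the common variables as arguments.

Polynomial running time is handled by a class `PT` of functions that is closed under composition.
Its basic recursion principle is `PT.binrec`; folds over lists, traversals of formulae (`PT.walk`)
and traversals of and/or-trees are derived from it. -/

namespace HornInterp
open FirstOrder Language



/-! ### Polynomially bounded functions -/

/-- Types whose elements are presented as data. -/
class Enc (α : Type*) where
  enc : α → Data

open HornInterp.Enc (enc)

/-- The size of the encoding. -/
def esize {α : Type*} [Enc α] (a : α) : ℕ := (enc a).size

theorem Data.size_pos (d : Data) : 0 < d.size := by cases d <;> simp [Data.size]

theorem esize_pos {α : Type*} [Enc α] (a : α) : 0 < esize a := Data.size_pos _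

/-- Functions that are bounded by a polynomial in the size of the encoded argument. -/
def PB {α : Type*} [Enc α] (f : α → ℕ) : Prop :=
  ∃ q : Polynomial ℕ, ∀ a, f a ≤ q.eval (esize a)

/-- The coefficients are natural numbers, so every monomial is monotone. -/
theorem eval_mono (q : Polynomial ℕ) {m n : ℕ} (h : m ≤ n) : q.eval m ≤ q.eval n := by
  simp only [Polynomial.eval_eq_sum]
  exact Finset.sum_le_sum fun i _ => Nat.mul_le_mul_left _ (Nat.pow_le_pow_left h _)

section PB
variable {α β : Type*} [Enc α] [Enc β] {f g : α → ℕ}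

theorem PB.mono (hg : PB g) (h : ∀ a, f a ≤ g a) : PB f := by
  obtain ⟨q, hq⟩ := hg
  exact ⟨q, fun a => (h a).trans (hq a)⟩

theorem PB.const (n : ℕ) : PB fun _ : α => n := ⟨Polynomial.C n, fun a => by simp⟩

theorem PB.esize : PB fun a : α => esize a := ⟨Polynomial.X, fun a => by simp⟩

theorem PB.add (hf : PB f) (hg : PB g) : PB fun a => f a + g a := by
  obtain ⟨p, hp⟩ := hf
  obtain ⟨q, hq⟩ := hg
  exact ⟨p + q, fun a => by simpa using add_le_add (hp a) (hq a)⟩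

theorem PB.mul (hf : PB f) (hg : PB g) : PB fun a => f a * g a := by
  obtain ⟨p, hp⟩ := hf
  obtain ⟨q, hq⟩ := hg
  exact ⟨p * q, fun a => by simpa using Nat.mul_le_mul (hp a) (hq a)⟩

theorem PB.eval (q : Polynomial ℕ) (hf : PB f) : PB fun a => q.eval (f a) := by
  obtain ⟨p, hp⟩ := hf
  exact ⟨q.comp p, fun a => by simpa using eval_mono q (hp a)⟩

/-- Only the size of the encoding of `h a` matters, so `h` need not be computable at all. -/
theorem PB.comp_of_le {k : β → ℕ} (hk : PB k) {h : α → β} (hf : PB f)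
    (hh : ∀ a, HornInterp.esize (h a) ≤ f a) : PB fun a => k (h a) := by
  obtain ⟨q, hq⟩ := hk
  exact (PB.eval q hf).mono fun a => (hq _).trans (eval_mono q (hh a))

end PB

/-! ### Polynomial-time functions -/

/-- The output of a program is not larger than its running time. -/
theorem Run.size_le {b p x y t} (h : Run b p x y t) : y.size ≤ t := by
  induction h with
  | inp => omega
  | nil => simp [Data.size]
  | hd b x =>
    cases x
    · simp [Data.size, Data.head]
    · simp only [Data.size, Data.head]; omega
  | tl b x =>
    cases x
    · simp [Data.size, Data.tail]
    · simp only [Data.size, Data.tail]; omega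
  | eq b x =>
    cases x with
    | nil => simp [Data.size, Data.eqTest]
    | cons y z =>
      have := y.size_pos
      have := z.size_pos
      simp only [Data.eqTest]
      split_ifs <;> simp [Data.size] <;> omega
  | pair => simp only [Data.size]; omega
  | _ => omega

/-- Functions computed in polynomial time. -/
@[fun_prop]
def PT {α β : Type*} [Enc α] [Enc β] (f : α → β) : Prop :=
  ∃ (p : Prog) (T : α → ℕ), PB T ∧ ∀ b a, ∃ t ≤ T a, Run b p (enc a) (enc (f a)) t

section PT
variable {α β γ δ : Type*} [Enc α] [Enc β] [Enc γ] [Enc δ]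

/-- Producing a tree costs at least its size, so a polynomial running time also bounds the result.
This is what makes the composition of two polynomial-time functions polynomial. -/
theorem PT.pb_esize {f : α → β} (hf : PT f) : PB fun a => esize (f a) := by
  obtain ⟨p, T, hT, h⟩ := hf
  refine hT.mono fun a => ?_
  obtain ⟨t, ht, hr⟩ := h .nil a
  exact hr.size_le.trans ht

@[fun_prop]
theorem PT.id : PT fun a : α => a :=
  ⟨.inp, fun a => esize a + 1, PB.esize.add (PB.const 1), fun b _ => ⟨_, le_rfl, .inp b _⟩⟩

@[fun_prop]
theorem PT.comp {g : β → γ} {f : α → β} (hg : PT g) (hf : PT f) : PT fun a => g (f a) := by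
  have hb := hf.pb_esize
  obtain ⟨p, T, hT, h⟩ := hf
  obtain ⟨q, U, hU, k⟩ := hg
  refine ⟨.comp q p, fun a => T a + U (f a) + 1,
    (hT.add (hU.comp_of_le hb fun _ => le_rfl)).add (PB.const 1), fun b a => ?_⟩
  obtain ⟨t, ht, hr⟩ := h b a
  obtain ⟨s, hs, hr'⟩ := k b (f a)
  exact ⟨_, by dsimp only; omega, .comp hr hr'⟩

/-- Reading the same encoding at another type. -/
theorem PT.of_enc_eq {f : α → β} {g : γ → δ} (hf : PT f) (h : γ → α)
    (h₁ : ∀ c, enc (h c) = enc c) (h₂ : ∀ c, enc (g c) = enc (f (h c))) : PT g := by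
  obtain ⟨p, T, hT, hr⟩ := hf
  refine ⟨p, fun c => T (h c), hT.comp_of_le PB.esize fun c => ?_, fun b c => ?_⟩
  · simp only [esize, h₁]; exact le_rfl
  · rw [h₂, ← h₁]; exact hr b _

theorem PT.of_enc {f : α → β} (h : ∀ a, enc (f a) = enc a) : PT f :=
  PT.of_enc_eq (PT.id (α := α)) _root_.id (fun _ => rfl) h

/-- The program that produces a fixed tree. -/
def Prog.lit : Data → Prog
  | .nil => .nil
  | .cons a b => .pair (lit a) (lit b)

theorem Run.lit (b x : Data) (p : Prog) : Run p (Prog.lit b) x b b.size := by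
  induction b with
  | nil => exact .nil _ _
  | cons a b iha ihb => exact .pair iha ihb

@[fun_prop]
theorem PT.const (y : β) : PT fun _ : α => y :=
  ⟨Prog.lit (enc y), fun _ => esize y, PB.const _, fun b _ => ⟨_, le_rfl, Run.lit _ _ b⟩⟩

instance : Enc Data := ⟨fun d => d⟩
instance : Enc Bool := ⟨fun b => if b then .cons .nil .nil else .nil⟩
instance : Enc ℕ := ⟨Data.ofNat⟩
instance : Enc (α × β) := ⟨fun p => .cons (enc p.1) (enc p.2)⟩
instance : Enc (List α) := ⟨fun l => .ofList (l.map enc)⟩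
instance : Enc (Option α) := ⟨fun o => .ofList (o.toList.map enc)⟩
instance {p : α → Prop} : Enc (Subtype p) := ⟨fun a => enc a.1⟩

theorem enc_nil : enc ([] : List α) = .nil := rfl
theorem enc_cons (a : α) (l : List α) : enc (a :: l) = .cons (enc a) (enc l) := rfl

@[fun_prop]
theorem PT.subtype_val {p : α → Prop} : PT fun a : Subtype p => a.1 := PT.of_enc fun _ => rfl

/-- An element of a subtype is encoded like the underlying element. Subtypes therefore express
promises on the input at no computational cost. -/
theorem PT.subtype_mk {p : β → Prop} {f : α → β} (hf : PT f) (h : ∀ a, p (f a)) :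
    PT fun a => (⟨f a, h a⟩ : Subtype p) :=
  PT.of_enc_eq hf _root_.id (fun _ => rfl) fun _ => rfl

theorem PT.head : PT Data.head :=
  ⟨.hd, fun a => esize a + 1, PB.esize.add (PB.const 1), fun b _ => ⟨_, le_rfl, .hd b _⟩⟩

theorem PT.tail : PT Data.tail :=
  ⟨.tl, fun a => esize a + 1, PB.esize.add (PB.const 1), fun b _ => ⟨_, le_rfl, .tl b _⟩⟩

@[fun_prop]
theorem PT.data_head {f : α → Data} (hf : PT f) : PT fun a => (f a).head := PT.head.comp hf
@[fun_prop]
theorem PT.data_tail {f : α → Data} (hf : PT f) : PT fun a => (f a).tail := PT.tail.comp hf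

@[fun_prop]
theorem PT.fst : PT fun p : α × β => p.1 :=
  PT.of_enc_eq PT.head enc (fun _ => rfl) fun _ => rfl

@[fun_prop]
theorem PT.snd : PT fun p : α × β => p.2 :=
  PT.of_enc_eq PT.tail enc (fun _ => rfl) fun _ => rfl

@[fun_prop]
theorem PT.prodMk {f : α → β} {g : α → γ} (hf : PT f) (hg : PT g) : PT fun a => (f a, g a) := by
  obtain ⟨p, T, hT, h⟩ := hf
  obtain ⟨q, U, hU, k⟩ := hg
  refine ⟨.pair p q, fun a => T a + U a + 1, (hT.add hU).add (PB.const 1), fun b a => ?_⟩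
  obtain ⟨t, ht, hr⟩ := h b a
  obtain ⟨s, hs, hr'⟩ := k b a
  exact ⟨_, by dsimp only; omega, .pair hr hr'⟩

@[fun_prop]
theorem PT.data_cons {f g : α → Data} (hf : PT f) (hg : PT g) : PT fun a => Data.cons (f a) (g a) :=
  PT.of_enc_eq (hf.prodMk hg) _root_.id (fun _ => rfl) fun _ => rfl

@[fun_prop]
theorem PT.list_cons {f : α → β} {g : α → List β} (hf : PT f) (hg : PT g) :
    PT fun a => f a :: g a :=
  PT.of_enc_eq (hf.prodMk hg) _root_.id (fun _ => rfl) fun _ => rfl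

@[fun_prop]
theorem PT.some {f : α → β} (hf : PT f) : PT fun a => some (f a) :=
  PT.of_enc_eq (hf.prodMk (PT.const Data.nil)) _root_.id (fun _ => rfl) fun _ => rfl

@[fun_prop]
theorem PT.data_eq {f g : α → Data} (hf : PT f) (hg : PT g) : PT fun a => decide (f a = g a) := by
  obtain ⟨p, T, hT, h⟩ := hf.prodMk hg
  refine ⟨.comp .eq p, fun a => T a + (esize (f a, g a) + 1) + 1,
    (hT.add ((hf.prodMk hg).pb_esize.add (PB.const 1))).add (PB.const 1), fun b a => ?_⟩
  obtain ⟨t, ht, hr⟩ := h b a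
  refine ⟨_, by show t + ((enc (f a, g a)).size + 1) + 1 ≤ _; simp only [esize]; omega,
    .comp hr ?_⟩
  convert Run.eq b _ using 1
  simp [enc, Data.eqTest]

/-- Each branch need only be computable where the test selects it. Partial operations, such as
taking the first entry of a list known to be non-empty, enter through this form. -/
theorem PT.ite_of_on {c : α → Bool} {f : {a // c a = true} → β} {g : {a // c a = false} → β}
    (hc : PT c) (hf : PT f) (hg : PT g) :
    PT fun a => if h : c a = true then f ⟨a, h⟩ else g ⟨a, by simpa using h⟩ := by
  obtain ⟨r, R, ⟨Q, hR⟩, e⟩ := hc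
  obtain ⟨p, T, ⟨Q', hT⟩, h⟩ := hf
  obtain ⟨q, U, ⟨Q'', hU⟩, k⟩ := hg
  refine ⟨.ite r p q, _, ⟨Q + Q' + Q'' + 1, fun a => le_rfl⟩, fun b a => ?_⟩
  obtain ⟨t, ht, hr⟩ := e b a
  have := hR a
  by_cases hca : c a = true
  · simp only [hca] at hr
    simp only [hca, dif_pos]
    obtain ⟨s, hs, hr'⟩ := h b ⟨a, hca⟩
    have : s ≤ Q'.eval (esize a) := hs.trans (hT ⟨a, hca⟩)
    exact ⟨_, by simp; omega, .ite_true hr hr'⟩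
  · have hca' : c a = false := by simpa using hca
    simp only [hca'] at hr
    obtain ⟨s, hs, hr'⟩ := k b ⟨a, hca'⟩
    have : s ≤ Q''.eval (esize a) := hs.trans (hU ⟨a, hca'⟩)
    refine ⟨t + s + 1, by simp; omega, ?_⟩
    simp only [hca', Bool.false_eq_true, dif_neg, not_false_eq_true]
    exact .ite_false hr hr'

@[fun_prop]
theorem PT.ite {P : α → Prop} [DecidablePred P] {f g : α → β} (hc : PT fun a => decide (P a))
    (hf : PT f) (hg : PT g) : PT fun a => if P a then f a else g a := by
  refine (PT.ite_of_on hc (f := fun a => f a.1) (g := fun a => g a.1) (by fun_prop)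
    (by fun_prop)).of_enc_eq _root_.id (fun _ => rfl) fun a => ?_
  by_cases h : P a <;> simp [h]

@[fun_prop]
theorem PT.decide_bool {f : α → Bool} (hf : PT f) : PT fun a => decide (f a = true) := by
  simpa using hf

@[fun_prop]
theorem PT.not {f : α → Bool} (hf : PT f) : PT fun a => !(f a) := by
  refine (PT.ite (P := fun a => f a = true) (f := fun _ => false) (g := fun _ => true)
    (by fun_prop) (by fun_prop) (by fun_prop)).of_enc_eq _root_.id (fun _ => rfl) fun a => ?_
  cases h : f a <;> simp [h]

@[fun_prop]
theorem PT.or {f g : α → Bool} (hf : PT f) (hg : PT g) : PT fun a => f a || g a := by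
  refine (PT.ite (P := fun a => f a = true) (f := fun _ => true) (g := g)
    (by fun_prop) (by fun_prop) (by fun_prop)).of_enc_eq _root_.id (fun _ => rfl) fun a => ?_
  cases h : f a <;> simp [h]

@[fun_prop]
theorem PT.decide_or {P Q : α → Prop} [DecidablePred P] [DecidablePred Q]
    (hf : PT fun a => decide (P a)) (hg : PT fun a => decide (Q a)) :
    PT fun a => decide (P a ∨ Q a) := by
  simpa using hf.or hg

end PT

/-! ### Recursion -/

section Rec
variable {α β γ σ X : Type*} [Enc α] [Enc β] [Enc γ] [Enc σ] [Enc X]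

/-- Binary recursion with polynomially bounded arguments, results and number of calls. -/
theorem PT.binrec {F : X → β} {halt : X → Bool} {leaf : {x // halt x = true} → β}
    {l r : {x // halt x = false} → X} {comb : {x // halt x = false} × β × β → β}
    (hs : PT halt) (hleaf : PT leaf) (hl : PT l) (hr : PT r) (hcomb : PT comb)
    (F_stop : ∀ x, F x.1 = leaf x) (F_step : ∀ x, F x.1 = comb (x, F (l x), F (r x)))
    (μ : X → ℕ) (hμ₀ : ∀ x, 0 < μ x) (hμ : ∀ x, μ (l x) + μ (r x) < μ x.1)
    {init : α → X} (hi : PT init) (R : α → X → Prop) (hR : ∀ a, R a (init a))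
    (hRl : ∀ a x, R a x.1 → R a (l x)) (hRr : ∀ a x, R a x.1 → R a (r x))
    (B : α → ℕ) (hB : PB B) (hBx : ∀ a x, R a x → esize x ≤ B a ∧ esize (F x) ≤ B a)
    (hM : PB fun a => μ (init a)) : PT fun a => F (init a) := by
  obtain ⟨ps, Ts, ⟨qs, hqs⟩, es⟩ := hs
  obtain ⟨pf, Tf, ⟨qf, hqf⟩, ef⟩ := hleaf
  obtain ⟨pl, Tl, ⟨ql, hql⟩, el⟩ := hl
  obtain ⟨pr, Tr, ⟨qr, hqr⟩, er⟩ := hr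
  obtain ⟨pc, Tc, ⟨qc, hqc⟩, ec⟩ := hcomb
  -- The argument is kept by `inp`, since `comb` reads it together with the two results. The
  -- component programs run correctly for every value of `b`, so they may be placed under the `fix`.
  let body : Prog := .ite ps pf (.comp pc (.pair .inp (.pair (.comp .call pl) (.comp .call pr))))
  -- Cost of one call apart from its recursive calls, for arguments and results of size at most `n`:
  -- test, base case, the two new arguments, the combination of a triple of size at most `n + (n + n
  -- + 1) + 1`, the copy of the argument, and at most 11 unit charges.
  let C : ℕ → ℕ := fun n => qs.eval n + qf.eval n + ql.eval n + qr.eval n +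
    qc.eval (n + (n + n + 1) + 1) + n + 11
  -- The measure bounds the number of calls, because the measures of the two new arguments plus one
  -- for the present call do not exceed the old measure.
  have key : ∀ m x a, μ x ≤ m → R a x →
      ∃ t ≤ μ x * C (B a), Run body body (enc x) (enc (F x)) t := by
    intro m
    induction m with
    | zero => intro x a hx; have := hμ₀ x; omega
    | succ m ih =>
      intro x a hx hRx
      obtain ⟨bx, bF⟩ := hBx a x hRx
      obtain ⟨t, ht, hrun⟩ := es body x
      have h1 : t ≤ qs.eval (B a) := ht.trans ((hqs x).trans (eval_mono _ bx))
      by_cases hst : halt x = true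
      · obtain ⟨s, hs, hrun'⟩ := ef body ⟨x, hst⟩
        have h2 : s ≤ qf.eval (B a) := hs.trans ((hqf _).trans (eval_mono _ bx))
        simp only [hst] at hrun
        refine ⟨t + s + 1, ?_, ?_⟩
        · calc t + s + 1 ≤ 1 * C (B a) := by simp only [C]; omega
            _ ≤ _ := Nat.mul_le_mul_right _ (hμ₀ x)
        · rw [F_stop ⟨x, hst⟩]
          exact .ite_true hrun hrun'
      · have hst' : halt x = false := by simpa using hst
        simp only [hst'] at hrun
        have hm := hμ ⟨x, hst'⟩
        have hm1 := hμ₀ (l ⟨x, hst'⟩)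
        have hm2 := hμ₀ (r ⟨x, hst'⟩)
        simp only at hm
        have Rl := hRl a ⟨x, hst'⟩ hRx
        have Rr := hRr a ⟨x, hst'⟩ hRx
        obtain ⟨tl, htl, runl⟩ := el body ⟨x, hst'⟩
        obtain ⟨tr, htr, runr⟩ := er body ⟨x, hst'⟩
        obtain ⟨sl, hsl, runl'⟩ := ih (l ⟨x, hst'⟩) a (by omega) Rl
        obtain ⟨sr, hsr, runr'⟩ := ih (r ⟨x, hst'⟩) a (by omega) Rr
        obtain ⟨tc, htc, runc⟩ := ec body (⟨x, hst'⟩, F (l ⟨x, hst'⟩), F (r ⟨x, hst'⟩))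
        have h2 : tl ≤ ql.eval (B a) := htl.trans ((hql _).trans (eval_mono _ bx))
        have h3 : tr ≤ qr.eval (B a) := htr.trans ((hqr _).trans (eval_mono _ bx))
        have bl := (hBx a _ Rl).2
        have br := (hBx a _ Rr).2
        have h4 : tc ≤ qc.eval (B a + (B a + B a + 1) + 1) := by
          refine htc.trans ((hqc _).trans (eval_mono _ ?_))
          simp only [esize, enc, Data.size] at bx bl br ⊢
          omega
        have bx' : (enc x).size ≤ B a := bx
        have runF : Run body body (enc x) (enc (F x)) _ := .ite_false hrun (.comp (.pair (.inp _ _)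
          (.pair (.comp runl (.call runl')) (.comp runr (.call runr'))))
            ((F_step ⟨x, hst'⟩).symm ▸ runc))
        refine ⟨_, ?_, runF⟩
        · have : (μ (l ⟨x, hst'⟩) + μ (r ⟨x, hst'⟩) + 1) * C (B a) ≤ μ x * C (B a) :=
            Nat.mul_le_mul_right _ hm
          rw [add_mul, add_mul, one_mul] at this
          refine le_trans ?_ this
          have hC : t + tl + tr + tc + (enc x).size + 11 ≤ C (B a) := by simp only [C]; omega
          omega
  obtain ⟨pi, Ti, hTi, ei⟩ := hi
  refine ⟨.comp (.fix body) pi, fun a => Ti a + (μ (init a) * C (B a) + 1) + 1, ?_, fun b a => ?_⟩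
  · refine (hTi.add ((hM.mul ?_).add (PB.const 1))).add (PB.const 1)
    exact (((((PB.eval _ hB).add (PB.eval _ hB)).add (PB.eval _ hB)).add (PB.eval _ hB)).add
      (PB.eval _ ((hB.add ((hB.add hB).add (PB.const 1))).add (PB.const 1)))).add hB |>.add
        (PB.const 11)
  · obtain ⟨t, ht, hrun⟩ := ei b a
    obtain ⟨s, hs, hrun'⟩ := key _ (init a) a le_rfl (hR a)
    exact ⟨_, by dsimp only; omega, .comp hrun (.fix hrun')⟩

end Rec

/-! ### Lists -/

section Lists
variable {α β γ δ σ X : Type*} [Enc α] [Enc β] [Enc γ] [Enc δ] [Enc σ] [Enc X]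

theorem PT.enc_comp {f : α → β} (hf : PT f) : PT fun a => enc (f a) :=
  hf.of_enc_eq _root_.id (fun _ => rfl) fun _ => rfl

theorem PT.list_head {f : α → List β} (hf : PT f) (h : ∀ a, f a ≠ []) :
    PT fun a => (f a).head (h a) := by
  refine hf.enc_comp.data_head.of_enc_eq _root_.id (fun _ => rfl) fun a => ?_
  have key : ∀ (l : List β) (hl : l ≠ []), enc (l.head hl) = enc (enc l).head := by
    rintro (_ | ⟨y, l⟩) hl
    · exact absurd rfl hl
    · rfl
  exact key _ _

@[fun_prop]
theorem PT.list_tail {f : α → List β} (hf : PT f) : PT fun a => (f a).tail := by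
  refine hf.enc_comp.data_tail.of_enc_eq _root_.id (fun _ => rfl) fun a => ?_
  rcases hfa : f a with _ | ⟨y, l⟩ <;> simp only [_root_.id, hfa] <;> rfl

theorem PT.data_isNil : PT fun d : Data => decide (d = .nil) := by fun_prop

@[fun_prop]
theorem PT.list_isEmpty {f : α → List β} (hf : PT f) : PT fun a => (f a).isEmpty := by
  refine (PT.data_isNil.comp hf.enc_comp).of_enc_eq _root_.id (fun _ => rfl) fun a => ?_
  rcases hfa : f a with _ | ⟨y, l⟩ <;> simp [_root_.id, hfa, enc_nil, enc_cons]

@[fun_prop]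
theorem PT.option_toList {f : α → Option β} (hf : PT f) : PT fun a => (f a).toList :=
  hf.of_enc_eq _root_.id (fun _ => rfl) fun _ => rfl

@[fun_prop]
theorem PT.option_isNone {f : α → Option β} (hf : PT f) : PT fun a => (f a).isNone := by
  refine hf.option_toList.list_isEmpty.of_enc_eq _root_.id (fun _ => rfl) fun a => ?_
  cases hfa : f a <;> simp [_root_.id, hfa]

@[fun_prop]
theorem PT.list_head? {f : α → List β} (hf : PT f) : PT fun a => (f a).head? := by
  have hne : ∀ a : {a // (f a).isEmpty = false}, f a.1 ≠ [] := fun a => by simpa using a.2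
  refine (PT.ite_of_on (f := fun _ => (none : Option β))
    (g := fun a => Option.some ((f a.1).head (hne a))) hf.list_isEmpty
    (PT.const none) (PT.some (PT.list_head (f := fun a : {a // (f a).isEmpty = false} => f a.1) (by fun_prop) hne))).of_enc_eq
    _root_.id (fun _ => rfl) fun a => ?_
  rcases hfa : f a with _ | ⟨y, l⟩ <;> simp [_root_.id, hfa]

/-- Case distinction on an option. -/
@[fun_prop]
theorem PT.option_elim {o : α → Option β} {d : α → γ} {f : α → β → γ} (ho : PT o) (hd : PT d)
    (hf : PT fun p : α × β => f p.1 p.2) : PT fun a => (o a).elim (d a) (f a) := by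
  have h1 : ∀ a : {a // (o a).isNone = false}, (o a.1).toList ≠ [] := fun a => by
    have := a.2
    rw [Option.isNone_eq_false_iff, Option.isSome_iff_exists] at this
    obtain ⟨b, hb⟩ := this
    simp [hb]
  refine (PT.ite_of_on (c := fun a => (o a).isNone) (f := fun a : {a // (o a).isNone = true} => d a.1)
    (g := fun a : {a // (o a).isNone = false} => f a.1 ((o a.1).toList.head (h1 a))) (by fun_prop) (by fun_prop)
    (hf.comp (PT.prodMk PT.subtype_val
      (PT.list_head (f := fun a : {a // (o a).isNone = false} => (o a.1).toList)
        (by fun_prop) h1)))).of_enc_eq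
    _root_.id (fun _ => rfl) fun a => ?_
  rcases hfa : o a with _ | y <;> simp [_root_.id, hfa]

@[fun_prop]
theorem PT.option_map {o : α → Option β} {f : α → β → γ} (ho : PT o)
    (hf : PT fun p : α × β => f p.1 p.2) : PT fun a => (o a).map (f a) := by
  refine (PT.option_elim ho (PT.const none) (f := fun a b => Option.some (f a b))
    (by fun_prop)).of_enc_eq _root_.id (fun _ => rfl) fun a => ?_
  rcases hfa : o a with _ | y <;> simp [_root_.id, hfa]

@[fun_prop]
theorem PT.option_getD {o : α → Option β} {d : α → β} (ho : PT o) (hd : PT d) :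
    PT fun a => (o a).getD (d a) := by
  refine (PT.option_elim ho hd (f := fun _ b => b) (by fun_prop)).of_enc_eq
    _root_.id (fun _ => rfl) fun a => ?_
  rcases hfa : o a with _ | y <;> simp [_root_.id, hfa]

@[fun_prop]
theorem PT.option_bind {o : α → Option β} {f : α → β → Option γ} (ho : PT o)
    (hf : PT fun p : α × β => f p.1 p.2) : PT fun a => (o a).bind (f a) := by
  refine (PT.option_elim ho (PT.const none) (f := f)
    (by fun_prop)).of_enc_eq _root_.id (fun _ => rfl) fun a => ?_
  rcases hfa : o a with _ | y <;> simp [_root_.id, hfa]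

/-! Sizes of lists -/

theorem esize_pair (a : α) (b : β) : esize (a, b) = esize a + esize b + 1 := rfl
theorem esize_nil : esize ([] : List α) = 1 := rfl
theorem esize_cons (a : α) (l : List α) : esize (a :: l) = esize a + esize l + 1 := rfl

theorem esize_append (l l' : List α) : esize (l ++ l') + 1 = esize l + esize l' := by
  induction l with
  | nil => simp [esize_nil]; omega
  | cons a l ih => simp only [List.cons_append, esize_cons]; omega

theorem esize_reverse (l : List α) : esize l.reverse = esize l := by
  induction l with
  | nil => rfl
  | cons a l ih =>
    have := esize_append l.reverse [a]
    simp only [List.reverse_cons, esize_cons, esize_nil] at *; omega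

theorem esize_le_of_mem {a : α} {l : List α} (h : a ∈ l) : esize a < esize l := by
  induction l with
  | nil => simp at h
  | cons b l ih =>
    simp only [List.mem_cons, esize_cons] at *
    rcases h with rfl | h
    · omega
    · have := ih h; omega

theorem length_lt_esize (l : List α) : l.length < esize l := by
  induction l with
  | nil => simp [esize_nil]
  | cons b l ih => simp only [esize_cons, List.length_cons]; omega

theorem esize_sublist {l l' : List α} (h : l.Sublist l') : esize l ≤ esize l' := by
  induction h with
  | slnil => rfl
  | cons a _ ih => simp only [esize_cons]; omega
  | cons_cons a _ ih => simp only [esize_cons]; omega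

theorem esize_list_le {l : List α} {N : ℕ} (h : ∀ a ∈ l, esize a ≤ N) :
    esize l ≤ l.length * (N + 1) + 1 := by
  induction l with
  | nil => simp [esize_nil]
  | cons b l ih =>
    have h1 := ih fun a ha => h a (by simp [ha])
    have h2 := h b (by simp)
    simp only [esize_cons, List.length_cons, add_mul, one_mul]; omega

/-! Iteration over lists -/

/-- The intermediate states are the folds of the prefixes, so these are what the size bound has to
control. -/
theorem PT.foldl {step : α → σ → β → σ} {init : α → σ} {l : α → List β}
    (hstep : PT fun p : α × σ × β => step p.1 p.2.1 p.2.2) (hinit : PT init) (hl : PT l)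
    {B : α → ℕ} (hB : PB B)
    (h : ∀ a l₁, l₁ <+: l a → esize (l₁.foldl (step a) (init a)) ≤ B a) :
    PT fun a => (l a).foldl (step a) (init a) := by
  have hne : ∀ x : {x : α × σ × List β // x.2.2.isEmpty = false}, x.1.2.2 ≠ [] := fun x => by
    simpa using x.2
  have hh := PT.list_head (f := fun x : {x : α × σ × List β // x.2.2.isEmpty = false} => x.1.2.2)
    (by fun_prop) hne
  -- A linear recursion is a binary one whose left call gets the empty list, stops at once and is
  -- ignored. With measure `2 * n + 1` for a list of length `n`, the two calls use `1 + (2 * (n - 1)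
  -- + 1)`, which is smaller.
  refine PT.binrec (α := α) (X := α × σ × List β) (F := fun x => x.2.2.foldl (step x.1) x.2.1)
    (halt := fun x => x.2.2.isEmpty) (leaf := fun x => x.1.2.1)
    (l := fun x => (x.1.1, x.1.2.1, []))
    (r := fun x => (x.1.1, step x.1.1 x.1.2.1 (x.1.2.2.head (hne x)), x.1.2.2.tail))
    (comb := fun p => p.2.2) (by fun_prop) (by fun_prop) (by fun_prop) ?_ (by fun_prop)
    ?_ ?_ (fun x => 2 * x.2.2.length + 1) (by simp) ?_ (init := fun a => (a, init a, l a))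
    (by fun_prop)
    -- The state is the fold of a prefix `l₁`. The remaining list is the rest of `l a`, or empty in
    -- the ignored left calls.
    (fun a x => x.1 = a ∧ ∃ l₁ l₃, l a = l₁ ++ l₃ ∧ (x.2.2 = l₃ ∨ x.2.2 = []) ∧
      x.2.1 = l₁.foldl (step a) (init a)) ?_ ?_ ?_
    (fun a => esize a + (B a + esize (l a) + 1) + 1) ?_ ?_ ?_
  · exact PT.prodMk (by fun_prop) (PT.prodMk (hstep.comp (PT.prodMk (by fun_prop)
      (PT.prodMk (by fun_prop) hh))) (by fun_prop))
  · rintro ⟨⟨a, s, l'⟩, hx⟩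
    simp only [List.isEmpty_iff] at hx
    simp [hx]
  · rintro ⟨⟨a, s, _ | ⟨y, l'⟩⟩, hx⟩
    · simp at hx
    · simp
  · rintro ⟨⟨a, s, _ | ⟨y, l'⟩⟩, hx⟩
    · simp at hx
    · simp; omega
  · exact fun a => ⟨rfl, [], l a, by simp, Or.inl rfl, rfl⟩
  · rintro a ⟨⟨a', s, l'⟩, hx⟩ ⟨h1, l₁, l₃, h2, -, h4⟩
    exact ⟨h1, l₁, l₃, h2, Or.inr rfl, h4⟩
  · rintro a ⟨⟨a', s, _ | ⟨y, l'⟩⟩, hx⟩ ⟨h1, l₁, l₃, h2, h3, h4⟩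
    · simp at hx
    · simp only [reduceCtorEq, or_false] at h1 h3 h4
      subst h1
      refine ⟨rfl, l₁ ++ [y], l', by simp [h2, ← h3], Or.inl rfl, ?_⟩
      simp [h4]
  · exact ((PB.esize.add ((hB.add hl.pb_esize).add (PB.const 1))).add (PB.const 1))
  · rintro a ⟨a', s, l'⟩ ⟨h1, l₁, l₃, h2, h3, h4⟩
    simp only at h1 h3 h4
    subst h1
    have hs := h a' l₁ ⟨l₃, h2.symm⟩
    have h5 : esize l' ≤ esize (l a') := by
      rcases h3 with rfl | rfl
      · rw [h2]; exact esize_sublist (List.sublist_append_right _ _)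
      · simp only [esize_nil]; exact esize_pos _
    rw [← h4] at hs
    refine ⟨by simp only [esize_pair]; omega, ?_⟩
    simp only
    rcases h3 with rfl | rfl
    · have := h a' (l₁ ++ l') ⟨[], by simp [h2]⟩
      simp only [List.foldl_append, ← h4] at this
      omega
    · simp only [List.foldl_nil]; omega
  · exact ((PB.const 2).mul (hl.pb_esize.mono fun a => (length_lt_esize _).le)).add (PB.const 1)

@[fun_prop]
theorem PT.list_reverse {l : α → List β} (hl : PT l) : PT fun a => (l a).reverse := by
  refine (PT.foldl (step := fun _ s b => b :: s) (init := fun _ => []) (l := l) (by fun_prop)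
    (by fun_prop) hl hl.pb_esize fun a l₁ h => ?_).of_enc_eq _root_.id (fun _ => rfl) fun a => ?_
  · rw [List.foldl_flip_cons_eq_append']
    simpa [esize_reverse] using esize_sublist h.sublist
  · rw [List.foldl_flip_cons_eq_append']; simp

@[fun_prop]
theorem PT.list_append {l l' : α → List β} (hl : PT l) (hl' : PT l') :
    PT fun a => l a ++ l' a := by
  refine (PT.foldl (step := fun _ s b => b :: s) (init := l') (l := fun a => (l a).reverse)
    (by fun_prop) hl' hl.list_reverse (hl.pb_esize.add hl'.pb_esize)
    fun a l₁ h => ?_).of_enc_eq _root_.id (fun _ => rfl) fun a => ?_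
  · rw [List.foldl_flip_cons_eq_append']
    have := esize_append l₁.reverse (l' a)
    have h2 := esize_sublist h.sublist
    rw [esize_reverse] at *
    omega
  · rw [List.foldl_flip_cons_eq_append']; simp

@[fun_prop]
theorem PT.list_map {f : α → β → γ} {l : α → List β} (hl : PT l)
    (hf : PT fun p : α × β => f p.1 p.2) : PT fun a => (l a).map (f a) := by
  obtain ⟨q, hq⟩ := hf.pb_esize
  have hB : PB fun a => esize (l a) * (q.eval (esize a + esize (l a) + 1) + 1) + 1 :=
    (hl.pb_esize.mul ((PB.eval q ((PB.esize.add hl.pb_esize).add (PB.const 1))).add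
      (PB.const 1))).add (PB.const 1)
  refine (PT.list_reverse (PT.foldl (step := fun a s b => f a b :: s) (init := fun _ => [])
    (l := l) (by fun_prop) (by fun_prop) hl hB fun a l₁ h => ?_)).of_enc_eq _root_.id
    (fun _ => rfl) fun a => ?_
  · rw [← List.foldl_map (f := f a) (g := fun s b => b :: s), List.foldl_flip_cons_eq_append',
      List.append_nil, esize_reverse]
    refine (esize_list_le (N := q.eval (esize a + esize (l a) + 1)) fun c hc => ?_).trans ?_
    · obtain ⟨b, hb, rfl⟩ := List.mem_map.1 hc
      refine (hq (a, b)).trans (eval_mono _ ?_)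
      have := esize_le_of_mem (h.subset hb)
      rw [esize_pair]; omega
    · have := (length_lt_esize l₁).le.trans (esize_sublist h.sublist)
      have := Nat.mul_le_mul_right (q.eval (esize a + esize (l a) + 1) + 1) this
      simpa using this
  · simp only [_root_.id]
    rw [← List.foldl_map (f := f a) (g := fun s b => b :: s), List.foldl_flip_cons_eq_append',
      List.append_nil, List.reverse_reverse]

theorem esize_flatten (l : List (List α)) : esize l.flatten ≤ esize l := by
  induction l with
  | nil => rfl
  | cons a l ih =>
    have := esize_append a l.flatten
    simp only [List.flatten_cons, esize_cons]; omega

@[fun_prop]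
theorem PT.list_flatten {l : α → List (List β)} (hl : PT l) : PT fun a => (l a).flatten := by
  have key : ∀ (l : List (List β)) (s : List β),
      l.foldl (fun s b => s ++ b) s = s ++ l.flatten := by
    intro l
    induction l with
    | nil => simp
    | cons b l ih => intro s; simp [ih]
  refine (PT.foldl (step := fun _ s b => s ++ b) (init := fun _ => []) (l := l) (by fun_prop)
    (by fun_prop) hl hl.pb_esize fun a l₁ h => ?_).of_enc_eq _root_.id (fun _ => rfl) fun a => ?_
  · rw [key]; exact (esize_flatten _).trans (esize_sublist h.sublist)
  · simp [key]

@[fun_prop]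
theorem PT.list_flatMap {f : α → β → List γ} {l : α → List β} (hl : PT l)
    (hf : PT fun p : α × β => f p.1 p.2) : PT fun a => (l a).flatMap (f a) := by
  simp only [List.flatMap]; fun_prop

@[fun_prop]
theorem PT.list_filter {f : α → β → Bool} {l : α → List β} (hl : PT l)
    (hf : PT fun p : α × β => f p.1 p.2) : PT fun a => (l a).filter (f a) := by
  have : ∀ a, (l a).filter (f a) = (l a).flatMap fun b => if f a b = true then [b] else [] := by
    intro a
    induction l a with
    | nil => rfl
    | cons b l ih => by_cases h : f a b <;> simp [h, ih]
  simp only [this]; fun_prop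

@[fun_prop]
theorem PT.list_any {f : α → β → Bool} {l : α → List β} (hl : PT l)
    (hf : PT fun p : α × β => f p.1 p.2) : PT fun a => (l a).any (f a) := by
  have : ∀ a, (l a).any (f a) = !((l a).filter (f a)).isEmpty := by
    intro a
    rw [Bool.eq_iff_iff]
    simp [List.filter_eq_nil_iff]
  simp only [this]; fun_prop

@[fun_prop]
theorem PT.list_find? {f : α → β → Bool} {l : α → List β} (hl : PT l)
    (hf : PT fun p : α × β => f p.1 p.2) : PT fun a => (l a).find? (f a) := by
  simp only [← List.head?_filter]; fun_prop

@[fun_prop]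
theorem PT.decide_mem {l : α → List Data} {f : α → Data} (hl : PT l) (hf : PT f) :
    PT fun a => decide (f a ∈ l a) := by
  have : ∀ a, decide (f a ∈ l a) = (l a).any fun b => decide (f a = b) := by
    intro a
    rw [Bool.eq_iff_iff]; simp
  simp only [this]; fun_prop

/-- A program compares encodings of keys, hence the injectivity assumption. -/
theorem PT.list_lookup_of {δ : Type*} [Enc δ] [DecidableEq δ] (hδ : Function.Injective (enc (α := δ)))
    {l : α → List (δ × β)} {f : α → δ}
    (hl : PT l) (hf : PT f) : PT fun a => (l a).lookup (f a) := by
  have hf' := hf.enc_comp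
  have hk : PT fun x : δ => enc x := PT.id.enc_comp
  have : ∀ a, (l a).lookup (f a) = ((l a).find? fun b => decide (enc b.1 = enc (f a))).map
      fun b => b.2 := by
    intro a
    induction l a with
    | nil => rfl
    | cons b l ih =>
      by_cases h : f a = b.1
      · simp [List.lookup, h]
      · have h1 : (f a == b.1) = false := by simpa using h
        have h2 : ¬ enc b.1 = enc (f a) := fun e => h (hδ e).symm
        simp [List.lookup, h1, h2, ih]
  simp only [this]
  fun_prop

@[fun_prop]
theorem PT.list_lookup {l : α → List (Data × β)} {f : α → Data}
    (hl : PT l) (hf : PT f) : PT fun a => (l a).lookup (f a) :=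
  PT.list_lookup_of (fun _ _ h => h) hl hf

/-! Numerals -/

/-- A unary numeral is a list of `nil`s, so arithmetic on numerals is inherited from operations on
lists. -/
theorem enc_nat_eq (n : ℕ) : enc n = enc (List.replicate n Data.nil) := by
  induction n with
  | zero => rfl
  | succ n ih => rw [List.replicate_succ, enc_cons, ← ih]; rfl

@[fun_prop]
theorem PT.list_length {l : α → List β} (hl : PT l) : PT fun a => (l a).length := by
  refine (PT.list_map (f := fun _ _ => Data.nil) hl (by fun_prop)).of_enc_eq _root_.id
    (fun _ => rfl) fun a => ?_
  rw [enc_nat_eq]; simp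

@[fun_prop]
theorem PT.replicate_nil {f : α → ℕ} (hf : PT f) : PT fun a => List.replicate (f a) Data.nil :=
  hf.of_enc_eq _root_.id (fun _ => rfl) fun _ => (enc_nat_eq _).symm

@[fun_prop]
theorem PT.nat_succ {f : α → ℕ} (hf : PT f) : PT fun a => f a + 1 :=
  (PT.data_cons (PT.const .nil) hf.enc_comp).of_enc_eq _root_.id (fun _ => rfl) fun _ => rfl

theorem ofNat_injective : Function.Injective Data.ofNat := by
  intro m
  induction m with
  | zero => intro n h; cases n <;> simp_all [Data.ofNat]
  | succ m ih =>
    intro n h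
    cases n with
    | zero => simp [Data.ofNat] at h
    | succ n => simp only [Data.ofNat, Data.cons.injEq, true_and] at h; rw [ih h]

theorem toNat_ofNat (n : ℕ) : (Data.ofNat n).toNat = n := by
  induction n with
  | zero => rfl
  | succ n ih => simp [Data.ofNat, Data.toNat, ih]

@[fun_prop]
theorem PT.ofNat {f : α → ℕ} (hf : PT f) : PT fun a => Data.ofNat (f a) :=
  hf.of_enc_eq _root_.id (fun _ => rfl) fun _ => rfl

@[fun_prop]
theorem PT.nat_eq {f g : α → ℕ} (hf : PT f) (hg : PT g) : PT fun a => decide (f a = g a) := by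
  refine (PT.data_eq hf.enc_comp hg.enc_comp).of_enc_eq _root_.id (fun _ => rfl) fun a => ?_
  simp only [_root_.id]
  congr 2
  exact propext ofNat_injective.eq_iff.symm

/-- A tree as the list of the left children along its right spine. -/
def Data.toList : Data → List Data
  | .nil => []
  | .cons a b => a :: toList b

theorem Data.ofList_toList (d : Data) : Data.ofList d.toList = d := by
  induction d with
  | nil => rfl
  | cons a b _ ih => simp [Data.toList, Data.ofList, ih]

theorem Data.length_toList (d : Data) : d.toList.length = d.toNat := by
  induction d with
  | nil => rfl
  | cons a b _ ih => simp [Data.toList, Data.toNat, ih]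

theorem enc_dataList (l : List Data) : enc l = Data.ofList l := by
  show Data.ofList (l.map fun d => d) = _
  rw [List.map_id']

@[fun_prop]
theorem PT.data_toList {f : α → Data} (hf : PT f) : PT fun a => (f a).toList :=
  hf.of_enc_eq _root_.id (fun _ => rfl) fun a => by
    rw [enc_dataList, Data.ofList_toList]; rfl

@[fun_prop]
theorem PT.data_toNat {f : α → Data} (hf : PT f) : PT fun a => (f a).toNat := by
  simp only [← Data.length_toList]; fun_prop

theorem esize_nat (n : ℕ) : esize n = 2 * n + 1 := by
  induction n with
  | zero => rfl
  | succ n ih =>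
    have : esize (n + 1) = 1 + esize n + 1 := rfl
    omega

/-- Iteration of a function that keeps the size polynomial. -/
theorem PT.iterate {f : α → σ → σ} {init : α → σ} {n : α → ℕ}
    (hf : PT fun p : α × σ => f p.1 p.2) (hinit : PT init) (hn : PT n)
    {B : α → ℕ} (hB : PB B) (h : ∀ a k, k ≤ n a → esize ((f a)^[k] (init a)) ≤ B a) :
    PT fun a => (f a)^[n a] (init a) := by
  have key : ∀ (l : List Data) (a : α) (s : σ), l.foldl (fun s _ => f a s) s = (f a)^[l.length] s := by
    intro l
    induction l with
    | nil => intros; rfl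
    | cons b l ih => intros; simp [ih]
  refine (PT.foldl (step := fun a s (_ : Data) => f a s) (init := init)
    (l := fun a => List.replicate (n a) Data.nil) (by fun_prop) hinit (by fun_prop) hB
    fun a l₁ hl₁ => ?_).of_enc_eq _root_.id (fun _ => rfl) fun a => ?_
  · rw [key]
    exact h a _ (by simpa using hl₁.length_le)
  · rw [key]; simp

@[fun_prop]
theorem PT.list_zip {l : α → List β} {l' : α → List γ} (hl : PT l) (hl' : PT l') :
    PT fun a => (l a).zip (l' a) := by
  -- The state holds the unread part of the second list and the reversed list of pairs. Once the
  -- second list is exhausted, nothing more is added.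
  have key : ∀ (l : List β) (l' : List γ) (s : List (β × γ)), (l.foldl (fun (s : List γ × List (β × γ)) b =>
      (s.1.tail, s.1.head?.elim s.2 fun c => (b, c) :: s.2)) (l', s)) =
        (l'.drop l.length, (l.zip l').reverse ++ s) := by
    intro l
    induction l with
    | nil => intros; simp
    | cons b l ih =>
      intro l' s
      rw [List.foldl_cons, ih]
      cases l' <;> simp
  refine (PT.list_reverse (PT.snd.comp (PT.foldl
      (step := fun _ (s : List γ × List (β × γ)) b =>
        (s.1.tail, s.1.head?.elim s.2 fun c => (b, c) :: s.2))
      (init := fun a => (l' a, [])) (l := l) (B := fun a => esize (l' a) +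
        (esize (l a) * (esize (l a) + esize (l' a) + 1 + 1) + 1) + 1)
      (by fun_prop) (by fun_prop) hl ?_ ?_))).of_enc_eq _root_.id
    (fun _ => rfl) fun a => ?_
  · have h1 := hl.pb_esize
    have h2 := hl'.pb_esize
    exact ((h2.add ((h1.mul (((h1.add h2).add (PB.const 1)).add (PB.const 1))).add
      (PB.const 1))).add (PB.const 1))
  · intro a l₁ h
    rw [key, esize_pair, List.append_nil, esize_reverse]
    have h1 : esize ((l' a).drop l₁.length) ≤ esize (l' a) := esize_sublist (List.drop_sublist _ _)
    have h2 : esize (l₁.zip (l' a)) ≤ esize (l a) * (esize (l a) + esize (l' a) + 1 + 1) + 1 := by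
      refine (esize_list_le (N := esize (l a) + esize (l' a) + 1) ?_).trans ?_
      · rintro ⟨b, c⟩ hbc
        have := esize_le_of_mem (h.subset (List.of_mem_zip hbc).1)
        have := esize_le_of_mem (List.of_mem_zip hbc).2
        rw [esize_pair]; omega
      · have h3 : (l₁.zip (l' a)).length ≤ esize (l a) := by
          rw [List.length_zip]
          exact (min_le_left _ _).trans ((length_lt_esize l₁).le.trans (esize_sublist h.sublist))
        have := Nat.mul_le_mul_right (esize (l a) + esize (l' a) + 1 + 1) h3
        omega
    omega
  · rw [key]; simp

@[fun_prop]
theorem PT.list_range {f : α → ℕ} (hf : PT f) : PT fun a => List.range (f a) := by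
  have key : ∀ n, (fun s : ℕ × List ℕ => (s.1 + 1, s.1 :: s.2))^[n] (0, []) =
      (n, (List.range n).reverse) := by
    intro n
    induction n with
    | zero => rfl
    | succ n ih => rw [Function.iterate_succ_apply', ih, List.range_succ]; simp
  refine (PT.list_reverse (PT.snd.comp (PT.iterate
    (f := fun (_ : α) (s : ℕ × List ℕ) => (s.1 + 1, s.1 :: s.2)) (init := fun _ => (0, []))
    (n := f) (B := fun a => esize (f a) + (esize (f a) * (esize (f a) + 1) + 1) + 1)
      (by fun_prop) (by fun_prop) hf ?_ ?_))).of_enc_eq _root_.id (fun _ => rfl) fun a => ?_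
  · have h := hf.pb_esize
    exact ((h.add ((h.mul (h.add (PB.const 1))).add (PB.const 1))).add (PB.const 1))
  · intro a k hk
    rw [key, esize_pair, esize_reverse]
    have h1 : esize k ≤ esize (f a) := by rw [esize_nat, esize_nat]; omega
    have h2 := esize_list_le (l := List.range k) (N := esize (f a)) fun i hi => by
      rw [List.mem_range] at hi
      rw [esize_nat, esize_nat]; omega
    have h3 : (List.range k).length ≤ esize (f a) := by rw [List.length_range, esize_nat]; omega
    have := Nat.mul_le_mul_right (esize (f a) + 1) h3
    omega
  · rw [key]; simp

@[fun_prop]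
theorem PT.list_zipIdx {l : α → List β} (hl : PT l) : PT fun a => (l a).zipIdx := by
  have : ∀ a, (l a).zipIdx = (l a).zip (List.range (l a).length) := fun a => by
    rw [List.zipIdx_eq_zip_range', List.range_eq_range']
  simp only [this]; fun_prop

@[fun_prop]
theorem PT.list_take {l : α → List β} {n : α → ℕ} (hl : PT l) (hn : PT n) :
    PT fun a => (l a).take (n a) := by
  have : ∀ a, (l a).take (n a) = ((l a).zip (List.range (n a))).map fun p => p.1 := fun a => by
    apply List.ext_getElem <;> simp [min_comm]
  simp only [this]; fun_prop

@[fun_prop]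
theorem PT.list_drop {l : α → List β} {n : α → ℕ} (hl : PT l) (hn : PT n) :
    PT fun a => (l a).drop (n a) := by
  have : ∀ k (l : List β), l.drop k = List.tail^[k] l := by
    intro k
    induction k with
    | zero => simp
    | succ k ih => intro l; rw [Function.iterate_succ_apply, ← ih, List.drop_tail]
  simp only [this]
  refine PT.iterate (f := fun _ => List.tail) (by fun_prop) hl hn hl.pb_esize fun a k _ => ?_
  rw [← this]
  exact esize_sublist (List.drop_sublist _ _)

/-- Removal of repetitions. -/
def dedupD (l : List Data) : List Data := l.foldl (fun s x => if x ∈ s then s else x :: s) []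

theorem dedupD_aux (l s : List Data) (hs : s.Nodup) :
    (l.foldl (fun s x => if x ∈ s then s else x :: s) s).Nodup ∧
    (∀ x, x ∈ l.foldl (fun s x => if x ∈ s then s else x :: s) s ↔ x ∈ l ∨ x ∈ s) ∧
    esize (l.foldl (fun s x => if x ∈ s then s else x :: s) s) ≤ esize l + esize s := by
  induction l generalizing s with
  | nil => simp [hs]
  | cons a l ih =>
    rw [List.foldl_cons]
    by_cases h : a ∈ s
    · rw [if_pos h]
      obtain ⟨h1, h2, h3⟩ := ih s hs
      refine ⟨h1, fun x => ?_, by rw [esize_cons]; omega⟩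
      rw [h2, List.mem_cons]
      constructor
      · tauto
      · rintro ((rfl | h) | h) <;> tauto
    · rw [if_neg h]
      obtain ⟨h1, h2, h3⟩ := ih (a :: s) (by simp [h, hs])
      refine ⟨h1, fun x => ?_, by rw [esize_cons] at *; omega⟩
      rw [h2, List.mem_cons, List.mem_cons]; tauto

theorem dedupD_nodup (l : List Data) : (dedupD l).Nodup := (dedupD_aux l [] (by simp)).1

@[simp]
theorem mem_dedupD {l : List Data} {x : Data} : x ∈ dedupD l ↔ x ∈ l := by
  rw [dedupD, (dedupD_aux l [] (by simp)).2.1 x]; simp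

@[fun_prop]
theorem PT.dedupD {l : α → List Data} (hl : PT l) : PT fun a => dedupD (l a) := by
  refine PT.foldl (by fun_prop) (by fun_prop) hl (hl.pb_esize.add (PB.const 1)) fun a l₁ h => ?_
  exact (dedupD_aux _ _ (by simp)).2.2.trans
    (add_le_add (esize_sublist h.sublist) (le_refl _))

end Lists

/-! ### Formulas as data -/

/-- The symbol coding in force. -/
class Coding (L : FirstOrder.Language.{u, v}) where
  coding : SymbolCoding L

section Formulas
variable {L : FirstOrder.Language.{u, v}} [Coding L]

instance : Enc (Fml L) := ⟨encFml Coding.coding⟩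
instance : Enc (Trm L) := ⟨encTrm Coding.coding⟩
instance : Enc RelSym := ⟨fun p => .cons p.name (.ofNat p.arity)⟩
instance : Enc (Atom L) := ⟨encAtom Coding.coding⟩
instance : Enc (Clause L) := ⟨encClause Coding.coding⟩

variable {α β γ : Type*} [Enc α] [Enc β] [Enc γ]

/-- Programs whose result is given as raw data. -/
theorem PT.of_enc_comp {f : α → β} {F : α → Data} (hF : PT F) (h : ∀ a, enc (f a) = F a) :
    PT f := hF.of_enc_eq _root_.id (fun _ => rfl) h

@[fun_prop]
theorem PT.imp {f g : α → Fml L} (hf : PT f) (hg : PT g) :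
    PT fun a => (f a).imp (g a) :=
  PT.of_enc_comp (F := fun a => Data.cons (.ofNat 3) (.cons (enc (f a)) (enc (g a))))
    ((PT.const (Data.ofNat 3)).data_cons (hf.enc_comp.data_cons hg.enc_comp)) fun _ => rfl

@[fun_prop]
theorem PT.not_fml {f : α → Fml L} (hf : PT f) : PT fun a => (f a).not := by
  show PT fun a => (f a).imp ⊥
  fun_prop

@[fun_prop]
theorem PT.inf {f g : α → Fml L} (hf : PT f) (hg : PT g) : PT fun a => f a ⊓ g a := by
  show PT fun a => ((f a).imp (g a).not).not
  fun_prop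


theorem esize_imp (φ ψ : Fml L) : esize (φ.imp ψ : Fml L) = esize φ + esize ψ + 9 := by
  show (Data.cons (.ofNat 3) (.cons (enc φ) (enc ψ))).size = (enc φ).size + (enc ψ).size + 9
  simp only [Data.size, Data.ofNat]; omega

theorem esize_bot : esize (⊥ : Fml L) = 3 := rfl

theorem esize_top : esize (⊤ : Fml L) = 15 := by
  show esize ((⊥ : Fml L).imp ⊥ : Fml L) = 15
  rw [esize_imp, esize_bot]

theorem esize_inf (φ ψ : Fml L) : esize (φ ⊓ ψ) = esize φ + esize ψ + 33 := by
  show esize ((φ.imp (ψ.imp ⊥ : Fml L) : Fml L).imp ⊥ : Fml L) = _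
  rw [esize_imp, esize_imp, esize_imp, esize_bot]; omega

/-- Conjunction of a list. -/
def conj (l : List (Fml L)) : Fml L := l.foldr (· ⊓ ·) ⊤

theorem esize_conj (l : List (Fml L)) : esize (conj l) ≤ 33 * esize l := by
  induction l with
  | nil => show esize (⊤ : Fml L) ≤ _; rw [esize_top, esize_nil]; omega
  | cons φ l ih =>
    show esize (φ ⊓ conj l) ≤ _
    rw [esize_inf, esize_cons]; omega

@[fun_prop]
theorem PT.conj {f : α → List (Fml L)} (hf : PT f) : PT fun a => conj (f a) := by
  refine (PT.foldl (step := fun _ s b => b ⊓ s) (init := fun _ => ⊤)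
    (l := fun a => (f a).reverse) (by fun_prop) (by fun_prop) (by fun_prop)
    ((PB.const 33).mul hf.pb_esize) fun a l₁ h => ?_).of_enc_eq _root_.id (fun _ => rfl)
      fun a => ?_
  · have : l₁.foldl (fun s b => b ⊓ s) ⊤ = HornInterp.conj l₁.reverse := by
      rw [HornInterp.conj, List.foldr_reverse]
    rw [this]
    refine (esize_conj _).trans (Nat.mul_le_mul_left _ ?_)
    rw [esize_reverse, ← esize_reverse (f a)]
    exact esize_sublist h.sublist
  · simp [HornInterp.conj, List.foldl_reverse]

@[fun_prop]
theorem PT.var {f : α → Data} (hf : PT f) : PT fun a => (Term.var (f a) : Trm L) :=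
  PT.of_enc_comp ((PT.const (Data.ofNat 0)).data_cons hf) fun _ => rfl

-- A free variable of a formula has the same code as a variable of a term, so terms enter the code
-- of an equation unchanged.
omit [Coding L] in
theorem encTermAux_relabel_inl (c : SymbolCoding L) {n : ℕ} (t : Trm L) :
    encTermAux c (t.relabel Sum.inl : L.Term (Data ⊕ Fin n)) = encTrm c t := by
  induction t with
  | var x => rfl
  | func f ts ih => simp only [Term.relabel, encTermAux, encTrm, ih]

@[fun_prop]
theorem PT.equal {f g : α → Trm L} (hf : PT f) (hg : PT g) :
    PT fun a => ((f a).equal (g a) : Fml L) :=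
  PT.of_enc_comp (F := fun a => Data.cons (.ofNat 1) (.cons (enc (f a)) (enc (g a))))
    ((PT.const (Data.ofNat 1)).data_cons (hf.enc_comp.data_cons hg.enc_comp)) fun a => by
      show encBounded Coding.coding (Term.bdEqual _ _) = _
      simp only [Term.bdEqual, encBounded, encTermAux_relabel_inl]; rfl

/-! ### Traversal of formulas -/

/-- The role of the left component of a pair of the given role: 0 symbols, 1 free variables,
2 terms, 3 lists of terms, 4 symbols with arguments, 5 pairs of terms, 6 formulas, 7 pairs of
formulas. -/
def modeL (m : ℕ) : ℕ :=
  if m = 3 then 2 else if m = 5 then 2 else if m = 7 then 6 else 0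

/-- The role of the right component. -/
def modeR (m : ℕ) (tag : Data) : ℕ :=
  if m = 2 then (if tag = .ofNat 0 then 1 else if tag = .ofNat 1 then 0 else 4)
  else if m = 3 then 3 else if m = 4 then 3 else if m = 5 then 2
  else if m = 6 then (if tag = .ofNat 0 then 0 else if tag = .ofNat 1 then 5
    else if tag = .ofNat 2 then 4 else if tag = .ofNat 3 then 7 else 6)
  else 6

/-- Traversal of an encoded formula. -/
def walk {β : Type*} (leaf : ℕ → Data → β) (comb : β → β → β) : ℕ → Data → β
  | m, .nil => leaf m .nil
  | m, .cons a b => if m = 0 ∨ m = 1 then leaf m (.cons a b) else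
      comb (walk leaf comb (modeL m) a) (walk leaf comb (modeR m a) b)

/-- Copying a formula with changed leaves and collecting a list from its leaves both have a `comb`
that adds at most one to the sizes of the parts, and then the result is linear in the number of
nodes. -/
theorem PT.walk {leaf : α → ℕ → Data → β} {comb : β → β → β} {m : ℕ} {d : α → Data}
    (hleaf : PT fun p : α × ℕ × Data => leaf p.1 p.2.1 p.2.2)
    (hcomb : PT fun p : β × β => comb p.1 p.2) (hd : PT d) (hm : m ≤ 7)
    (hb : ∀ b c, esize (comb b c) ≤ esize b + esize c + 1) :
    PT fun a => walk (leaf a) comb m (d a) := by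
  obtain ⟨q, hq⟩ := hleaf.pb_esize
  -- A bound for the value at a single leaf; 15 is the size of the numeral 7, the largest role.
  let V : α → ℕ := fun a => q.eval (esize a + (15 + esize (d a) + 1) + 1)
  have hm1 : ∀ m, modeL m ≤ 7 := fun m => by unfold modeL; split_ifs <;> omega
  have hm2 : ∀ m t, modeR m t ≤ 7 := fun m t => by unfold modeR; split_ifs <;> omega
  -- Every node of the traversed tree pays for one leaf value and for the unit lost in `comb`.
  have hsz : ∀ a m (x : Data), m ≤ 7 → x.size ≤ esize (d a) →
      esize (HornInterp.walk (leaf a) comb m x) ≤ x.size * (V a + 1) := by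
    intro a m x
    have hl : ∀ m x, m ≤ 7 → x.size ≤ esize (d a) →
        esize (leaf a m x) ≤ x.size * (V a + 1) := by
      intro m x hm hx
      refine (hq (a, m, x)).trans (le_trans (eval_mono _ (n := esize a + (15 + esize (d a) + 1) + 1)
        ?_) ?_)
      · rw [esize_pair, esize_pair, esize_nat]
        have : esize x = x.size := rfl
        omega
      · exact (Nat.le_succ _).trans (Nat.le_mul_of_pos_left _ x.size_pos)
    induction x generalizing m with
    | nil => exact hl m _
    | cons u v ihu ihv =>
      intro hm hx
      simp only [HornInterp.walk]
      split_ifs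
      · exact hl m _ hm hx
      · simp only [Data.size] at hx ⊢
        have h1 := ihu (modeL m) (by have := hm1 m; omega) (by omega)
        have h2 := ihv (modeR m u) (by have := hm2 m u; omega) (by omega)
        refine (hb _ _).trans ?_
        rw [add_mul, add_mul, one_mul]
        omega
  refine PT.binrec (α := α) (X := α × ℕ × Data)
    (F := fun x => HornInterp.walk (leaf x.1) comb x.2.1 x.2.2)
    (halt := fun x => decide (x.2.2 = .nil ∨ x.2.1 = 0 ∨ x.2.1 = 1))
    (leaf := fun x => leaf x.1.1 x.1.2.1 x.1.2.2)
    (l := fun x => (x.1.1, modeL x.1.2.1, x.1.2.2.head))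
    (r := fun x => (x.1.1, modeR x.1.2.1 x.1.2.2.head, x.1.2.2.tail))
    (comb := fun p => comb p.2.1 p.2.2) (by fun_prop) ?_ ?_ ?_ ?_ ?_ ?_
    (fun x => x.2.2.size) (fun x => x.2.2.size_pos) ?_ (init := fun a => (a, m, d a)) (by fun_prop)
    (fun a x => x.1 = a ∧ x.2.1 ≤ 7 ∧ x.2.2.size ≤ esize (d a)) ?_ ?_ ?_
    (fun a => esize a + (15 + esize (d a) + 1) + 1 + esize (d a) * (V a + 1)) ?_ ?_ hd.pb_esize
  · exact hleaf.comp (PT.subtype_val (p := fun x : α × ℕ × Data => _))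
  · have : PT fun p : α × ℕ × Data => modeL p.2.1 := by unfold modeL; fun_prop
    have h := this.comp (PT.subtype_val (p := fun x : α × ℕ × Data =>
      decide (x.2.2 = .nil ∨ x.2.1 = 0 ∨ x.2.1 = 1) = false))
    fun_prop
  · have : PT fun p : α × ℕ × Data => modeR p.2.1 p.2.2.head := by unfold modeR; fun_prop
    have h := this.comp (PT.subtype_val (p := fun x : α × ℕ × Data =>
      decide (x.2.2 = .nil ∨ x.2.1 = 0 ∨ x.2.1 = 1) = false))
    fun_prop
  · exact hcomb.comp PT.snd
  · rintro ⟨⟨a, m, _ | ⟨u, v⟩⟩, hx⟩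
    · rfl
    · have : m = 0 ∨ m = 1 := by simpa using hx
      simp [HornInterp.walk, this]
  · rintro ⟨⟨a, m, _ | ⟨u, v⟩⟩, hx⟩
    · simp at hx
    · have : ¬ (m = 0 ∨ m = 1) := by simpa using hx
      simp only [HornInterp.walk, this, if_false, Data.head, Data.tail]
  · rintro ⟨⟨a, m, _ | ⟨u, v⟩⟩, hx⟩
    · simp at hx
    · simp only [Data.head, Data.tail, Data.size]; omega
  · exact fun a => ⟨rfl, hm, le_rfl⟩
  · rintro a ⟨⟨a', m, _ | ⟨u, v⟩⟩, hx⟩ ⟨h1, h2, h3⟩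
    · simp at hx
    · simp only [Data.size] at h3
      exact ⟨h1, hm1 _, by simp only [Data.head]; omega⟩
  · rintro a ⟨⟨a', m, _ | ⟨u, v⟩⟩, hx⟩ ⟨h1, h2, h3⟩
    · simp at hx
    · simp only [Data.size] at h3
      exact ⟨h1, hm2 _ _, by simp only [Data.tail]; omega⟩
  · have hn := hd.pb_esize
    have h1 := (PB.esize.add (((PB.const 15).add hn).add (PB.const 1))).add (PB.const 1)
    exact h1.add (hn.mul ((PB.eval q h1).add (PB.const 1)))
  · rintro a ⟨a', m, x⟩ ⟨h1, h2, h3⟩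
    simp only at h1 h2 h3 ⊢
    subst h1
    have h4 := (hsz a' m x h2 h3).trans (Nat.mul_le_mul_right _ h3)
    have h5 : esize x = x.size := rfl
    rw [esize_pair, esize_pair, esize_nat]
    exact ⟨by omega, by omega⟩

/-! ### Renaming of variables and free variables -/

/-- Renaming of the free variables of a formula. -/
def rename (ρ : Data → Data) (φ : Fml L) : Fml L :=
  BoundedFormula.subst φ fun x => Term.var (ρ x)

/-- Renaming of the variables of a term. -/
def renameT (ρ : Data → Data) (t : Trm L) : Trm L := t.subst fun x => Term.var (ρ x)

section walk
variable {κ : Type*} (leaf : ℕ → Data → κ) (comb : κ → κ → κ)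

theorem walk_zero (x : Data) : walk leaf comb 0 x = leaf 0 x := by cases x <;> rfl
theorem walk_one (x : Data) : walk leaf comb 1 x = leaf 1 x := by cases x <;> rfl

theorem walk_list (l : List Data) :
    walk leaf comb 3 (.ofList l) = (l.map (walk leaf comb 2)).foldr comb (leaf 3 .nil) := by
  induction l with
  | nil => rfl
  | cons a l ih => simp [Data.ofList, walk, modeL, modeR, ih]

theorem walk_var (x : Data) :
    walk leaf comb 2 (.cons (.ofNat 0) x) = comb (leaf 0 (.ofNat 0)) (leaf 1 x) := by
  simp [walk, modeL, modeR, walk_zero, walk_one]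

theorem walk_bvar (x : Data) :
    walk leaf comb 2 (.cons (.ofNat 1) x) = comb (leaf 0 (.ofNat 1)) (leaf 0 x) := by
  simp [walk, modeL, modeR, walk_zero, ofNat_injective.eq_iff]

theorem walk_func (f : Data) (l : List Data) :
    walk leaf comb 2 (.cons (.ofNat 2) (.cons f (.ofList l))) = comb (leaf 0 (.ofNat 2))
      (comb (leaf 0 f) ((l.map (walk leaf comb 2)).foldr comb (leaf 3 .nil))) := by
  simp [walk, modeL, modeR, walk_zero, ofNat_injective.eq_iff, walk_list]

theorem walk_falsum (x : Data) :
    walk leaf comb 6 (.cons (.ofNat 0) x) = comb (leaf 0 (.ofNat 0)) (leaf 0 x) := by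
  simp [walk, modeL, modeR, walk_zero]

theorem walk_equal (x y : Data) :
    walk leaf comb 6 (.cons (.ofNat 1) (.cons x y)) =
      comb (leaf 0 (.ofNat 1)) (comb (walk leaf comb 2 x) (walk leaf comb 2 y)) := by
  simp [walk, modeL, modeR, walk_zero, ofNat_injective.eq_iff]

theorem walk_rel (f : Data) (l : List Data) :
    walk leaf comb 6 (.cons (.ofNat 2) (.cons f (.ofList l))) = comb (leaf 0 (.ofNat 2))
      (comb (leaf 0 f) ((l.map (walk leaf comb 2)).foldr comb (leaf 3 .nil))) := by
  simp [walk, modeL, modeR, walk_zero, ofNat_injective.eq_iff, walk_list]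

theorem walk_imp (x y : Data) :
    walk leaf comb 6 (.cons (.ofNat 3) (.cons x y)) =
      comb (leaf 0 (.ofNat 3)) (comb (walk leaf comb 6 x) (walk leaf comb 6 y)) := by
  simp [walk, modeL, modeR, walk_zero, ofNat_injective.eq_iff]

theorem walk_all (x : Data) :
    walk leaf comb 6 (.cons (.ofNat 4) x) = comb (leaf 0 (.ofNat 4)) (walk leaf comb 6 x) := by
  simp [walk, modeL, modeR, walk_zero, ofNat_injective.eq_iff]

end walk

theorem ofList_eq_foldr (l : List Data) : Data.ofList l = l.foldr .cons .nil := by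
  induction l with
  | nil => rfl
  | cons a l ih => simp [Data.ofList, ih]

/-- The action of a renaming on the parts of a formula: 1 marks the variables. -/
def renameLeaf (ρ : Data → Data) (m : ℕ) (x : Data) : Data := if m = 1 then ρ x else x

omit [Coding L] in
theorem encTrm_renameT (c : SymbolCoding L) (ρ : Data → Data) (t : Trm L) :
    encTrm c (renameT ρ t) = walk (renameLeaf ρ) .cons 2 (encTrm c t) := by
  induction t with
  | var x => simp [renameT, encTrm, walk_var, renameLeaf]
  | func f ts ih =>
    simp only [renameT] at ih
    simp only [renameT, Term.subst, encTrm, walk_func, ih, List.map_ofFn, Function.comp_def]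
    simp [ofList_eq_foldr, renameLeaf]

/-- The substitution that `BoundedFormula.subst` applies to terms. -/
abbrev liftSubst {n : ℕ} (σ : Data → Trm L) : Data ⊕ Fin n → L.Term (Data ⊕ Fin n) :=
  Sum.elim (Term.relabel Sum.inl ∘ σ) (Term.var ∘ Sum.inr)

omit [Coding L] in
theorem encTermAux_rename (c : SymbolCoding L) (ρ : Data → Data) {n : ℕ}
    (t : L.Term (Data ⊕ Fin n)) :
    encTermAux c (t.subst (liftSubst fun x => Term.var (ρ x))) =
      walk (renameLeaf ρ) .cons 2 (encTermAux c t) := by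
  induction t with
  | var x => rcases x with x | x <;> simp [encTermAux, walk_var, walk_bvar, renameLeaf]
  | func f ts ih =>
    simp only [Term.subst, encTermAux, ih, walk_func, List.map_ofFn, Function.comp_def]
    simp [ofList_eq_foldr, renameLeaf]

-- Renaming alters exactly the leaves with role 1. Bound variables are numbered indices with role 0,
-- so no capture can occur and the traversal needs no knowledge of quantifiers.
omit [Coding L] in
theorem encBounded_rename (c : SymbolCoding L) (ρ : Data → Data) {n : ℕ}
    (φ : L.BoundedFormula Data n) :
    encBounded c (φ.subst fun x => Term.var (ρ x)) =
      walk (renameLeaf ρ) .cons 6 (encBounded c φ) := by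
  have key : ∀ {n : ℕ} (t : L.Term (Data ⊕ Fin n)), encTermAux c (t.subst
      (Sum.elim (Term.relabel Sum.inl ∘ fun x => Term.var (ρ x)) (Term.var ∘ Sum.inr))) =
      walk (renameLeaf ρ) .cons 2 (encTermAux c t) := encTermAux_rename c ρ
  unfold BoundedFormula.subst
  induction φ with
  | falsum => simp [BoundedFormula.mapTermRel, encBounded, walk_falsum, renameLeaf]
  | equal s t =>
    simp only [BoundedFormula.mapTermRel, encBounded, walk_equal, renameLeaf, key]; simp
  | rel R ts =>
    simp only [BoundedFormula.mapTermRel, encBounded, walk_rel, List.map_ofFn]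
    simp only [Function.comp_def, ← key]
    simp [ofList_eq_foldr, renameLeaf]
  | imp φ ψ ih₁ ih₂ =>
    simp only [BoundedFormula.mapTermRel, encBounded, walk_imp, renameLeaf, ih₁, ih₂]; simp
  | all φ ih =>
    simp only [BoundedFormula.mapTermRel, encBounded, walk_all, renameLeaf]
    simp only [id_eq]
    simp [ih]

theorem PT.renameLeaf {ρ : α → Data → Data} (hρ : PT fun p : α × Data => ρ p.1 p.2) :
    PT fun p : α × ℕ × Data => renameLeaf (ρ p.1) p.2.1 p.2.2 := by
  have := hρ.comp (f := fun p : α × ℕ × Data => (p.1, p.2.2)) (by fun_prop)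
  unfold HornInterp.renameLeaf; fun_prop

@[fun_prop]
theorem PT.rename {ρ : α → Data → Data} {φ : α → Fml L} (hφ : PT φ)
    (hρ : PT fun p : α × Data => ρ p.1 p.2) : PT fun a => rename (ρ a) (φ a) :=
  PT.of_enc_comp (PT.walk (PT.renameLeaf hρ) (by fun_prop) hφ.enc_comp (m := 6) (by norm_num)
    fun _ _ => le_rfl) fun a => encBounded_rename _ _ _

@[fun_prop]
theorem PT.renameT {ρ : α → Data → Data} {t : α → Trm L} (ht : PT t)
    (hρ : PT fun p : α × Data => ρ p.1 p.2) : PT fun a => renameT (ρ a) (t a) :=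
  PT.of_enc_comp (PT.walk (PT.renameLeaf hρ) (by fun_prop) ht.enc_comp (m := 2) (by norm_num)
    fun _ _ => le_rfl) fun a => encTrm_renameT _ _ _

/-- The occurrences of free variables in a part of a formula. -/
def varLeaf (m : ℕ) (x : Data) : List Data := if m = 1 then [x] else []

/-- The list of the occurrences of free variables in a formula. -/
def varList (φ : Fml L) : List Data := walk varLeaf (· ++ ·) 6 (enc φ)

@[fun_prop]
theorem PT.varList {φ : α → Fml L} (hφ : PT φ) : PT fun a => varList (φ a) :=
  PT.walk (leaf := fun _ => varLeaf) (by unfold varLeaf; fun_prop) (by fun_prop) hφ.enc_comp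
    (by norm_num) fun b c => by have := esize_append b c; omega

theorem mem_foldr_append {κ : Type*} (l : List (List κ)) (x : κ) :
    x ∈ l.foldr (· ++ ·) [] ↔ ∃ y ∈ l, x ∈ y := by
  induction l <;> simp [*]

omit [Coding L] in
theorem mem_walk_term {n : ℕ} (c : SymbolCoding L) (t : L.Term (Data ⊕ Fin n)) (x : Data) :
    x ∈ walk varLeaf (· ++ ·) 2 (encTermAux c t) ↔ x ∈ t.varFinsetLeft := by
  induction t with
  | var y => rcases y with y | y <;> simp [encTermAux, walk_var, walk_bvar, varLeaf]
  | func f ts ih =>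
    simp only [encTermAux, walk_func, varLeaf, List.map_ofFn, Term.varFinsetLeft]
    simp [mem_foldr_append, List.mem_ofFn, ih]

-- Bound variables and symbols have role 0 and contribute nothing, so only the free occurrences are
-- collected.
@[simp]
theorem mem_varList (φ : Fml L) (x : Data) : x ∈ varList φ ↔ x ∈ fv φ := by
  suffices h : ∀ {n : ℕ} (φ : L.BoundedFormula Data n),
      x ∈ walk varLeaf (· ++ ·) 6 (encBounded Coding.coding φ) ↔ x ∈ φ.freeVarFinset from h φ
  intro n φ
  induction φ with
  | falsum => simp [BoundedFormula.freeVarFinset, encBounded, walk_falsum, varLeaf]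
  | equal s t =>
    simp [BoundedFormula.freeVarFinset, encBounded, walk_equal, varLeaf, mem_walk_term]
  | rel R ts =>
    simp only [BoundedFormula.freeVarFinset, encBounded, walk_rel, varLeaf, List.map_ofFn]
    simp [mem_foldr_append, List.mem_ofFn, mem_walk_term]
  | imp φ ψ ih₁ ih₂ =>
    simp [BoundedFormula.freeVarFinset, encBounded, walk_imp, varLeaf, ih₁, ih₂]
  | all φ ih => simp [BoundedFormula.freeVarFinset, encBounded, walk_all, varLeaf, ih]

end Formulas

/-! ### Semantics -/

section Semantics
variable {L : FirstOrder.Language.{u, v}} {M : Interp.{u, v, w} L} {φ ψ : Fml L} {a b : Data → M.U}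

@[simp] theorem sat_bot : ¬ M.Sat ⊥ a := fun h => h
@[simp] theorem sat_imp : M.Sat (φ.imp ψ) a ↔ (M.Sat φ a → M.Sat ψ a) := Iff.rfl
@[simp] theorem sat_top : M.Sat ⊤ a := fun h => h
@[simp] theorem sat_not : M.Sat φ.not a ↔ ¬ M.Sat φ a := Iff.rfl
@[simp] theorem sat_inf : M.Sat (φ ⊓ ψ) a ↔ M.Sat φ a ∧ M.Sat ψ a := by
  let := M.str; exact Formula.realize_inf
@[simp] theorem sat_sup : M.Sat (φ ⊔ ψ) a ↔ M.Sat φ a ∨ M.Sat ψ a := by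
  let := M.str; exact Formula.realize_sup

/-- The value of a term. -/
def Interp.val (M : Interp.{u, v, w} L) (t : Trm L) (a : Data → M.U) : M.U :=
  letI := M.str
  t.realize a

@[simp] theorem val_var (x : Data) : M.val (.var x) a = a x := rfl

@[simp] theorem sat_equal (s t : Trm L) : M.Sat (s.equal t) a ↔ M.val s a = M.val t a := by
  let := M.str; exact Formula.realize_equal

@[simp] theorem sat_conj (l : List (Fml L)) : M.Sat (conj l) a ↔ ∀ φ ∈ l, M.Sat φ a := by
  induction l with
  | nil => simp [conj]
  | cons φ l ih => rw [conj, List.foldr_cons, ← conj]; simp [ih]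

theorem sat_subst (σ : Data → Trm L) :
    M.Sat (BoundedFormula.subst φ σ) a ↔ M.Sat φ fun x => M.val (σ x) a := by
  let := M.str; exact BoundedFormula.realize_subst

@[simp] theorem sat_rename (ρ : Data → Data) : M.Sat (rename ρ φ) a ↔ M.Sat φ fun x => a (ρ x) :=
  sat_subst _

@[simp] theorem val_renameT (ρ : Data → Data) (t : Trm L) :
    M.val (renameT ρ t) a = M.val t fun x => a (ρ x) := by
  let := M.str; exact Term.realize_subst

theorem sat_congr (h : ∀ x ∈ fv φ, a x = b x) : M.Sat φ a ↔ M.Sat φ b := by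
  let := M.str
  show BoundedFormula.Realize φ a default ↔ BoundedFormula.Realize φ b default
  rw [← BoundedFormula.realize_restrictFreeVar (f := fun x : φ.freeVarFinset => x.1) (v := a) (v' := a)
    fun x => rfl, ← BoundedFormula.realize_restrictFreeVar (f := fun x : φ.freeVarFinset => x.1) (v := a) (v' := b)
    fun x => h x.1 x.2]

@[simp] theorem fv_bot : fv (⊥ : Fml L) = ∅ := by simp [fv, BoundedFormula.freeVarFinset]
@[simp] theorem fv_imp : fv (φ.imp ψ) = fv φ ∪ fv ψ := by simp [fv, BoundedFormula.freeVarFinset]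
@[simp] theorem fv_top : fv (⊤ : Fml L) = ∅ := by
  show fv ((⊥ : Fml L).imp ⊥) = ∅
  simp
@[simp] theorem fv_not : fv φ.not = fv φ := by
  show fv (φ.imp ⊥) = _
  simp
@[simp] theorem fv_inf : fv (φ ⊓ ψ) = fv φ ∪ fv ψ := by
  show fv (φ.imp (ψ.not)).not = _
  rw [fv_not, fv_imp, fv_not]
@[simp] theorem fv_sup : fv (φ ⊔ ψ) = fv φ ∪ fv ψ := by
  show fv (φ.not.imp ψ) = _
  rw [fv_imp, fv_not]

@[simp] theorem mem_fv_conj (l : List (Fml L)) (x : Data) : x ∈ fv (conj l) ↔ ∃ φ ∈ l, x ∈ fv φ := by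
  induction l with
  | nil => simp [conj]
  | cons φ l ih => rw [conj, List.foldr_cons, ← conj]; simp [ih]

theorem mem_fv_equal (s t : Trm L) (x : Data) :
    x ∈ fv (s.equal t : Fml L) ↔ x ∈ s.varFinset ∨ x ∈ t.varFinset := by
  have key : ∀ t : Trm L, (t.relabel Sum.inl : L.Term (Data ⊕ Fin 0)).varFinsetLeft = t.varFinset := by
    intro t
    induction t with
    | var y => rfl
    | func f ts ih => simp [ih]
  show x ∈ (Term.bdEqual _ _).freeVarFinset ↔ _
  simp [Term.bdEqual, BoundedFormula.freeVarFinset, key]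

theorem mem_varFinset_renameT (ρ : Data → Data) (t : Trm L) (x : Data) :
    x ∈ (renameT ρ t).varFinset ↔ ∃ y ∈ t.varFinset, ρ y = x := by
  induction t with
  | var y => simp [renameT, eq_comm]
  | func f ts ih =>
    simp only [renameT] at ih
    simp only [renameT, Term.subst, Term.varFinset, Finset.mem_biUnion, ih]
    simp only [Finset.mem_univ, true_and]
    exact ⟨fun ⟨i, y, h, e⟩ => ⟨y, ⟨i, h⟩, e⟩, fun ⟨y, ⟨i, h⟩, e⟩ => ⟨i, y, h, e⟩⟩

theorem fv_rename (ρ : Data → Data) (φ : Fml L) : fv (rename ρ φ) = ρ '' fv φ := by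
  have key : ∀ {n : ℕ} (t : L.Term (Data ⊕ Fin n)), (t.subst
      (Sum.elim (Term.relabel Sum.inl ∘ fun x => Term.var (ρ x)) (Term.var ∘ Sum.inr)) :
        L.Term (Data ⊕ Fin n)).varFinsetLeft = t.varFinsetLeft.image ρ := by
    intro n t
    induction t with
    | var y => rcases y with y | y <;> simp
    | func f ts ih => ext x; simp [ih]; exact ⟨fun ⟨i, y, h, e⟩ => ⟨y, ⟨i, h⟩, e⟩, fun ⟨y, ⟨i, h⟩, e⟩ => ⟨i, y, h, e⟩⟩
  have : ∀ {n : ℕ} (φ : L.BoundedFormula Data n),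
      (φ.subst fun x => Term.var (ρ x)).freeVarFinset = φ.freeVarFinset.image ρ := by
    intro n φ
    unfold BoundedFormula.subst
    induction φ with
    | falsum => rfl
    | equal s t =>
      simp only [BoundedFormula.mapTermRel, BoundedFormula.freeVarFinset, key, Finset.image_union]
    | rel R ts =>
      simp only [BoundedFormula.mapTermRel, BoundedFormula.freeVarFinset, key,
        Finset.biUnion_image]
    | imp φ ψ ih₁ ih₂ =>
      simp only [BoundedFormula.mapTermRel, BoundedFormula.freeVarFinset, ih₁, ih₂,
        Finset.image_union]
    | all φ ih =>
      simp only [BoundedFormula.mapTermRel, BoundedFormula.freeVarFinset, id_eq,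
        ih]
  ext x
  simp [fv, rename, this]

namespace ConstraintLanguage
variable {Con : ConstraintLanguage L}

theorem top_mem : (⊤ : Fml L) ∈ Con.carrier := Con.imp_mem _ Con.falsum_mem _ Con.falsum_mem
theorem not_mem (h : φ ∈ Con.carrier) : φ.not ∈ Con.carrier := Con.imp_mem _ h _ Con.falsum_mem
theorem inf_mem (h : φ ∈ Con.carrier) (h' : ψ ∈ Con.carrier) : φ ⊓ ψ ∈ Con.carrier :=
  not_mem (Con.imp_mem _ h _ (not_mem h'))
theorem sup_mem (h : φ ∈ Con.carrier) (h' : ψ ∈ Con.carrier) : φ ⊔ ψ ∈ Con.carrier :=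
  Con.imp_mem _ (not_mem h) _ h'
theorem rename_mem (h : φ ∈ Con.carrier) (ρ : Data → Data) : rename ρ φ ∈ Con.carrier :=
  Con.subst_mem _ h _
theorem conj_mem {l : List (Fml L)} (h : ∀ φ ∈ l, φ ∈ Con.carrier) : conj l ∈ Con.carrier := by
  induction l with
  | nil => exact top_mem
  | cons φ l ih => exact inf_mem (h _ (by simp)) (ih fun ψ hψ => h _ (by simp [hψ]))

end ConstraintLanguage

end Semantics

/-! ### Reductions -/

/-- A `PT` program works whatever `call` refers to, in particular when it refers to the program
itself. -/
theorem polyTimeOn_of_PT {α β : Type*} [Enc α] [Enc β] {dom : α → Prop} {ea : α → Data}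
    {eb : β → Data} {f : α → β} (h : PT fun a : {a // dom a} => f a.1) (hea : ∀ a, ea a = enc a)
    (heb : ∀ b, eb b = enc b) : PolyTimeOn dom ea eb f := by
  obtain ⟨p, T, ⟨q, hq⟩, hr⟩ := h
  refine ⟨p, q, fun a ha => ?_⟩
  obtain ⟨t, ht, hr⟩ := hr p ⟨a, ha⟩
  rw [hea, heb]
  exact ⟨t, ht.trans (hq ⟨a, ha⟩), hr⟩

/-- A complete program may use `call` for itself. Wrapping it in `fix` closes it off and makes it
usable as a component. -/
theorem PT.of_polyTimeOn {α β γ : Type*} [Enc α] [Enc β] [Enc γ] {dom : α → Prop} {ea : α → Data}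
    {eb : β → Data} {f : α → β} (h : PolyTimeOn dom ea eb f) {g : γ → α} (hg : PT g)
    (hdom : ∀ c, dom (g c)) (hea : ∀ a, ea a = enc a)
    (heb : ∀ b, eb b = enc b) : PT fun c => f (g c) := by
  obtain ⟨p, q, hq⟩ := h
  have : PT fun a : {a // dom a} => f a.1 := by
    refine ⟨.fix p, fun a => q.eval (esize a) + 1, (PB.eval q PB.esize).add (PB.const 1),
      fun b a => ?_⟩
    obtain ⟨t, ht, hr⟩ := hq a.1 a.2
    rw [hea, heb] at hr
    rw [hea] at ht
    exact ⟨t + 1, Nat.succ_le_succ ht, .fix hr⟩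
  exact this.comp (PT.subtype_mk hg hdom)

/-- The second pair of maps is only promised to work on well-formed instances and genuine solutions.
The correctness part of the first reduction provides the promise for instances, that of the second
one for the solutions passed back. -/
theorem PolyReduces.trans {P Q R : SearchProblem} (h₁ : PolyReduces P Q) (h₂ : PolyReduces Q R) :
    PolyReduces P R := by
  let : Enc P.Inst := ⟨P.encInst⟩
  let : Enc P.Ans := ⟨P.encAns⟩
  let : Enc Q.Inst := ⟨Q.encInst⟩
  let : Enc Q.Ans := ⟨Q.encAns⟩
  let : Enc R.Inst := ⟨R.encInst⟩
  let : Enc R.Ans := ⟨R.encAns⟩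
  obtain ⟨f, g, hf, hg, h⟩ := h₁
  obtain ⟨f', g', hf', hg', h'⟩ := h₂
  have hfi : PT fun a : {a : P.Inst × R.Ans // P.IsInst a.1 ∧ R.Sol (f' (f a.1)) a.2} => f a.1.1 :=
    PT.of_polyTimeOn hf (by fun_prop) (fun a => a.2.1) (fun _ => rfl) fun _ => rfl
  have hgi := PT.of_polyTimeOn hg'
    (g := fun a : {a : P.Inst × R.Ans // P.IsInst a.1 ∧ R.Sol (f' (f a.1)) a.2} =>
      (f a.1.1, a.1.2)) (hfi.prodMk (PT.snd.comp PT.subtype_val)) (fun a => ⟨(h _ a.2.1).1, a.2.2⟩) (fun _ => rfl) fun _ => rfl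
  refine ⟨fun x => f' (f x), fun a => g (a.1, g' (f a.1, a.2)), ?_, ?_, fun x hx =>
    ⟨(h' _ (h x hx).1).1, fun hy => (h' _ (h x hx).1).2.1 ((h x hx).2.1 hy), fun z hz =>
      (h x hx).2.2 _ ((h' _ (h x hx).1).2.2 _ hz)⟩⟩
  · exact polyTimeOn_of_PT (PT.of_polyTimeOn hf' (PT.of_polyTimeOn hf PT.subtype_val (fun a => a.2)
      (fun _ => rfl) fun _ => rfl) (fun a => (h _ a.2).1) (fun _ => rfl) fun _ => rfl)
      (fun _ => rfl) fun _ => rfl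
  · exact polyTimeOn_of_PT (PT.of_polyTimeOn hg
      (g := fun a : {a : P.Inst × R.Ans // P.IsInst a.1 ∧ R.Sol (f' (f a.1)) a.2} =>
        (a.1.1, g' (f a.1.1, a.1.2))) ((PT.fst.comp PT.subtype_val).prodMk hgi)
      (fun a => ⟨a.2.1, (h' _ (h _ a.2.1).1).2.2 _ a.2.2⟩) (fun _ => rfl) fun _ => rfl)
      (fun _ => rfl) fun _ => rfl

theorem PolyReduces.trans_seq {P Q R : SearchProblem} (h₁ : PolyReduces P Q)
    (h₂ : PolyReducesToSeq Q R) : PolyReducesToSeq P R := by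
  let : Enc P.Inst := ⟨P.encInst⟩
  let : Enc P.Ans := ⟨P.encAns⟩
  let : Enc Q.Inst := ⟨Q.encInst⟩
  let : Enc Q.Ans := ⟨Q.encAns⟩
  let : Enc R.Inst := ⟨R.encInst⟩
  let : Enc R.Ans := ⟨R.encAns⟩
  obtain ⟨f, g, hf, hg, h⟩ := h₁
  obtain ⟨f', g', hf', hg', h'⟩ := h₂
  have hfi : PT fun a : {a : P.Inst × List R.Ans // P.IsInst a.1 ∧
      List.Forall₂ R.Sol (f' (f a.1)) a.2} => f a.1.1 :=
    PT.of_polyTimeOn hf (by fun_prop) (fun a => a.2.1) (fun _ => rfl) fun _ => rfl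
  have hgi := PT.of_polyTimeOn hg'
    (g := fun a : {a : P.Inst × List R.Ans // P.IsInst a.1 ∧
      List.Forall₂ R.Sol (f' (f a.1)) a.2} =>
      (f a.1.1, a.1.2)) (hfi.prodMk (PT.snd.comp PT.subtype_val)) (fun a => ⟨(h _ a.2.1).1, a.2.2⟩) (fun _ => rfl) fun _ => rfl
  refine ⟨fun x => f' (f x), fun a => g (a.1, g' (f a.1, a.2)), ?_, ?_, fun x hx =>
    ⟨(h' _ (h x hx).1).1, fun hy => (h' _ (h x hx).1).2.1 ((h x hx).2.1 hy), fun z hz =>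
      (h x hx).2.2 _ ((h' _ (h x hx).1).2.2 _ hz)⟩⟩
  · exact polyTimeOn_of_PT (PT.of_polyTimeOn hf' (PT.of_polyTimeOn hf PT.subtype_val (fun a => a.2)
      (fun _ => rfl) fun _ => rfl) (fun a => (h _ a.2).1) (fun _ => rfl) fun _ => rfl)
      (fun _ => rfl) fun _ => rfl
  · exact polyTimeOn_of_PT (PT.of_polyTimeOn hg
      (g := fun a : {a : P.Inst × List R.Ans // P.IsInst a.1 ∧
        List.Forall₂ R.Sol (f' (f a.1)) a.2} =>
        (a.1.1, g' (f a.1.1, a.1.2))) ((PT.fst.comp PT.subtype_val).prodMk hgi)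
      (fun a => ⟨a.2.1, (h' _ (h _ a.2.1).1).2.2 _ a.2.2⟩) (fun _ => rfl) fun _ => rfl)
      (fun _ => rfl) fun _ => rfl

/-- The backward map is asked to be polynomial on all answers, not only on solutions; the
constructions below are of this kind, so the running time can be settled before correctness. -/
theorem PolyReduces.intro {I A : Type u} {I' A' : Type v} [Enc I] [Enc A] [Enc I'] [Enc A'] {eI : I → Data}
    {eA : A → Data} {eI' : I' → Data} {eA' : A' → Data} {isI : I → Prop} {isI' : I' → Prop}
    {sol : I → A → Prop} {sol' : I' → A' → Prop} (f : I → I') (g : I → A' → A)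
    (hf : PT fun x : {x // isI x} => f x.1)
    (hg : PT fun a : {a : I × A' // isI a.1} => g a.1.1 a.1.2)
    (h : ∀ x, isI x → isI' (f x) ∧ ((∃ y, sol x y) → ∃ z, sol' (f x) z) ∧
      ∀ z, sol' (f x) z → sol x (g x z))
    (heI : ∀ x, eI x = enc x := by exact fun _ => rfl)
    (heA : ∀ x, eA x = enc x := by exact fun _ => rfl)
    (heI' : ∀ x, eI' x = enc x := by exact fun _ => rfl)
    (heA' : ∀ x, eA' x = enc x := by exact fun _ => rfl) :
    PolyReduces ⟨I, A, eI, eA, isI, sol⟩ ⟨I', A', eI', eA', isI', sol'⟩ := by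
  refine ⟨f, fun a => g a.1 a.2, polyTimeOn_of_PT hf heI heI', ?_, h⟩
  refine polyTimeOn_of_PT (hg.comp (PT.subtype_mk (f := fun a : {a : I × A' // isI a.1 ∧
    sol' (f a.1) a.2} => a.1) PT.subtype_val fun a => a.2.1)) (fun a => ?_) heA
  exact congrArg₂ Data.cons (heI _) (heA' _)

theorem PolyReducesToSeq.intro {I A : Type u} {I' A' : Type v} [Enc I] [Enc A] [Enc I'] [Enc A']
    {eI : I → Data} {eA : A → Data} {eI' : I' → Data} {eA' : A' → Data} {isI : I → Prop}
    {isI' : I' → Prop} {sol : I → A → Prop} {sol' : I' → A' → Prop} (f : I → List I')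
    (g : I → List A' → A)
    (hf : PT fun x : {x // isI x} => f x.1)
    (hg : PT fun a : {a : I × List A' // isI a.1} => g a.1.1 a.1.2)
    (h : ∀ x, isI x → (∀ q ∈ f x, isI' q) ∧ ((∃ y, sol x y) → ∀ q ∈ f x, ∃ z, sol' q z) ∧
      ∀ zs, List.Forall₂ sol' (f x) zs → sol x (g x zs))
    (heI : ∀ x, eI x = enc x := by exact fun _ => rfl)
    (heA : ∀ x, eA x = enc x := by exact fun _ => rfl)
    (heI' : ∀ x, eI' x = enc x := by exact fun _ => rfl)
    (heA' : ∀ x, eA' x = enc x := by exact fun _ => rfl) :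
    PolyReducesToSeq ⟨I, A, eI, eA, isI, sol⟩ ⟨I', A', eI', eA', isI', sol'⟩ := by
  refine ⟨f, fun a => g a.1 a.2, polyTimeOn_of_PT hf heI fun l => ?_, ?_, h⟩
  · have : eI' = enc := funext heI'
    rw [this]; rfl
  · refine polyTimeOn_of_PT (hg.comp (PT.subtype_mk (f := fun a : {a : I × List A' // isI a.1 ∧
      List.Forall₂ sol' (f a.1) a.2} => a.1) PT.subtype_val fun a => a.2.1)) (fun a => ?_) heA
    have : eA' = enc := funext heA'
    subst this
    exact congrArg₂ Data.cons (heI _) rfl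

/-! ### Tables -/

section Tables
variable {L : FirstOrder.Language.{u, v}}

theorem table_map_of_injective {κ κ' : Type*} [DecidableEq κ] (σ : κ' → κ)
    (hσ : Function.Injective σ) (f : κ' → Fml L) {ks : List κ'} {k : κ'} (hk : k ∈ ks) :
    table (ks.map fun p => (σ p, f p)) (σ k) = f k := by
  unfold table
  induction ks with
  | nil => simp at hk
  | cons a l ih =>
    by_cases h : k = a
    · subst h; simp
    · have h1 : (σ k == σ a) = false := by simpa using fun e => h (hσ e)
      have hk' : k ∈ l := by simpa [h] using hk
      simp only [List.map_cons, List.lookup, h1]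
      exact ih hk'

theorem table_map {κ : Type*} [DecidableEq κ] (f : κ → Fml L) {ks : List κ} {k : κ} (hk : k ∈ ks) :
    table (ks.map fun p => (p, f p)) k = f k :=
  table_map_of_injective _root_.id (fun _ _ h => h) f hk

/-- Outside its keys a table yields falsity, a closed constraint. Hence a finite table gives an
assignment for all relation symbols, as `IsAssignment` demands. -/
theorem table_cases {κ : Type*} [DecidableEq κ] (l : List (κ × Fml L)) (k : κ) :
    table l k = ⊥ ∨ (k, table l k) ∈ l := by
  unfold table
  induction l with
  | nil => exact Or.inl rfl
  | cons a l ih =>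
    by_cases h : k = a.1
    · subst h; simp [List.lookup]
    · have h1 : (k == a.1) = false := by simpa using h
      simp only [List.lookup, h1, List.mem_cons]
      rcases ih with ih | ih
      · exact Or.inl ih
      · exact Or.inr (Or.inr ih)

theorem table_eq_of_mem {κ : Type*} [DecidableEq κ] {l : List (κ × Fml L)} {k : κ} {φ : Fml L}
    (hl : (l.map Prod.fst).Nodup) (h : (k, φ) ∈ l) : table l k = φ := by
  unfold table
  induction l with
  | nil => simp at h
  | cons a l ih =>
    simp only [List.map_cons, List.nodup_cons] at hl
    rcases List.mem_cons.1 h with rfl | h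
    · simp [List.lookup]
    · have h1 : (k == a.1) = false := by
        simp only [beq_eq_false_iff_ne]
        rintro rfl
        exact hl.1 (List.mem_map.2 ⟨_, h, rfl⟩)
      simp only [List.lookup, h1]
      exact ih hl.2 h

variable [Coding L] {α : Type*} [Enc α]

@[fun_prop]
theorem PT.table {l : α → List (Data × Fml L)} {k : α → Data} (hl : PT l) (hk : PT k) :
    PT fun a => table (l a) (k a) := by
  unfold HornInterp.table; fun_prop

theorem relSym_enc_injective : Function.Injective (enc (α := RelSym)) := by
  rintro ⟨p, m⟩ ⟨q, n⟩ h
  simp only [enc, Data.cons.injEq] at h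
  rw [h.1, ofNat_injective h.2]

@[fun_prop]
theorem PT.table_relSym {l : α → List (RelSym × Fml L)} {k : α → RelSym} (hl : PT l) (hk : PT k) :
    PT fun a => HornInterp.table (l a) (k a) := by
  have := PT.list_lookup_of relSym_enc_injective hl hk
  unfold HornInterp.table; fun_prop

@[fun_prop]
theorem PT.relSym_mk {f : α → Data} {g : α → ℕ} (hf : PT f) (hg : PT g) :
    PT fun a => RelSym.mk (f a) (g a) :=
  PT.of_enc_comp ((hf.prodMk hg).enc_comp) fun _ => rfl

end Tables

/-! ### Entries and positions in lists -/

section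
variable {α β γ : Type*} [Enc α] [Enc β] [Enc γ]

@[fun_prop]
theorem PT.list_getD {l : α → List β} {n : α → ℕ} {d : α → β} (hl : PT l) (hn : PT n) (hd : PT d) :
    PT fun a => (l a).getD (n a) (d a) := by
  have : ∀ a, (l a).getD (n a) (d a) = ((l a).drop (n a)).head?.getD (d a) := fun a => by
    simp [List.head?_drop]
  simp only [this]; fun_prop

@[fun_prop]
theorem PT.list_idxOf {l : α → List Data} {f : α → Data} (hl : PT l) (hf : PT f) :
    PT fun a => (l a).idxOf (f a) := by
  -- The default `l.length + k` matches the value of `idxOf` at absent elements, so membership is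
  -- not needed.
  have key : ∀ (l : List Data) (x : Data) k,
      l.idxOf x + k = ((l.zipIdx k).lookup x).getD (l.length + k) := by
    intro l x
    induction l with
    | nil => simp
    | cons b l ih =>
      intro k
      by_cases h : x = b
      · subst h; simp [List.zipIdx_cons]
      · have h1 : (x == b) = false := by simpa using h
        have := ih (k + 1)
        rw [List.idxOf_cons_ne _ (Ne.symm h)]
        simp only [List.zipIdx_cons, List.lookup, h1, List.length_cons]
        rw [Nat.succ_add, ← Nat.add_succ, this]
        congr 1; omega
  have : ∀ a, (l a).idxOf (f a) = ((l a).zipIdx.lookup (f a)).getD (l a).length := fun a => by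
    simpa using key (l a) (f a) 0
  simp only [this]; fun_prop

end

/-! ### Clauses -/

section
variable {L : FirstOrder.Language.{u, v}} [Coding L] {α : Type*} [Enc α]

theorem PT.clause_tuple : PT fun h : Clause L => (h.constraint, h.body, h.head) :=
  PT.of_enc fun _ => rfl

@[fun_prop]
theorem PT.clause_constraint {f : α → Clause L} (hf : PT f) : PT fun a => (f a).constraint :=
  PT.fst.comp (PT.clause_tuple.comp hf)

@[fun_prop]
theorem PT.clause_body {f : α → Clause L} (hf : PT f) : PT fun a => (f a).body :=
  PT.fst.comp (PT.snd.comp (PT.clause_tuple.comp hf))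

@[fun_prop]
theorem PT.clause_head {f : α → Clause L} (hf : PT f) : PT fun a => (f a).head :=
  PT.snd.comp (PT.snd.comp (PT.clause_tuple.comp hf))

@[fun_prop]
theorem PT.clause_mk {f : α → Fml L} {g : α → List (Atom L)} {h : α → Option (Atom L)} (hf : PT f)
    (hg : PT g) (hh : PT h) : PT fun a => Clause.mk (f a) (g a) (h a) :=
  PT.of_enc_comp ((hf.prodMk (hg.prodMk hh)).enc_comp) fun _ => rfl

@[fun_prop]
theorem PT.atom_name {f : α → Atom L} (hf : PT f) : PT fun a => (f a).name :=
  (PT.data_head hf.enc_comp).of_enc_eq _root_.id (fun _ => rfl) fun _ => rfl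

@[fun_prop]
theorem PT.atom_args {f : α → Atom L} (hf : PT f) : PT fun a => (f a).args :=
  (PT.data_tail hf.enc_comp).of_enc_eq _root_.id (fun _ => rfl) fun _ => rfl

@[fun_prop]
theorem PT.atom_mk {f : α → Data} {g : α → List (Trm L)} (hf : PT f) (hg : PT g) :
    PT fun a => Atom.mk (f a) (g a) :=
  PT.of_enc_comp ((hf.prodMk hg).enc_comp) fun _ => rfl

omit [Coding L] in
theorem sat_inst {M : Interp.{u, v, w} L} {a : Data → M.U} (sol : RelSym → Fml L) (h : Clause L) :
    M.Sat (h.inst sol) a ↔ (M.Sat h.constraint a → (∀ B ∈ h.body, M.Sat (B.inst sol) a) →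
      M.Sat (h.head.elim ⊥ (Atom.inst sol)) a) := by
  show M.Sat ((h.constraint ⊓ conj (h.body.map (Atom.inst sol)) : Fml L).imp _) a ↔ _
  rw [sat_imp, sat_inf, sat_conj]
  simp

end

/-! ### Flat clauses -/

/-- A clause over relation symbols with fixed argument variables. -/
structure FClause (L : FirstOrder.Language.{u, v}) where
  id : Data
  con : Fml L
  body : List Data
  head : Option Data

/-- The relation symbols of a clause. -/
def FClause.occ {L : FirstOrder.Language.{u, v}} (c : FClause L) : List Data :=
  c.body ++ c.head.toList

/-- A set of flat clauses with a table of the argument variables of all relation symbols. -/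
abbrev Flat (L : FirstOrder.Language.{u, v}) := List (FClause L) × List (Data × List Data)

namespace Flat
variable {L : FirstOrder.Language.{u, v}}

def keys (F : Flat L) : List Data := F.2.map Prod.fst

def vars (F : Flat L) (p : Data) : List Data := (F.2.lookup p).getD []

/-- `p` is in the head and `q` in the body of some clause. -/
def Dep (F : Flat L) (p q : Data) : Prop := ∃ c ∈ F.1, c.head = some p ∧ q ∈ c.body

def Acyclic (F : Flat L) : Prop := ∀ p, ¬ Relation.TransGen F.Dep p p

def Linear (F : Flat L) : Prop := ∀ c ∈ F.1, c.body.length ≤ 1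

def BodyDisjoint (F : Flat L) : Prop := (F.1.flatMap FClause.body).Nodup

def HeadDisjoint (F : Flat L) : Prop := (F.1.flatMap fun c => c.head.toList).Nodup

structure WF (Con : ConstraintLanguage L) (F : Flat L) : Prop where
  mem : ∀ c ∈ F.1, c.con ∈ Con.carrier
  occ : ∀ c ∈ F.1, ∀ p ∈ c.occ, p ∈ F.keys
  nodup : ∀ p, (F.vars p).Nodup

/-- With fixed argument variables a clause holds as it stands, without instantiation of the formulae
`J p`. This is the form in which the entailments and variable conditions of interpolation occur. -/
structure IsSol (S : Set (Interp.{u, v, w} L)) (Con : ConstraintLanguage L) (F : Flat L)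
    (J : Data → Fml L) : Prop where
  mem : ∀ p ∈ F.keys, J p ∈ Con.carrier
  vars : ∀ p ∈ F.keys, ∀ x ∈ fv (J p), x ∈ F.vars p
  valid : ∀ c ∈ F.1, ∀ M ∈ S, ∀ a : Data → M.U, M.Sat c.con a → (∀ b ∈ c.body, M.Sat (J b) a) →
    M.Sat (c.head.elim ⊥ J) a

theorem vars_eq_of_mem {F : Flat L} (h : F.keys.Nodup) {p : Data} {xs : List Data}
    (hp : (p, xs) ∈ F.2) : F.vars p = xs := by
  unfold vars
  unfold keys at h
  generalize F.2 = l at h hp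
  induction l with
  | nil => simp at hp
  | cons a l ih =>
    simp only [List.map_cons, List.nodup_cons] at h
    rcases List.mem_cons.1 hp with rfl | hp
    · simp [List.lookup]
    · have h1 : (p == a.1) = false := by
        simp only [beq_eq_false_iff_ne]
        rintro rfl
        exact h.1 (List.mem_map.2 ⟨_, hp, rfl⟩)
      simp only [List.lookup, h1]
      exact ih h.2 hp

theorem vars_map (C : List (FClause L)) (ks : List Data) (f : Data → List Data) {p : Data}
    (hp : p ∈ ks) : Flat.vars ((C, ks.map fun p => (p, f p)) : Flat L) p = f p := by
  unfold vars
  induction ks with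
  | nil => simp at hp
  | cons a l ih =>
    by_cases h : p = a
    · subst h; simp
    · have h1 : (p == a) = false := by simpa using h
      simp only [List.map_cons, List.lookup, h1]
      exact ih (by simpa [h] using hp)

theorem vars_eq_nil {F : Flat L} {p : Data} (hp : p ∉ F.keys) : F.vars p = [] := by
  unfold vars
  have : F.2.lookup p = none := by
    unfold keys at hp
    generalize F.2 = l at hp
    induction l with
    | nil => rfl
    | cons a l ih =>
      simp only [List.map_cons, List.mem_cons, not_or] at hp
      have h1 : (p == a.1) = false := by simpa using hp.1
      simp only [List.lookup, h1]
      exact ih hp.2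
  rw [this]; rfl

end Flat

section
variable {L : FirstOrder.Language.{u, v}} [Coding L] {α : Type*} [Enc α]

instance : Enc (FClause L) := ⟨fun c => enc (c.id, c.con, c.body, c.head)⟩

theorem PT.fclause_tuple : PT fun c : FClause L => (c.id, c.con, c.body, c.head) :=
  PT.of_enc fun _ => rfl

@[fun_prop]
theorem PT.fclause_id {f : α → FClause L} (hf : PT f) : PT fun a => (f a).id :=
  PT.fst.comp (PT.fclause_tuple.comp hf)

@[fun_prop]
theorem PT.fclause_con {f : α → FClause L} (hf : PT f) : PT fun a => (f a).con :=
  PT.fst.comp (PT.snd.comp (PT.fclause_tuple.comp hf))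

@[fun_prop]
theorem PT.fclause_body {f : α → FClause L} (hf : PT f) : PT fun a => (f a).body :=
  PT.fst.comp (PT.snd.comp (PT.snd.comp (PT.fclause_tuple.comp hf)))

@[fun_prop]
theorem PT.fclause_head {f : α → FClause L} (hf : PT f) : PT fun a => (f a).head :=
  PT.snd.comp (PT.snd.comp (PT.snd.comp (PT.fclause_tuple.comp hf)))

@[fun_prop]
theorem PT.fclause_mk {i : α → Data} {f : α → Fml L} {g : α → List Data} {h : α → Option Data}
    (hi : PT i) (hf : PT f) (hg : PT g) (hh : PT h) :
    PT fun a => FClause.mk (i a) (f a) (g a) (h a) :=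
  PT.of_enc_comp ((hi.prodMk (hf.prodMk (hg.prodMk hh))).enc_comp) fun _ => rfl

@[fun_prop]
theorem PT.flat_keys {f : α → Flat L} (hf : PT f) : PT fun a => (f a).keys := by
  unfold Flat.keys; fun_prop

@[fun_prop]
theorem PT.flat_vars {f : α → Flat L} {p : α → Data} (hf : PT f) (hp : PT p) :
    PT fun a => (f a).vars (p a) := by
  unfold Flat.vars; fun_prop

/-- Solving of flat clauses. -/
def flatSolving (S : Set (Interp.{u, v, w} L)) (Con : ConstraintLanguage L)
    (frag : Flat L → Prop) : SearchProblem where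
  Inst := Flat L
  Ans := List (Data × Fml L)
  encInst F := enc F
  encAns J := enc J
  IsInst F := F.WF Con ∧ frag F
  Sol F J := F.IsSol S Con (table J)

/-! ### From flat clauses to Horn clauses -/

namespace Flat

def atom (F : Flat L) (p : Data) : Atom L := ⟨p, (F.vars p).map Term.var⟩

def sym (F : Flat L) (p : Data) : RelSym := ⟨p, (F.vars p).length⟩

def toHorn (F : Flat L) : List (Clause L) :=
  F.1.map fun c => ⟨c.con, c.body.map F.atom, c.head.map F.atom⟩

/-- The argument variable at the position of a formal parameter. -/
def actual (xs : List Data) (x : Data) : Data := xs.getD x.toNat x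

/-- The formal parameter for an argument variable. -/
def formal (xs : List Data) (x : Data) : Data := .ofNat (xs.idxOf x)

omit [Coding L] in
theorem sym_atom (F : Flat L) (p : Data) : (F.atom p).sym = F.sym p := by
  simp [atom, Atom.sym, sym]

omit [Coding L] in
theorem inst_atom (F : Flat L) (p : Data) (sol : RelSym → Fml L) :
    (F.atom p).inst sol = rename (actual (F.vars p)) (sol (F.sym p)) := by
  unfold Atom.inst rename
  rw [sym_atom]
  congr 1
  funext x
  simp only [atom, actual, List.getD_eq_getElem?_getD, List.getElem?_map]
  cases (F.vars p)[x.toNat]? <;> rfl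

-- A variable in `xs` goes to its index and then back to the entry at that index, which is the
-- variable itself.
omit [Coding L] in
theorem sat_actual_formal {M : Interp.{u, v, w} L} {a : Data → M.U} {φ : Fml L} {xs : List Data}
    (h : ∀ x ∈ fv φ, x ∈ xs) :
    M.Sat (rename (actual xs) (rename (formal xs) φ)) a ↔ M.Sat φ a := by
  rw [sat_rename, sat_rename]
  refine sat_congr fun x hx => ?_
  have := List.idxOf_lt_length_of_mem (h x hx)
  simp [actual, formal, toNat_ofNat, this]

def toAnswer (F : Flat L) (sol : List (RelSym × Fml L)) : List (Data × Fml L) :=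
  F.keys.map fun p => (p, rename (actual (F.vars p)) (table sol (F.sym p)))

omit [Coding L] in
theorem sym_injective (F : Flat L) : Function.Injective F.sym := fun p q h => by
  simpa [sym] using congrArg RelSym.name h

omit [Coding L] in
theorem fv_formal {xs : List Data} {φ : Fml L} (h : ∀ x ∈ fv φ, x ∈ xs) {y : Data}
    (hy : y ∈ fv (rename (formal xs) φ)) : ∃ i < xs.length, y = Data.ofNat i := by
  rw [fv_rename] at hy
  obtain ⟨x, hx, rfl⟩ := hy
  exact ⟨_, List.idxOf_lt_length_of_mem (h x hx), rfl⟩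

omit [Coding L] in
theorem fv_actual {xs : List Data} {φ : Fml L} (h : fv φ ⊆ {x | ∃ i < xs.length, x = Data.ofNat i})
    {y : Data} (hy : y ∈ fv (rename (actual xs) φ)) : y ∈ xs := by
  rw [fv_rename] at hy
  obtain ⟨x, hx, rfl⟩ := hy
  obtain ⟨i, hi, rfl⟩ := h hx
  simp [actual, toNat_ofNat, hi]

omit [Coding L] in
theorem acyclic_toHorn {F : Flat L} (h : F.Acyclic) : RecursionFree F.toHorn := by
  intro p hp
  refine h p.name (Relation.TransGen.lift RelSym.name ?_ p p hp)
  rintro p q ⟨h, hh, hp, hq⟩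
  obtain ⟨c, hc, rfl⟩ := List.mem_map.1 hh
  refine ⟨c, hc, ?_, ?_⟩
  · rcases hch : c.head with _ | r <;> simp [Clause.headSyms, hch] at hp ⊢
    simp [hp, Atom.sym, atom]
  · simp only [Clause.bodySyms, List.map_map, List.mem_map, Function.comp] at hq
    obtain ⟨r, hr, rfl⟩ := hq
    simpa [Atom.sym, atom] using hr

omit [Coding L] in
theorem linear_toHorn {F : Flat L} (h : F.Linear) : IsLinear F.toHorn := by
  intro h' hh
  obtain ⟨c, hc, rfl⟩ := List.mem_map.1 hh
  simpa using h c hc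

omit [Coding L] in
theorem headDisjoint_toHorn {F : Flat L} (h : F.HeadDisjoint) : IsHeadDisjoint F.toHorn := by
  unfold IsHeadDisjoint toHorn
  rw [List.pairwise_map]
  refine (List.nodup_flatMap.1 h).2.imp fun {c c'} hcc p hp hp' => ?_
  simp only [Clause.headSyms, List.mem_map, Option.mem_toList, Option.map_eq_some_iff] at hp hp'
  obtain ⟨_, ⟨q, hq, rfl⟩, rfl⟩ := hp
  obtain ⟨_, ⟨q', hq', rfl⟩, e⟩ := hp'
  rw [sym_atom, sym_atom] at e
  cases F.sym_injective e
  exact hcc (by simpa using hq) (by simpa using hq')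

-- `IsBodyDisjoint` also forbids a symbol in the head and the body of the same clause. Flat
-- body-disjointness says nothing about this, but acyclicity does.
omit [Coding L] in
theorem bodyDisjoint_toHorn {F : Flat L} (ha : F.Acyclic) (h : F.BodyDisjoint) :
    IsBodyDisjoint F.toHorn := by
  have hb := List.nodup_flatMap.1 h
  constructor
  · unfold toHorn
    rw [List.pairwise_map]
    refine hb.2.imp fun {c c'} hcc p hp hp' => ?_
    simp only [Clause.bodySyms, List.map_map, List.mem_map, Function.comp, sym_atom] at hp hp'
    obtain ⟨q, hq, rfl⟩ := hp
    obtain ⟨q', hq', e⟩ := hp'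
    cases F.sym_injective e
    exact hcc hq hq'
  · intro h' hh
    obtain ⟨c, hc, rfl⟩ := List.mem_map.1 hh
    have : (⟨c.con, c.body.map F.atom, c.head.map F.atom⟩ : Clause L).headSyms ++
        (⟨c.con, c.body.map F.atom, c.head.map F.atom⟩ : Clause L).bodySyms =
        (c.head.toList ++ c.body).map F.sym := by
      cases c.head <;> simp [Clause.headSyms, Clause.bodySyms, Function.comp_def, sym_atom]
    rw [this]
    refine List.Nodup.map F.sym_injective ?_
    rw [List.nodup_append']
    refine ⟨by cases c.head <;> simp, hb.1 c hc, fun p hp hp' => ?_⟩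
    exact ha p (.single ⟨c, hc, by simpa using hp, hp'⟩)

end Flat

@[fun_prop]
theorem PT.actual {xs : α → List Data} {x : α → Data} (hxs : PT xs) (hx : PT x) :
    PT fun a => Flat.actual (xs a) (x a) := by
  unfold Flat.actual; fun_prop

@[fun_prop]
theorem PT.formal {xs : α → List Data} {x : α → Data} (hxs : PT xs) (hx : PT x) :
    PT fun a => Flat.formal (xs a) (x a) := by
  unfold Flat.formal; fun_prop

/-- Instantiating an atom whose arguments are the fixed variables is the renaming by `Flat.actual`,
which undoes the renaming by `Flat.formal`. So solutions are carried over in both directions by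
renaming. -/
theorem flat_reduces_horn {S : Set (Interp.{u, v, w} L)} {Con : ConstraintLanguage L}
    {frag : Flat L → Prop} {fragH : List (Clause L) → Prop}
    (hfrag : ∀ F : Flat L, F.WF Con → frag F → RecursionFree F.toHorn ∧ fragH F.toHorn) :
    PolyReduces (flatSolving S Con frag) (hornSolving Coding.coding S Con fragH) := by
  have hf : PT (Flat.toHorn (L := L)) := by unfold Flat.toHorn Flat.atom; fun_prop
  have hg : PT fun a : Flat L × List (RelSym × Fml L) => Flat.toAnswer a.1 a.2 := by
    unfold Flat.toAnswer Flat.sym; fun_prop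
  unfold flatSolving hornSolving
  refine PolyReduces.intro Flat.toHorn Flat.toAnswer (hf.comp PT.subtype_val)
    (hg.comp PT.subtype_val) fun F hF => ⟨⟨?_, hfrag F hF.1 hF.2⟩, ?_, ?_⟩
  · intro h hh
    obtain ⟨c, hc, rfl⟩ := List.mem_map.1 hh
    exact hF.1.mem c hc
  · rintro ⟨J, hJ⟩
    let sol := F.keys.map fun p => (F.sym p, rename (Flat.formal (F.vars p)) (table J p))
    have hsol : ∀ p ∈ F.keys, table sol (F.sym p) = rename (Flat.formal (F.vars p)) (table J p) :=
      fun p hp => table_map_of_injective F.sym F.sym_injective _ hp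
    have hsat : ∀ p ∈ F.keys, ∀ M : Interp.{u, v, w} L, ∀ a : Data → M.U,
        (M.Sat ((F.atom p).inst (table sol)) a ↔ M.Sat (table J p) a) := by
      intro p hp M a
      rw [Flat.inst_atom, hsol p hp]
      exact Flat.sat_actual_formal (hJ.vars p hp)
    refine ⟨sol, ?_, ?_⟩
    · intro s
      -- Symbols that do not come from a key receive falsity.
      rcases table_cases sol s with h | h
      · rw [h]; exact ⟨Con.falsum_mem, by simp⟩
      · obtain ⟨p, hp, e⟩ := List.mem_map.1 h
        simp only [Prod.mk.injEq] at e
        obtain ⟨rfl, e⟩ := e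
        rw [← e]
        exact ⟨ConstraintLanguage.rename_mem (hJ.mem p hp) _, fun y hy =>
          Flat.fv_formal (hJ.vars p hp) hy⟩
    · intro M hM h hh a
      obtain ⟨c, hc, rfl⟩ := List.mem_map.1 hh
      rw [sat_inst]
      intro h1 h2
      have h3 := hJ.valid c hc M hM a h1 fun b hb => (hsat b (hF.1.occ c hc b (by simp [FClause.occ, hb])) M a).1
        (h2 _ (List.mem_map_of_mem hb))
      rcases hch : c.head with _ | p
      · simp [hch] at h3
      · simp only [hch, Option.elim_some, Option.map_some] at h3 ⊢
        exact (hsat p (hF.1.occ c hc p (by simp [FClause.occ, hch])) M a).2 h3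
  · rintro sol ⟨h1, h2⟩
    have hJ : ∀ p ∈ F.keys, table (F.toAnswer sol) p = (F.atom p).inst (table sol) := fun p hp => by
      rw [Flat.inst_atom]; exact table_map (fun p => rename (Flat.actual (F.vars p)) (table sol (F.sym p))) hp
    refine ⟨fun p hp => ?_, fun p hp x hx => ?_, fun c hc M hM a hca hb => ?_⟩
    · rw [hJ p hp, Flat.inst_atom]
      exact ConstraintLanguage.rename_mem (h1 _).1 _
    · rw [hJ p hp, Flat.inst_atom] at hx
      exact Flat.fv_actual (h1 (F.sym p)).2 hx
    · have h3 := h2 M hM _ (List.mem_map_of_mem hc) a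
      rw [sat_inst] at h3
      have h4 := h3 hca (by
        intro B hB
        obtain ⟨b, hb', rfl⟩ := List.mem_map.1 hB
        rw [← hJ b (hF.1.occ c hc b (by simp [FClause.occ, hb']))]
        exact hb b hb')
      rcases hch : c.head with _ | p
      · simp [hch] at h4
      · simp only [hch, Option.elim_some, Option.map_some] at h4 ⊢
        rwa [hJ p (hF.1.occ c hc p (by simp [FClause.occ, hch]))]

end

/-! ### Clauses with separated variables -/

namespace Flat
variable {L : FirstOrder.Language.{u, v}}

/-- The clauses only share the argument variables of the relation symbols that they have in
common, and all argument variables of the symbols of a clause occur in its constraint. -/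
structure Apart (F : Flat L) : Prop where
  ids : (F.1.map FClause.id).Nodup
  keys_nodup : F.keys.Nodup
  con_vars : ∀ c ∈ F.1, ∀ q ∈ c.occ, ∀ x ∈ F.vars q, x ∈ fv c.con
  own : ∀ c ∈ F.1, ∀ q ∈ F.keys, ∀ x ∈ F.vars q, x ∈ fv c.con → q ∈ c.occ
  shared : ∀ c ∈ F.1, ∀ c' ∈ F.1, c.id ≠ c'.id → ∀ x ∈ fv c.con, x ∈ fv c'.con →
    ∃ q ∈ F.keys, x ∈ F.vars q
  disjoint : ∀ p ∈ F.keys, ∀ q ∈ F.keys, ∀ x ∈ F.vars p, x ∈ F.vars q → p = q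

/-- Every relation symbol occurs in a head and in a body. -/
structure Complete (F : Flat L) : Prop where
  head : ∀ p ∈ F.keys, ∃ c ∈ F.1, c.head = some p
  body : ∀ p ∈ F.keys, ∃ c ∈ F.1, p ∈ c.body

end Flat

section Completion
variable {L : FirstOrder.Language.{u, v}}

/-- A valid equation system that mentions the given variables. -/
def eqs (xs : List Data) : Fml L := conj (xs.map fun x => (Term.var x : Trm L).equal (Term.var x))

@[simp]
theorem mem_fv_eqs {xs : List Data} {x : Data} : x ∈ fv (eqs xs : Fml L) ↔ x ∈ xs := by
  simp [eqs, mem_fv_equal]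

theorem eqs_mem {Con : ConstraintLanguage L} (xs : List Data) : eqs xs ∈ Con.carrier :=
  ConstraintLanguage.conj_mem fun φ hφ => by
    obtain ⟨x, _, rfl⟩ := List.mem_map.1 hφ
    exact Con.equal_mem _ _

namespace Flat

def headless (F : Flat L) : List Data :=
  F.keys.filter fun p => !decide (p ∈ F.1.flatMap fun c => c.head.toList)

def bodyless (F : Flat L) : List Data :=
  F.keys.filter fun p => !decide (p ∈ F.1.flatMap FClause.body)

/-- Trivial clauses are added for the relation symbols that do not occur in heads or in bodies. -/
def complete (F : Flat L) : Flat L :=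
  (F.1.map (fun c => ⟨.cons .nil c.id, c.con, c.body, c.head⟩) ++
    (F.headless.map (fun p => ⟨.cons (.ofNat 1) p, ⊥ ⊓ eqs (F.vars p), [], some p⟩) ++
    F.bodyless.map (fun p => ⟨.cons (.ofNat 2) p, ⊥ ⊓ eqs (F.vars p), [p], none⟩)), F.2)

theorem mem_complete {F : Flat L} {c : FClause L} : c ∈ F.complete.1 ↔
    (∃ c' ∈ F.1, (⟨.cons .nil c'.id, c'.con, c'.body, c'.head⟩ : FClause L) = c) ∨
    (∃ p ∈ F.headless, (⟨.cons (.ofNat 1) p, ⊥ ⊓ eqs (F.vars p), [], some p⟩ : FClause L) = c) ∨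
    (∃ p ∈ F.bodyless, (⟨.cons (.ofNat 2) p, ⊥ ⊓ eqs (F.vars p), [p], none⟩ : FClause L) = c) := by
  simp [complete]

theorem mem_headless {F : Flat L} {p : Data} :
    p ∈ F.headless ↔ p ∈ F.keys ∧ ∀ c ∈ F.1, c.head ≠ some p := by
  simp [headless]

theorem mem_bodyless {F : Flat L} {p : Data} :
    p ∈ F.bodyless ↔ p ∈ F.keys ∧ ∀ c ∈ F.1, p ∉ c.body := by
  simp [bodyless]

theorem complete_vars (F : Flat L) (p : Data) : F.complete.vars p = F.vars p := rfl

/-- An added clause has an empty body or no head, so it creates no dependence. -/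
theorem complete_dep {F : Flat L} {p q : Data} (h : F.complete.Dep p q) : F.Dep p q := by
  obtain ⟨c, hc, hp, hq⟩ := h
  rcases mem_complete.1 hc with ⟨d, hd, rfl⟩ | ⟨r, hr, rfl⟩ | ⟨r, hr, rfl⟩
  · exact ⟨d, hd, hp, hq⟩
  · simp at hq
  · simp at hp

theorem complete_acyclic {F : Flat L} (h : F.Acyclic) : F.complete.Acyclic := fun p hp =>
  h p (Relation.TransGen.mono (fun _ _ => complete_dep) _ _ hp)

theorem complete_complete (F : Flat L) : F.complete.Complete := by
  constructor
  · intro p hp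
    by_cases h : ∃ c ∈ F.1, c.head = some p
    · obtain ⟨c, hc, hcp⟩ := h
      exact ⟨_, mem_complete.2 (Or.inl ⟨c, hc, rfl⟩), hcp⟩
    · push Not at h
      exact ⟨_, mem_complete.2 (Or.inr (Or.inl ⟨p, mem_headless.2 ⟨hp, h⟩, rfl⟩)), rfl⟩
  · intro p hp
    by_cases h : ∃ c ∈ F.1, p ∈ c.body
    · obtain ⟨c, hc, hcp⟩ := h
      exact ⟨_, mem_complete.2 (Or.inl ⟨c, hc, rfl⟩), hcp⟩
    · push Not at h
      exact ⟨_, mem_complete.2 (Or.inr (Or.inr ⟨p, mem_bodyless.2 ⟨hp, h⟩, rfl⟩)), by simp⟩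

theorem complete_linear {F : Flat L} (h : F.Linear) : F.complete.Linear := by
  intro c hc
  rcases mem_complete.1 hc with ⟨d, hd, rfl⟩ | ⟨r, hr, rfl⟩ | ⟨r, hr, rfl⟩
  · exact h d hd
  · simp
  · simp

/-- A symbol is put into a new body only if it is in no old one, and only once, as the keys are
distinct. -/
theorem complete_bodyDisjoint {F : Flat L} (hk : F.keys.Nodup) (h : F.BodyDisjoint) :
    F.complete.BodyDisjoint := by
  unfold BodyDisjoint complete
  simp only [List.flatMap_append, List.flatMap_map]
  rw [List.nodup_append']
  refine ⟨h, ?_, ?_⟩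
  · have : (F.headless.flatMap fun _ => ([] : List Data)) = [] := by simp
    rw [this, List.nil_append, List.flatMap_singleton']
    exact hk.filter _
  · intro p hp hp'
    obtain ⟨c, hc, hpc⟩ := List.mem_flatMap.1 hp
    simp only [List.mem_append, List.mem_flatMap, List.mem_singleton] at hp'
    rcases hp' with ⟨_, _, h⟩ | ⟨q, hq, rfl⟩
    · simp at h
    · exact (mem_bodyless.1 hq).2 c hc hpc

theorem complete_headDisjoint {F : Flat L} (hk : F.keys.Nodup) (h : F.HeadDisjoint) :
    F.complete.HeadDisjoint := by
  unfold HeadDisjoint complete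
  simp only [List.flatMap_append, List.flatMap_map]
  rw [List.nodup_append']
  refine ⟨h, ?_, ?_⟩
  · have : (F.bodyless.flatMap fun _ => (none : Option Data).toList) = [] := by simp
    rw [this, List.append_nil]
    simp only [Option.toList_some, List.flatMap_singleton']
    exact hk.filter _
  · intro p hp hp'
    obtain ⟨c, hc, hpc⟩ := List.mem_flatMap.1 hp
    simp only [List.mem_append, List.mem_flatMap, Option.mem_toList] at hp' hpc
    rcases hp' with ⟨q, hq, h⟩ | ⟨q, hq, h⟩
    · simp only [Option.some.injEq] at h
      subst h
      exact (mem_headless.1 hq).2 c hc hpc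
    · simp at h

/-- The part `eqs (F.vars p)` of an added constraint is there for `con_vars`: it makes the arguments
of the symbol free variables of the clause. The identifiers of the three kinds of clauses begin with
the tags 0, 1 and 2. -/
theorem complete_apart {F : Flat L} (h : F.Apart) : F.complete.Apart := by
  have hn : ∀ (m : ℕ) (l : List Data), l.Nodup → (l.map fun p => Data.cons (.ofNat m) p).Nodup :=
    fun m l hl => hl.map fun a b e => by simpa using e
  constructor
  · unfold complete
    simp only [List.map_append, List.map_map, Function.comp_def]
    rw [List.nodup_append', List.nodup_append']
    refine ⟨?_, ⟨hn 1 _ (h.keys_nodup.filter _), hn 2 _ (h.keys_nodup.filter _), ?_⟩, ?_⟩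
    · have := hn 0 _ h.ids
      rwa [List.map_map] at this
    · intro x hx hx'
      obtain ⟨p, _, rfl⟩ := List.mem_map.1 hx
      obtain ⟨q, _, e⟩ := List.mem_map.1 hx'
      simp [ofNat_injective.eq_iff] at e
    · intro x hx hx'
      obtain ⟨p, _, rfl⟩ := List.mem_map.1 hx
      rcases List.mem_append.1 hx' with hx' | hx' <;> obtain ⟨q, _, e⟩ := List.mem_map.1 hx' <;>
        simp [Data.ofNat] at e
  · exact h.keys_nodup
  · intro c hc q hq x hx
    rcases mem_complete.1 hc with ⟨d, hd, rfl⟩ | ⟨r, hr, rfl⟩ | ⟨r, hr, rfl⟩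
    · exact h.con_vars d hd q hq x hx
    all_goals
      have : q = r := by simpa [FClause.occ] using hq
      subst this
      simpa [complete_vars] using hx
  · intro c hc q hq x hx hxc
    rcases mem_complete.1 hc with ⟨d, hd, rfl⟩ | ⟨r, hr, rfl⟩ | ⟨r, hr, rfl⟩
    · exact h.own d hd q hq x hx hxc
    · have := h.disjoint q hq r (mem_headless.1 hr).1 x hx (by simpa using hxc)
      simp [FClause.occ, this]
    · have := h.disjoint q hq r (mem_bodyless.1 hr).1 x hx (by simpa using hxc)
      simp [FClause.occ, this]
  · intro c hc c' hc' hne x hx hx'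
    rcases mem_complete.1 hc with ⟨d, hd, rfl⟩ | ⟨r, hr, rfl⟩ | ⟨r, hr, rfl⟩
    · rcases mem_complete.1 hc' with ⟨d', hd', rfl⟩ | ⟨r, hr, rfl⟩ | ⟨r, hr, rfl⟩
      · exact h.shared d hd d' hd' (fun e => hne (by simp [e])) x hx hx'
      · exact ⟨r, (mem_headless.1 hr).1, by simpa [complete_vars] using hx'⟩
      · exact ⟨r, (mem_bodyless.1 hr).1, by simpa [complete_vars] using hx'⟩
    · exact ⟨r, (mem_headless.1 hr).1, by simpa [complete_vars] using hx⟩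
    · exact ⟨r, (mem_bodyless.1 hr).1, by simpa [complete_vars] using hx⟩
  · exact h.disjoint

theorem complete_wf {Con : ConstraintLanguage L} {F : Flat L} (h : F.WF Con) :
    F.complete.WF Con := by
  refine ⟨fun c hc => ?_, fun c hc p hp => ?_, h.nodup⟩
  · rcases mem_complete.1 hc with ⟨d, hd, rfl⟩ | ⟨r, hr, rfl⟩ | ⟨r, hr, rfl⟩
    · exact h.mem d hd
    all_goals exact ConstraintLanguage.inf_mem Con.falsum_mem (eqs_mem _)
  · rcases mem_complete.1 hc with ⟨d, hd, rfl⟩ | ⟨r, hr, rfl⟩ | ⟨r, hr, rfl⟩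
    · exact h.occ d hd p hp
    · have : p = r := by simpa [FClause.occ] using hp
      exact this ▸ (mem_headless.1 hr).1
    · have : p = r := by simpa [FClause.occ] using hp
      exact this ▸ (mem_bodyless.1 hr).1

/-- The added constraints contain falsity, so the added clauses hold under every assignment of
formulae. -/
theorem complete_isSol {S : Set (Interp.{u, v, w} L)} {Con : ConstraintLanguage L} {F : Flat L}
    {J : Data → Fml L} : F.complete.IsSol S Con J ↔ F.IsSol S Con J := by
  constructor
  · intro h
    exact ⟨h.mem, h.vars, fun c hc => h.valid ⟨.cons .nil c.id, c.con, c.body, c.head⟩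
      (mem_complete.2 (Or.inl ⟨c, hc, rfl⟩))⟩
  · intro h
    refine ⟨h.mem, h.vars, fun c hc M hM a h1 h2 => ?_⟩
    rcases mem_complete.1 hc with ⟨d, hd, rfl⟩ | ⟨r, hr, rfl⟩ | ⟨r, hr, rfl⟩
    · exact h.valid d hd M hM a h1 h2
    all_goals simp at h1

end Flat

variable [Coding L] {α : Type*} [Enc α]

@[fun_prop]
theorem PT.eqs {f : α → List Data} (hf : PT f) : PT fun a => (eqs (f a) : Fml L) := by
  unfold HornInterp.eqs; fun_prop

theorem PT.complete : PT (Flat.complete : Flat L → Flat L) := by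
  unfold Flat.complete Flat.headless Flat.bodyless; fun_prop

theorem flat_reduces_complete {S : Set (Interp.{u, v, w} L)} {Con : ConstraintLanguage L}
    {frag : Flat L → Prop} (hfrag : ∀ F : Flat L, F.Apart → frag F → frag F.complete) :
    PolyReduces (flatSolving S Con fun F => F.Apart ∧ F.Acyclic ∧ frag F)
      (flatSolving S Con fun F => (F.Apart ∧ F.Complete ∧ F.Acyclic) ∧ frag F) := by
  unfold flatSolving
  refine PolyReduces.intro Flat.complete (fun _ J => J) (PT.complete.comp PT.subtype_val)
    (by fun_prop) fun F hF => ⟨⟨Flat.complete_wf hF.1, ⟨Flat.complete_apart hF.2.1,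
      F.complete_complete, Flat.complete_acyclic hF.2.2.1⟩, hfrag F hF.2.1 hF.2.2.2⟩, ?_, ?_⟩
  · rintro ⟨J, hJ⟩
    exact ⟨J, Flat.complete_isSol.2 hJ⟩
  · intro J hJ
    exact Flat.complete_isSol.1 hJ

end Completion

/-! ### From Horn clauses to flat clauses -/

section Flatten
variable {L : FirstOrder.Language.{u, v}}

namespace Clause

def atoms (h : Clause L) : List (Atom L) := h.body ++ h.head.toList

end Clause

/-- The argument variables of the relation symbol with the given encoding. -/
def argVars (k : Data) : List Data :=
  (List.range k.tail.toNat).map fun i => .cons .nil (.cons k (.ofNat i))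

/-- The arity is included because equal names of different arities are different symbols. -/
def Atom.key (A : Atom L) : Data := .cons A.name (.ofNat A.args.length)

def symOf (k : Data) : RelSym := ⟨k.head, k.tail.toNat⟩

/-- Renaming of the variables of the `i`-th clause. -/
def localVar (i : ℕ) (x : Data) : Data := .cons (.cons .nil .nil) (.cons (.ofNat i) x)

/-- The equations between the argument variables of a relation symbol and the arguments of an
atom of the `i`-th clause. -/
def Atom.bind (i : ℕ) (A : Atom L) : Fml L :=
  conj (((argVars A.key).zip A.args).map fun p =>
    (Term.var p.1 : Trm L).equal (renameT (localVar i) p.2))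

/-- The arguments of the atoms survive only as equations in the constraint. This makes all arguments
of the symbols of a clause occur in its constraint and leaves no other link between clauses. -/
def Clause.flatten (h : Clause L) (i : ℕ) : FClause L :=
  ⟨.ofNat i, rename (localVar i) h.constraint ⊓ conj (h.atoms.map (Atom.bind i)),
    h.body.map Atom.key, h.head.map Atom.key⟩

def hornKeys (HC : List (Clause L)) : List Data :=
  dedupD (HC.flatMap fun h => h.atoms.map Atom.key)

def toFlat (HC : List (Clause L)) : Flat L :=
  (HC.zipIdx.map fun p => p.1.flatten p.2, (hornKeys HC).map fun k => (k, argVars k))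

theorem symOf_key (A : Atom L) : symOf A.key = A.sym := by
  simp [symOf, Atom.key, Atom.sym, Data.head, Data.tail, toNat_ofNat]

theorem key_eq_iff {A B : Atom L} : A.key = B.key ↔ A.sym = B.sym := by
  constructor
  · intro h; rw [← symOf_key, h, symOf_key]
  · intro h
    simp only [Atom.sym, RelSym.mk.injEq] at h
    simp [Atom.key, h]

theorem length_argVars_key (A : Atom L) : (argVars A.key).length = A.args.length := by
  simp [argVars, Atom.key, Data.tail, toNat_ofNat]

theorem getElem_argVars (k : Data) (i : ℕ) (h : i < (argVars k).length) :
    (argVars k)[i] = .cons .nil (.cons k (.ofNat i)) := by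
  simp [argVars]

theorem mem_argVars {k x : Data} : x ∈ argVars k ↔
    ∃ i < k.tail.toNat, x = .cons .nil (.cons k (.ofNat i)) := by
  simp [argVars, eq_comm]

theorem argVars_nodup (k : Data) : (argVars k).Nodup :=
  List.nodup_range.map fun i j h => by
    simp only [Data.cons.injEq, true_and] at h
    exact ofNat_injective h

theorem mem_hornKeys {HC : List (Clause L)} {k : Data} :
    k ∈ hornKeys HC ↔ ∃ h ∈ HC, ∃ A ∈ h.atoms, A.key = k := by
  simp [hornKeys]

theorem toFlat_keys (HC : List (Clause L)) : (toFlat HC).keys = hornKeys HC := by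
  simp [toFlat, Flat.keys, Function.comp_def]

theorem toFlat_vars {HC : List (Clause L)} {k : Data} (hk : k ∈ hornKeys HC) :
    (toFlat HC).vars k = argVars k := Flat.vars_map _ _ _ hk

theorem mem_toFlat {HC : List (Clause L)} {c : FClause L} :
    c ∈ (toFlat HC).1 ↔ ∃ (h : Clause L) (i : ℕ), HC[i]? = some h ∧ c = h.flatten i := by
  simp only [toFlat, List.mem_map, Prod.exists, List.mem_zipIdx_iff_getElem?]
  exact ⟨fun ⟨h, i, e, e'⟩ => ⟨h, i, e, e'.symm⟩, fun ⟨h, i, e, e'⟩ => ⟨h, i, e, e'.symm⟩⟩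

theorem occ_flatten (h : Clause L) (i : ℕ) : (h.flatten i).occ = h.atoms.map Atom.key := by
  cases e : h.head <;> simp [Clause.flatten, FClause.occ, Clause.atoms, e]

theorem sat_bind {M : Interp.{u, v, w} L} {a : Data → M.U} (i : ℕ) (A : Atom L) :
    M.Sat (A.bind i) a ↔ ∀ j (hj : j < A.args.length),
      a (.cons .nil (.cons A.key (.ofNat j))) = M.val A.args[j] fun x => a (localVar i x) := by
  simp only [Atom.bind, sat_conj, List.mem_map]
  constructor
  · intro h j hj
    have hj' : j < ((argVars A.key).zip A.args).length := by
      rw [List.length_zip, length_argVars_key, min_self]; exact hj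
    have := h _ ⟨_, List.getElem_mem hj', rfl⟩
    simpa [getElem_argVars] using this
  · rintro h φ ⟨p, hp, rfl⟩
    obtain ⟨j, hj, rfl⟩ := List.mem_iff_getElem.1 hp
    have hj' : j < A.args.length := by
      rw [List.length_zip, length_argVars_key, min_self] at hj; exact hj
    simpa [getElem_argVars] using h j hj'

/-- Under the equations the argument variables have the values of the actual arguments, so
evaluating at the argument variables amounts to substituting the terms. -/
theorem sat_actual_bind {M : Interp.{u, v, w} L} {a : Data → M.U} {i : ℕ} {A : Atom L}
    (h : M.Sat (A.bind i) a) {sol : RelSym → Fml L}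
    (hs : fv (sol A.sym) ⊆ {x | ∃ i < A.sym.arity, x = Data.ofNat i}) :
    M.Sat (rename (Flat.actual (argVars A.key)) (sol A.sym)) a ↔
      M.Sat (A.inst sol) fun x => a (localVar i x) := by
  rw [sat_rename, Atom.inst, sat_subst]
  refine sat_congr fun x hx => ?_
  obtain ⟨j, hj, rfl⟩ := hs hx
  have hj' : j < A.args.length := hj
  have hj'' : j < (argVars A.key).length := by rw [length_argVars_key]; exact hj'
  simp only [Flat.actual, toNat_ofNat, List.getD_eq_getElem _ _ hj', List.getD_eq_getElem _ _ hj'',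
    getElem_argVars]
  exact (sat_bind i A).1 h j hj'

theorem mem_fv_bind {i : ℕ} {A : Atom L} {x : Data} (h : x ∈ fv (A.bind i)) :
    x ∈ argVars A.key ∨ ∃ y, x = localVar i y := by
  simp only [Atom.bind, mem_fv_conj, List.mem_map] at h
  obtain ⟨_, ⟨p, hp, rfl⟩, h⟩ := h
  rw [mem_fv_equal, mem_varFinset_renameT] at h
  rcases h with h | ⟨y, _, rfl⟩
  · simp only [Term.varFinset, Finset.mem_singleton] at h
    exact Or.inl (h ▸ (List.of_mem_zip (a := p.1) (b := p.2) hp).1)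
  · exact Or.inr ⟨y, rfl⟩

theorem argVars_subset_fv_bind (i : ℕ) {A : Atom L} {x : Data} (h : x ∈ argVars A.key) :
    x ∈ fv (A.bind i) := by
  simp only [Atom.bind, mem_fv_conj, List.mem_map]
  obtain ⟨j, hj, rfl⟩ := List.mem_iff_getElem.1 h
  have hj' : j < ((argVars A.key).zip A.args).length := by
    rw [List.length_zip, ← length_argVars_key, min_self]; exact hj
  refine ⟨_, ⟨_, List.getElem_mem hj', rfl⟩, ?_⟩
  rw [mem_fv_equal]
  simp

theorem mem_fv_flatten {h : Clause L} {i : ℕ} {x : Data} (hx : x ∈ fv (h.flatten i).con) :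
    (∃ A ∈ h.atoms, x ∈ argVars A.key) ∨ ∃ y, x = localVar i y := by
  simp only [Clause.flatten, fv_inf, Set.mem_union, fv_rename, mem_fv_conj, List.mem_map] at hx
  rcases hx with ⟨y, _, rfl⟩ | ⟨_, ⟨A, hA, rfl⟩, hx⟩
  · exact Or.inr ⟨y, rfl⟩
  · rcases mem_fv_bind hx with h | h
    · exact Or.inl ⟨A, hA, h⟩
    · exact Or.inr h

/-- The two families of variables carry different tags, so they never meet. -/
theorem localVar_not_mem_argVars {i : ℕ} {y k : Data} : localVar i y ∉ argVars k := fun h => by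
  obtain ⟨j, _, e⟩ := mem_argVars.1 h
  simp [localVar] at e

theorem argVars_disjoint {k k' x : Data} (h : x ∈ argVars k) (h' : x ∈ argVars k') : k = k' := by
  obtain ⟨j, _, rfl⟩ := mem_argVars.1 h
  obtain ⟨j', _, e⟩ := mem_argVars.1 h'
  simp only [Data.cons.injEq, true_and] at e
  exact e.1

/-- An argument variable contains the key of its symbol and a local variable contains the index of
its clause. A variable in two clauses is therefore an argument variable, and it identifies its
symbol. -/
theorem toFlat_apart (HC : List (Clause L)) : (toFlat HC).Apart := by
  have hmem : ∀ {h : Clause L} {i : ℕ}, HC[i]? = some h → ∀ A ∈ h.atoms, A.key ∈ hornKeys HC :=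
    fun {h i} hi A hA => mem_hornKeys.2 ⟨h, List.mem_of_getElem? hi, A, hA, rfl⟩
  constructor
  · have : (toFlat HC).1.map FClause.id = (List.range HC.length).map Data.ofNat := by
      simp only [toFlat, List.map_map, Function.comp_def, Clause.flatten]
      rw [show (fun x : Clause L × ℕ => Data.ofNat x.2) = Data.ofNat ∘ Prod.snd from rfl,
        ← List.map_map, List.zipIdx_map_snd, List.range_eq_range']
    rw [this]
    exact List.nodup_range.map ofNat_injective
  · rw [toFlat_keys]; exact dedupD_nodup _
  · intro c hc q hq x hx
    obtain ⟨h, i, hi, rfl⟩ := mem_toFlat.1 hc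
    rw [occ_flatten] at hq
    obtain ⟨A, hA, rfl⟩ := List.mem_map.1 hq
    rw [toFlat_vars (hmem hi A hA)] at hx
    simp only [Clause.flatten, fv_inf, Set.mem_union, mem_fv_conj, List.mem_map]
    exact Or.inr ⟨_, ⟨A, hA, rfl⟩, argVars_subset_fv_bind i hx⟩
  · intro c hc q hq x hx hxc
    obtain ⟨h, i, hi, rfl⟩ := mem_toFlat.1 hc
    rw [toFlat_keys] at hq
    rw [toFlat_vars hq] at hx
    rw [occ_flatten]
    rcases mem_fv_flatten hxc with ⟨A, hA, h⟩ | ⟨y, rfl⟩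
    · exact List.mem_map.2 ⟨A, hA, argVars_disjoint h hx⟩
    · exact absurd hx localVar_not_mem_argVars
  · intro c hc c' hc' hne x hx hx'
    obtain ⟨h, i, hi, rfl⟩ := mem_toFlat.1 hc
    obtain ⟨h', i', hi', rfl⟩ := mem_toFlat.1 hc'
    rcases mem_fv_flatten hx with ⟨A, hA, h⟩ | ⟨y, rfl⟩
    · exact ⟨A.key, by rw [toFlat_keys]; exact hmem hi A hA, by rwa [toFlat_vars (hmem hi A hA)]⟩
    · rcases mem_fv_flatten hx' with ⟨A, hA, h⟩ | ⟨y', e⟩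
      · exact absurd h localVar_not_mem_argVars
      · simp only [localVar, Data.cons.injEq, true_and] at e
        exact absurd e.1 hne
  · intro p hp q hq x hx hx'
    rw [toFlat_keys] at hp hq
    rw [toFlat_vars hp] at hx
    rw [toFlat_vars hq] at hx'
    exact argVars_disjoint hx hx'

theorem toFlat_wf {Con : ConstraintLanguage L} {HC : List (Clause L)}
    (h : ∀ h ∈ HC, h.constraint ∈ Con.carrier) : (toFlat HC).WF Con := by
  refine ⟨fun c hc => ?_, fun c hc p hp => ?_, fun p => ?_⟩
  · obtain ⟨h', i, hi, rfl⟩ := mem_toFlat.1 hc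
    refine ConstraintLanguage.inf_mem (ConstraintLanguage.rename_mem
      (h h' (List.mem_of_getElem? hi)) _) (ConstraintLanguage.conj_mem fun φ hφ => ?_)
    obtain ⟨A, _, rfl⟩ := List.mem_map.1 hφ
    refine ConstraintLanguage.conj_mem fun φ hφ => ?_
    obtain ⟨p, _, rfl⟩ := List.mem_map.1 hφ
    exact Con.equal_mem _ _
  · obtain ⟨h', i, hi, rfl⟩ := mem_toFlat.1 hc
    rw [occ_flatten] at hp
    obtain ⟨A, hA, rfl⟩ := List.mem_map.1 hp
    rw [toFlat_keys]
    exact mem_hornKeys.2 ⟨h', List.mem_of_getElem? hi, A, hA, rfl⟩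
  · by_cases hp : p ∈ hornKeys HC
    · rw [toFlat_vars hp]; exact argVars_nodup p
    · rw [Flat.vars_eq_nil (by rwa [toFlat_keys])]; exact List.nodup_nil

theorem toFlat_acyclic {HC : List (Clause L)} (h : RecursionFree HC) : (toFlat HC).Acyclic := by
  intro p hp
  refine h (symOf p) (Relation.TransGen.lift symOf ?_ p p hp)
  rintro p q ⟨c, hc, hp, hq⟩
  obtain ⟨h', i, hi, rfl⟩ := mem_toFlat.1 hc
  simp only [Clause.flatten, Option.map_eq_some_iff, List.mem_map] at hp hq
  obtain ⟨A, hA, rfl⟩ := hp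
  obtain ⟨B, hB, rfl⟩ := hq
  show DependsOn HC (symOf A.key) (symOf B.key)
  rw [symOf_key, symOf_key]
  exact ⟨h', List.mem_of_getElem? hi, by simp [Clause.headSyms, hA],
    List.mem_map.2 ⟨B, hB, rfl⟩⟩

theorem toFlat_linear {HC : List (Clause L)} (h : IsLinear HC) : (toFlat HC).Linear := by
  intro c hc
  obtain ⟨h', i, hi, rfl⟩ := mem_toFlat.1 hc
  simpa [Clause.flatten] using h h' (List.mem_of_getElem? hi)

theorem flatMap_toFlat {κ : Type*} {HC : List (Clause L)} {f : FClause L → List κ}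
    {g : Clause L → List κ} (h : ∀ c i, f (Clause.flatten c i) = g c) :
    (toFlat HC).1.flatMap f = HC.flatMap g := by
  simp only [toFlat, List.flatMap_map]
  simp only [h]
  conv_rhs => rw [← List.zipIdx_map_fst 0 HC, List.flatMap_map]

theorem toFlat_bodyDisjoint {HC : List (Clause L)} (h : IsBodyDisjoint HC) :
    (toFlat HC).BodyDisjoint := by
  unfold Flat.BodyDisjoint
  rw [flatMap_toFlat (g := fun h => h.body.map Atom.key) fun _ _ => rfl, List.nodup_flatMap]
  refine ⟨fun h' hh' => ?_, h.1.imp fun {h h'} hd k hk hk' => ?_⟩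
  · have := (List.nodup_append'.1 (h.2 h' hh')).2.1
    rw [Clause.bodySyms] at this
    refine List.Nodup.of_map symOf ?_
    rw [List.map_map]
    convert this using 2
    exact funext symOf_key
  · obtain ⟨A, hA, rfl⟩ := List.mem_map.1 hk
    obtain ⟨B, hB, e⟩ := List.mem_map.1 hk'
    exact hd A.sym (List.mem_map.2 ⟨A, hA, rfl⟩) (List.mem_map.2 ⟨B, hB, key_eq_iff.1 e⟩)

theorem toFlat_headDisjoint {HC : List (Clause L)} (h : IsHeadDisjoint HC) :
    (toFlat HC).HeadDisjoint := by
  unfold Flat.HeadDisjoint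
  rw [flatMap_toFlat (g := fun h => (h.head.map Atom.key).toList) fun _ _ => rfl,
    List.nodup_flatMap]
  refine ⟨fun h' hh' => by cases h'.head <;> simp, h.imp fun {h h'} hd k hk hk' => ?_⟩
  simp only [Option.mem_toList, Option.map_eq_some_iff] at hk hk'
  obtain ⟨A, hA, rfl⟩ := hk
  obtain ⟨B, hB, e⟩ := hk'
  refine hd A.sym (by simp [Clause.headSyms, hA]) ?_
  simp only [Clause.headSyms, hB, Option.toList_some, List.map_cons, List.map_nil,
    List.mem_singleton]
  exact (key_eq_iff.1 e).symm

/-- The assignment that extends an assignment of the variables of the `i`-th clause to the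
argument variables. -/
def bindAssignment {U : Type*} (val : Trm L → U) (b : Data → U) (As : List (Atom L)) : Data → U
  | .cons .nil (.cons k j) =>
    (As.find? fun A => decide (A.key = k)).elim (b .nil)
      fun A => (A.args[j.toNat]?).elim (b .nil) val
  | .cons (.cons .nil .nil) (.cons _ x) => b x
  | _ => b .nil

/-- As no symbol is repeated in the clause, the search by key finds the atom `A` itself and not
another atom with the same symbol. -/
theorem bindAssignment_key {U : Type*} {val : Trm L → U} {b : Data → U} {As : List (Atom L)}
    (hA : (As.map Atom.sym).Nodup) {A : Atom L} (h : A ∈ As) {j : ℕ} (hj : j < A.args.length) :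
    bindAssignment val b As (.cons .nil (.cons A.key (.ofNat j))) = val A.args[j] := by
  have : As.find? (fun B => decide (B.key = A.key)) = some A := by
    induction As with
    | nil => simp at h
    | cons B l ih =>
      simp only [List.map_cons, List.nodup_cons] at hA
      rcases List.mem_cons.1 h with rfl | h
      · simp
      · have : ¬ B.key = A.key := fun e => hA.1 (List.mem_map.2 ⟨A, h, (key_eq_iff.1 e).symm⟩)
        simp [this, ih hA.2 h]
  simp [bindAssignment, this, toNat_ofNat, hj]

/-- The solution of Horn clauses for a solution of the flat clauses. -/
def hornAnswer (HC : List (Clause L)) (J : List (Data × Fml L)) : List (RelSym × Fml L) :=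
  (hornKeys HC).map fun k => (symOf k, rename (Flat.formal (argVars k)) (table J k))

/-- Arbitrary data can share a decoded arity, because `toNat` only sees the length of the spine. On
keys of atoms the arity is a genuine numeral and decoding is faithful. -/
theorem symOf_injOn {HC : List (Clause L)} {k k' : Data} (h : k ∈ hornKeys HC)
    (h' : k' ∈ hornKeys HC) (e : symOf k = symOf k') : k = k' := by
  obtain ⟨_, _, A, _, rfl⟩ := mem_hornKeys.1 h
  obtain ⟨_, _, B, _, rfl⟩ := mem_hornKeys.1 h'
  rw [symOf_key, symOf_key] at e
  exact key_eq_iff.2 e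

theorem table_hornAnswer {HC : List (Clause L)} {J : List (Data × Fml L)} {k : Data}
    (h : k ∈ hornKeys HC) : table (hornAnswer HC J) (symOf k) =
      rename (Flat.formal (argVars k)) (table J k) := by
  refine table_eq_of_mem ?_ (List.mem_map.2 ⟨k, h, rfl⟩)
  unfold hornAnswer
  rw [List.map_map]
  exact (dedupD_nodup _).map_on fun a ha b hb e => symOf_injOn ha hb e

variable [Coding L]

/-- The assumption `hnd` is what makes flattening sound: two atoms `p(s)` and `p(t)` in the same
clause would share their argument variables, and the equations would force `s = t`. -/
theorem horn_reduces_flat {S : Set (Interp.{u, v, w} L)} {Con : ConstraintLanguage L}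
    {frag : Flat L → Prop} {fragH : List (Clause L) → Prop}
    (hnd : ∀ HC : List (Clause L), RecursionFree HC → fragH HC → ∀ h ∈ HC, (h.atoms.map Atom.sym).Nodup)
    (hfrag : ∀ HC, fragH HC → frag (toFlat HC)) :
    PolyReduces (hornSolving Coding.coding S Con fragH)
      (flatSolving S Con fun F => F.Apart ∧ F.Acyclic ∧ frag F) := by
  have hf : PT (toFlat (L := L)) := by
    unfold toFlat hornKeys Clause.flatten Clause.atoms Atom.bind localVar argVars Atom.key; fun_prop
  have hg : PT fun a : List (Clause L) × List (Data × Fml L) => hornAnswer a.1 a.2 := by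
    unfold hornAnswer hornKeys Clause.atoms argVars Atom.key symOf; fun_prop
  unfold flatSolving hornSolving
  refine PolyReduces.intro toFlat hornAnswer (hf.comp PT.subtype_val)
    (hg.comp PT.subtype_val) fun HC hHC => ⟨⟨toFlat_wf hHC.1, toFlat_apart HC,
      toFlat_acyclic hHC.2.1, hfrag HC hHC.2.2⟩, ?_, ?_⟩
  · rintro ⟨sol, h1, h2⟩
    have hJ : ∀ k ∈ hornKeys HC, table ((hornKeys HC).map fun k =>
        (k, rename (Flat.actual (argVars k)) (table sol (symOf k)))) k =
        rename (Flat.actual (argVars k)) (table sol (symOf k)) :=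
      fun k hk => table_map (fun k => rename (Flat.actual (argVars k)) (table sol (symOf k))) hk
    have hlen : ∀ k, (argVars k).length = (symOf k).arity := fun k => by simp [argVars, symOf]
    refine ⟨(hornKeys HC).map fun k =>
      (k, rename (Flat.actual (argVars k)) (table sol (symOf k))), fun k hk => ?_,
      fun k hk x hx => ?_, fun c hc M hM a hca hb => ?_⟩
    · rw [toFlat_keys] at hk
      rw [hJ k hk]
      exact ConstraintLanguage.rename_mem (h1 _).1 _
    · rw [toFlat_keys] at hk
      rw [hJ k hk] at hx
      rw [toFlat_vars hk]
      exact Flat.fv_actual (by rw [hlen]; exact (h1 _).2) hx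
    · obtain ⟨h, i, hi, rfl⟩ := mem_toFlat.1 hc
      have hh := List.mem_of_getElem? hi
      simp only [Clause.flatten, sat_inf, sat_rename, sat_conj, List.mem_map, forall_exists_index,
        and_imp, forall_apply_eq_imp_iff₂] at hca
      have hA : ∀ A ∈ h.atoms, (M.Sat (table ((hornKeys HC).map fun k =>
        (k, rename (Flat.actual (argVars k)) (table sol (symOf k)))) A.key) a ↔
          M.Sat (A.inst (table sol)) fun x => a (localVar i x)) := fun A hA => by
        rw [hJ _ (mem_hornKeys.2 ⟨h, hh, A, hA, rfl⟩), symOf_key]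
        exact sat_actual_bind (hca.2 A hA) (h1 A.sym).2
      have h3 := (sat_inst _ _).1 (h2 M hM h hh fun x => a (localVar i x)) hca.1 fun B hB =>
        (hA B (by simp [Clause.atoms, hB])).1 (hb _ (List.mem_map.2 ⟨B, hB, rfl⟩))
      rcases hch : h.head with _ | A
      · simp [hch] at h3
      · simp only [hch, Option.elim_some, Clause.flatten, Option.map_some] at h3 ⊢
        exact (hA A (by simp [Clause.atoms, hch])).2 h3
  · intro J hJ
    have hk : ∀ {h : Clause L}, h ∈ HC → ∀ {A : Atom L}, A ∈ h.atoms → A.key ∈ hornKeys HC :=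
      fun hh _ hA => mem_hornKeys.2 ⟨_, hh, _, hA, rfl⟩
    have hasg : IsAssignment Con (table (hornAnswer HC J)) := by
      intro s
      rcases table_cases (hornAnswer HC J) s with h | h
      · rw [h]; exact ⟨Con.falsum_mem, by simp⟩
      · obtain ⟨k, hk, e⟩ := List.mem_map.1 h
        simp only [Prod.mk.injEq] at e
        obtain ⟨rfl, e⟩ := e
        rw [← e]
        have hk' : k ∈ (toFlat HC).keys := by rwa [toFlat_keys]
        refine ⟨ConstraintLanguage.rename_mem (hJ.mem k hk') _, fun y hy => ?_⟩
        have := hJ.vars k hk'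
        rw [toFlat_vars hk] at this
        obtain ⟨i, hi, rfl⟩ := Flat.fv_formal this hy
        exact ⟨i, by simpa [argVars, symOf] using hi, rfl⟩
    refine ⟨hasg, fun M hM h hh b => (sat_inst _ _).2 fun h1 h2 => ?_⟩
    obtain ⟨i, hi⟩ := List.getElem?_of_mem hh
    -- An assignment for the original clause extends to one that satisfies all the equations; the
    -- argument variables simply receive the values of the arguments.
    let a := bindAssignment (fun t => M.val t b) b h.atoms
    have hbind : ∀ A ∈ h.atoms, M.Sat (A.bind i) a := fun A hA => by
      rw [sat_bind]
      intro j hj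
      exact bindAssignment_key (hnd HC hHC.2.1 hHC.2.2 h hh) hA hj
    have hA : ∀ A ∈ h.atoms, (M.Sat (table J A.key) a ↔
        M.Sat (A.inst (table (hornAnswer HC J))) b) := fun A hA => by
      have := sat_actual_bind (hbind A hA) (hasg A.sym).2
      rw [show (fun x => a (localVar i x)) = b from rfl] at this
      rw [← this, ← symOf_key, table_hornAnswer (hk hh hA)]
      refine (Flat.sat_actual_formal ?_).symm
      have := hJ.vars A.key (by rw [toFlat_keys]; exact hk hh hA)
      rwa [toFlat_vars (hk hh hA)] at this
    have h3 := hJ.valid (h.flatten i) (mem_toFlat.2 ⟨h, i, hi, rfl⟩) M hM a (by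
      simp only [Clause.flatten, sat_inf, sat_rename, sat_conj, List.mem_map, forall_exists_index,
        and_imp, forall_apply_eq_imp_iff₂]
      exact ⟨h1, hbind⟩) (by
      intro k hk
      obtain ⟨B, hB, rfl⟩ := List.mem_map.1 hk
      exact (hA B (by simp [Clause.atoms, hB])).2 (h2 B hB))
    rcases hch : h.head with _ | A
    · simp [hch, Clause.flatten] at h3
    · simp only [hch, Option.elim_some, Clause.flatten, Option.map_some] at h3 ⊢
      exact (hA A (by simp [Clause.atoms, hch])).1 h3

/-- Flat clauses in the form produced from Horn clauses. -/
def Flat.Normal (F : Flat L) : Prop := F.Apart ∧ F.Complete ∧ F.Acyclic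

theorem horn_reduces_normal {S : Set (Interp.{u, v, w} L)} {Con : ConstraintLanguage L}
    {frag : Flat L → Prop} {fragH : List (Clause L) → Prop}
    (hnd : ∀ HC : List (Clause L), RecursionFree HC → fragH HC → ∀ h ∈ HC, (h.atoms.map Atom.sym).Nodup)
    (hfrag : ∀ HC, fragH HC → frag (toFlat HC))
    (hfrag' : ∀ F : Flat L, F.Apart → frag F → frag F.complete) :
    PolyReduces (hornSolving Coding.coding S Con fragH)
      (flatSolving S Con fun F => F.Normal ∧ frag F) :=
  (horn_reduces_flat hnd hfrag).trans (flat_reduces_complete hfrag')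

end Flatten

section Binary
variable {L : FirstOrder.Language.{u, v}}

/-! ### Binary interpolation -/

variable [Coding L]

def commonVars (A B : Fml L) : List Data := dedupD ((varList A).filter fun x => decide (x ∈ varList B))

def binaryFlat (A B : Fml L) : Flat L :=
  ([⟨.nil, A, [], some .nil⟩, ⟨.nil, B, [.nil], none⟩], [(.nil, commonVars A B)])

/-- One symbol, named `nil`, stands for the interpolant; its arguments are the common variables, so
the two clauses are precisely the two entailments. -/
theorem binary_reduces_horn {S : Set (Interp.{u, v, w} L)} {Con : ConstraintLanguage L} :
    PolyReduces (binaryInterpolation Coding.coding S Con)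
      (hornSolving Coding.coding S Con IsInterpolationPair) := by
  refine PolyReduces.trans (Q := flatSolving S Con fun F => ∃ A B, F = binaryFlat A B) ?_
    (flat_reduces_horn ?_)
  · have hf : PT fun P : Fml L × Fml L => binaryFlat P.1 P.2 := by
      unfold binaryFlat commonVars; fun_prop
    unfold binaryInterpolation flatSolving
    refine PolyReduces.intro (fun P => binaryFlat P.1 P.2) (fun _ J => table J .nil)
      (hf.comp PT.subtype_val) (by fun_prop) fun P hP => ?_
    have hv : (binaryFlat P.1 P.2).vars .nil = commonVars P.1 P.2 := rfl
    refine ⟨⟨⟨?_, ?_, ?_⟩, _, _, rfl⟩, ?_, ?_⟩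
    · simpa [binaryFlat] using hP
    · simp [binaryFlat, FClause.occ, Flat.keys]
    · intro p
      by_cases hp : p ∈ (binaryFlat P.1 P.2).keys
      · have : p = .nil := by simpa [binaryFlat, Flat.keys] using hp
        rw [this, hv]
        exact dedupD_nodup _
      · rw [Flat.vars_eq_nil hp]; exact List.nodup_nil
    · rintro ⟨I, hI, hA, hB, hfv⟩
      have ht : table [(Data.nil, I)] Data.nil = I := by simp [table, List.lookup]
      refine ⟨[(.nil, I)], ?_, ?_, ?_⟩
      · intro p hp
        have : p = .nil := by simpa [binaryFlat, Flat.keys] using hp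
        rwa [this, ht]
      · intro p hp
        have : p = .nil := by simpa [binaryFlat, Flat.keys] using hp
        rw [this, ht, hv]
        intro x hx
        have := hfv hx
        simpa [commonVars] using this
      · intro c hc M hM a h1 h2
        simp only [binaryFlat, List.mem_cons, List.not_mem_nil, or_false] at hc
        rcases hc with rfl | rfl
        · simpa [ht] using hA M hM a (by simpa using h1)
        · have h3 : M.Sat I a := by simpa [ht] using h2
          exact absurd h3 (hB M hM a (by simpa using h1))
    · intro J hJ
      have hk : Data.nil ∈ (binaryFlat P.1 P.2).keys := by simp [binaryFlat, Flat.keys]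
      refine ⟨hJ.mem _ hk, fun M hM a h => ?_, fun M hM a h => ?_, fun x hx => ?_⟩
      · exact hJ.valid ⟨.nil, P.1, [], some .nil⟩ (by simp [binaryFlat]) M hM a (by simpa using h)
          (by simp)
      · intro (hn : M.Sat (table J .nil) a)
        exact hJ.valid ⟨.nil, P.2, [.nil], none⟩ (by simp [binaryFlat]) M hM a
          (by simpa using h) (by simpa using hn)
      · have := hJ.vars _ hk x hx
        rw [hv] at this
        simpa [commonVars] using this
  · rintro F - ⟨A, B, rfl⟩
    refine ⟨Flat.acyclic_toHorn fun p hp => ?_, ?_⟩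
    · have : ∀ p q, ¬ (binaryFlat A B).Dep p q := by
        rintro p q ⟨c, hc, hp, hq⟩
        simp only [binaryFlat, List.mem_cons, List.not_mem_nil, or_false] at hc
        rcases hc with rfl | rfl
        · simp at hq
        · simp at hp
      obtain ⟨q, _, h⟩ := (Relation.TransGen.tail'_iff).1 hp
      exact this _ _ h
    · refine ⟨A, B, .nil, commonVars A B, dedupD_nodup _, ?_, rfl⟩
      ext x; simp [commonVars]

/-- The variable that a term consists of. -/
def termVar (t : Trm L) : Data := (enc t).tail

/-- The arguments in an interpolation pair already are the common variables of the two constraints,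
so these constraints form the binary problem without any normalisation. -/
theorem horn_reduces_binary {S : Set (Interp.{u, v, w} L)} {Con : ConstraintLanguage L} :
    PolyReducesToSeq (hornSolving Coding.coding S Con IsInterpolationPair)
      (binaryInterpolation Coding.coding S Con) := by
  let f : List (Clause L) → List (Fml L × Fml L) := fun HC => HC.head?.elim [] fun h =>
    HC.tail.head?.elim [] fun h' => [(h.constraint, h'.constraint)]
  let g : List (Clause L) → List (Fml L) → List (RelSym × Fml L) := fun HC Is =>
    (HC.head?.bind fun h => h.head).elim [] fun A => [(⟨A.name, A.args.length⟩,
      rename (Flat.formal (A.args.map termVar)) (Is.head?.getD ⊥))]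
  have hf : PT f := by fun_prop
  have ht : PT (termVar (L := L)) := PT.data_tail PT.id.enc_comp
  have hg : PT fun a : List (Clause L) × List (Fml L) => g a.1 a.2 := by
    have : PT fun p : (List (Clause L) × List (Fml L)) × Atom L => p.2.args.map termVar :=
      PT.list_map (f := fun _ => termVar) (by fun_prop) (ht.comp PT.snd)
    have h2 : PT fun p : ((List (Clause L) × List (Fml L)) × Atom L) × Data =>
        Flat.formal (p.1.2.args.map termVar) p.2 := PT.formal (this.comp PT.fst) PT.snd
    have h3 := PT.rename (ρ := fun (p : (List (Clause L) × List (Fml L)) × Atom L) x =>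
        Flat.formal (p.2.args.map termVar) x)
      (φ := fun p : (List (Clause L) × List (Fml L)) × Atom L =>
      p.1.2.head?.getD ⊥) (by fun_prop) h2
    simp only [g]
    refine PT.option_elim (by fun_prop) (by fun_prop) (PT.list_cons (PT.prodMk ?_ h3) (by fun_prop))
    fun_prop
  unfold binaryInterpolation hornSolving
  refine PolyReducesToSeq.intro f g (hf.comp PT.subtype_val) (hg.comp PT.subtype_val) ?_
  rintro _ ⟨hcon, -, A, B, p, xs, hnd, hxs, rfl⟩
  -- All arguments are variables, so their names can be read off the codes of the terms.
  have hargs : xs.map ((termVar (L := L)) ∘ Term.var) = xs := by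
    rw [show (termVar (L := L)) ∘ Term.var = _root_.id from rfl, List.map_id]
  have hxs' : ∀ x, x ∈ xs ↔ x ∈ fv A ∧ x ∈ fv B := fun x => Set.ext_iff.1 hxs x
  have hatom : ∀ sol : RelSym → Fml L, (⟨p, xs.map Term.var⟩ : Atom L).inst sol =
      rename (Flat.actual xs) (sol ⟨p, xs.length⟩) := by
    intro sol
    have := Flat.inst_atom (([], [(p, xs)]) : Flat L) p sol
    simpa [Flat.atom, Flat.sym, Flat.vars, List.lookup] using this
  simp only [f, List.head?_cons, List.tail_cons, Option.elim_some, List.mem_singleton,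
    forall_eq, List.forall₂_cons_left_iff, List.forall₂_nil_left_iff, exists_and_left]
  refine ⟨⟨hcon ⟨A, [], some ⟨p, xs.map Term.var⟩⟩ (by simp),
    hcon ⟨B, [⟨p, xs.map Term.var⟩], none⟩ (by simp)⟩, ?_, ?_⟩
  · rintro ⟨sol, h1, h2⟩
    refine ⟨rename (Flat.actual xs) (table sol ⟨p, xs.length⟩),
      ConstraintLanguage.rename_mem (h1 _).1 _, fun M hM a h => ?_, fun M hM a h => ?_,
      fun x hx => ?_⟩
    · rw [← hatom]
      exact (sat_inst _ _).1 (h2 M hM ⟨A, [], some ⟨p, xs.map Term.var⟩⟩ (by simp) a) (h A rfl)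
        (by simp)
    · rw [← hatom]
      intro (h3 : M.Sat _ a)
      have := (sat_inst _ _).1 (h2 M hM ⟨B, [⟨p, xs.map Term.var⟩], none⟩ (by simp) a) (h B rfl)
        (by simp only [List.mem_singleton, forall_eq]; exact h3)
      exact this
    · exact (hxs' x).1 (Flat.fv_actual (h1 _).2 hx)
  · rintro zs ⟨I, ⟨hI, hA, hB, hfv⟩, zs', rfl, rfl⟩
    have hfv' : ∀ x ∈ fv I, x ∈ xs := fun x hx => (hxs' x).2 (hfv hx)
    have hsol : g [⟨A, [], some ⟨p, xs.map Term.var⟩⟩, ⟨B, [⟨p, xs.map Term.var⟩], none⟩] [I] =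
        [(⟨p, xs.length⟩, rename (Flat.formal xs) I)] := by
      simp [g, hargs]
    rw [hsol]
    have htab : table [((⟨p, xs.length⟩ : RelSym), rename (Flat.formal xs) I)] ⟨p, xs.length⟩ =
        rename (Flat.formal xs) I := by simp [table, List.lookup]
    have hsat : ∀ (M : Interp.{u, v, w} L) (a : Data → M.U), M.Sat ((⟨p, xs.map Term.var⟩ : Atom L).inst
        (table [((⟨p, xs.length⟩ : RelSym), rename (Flat.formal xs) I)])) a ↔ M.Sat I a := by
      intro M a
      rw [hatom, htab]
      exact Flat.sat_actual_formal hfv'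
    refine ⟨fun s => ?_, fun M hM h hh a => ?_⟩
    · rcases table_cases [((⟨p, xs.length⟩ : RelSym), rename (Flat.formal xs) I)] s with h | h
      · rw [h]; exact ⟨Con.falsum_mem, by simp⟩
      · simp only [List.mem_singleton, Prod.mk.injEq] at h
        rw [h.1, htab]
        exact ⟨ConstraintLanguage.rename_mem hI _, fun y hy => Flat.fv_formal hfv' hy⟩
    · rw [sat_inst]
      intro h1 h2
      simp only [List.mem_cons, List.not_mem_nil, or_false] at hh
      rcases hh with rfl | rfl
      · exact (hsat M a).2 (hA M hM a (by simpa using h1))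
      · exact absurd ((hsat M a).1 (h2 _ (by simp))) (hB M hM a (by simpa using h1))

end Binary

/-! ### Inductive sequences to flat clauses -/

section Sequence
variable {L : FirstOrder.Language.{u, v}} [Coding L]

def seqVars (T : List (Fml L)) (i : ℕ) : List Data :=
  dedupD (((T.take i).flatMap varList).filter fun x => decide (x ∈ (T.drop i).flatMap varList))

theorem mem_seqVars {T : List (Fml L)} {i : ℕ} {x : Data} :
    x ∈ seqVars T i ↔ x ∈ fvs (T.take i) ∩ fvs (T.drop i) := by
  simp [seqVars, fvs]

/-- Symbol `i` stands for the interpolant `Iᵢ`, and the two extra clauses express `I₀ = true` and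
`Iₙ = false`. All identifiers are `nil`, as `Flat.Apart` is not needed in this direction. -/
def seqFlat (T : List (Fml L)) : Flat L :=
  ((T.zipIdx.map fun p => ⟨.nil, p.1, [.ofNat p.2], some (.ofNat (p.2 + 1))⟩) ++
    [⟨.nil, ⊤, [], some (.ofNat 0)⟩, ⟨.nil, ⊤, [.ofNat T.length], none⟩],
    ((List.range (T.length + 1)).map Data.ofNat).map fun p => (p, seqVars T p.toNat))

theorem mem_seqFlat {T : List (Fml L)} {c : FClause L} : c ∈ (seqFlat T).1 ↔
    (∃ (i : ℕ) (φ : Fml L), T[i]? = some φ ∧ c = ⟨.nil, φ, [.ofNat i], some (.ofNat (i + 1))⟩) ∨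
    c = ⟨.nil, ⊤, [], some (.ofNat 0)⟩ ∨ c = ⟨.nil, ⊤, [.ofNat T.length], none⟩ := by
  simp only [seqFlat, List.mem_append, List.mem_map, Prod.exists, List.mem_zipIdx_iff_getElem?,
    List.mem_cons, List.not_mem_nil, or_false]
  refine or_congr ⟨fun ⟨φ, i, e, e'⟩ => ⟨i, φ, e, e'.symm⟩, fun ⟨i, φ, e, e'⟩ => ⟨φ, i, e, e'.symm⟩⟩
    Iff.rfl

theorem mem_keys_seqFlat {T : List (Fml L)} {p : Data} :
    p ∈ (seqFlat T).keys ↔ ∃ i ≤ T.length, p = .ofNat i := by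
  simp [seqFlat, Flat.keys, Function.comp_def, eq_comm]

theorem vars_seqFlat {T : List (Fml L)} {i : ℕ} (hi : i ≤ T.length) :
    (seqFlat T).vars (.ofNat i) = seqVars T i := by
  have := Flat.vars_map (seqFlat T).1 ((List.range (T.length + 1)).map Data.ofNat)
    (fun p => seqVars T p.toNat) (p := .ofNat i)
    (List.mem_map.2 ⟨i, List.mem_range.2 (by omega), rfl⟩)
  rwa [toNat_ofNat] at this

theorem sequence_reduces_flat {S : Set (Interp.{u, v, w} L)} (hS : S.Nonempty)
    {Con : ConstraintLanguage L} :
    PolyReduces (sequenceInterpolation Coding.coding S Con)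
      (flatSolving S Con fun F => F.Acyclic ∧ F.Linear ∧ F.BodyDisjoint ∧ F.HeadDisjoint) := by
  -- A solution of the clauses makes the two end formulae only equivalent to `⊤` and `⊥`, whereas an
  -- interpolant sequence must have these very formulae there. The ends are replaced.
  let g : List (Fml L) → List (Data × Fml L) → List (Fml L) := fun T J =>
    (List.range (T.length + 1)).map fun i => if i = 0 then ⊤ else if i = T.length then ⊥ else
      table J (.ofNat i)
  have hf : PT (seqFlat (L := L)) := by unfold seqFlat seqVars; fun_prop
  have hg : PT fun a : List (Fml L) × List (Data × Fml L) => g a.1 a.2 := by fun_prop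
  unfold sequenceInterpolation flatSolving
  refine PolyReduces.intro seqFlat g (hf.comp PT.subtype_val) (hg.comp PT.subtype_val)
    fun T hT => ⟨⟨⟨fun c hc => ?_, fun c hc p hp => ?_, fun p => ?_⟩, ?_, ?_, ?_, ?_⟩, ?_, ?_⟩
  · rcases mem_seqFlat.1 hc with ⟨i, φ, hi, rfl⟩ | rfl | rfl
    · exact hT φ (List.mem_of_getElem? hi)
    all_goals exact ConstraintLanguage.top_mem
  · rw [mem_keys_seqFlat]
    rcases mem_seqFlat.1 hc with ⟨i, φ, hi, rfl⟩ | rfl | rfl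
    · have := (List.getElem?_eq_some_iff.1 hi).1
      simp only [FClause.occ, Option.toList_some, List.mem_append, List.mem_singleton] at hp
      rcases hp with rfl | rfl
      · exact ⟨i, by omega, rfl⟩
      · exact ⟨i + 1, by omega, rfl⟩
    · exact ⟨0, by omega, by simpa [FClause.occ] using hp⟩
    · exact ⟨T.length, le_rfl, by simpa [FClause.occ] using hp⟩
  · by_cases hp : p ∈ (seqFlat T).keys
    · obtain ⟨i, hi, rfl⟩ := mem_keys_seqFlat.1 hp
      rw [vars_seqFlat hi]; exact dedupD_nodup _
    · rw [Flat.vars_eq_nil hp]; exact List.nodup_nil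
  · have : ∀ p q, (seqFlat T).Dep p q → q.toNat < p.toNat := by
      rintro p q ⟨c, hc, hp, hq⟩
      rcases mem_seqFlat.1 hc with ⟨i, φ, hi, rfl⟩ | rfl | rfl
      · simp only [Option.some.injEq, List.mem_singleton] at hp hq
        rw [← hp, hq, toNat_ofNat, toNat_ofNat]; omega
      · simp at hq
      · simp at hp
    intro p hp
    have key : ∀ p q, Relation.TransGen (seqFlat T).Dep p q → q.toNat < p.toNat := by
      intro p q h
      induction h with
      | single h => exact this _ _ h
      | tail _ h ih => exact (this _ _ h).trans ih
    exact lt_irrefl _ (key p p hp)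
  · intro c hc
    rcases mem_seqFlat.1 hc with ⟨i, φ, hi, rfl⟩ | rfl | rfl <;> simp
  · have : (seqFlat T).1.flatMap FClause.body = (List.range (T.length + 1)).map Data.ofNat := by
      simp only [seqFlat, List.flatMap_append, List.flatMap_map, List.flatMap_cons,
        List.flatMap_nil, List.range_succ, List.map_append, List.map_cons, List.map_nil,
        List.append_nil, List.nil_append]
      congr 1
      rw [← List.map_eq_flatMap, show (fun x : Fml L × ℕ => Data.ofNat x.2) = Data.ofNat ∘ Prod.snd
        from rfl, ← List.map_map, List.zipIdx_map_snd, List.range_eq_range']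
    unfold Flat.BodyDisjoint
    rw [this]
    exact List.nodup_range.map ofNat_injective
  · have : (seqFlat T).1.flatMap (fun c => c.head.toList) =
        (List.range T.length).map (fun i => Data.ofNat (i + 1)) ++ [Data.ofNat 0] := by
      simp only [seqFlat, List.flatMap_append, List.flatMap_map, List.flatMap_cons,
        List.flatMap_nil, List.append_nil, Option.toList_some, Option.toList_none]
      congr 1
      rw [← List.map_eq_flatMap, show (fun x : Fml L × ℕ => Data.ofNat (x.2 + 1)) =
        (fun i => Data.ofNat (i + 1)) ∘ Prod.snd from rfl, ← List.map_map, List.zipIdx_map_snd,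
        List.range_eq_range']
    unfold Flat.HeadDisjoint
    rw [this, List.nodup_append']
    refine ⟨List.nodup_range.map fun i j h => by simpa using ofNat_injective h, by simp, ?_⟩
    intro x hx hx'
    obtain ⟨i, _, rfl⟩ := List.mem_map.1 hx
    simp [ofNat_injective.eq_iff] at hx'
  · rintro ⟨I, -, hI, h0, hn, hent, hfv⟩
    have hJ : ∀ i ≤ T.length, table (((List.range (T.length + 1)).map Data.ofNat).map
        fun p => (p, I.getD p.toNat ⊥)) (.ofNat i) = I.getD i ⊥ := fun i hi => by
      have := table_map (fun p : Data => I.getD p.toNat ⊥) (k := .ofNat i)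
        (ks := (List.range (T.length + 1)).map Data.ofNat)
        (List.mem_map.2 ⟨i, List.mem_range.2 (by omega), rfl⟩)
      rwa [toNat_ofNat] at this
    have hmem : ∀ i, I.getD i ⊥ ∈ Con.carrier := fun i => by
      by_cases h : i < I.length
      · rw [List.getD_eq_getElem _ _ h]; exact hI _ (List.getElem_mem h)
      · rw [List.getD_eq_default _ _ (by omega)]; exact Con.falsum_mem
    refine ⟨((List.range (T.length + 1)).map Data.ofNat).map fun p => (p, I.getD p.toNat ⊥),
      fun p hp => ?_, fun p hp x hx => ?_, fun c hc M hM a h1 h2 => ?_⟩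
    · obtain ⟨i, hi, rfl⟩ := mem_keys_seqFlat.1 hp
      rw [hJ i hi]; exact hmem i
    · obtain ⟨i, hi, rfl⟩ := mem_keys_seqFlat.1 hp
      rw [hJ i hi] at hx
      rw [vars_seqFlat hi, mem_seqVars]
      exact hfv i hi hx
    · rcases mem_seqFlat.1 hc with ⟨i, φ, hi, rfl⟩ | rfl | rfl
      · obtain ⟨hi', rfl⟩ := List.getElem?_eq_some_iff.1 hi
        simp only [List.mem_singleton, forall_eq, Option.elim_some] at h2 ⊢
        rw [hJ _ hi'.le] at h2
        rw [hJ (i + 1) hi']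
        refine hent i hi' M hM a ?_
        rintro ψ (rfl | rfl)
        · exact h2
        · rwa [List.getD_eq_getElem _ _ hi']
      · show M.Sat (table _ (Data.ofNat 0)) a
        rw [hJ 0 (by omega), h0]; exact sat_top
      · have := h2 (Data.ofNat T.length) (by simp)
        rw [hJ _ le_rfl, hn] at this
        exact this
  · intro J hJ
    have h0 : ∀ M ∈ S, ∀ a : Data → M.U, M.Sat (table J (.ofNat 0)) a := fun M hM a =>
      hJ.valid ⟨.nil, ⊤, [], some (.ofNat 0)⟩ (mem_seqFlat.2 (by simp)) M hM a sat_top (by simp)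
    have hn : ∀ M ∈ S, ∀ a : Data → M.U, ¬ M.Sat (table J (.ofNat T.length)) a := fun M hM a h =>
      hJ.valid ⟨.nil, ⊤, [.ofNat T.length], none⟩ (mem_seqFlat.2 (by simp)) M hM a sat_top
        (by simpa using h)
    -- For the empty sequence both extra clauses concern symbol 0, which would have to be true and
    -- false at once in a structure of `S`. Otherwise the two ends are different and can be replaced
    -- independently.
    have hpos : T.length ≠ 0 := by
      intro h
      obtain ⟨M, hM⟩ := hS
      obtain ⟨m⟩ := M.nonempty
      have := hn M hM fun _ => m
      rw [h] at this
      exact this (h0 M hM _)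
    have hI : ∀ i ≤ T.length, (g T J).getD i ⊥ =
        if i = 0 then ⊤ else if i = T.length then ⊥ else table J (.ofNat i) := fun i hi => by
      rw [List.getD_eq_getElem _ _ (by simp [g]; omega)]
      simp [g]
    -- Replacing the ends does not change the meaning in the structures of `S`.
    have hsat : ∀ i ≤ T.length, ∀ M ∈ S, ∀ a : Data → M.U,
        (M.Sat ((g T J).getD i ⊥) a ↔ M.Sat (table J (.ofNat i)) a) := by
      intro i hi M hM a
      rw [hI i hi]
      split_ifs with e e'
      · subst e; simp [h0 M hM a]
      · subst e'; simp [hn M hM a]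
      · rfl
    refine ⟨by simp [g], fun φ hφ => ?_, ?_, ?_, fun i hi M hM a h => ?_, fun i hi x hx => ?_⟩
    · simp only [g, List.mem_map, List.mem_range] at hφ
      obtain ⟨i, hi, rfl⟩ := hφ
      split_ifs
      · exact ConstraintLanguage.top_mem
      · exact Con.falsum_mem
      · exact hJ.mem _ (mem_keys_seqFlat.2 ⟨i, by omega, rfl⟩)
    · rw [hI 0 (by omega)]; simp
    · rw [hI _ le_rfl]; simp [hpos]
    · rw [hsat (i + 1) hi M hM]
      refine hJ.valid ⟨.nil, T[i], [.ofNat i], some (.ofNat (i + 1))⟩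
        (mem_seqFlat.2 (Or.inl ⟨i, _, List.getElem?_eq_getElem hi, rfl⟩)) M hM a
        (h _ (Or.inr (List.getD_eq_getElem _ _ hi).symm)) ?_
      simp only [List.mem_singleton, forall_eq]
      rw [← hsat i hi.le M hM]
      exact h _ (Or.inl rfl)
    · rw [hI i hi] at hx
      split_ifs at hx
      · simp at hx
      · simp at hx
      · have := hJ.vars _ (mem_keys_seqFlat.2 ⟨i, hi, rfl⟩) x hx
        rwa [vars_seqFlat hi, mem_seqVars] at this

end Sequence

/-! ### Chains of a partial function -/

section Chain
variable {α : Type*}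

/-- The elements obtained by iterating a partial function. -/
def chain (up : α → Option α) : ℕ → α → List α
  | 0, a => [a]
  | n + 1, a => a :: (up a).elim [] (chain up n)

/-- One step of an iteration that collects the chain in reverse order and is stationary once `up` is
undefined. -/
def chainStep (up : α → Option α) (l : List α) : List α :=
  (l.head?.bind up).elim l fun b => b :: l

theorem chainStep_iterate (up : α → Option α) (n : ℕ) (a : α) (l : List α) :
    (chainStep up)^[n] (a :: l) = (chain up n a).reverse ++ l := by
  induction n generalizing a l with
  | zero => rfl
  | succ n ih =>
    rw [Function.iterate_succ_apply, chain]
    cases h : up a with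
    | none =>
      have h1 : chainStep up (a :: l) = a :: l := by simp [chainStep, h]
      rw [h1, Function.iterate_fixed h1]
      simp
    | some b =>
      have h1 : chainStep up (a :: l) = b :: a :: l := by simp [chainStep, h]
      rw [h1, ih]
      simp

theorem chainStep_mem {up : α → Option α} {P : α → Prop} (h : ∀ a b, up a = some b → P b) {l : List α}
    (hl : ∀ a ∈ l, P a) : ∀ a ∈ chainStep up l, P a := by
  unfold chainStep
  cases h1 : l.head?.bind up with
  | none => exact hl
  | some b =>
    obtain ⟨a, _, hab⟩ := Option.bind_eq_some_iff.1 h1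
    intro c hc
    rcases List.mem_cons.1 hc with rfl | hc
    · exact h a c hab
    · exact hl c hc

theorem chainStep_length (up : α → Option α) (l : List α) :
    (chainStep up l).length ≤ l.length + 1 := by
  unfold chainStep
  cases l.head?.bind up <;> simp

/-- Each step adds at most one element, and all elements after the first are no larger than `a`;
hence the accumulated list stays polynomial. -/
theorem PT.chain {α σ : Type*} [Enc α] [Enc σ] {up : α → σ → Option σ} {n : α → ℕ} {s : α → σ}
    (hup : PT fun p : α × σ => up p.1 p.2) (hn : PT n) (hs : PT s)
    (hsize : ∀ a x y, up a x = .some y → esize y ≤ esize a) :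
    PT fun a => chain (up a) (n a) (s a) := by
  have h1 : ∀ a, HornInterp.chain (up a) (n a) (s a) = ((chainStep (up a))^[n a] [s a]).reverse := fun a => by
    rw [chainStep_iterate]; simp
  simp only [h1]
  refine PT.list_reverse (PT.iterate (f := fun a => chainStep (up a)) (init := fun a => [s a]) ?_
    (by fun_prop) hn (B := fun a => (esize (n a) + 1) * (esize a + esize (s a) + 1) + 1) ?_
    fun a k hk => ?_)
  · unfold chainStep
    have h2 : PT fun p : (α × List σ) × σ => up p.1.1 p.2 :=
      hup.comp (f := fun p : (α × List σ) × σ => (p.1.1, p.2)) (by fun_prop)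
    fun_prop
  · exact (((hn.pb_esize.add (PB.const 1)).mul
      ((PB.esize.add hs.pb_esize).add (PB.const 1))).add (PB.const 1))
  · have h2 : (∀ x ∈ (chainStep (up a))^[k] [s a], esize x ≤ esize a + esize (s a)) ∧
        ((chainStep (up a))^[k] [s a]).length ≤ k + 1 := by
      clear hk
      induction k with
      | zero => simp
      | succ k ih =>
        rw [Function.iterate_succ_apply']
        refine ⟨chainStep_mem (fun x y h => (hsize a x y h).trans (by omega)) ih.1, ?_⟩
        have := chainStep_length (up a) ((chainStep (up a))^[k] [s a])
        omega
    have h3 := esize_list_le h2.1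
    have h4 : k + 1 ≤ esize (n a) + 1 := by rw [esize_nat]; omega
    have := Nat.mul_le_mul_right (esize a + esize (s a) + 1) (h2.2.trans h4)
    omega

/-- The rank drops at each step, so `n ≥ r a` steps reach everything that can be reached. -/
theorem mem_chain {up : α → Option α} {r : α → ℕ} (hr : ∀ a b, up a = some b → r b < r a) {n : ℕ}
    {a x : α} (ha : r a ≤ n) :
    x ∈ chain up n a ↔ Relation.ReflTransGen (fun a b => up a = some b) a x := by
  induction n generalizing a with
  | zero =>
    simp only [chain, List.mem_singleton]
    constructor
    · rintro rfl; exact .refl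
    · intro h
      rcases h.cases_head with rfl | ⟨b, hb, _⟩
      · rfl
      · have := hr a b hb; omega
  | succ n ih =>
    simp only [chain, List.mem_cons]
    constructor
    · rintro (rfl | h)
      · exact .refl
      · cases hb : up a with
        | none => simp [hb] at h
        | some b =>
          rw [hb] at h
          have := hr a b hb
          exact .head hb ((ih (by omega)).1 h)
    · intro h
      rcases h.cases_head with rfl | ⟨b, hb, h⟩
      · exact Or.inl rfl
      · right
        have := hr a b hb
        rw [hb]
        exact (ih (by omega)).2 h

/-- The rank of `a` is the number of elements of `l` that can be reached from it. After a step to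
`b` these are fewer, since `b` itself is lost by acyclicity. -/
theorem exists_rank {R : α → α → Prop} (hR : ∀ a, ¬ Relation.TransGen R a a) {l : List α}
    (hl : ∀ a b, R a b → b ∈ l) :
    ∃ r : α → ℕ, (∀ a, r a ≤ l.length) ∧ ∀ a b, R a b → r b < r a := by
  classical
  refine ⟨fun a => (l.toFinset.filter fun b => Relation.TransGen R a b).card, fun a => ?_,
    fun a b h => Finset.card_lt_card (Finset.ssubset_iff_of_subset ?_ |>.2 ⟨b, ?_, ?_⟩)⟩
  · exact (Finset.card_filter_le _ _).trans (List.toFinset_card_le l)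
  · intro c hc
    rw [Finset.mem_filter] at hc ⊢
    exact ⟨hc.1, .head h hc.2⟩
  · rw [Finset.mem_filter, List.mem_toFinset]
    exact ⟨hl a b h, .single h⟩
  · rw [Finset.mem_filter]
    exact fun h => hR b h.2

theorem mem_chain_of_acyclic {up : α → Option α}
    (hup : ∀ a, ¬ Relation.TransGen (fun a b => up a = some b) a a) {l : List α}
    (hl : ∀ a b, up a = some b → b ∈ l) {n : ℕ} (hn : l.length ≤ n) {a x : α} :
    x ∈ chain up n a ↔ Relation.ReflTransGen (fun a b => up a = some b) a x := by
  obtain ⟨r, h1, h2⟩ := exists_rank hup hl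
  exact mem_chain h2 ((h1 a).trans hn)

end Chain

/-! ### Tree interpolation to flat clauses -/

section Tree
variable {L : FirstOrder.Language.{u, v}}

namespace TreeProblem

def parent (P : TreeProblem L) (w : Data) : Option Data :=
  (P.edges.find? fun e => decide (e.2 = w)).map fun e => e.1

def children (P : TreeProblem L) (v : Data) : List Data :=
  (P.edges.filter fun e => decide (e.1 = v)).map fun e => e.2

theorem mem_children {P : TreeProblem L} {v w : Data} : w ∈ P.children v ↔ P.E v w := by
  simp [children, E]

theorem E_of_parent {P : TreeProblem L} {v w : Data} (h : P.parent w = some v) : P.E v w := by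
  simp only [parent, Option.map_eq_some_iff] at h
  obtain ⟨e, he, rfl⟩ := h
  have h1 := List.mem_of_find?_eq_some he
  have h2 := List.find?_some he
  rw [decide_eq_true_iff] at h2
  rw [← h2]
  exact h1

theorem IsTree.unique {P : TreeProblem L} (h : P.IsTree) {v v' w : Data} (h1 : P.E v w)
    (h2 : P.E v' w) : v = v' := by
  obtain ⟨-, -, hV, -, hr, hu, -⟩ := h
  exact (hu w (hV _ _ h1).2 (by rintro rfl; exact hr _ h1)).unique h1 h2

theorem IsTree.parent_eq {P : TreeProblem L} (h : P.IsTree) {v w : Data} :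
    P.parent w = some v ↔ P.E v w := by
  refine ⟨E_of_parent, fun he => ?_⟩
  cases h1 : P.parent w with
  | none =>
    simp only [parent, Option.map_eq_none_iff, List.find?_eq_none] at h1
    exact absurd (decide_eq_true rfl) (h1 _ he)
  | some v' => rw [h.unique he (E_of_parent h1)]

/-- By uniqueness of parents, a cycle through a node also passes through its parent. Following the
path back, it would pass through the root, which no edge enters. -/
theorem IsTree.acyclic {P : TreeProblem L} (h : P.IsTree) (v : Data) :
    ¬ Relation.TransGen P.E v v := by
  have key : ∀ w, P.Below P.root w → ¬ Relation.TransGen P.E w w := by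
    intro w hw
    induction hw with
    | refl =>
      intro hc
      obtain ⟨b, -, hb⟩ := Relation.TransGen.tail'_iff.1 hc
      exact h.2.2.2.2.1 b hb
    | tail _ hbc ih =>
      intro hc
      obtain ⟨b, hb, hb'⟩ := Relation.TransGen.tail'_iff.1 hc
      obtain rfl := h.unique hbc hb'
      exact ih (.head' hbc hb)
  intro hc
  obtain ⟨b, -, hb⟩ := Relation.TransGen.tail'_iff.1 hc
  exact key v (h.2.2.2.2.2.2 v (h.2.2.1 b v hb).2) hc

/-- Descent is decided upwards, along the unique chain of parents of `w`; as many steps as there are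
nodes suffice. -/
def isBelow (P : TreeProblem L) (v w : Data) : Bool :=
  decide (v ∈ chain P.parent P.nodes.length w)

theorem IsTree.isBelow_iff {P : TreeProblem L} (h : P.IsTree) {v w : Data} :
    P.isBelow v w = true ↔ P.Below v w := by
  have h1 : (fun a b => P.parent a = some b) = Function.swap P.E := by
    funext a b; exact propext h.parent_eq
  rw [isBelow, decide_eq_true_iff, mem_chain_of_acyclic (l := P.V) ?_ ?_ (by simp [V]), h1,
    Relation.reflTransGen_swap, Below]
  · intro a
    rw [h1, Relation.transGen_swap]
    exact h.acyclic a
  · intro a b hab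
    exact (h.2.2.1 _ _ (E_of_parent hab)).1

variable [Coding L] {α : Type*} [Enc α]

def args (P : TreeProblem L) (v : Data) : List Data :=
  dedupD (((P.V.filter fun w => P.isBelow v w).flatMap fun w => varList (P.label w)).filter fun x =>
    decide (x ∈ (P.V.filter fun w => !P.isBelow v w).flatMap fun w => varList (P.label w)))

theorem IsTree.mem_args {P : TreeProblem L} (h : P.IsTree) {v x : Data} : x ∈ P.args v ↔
    (∃ w ∈ P.V, P.Below v w ∧ x ∈ fv (P.label w)) ∧
      ∃ w ∈ P.V, ¬ P.Below v w ∧ x ∈ fv (P.label w) := by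
  simp only [args, mem_dedupD, List.mem_filter, List.mem_flatMap, h.isBelow_iff, mem_varList,
    decide_eq_true_iff, Bool.not_eq_true', ← Bool.not_eq_true, and_assoc]

/-- Each node is a symbol. The label of a node together with its children implies the node, and the
root implies `false`. -/
def toFlat (P : TreeProblem L) : Flat L :=
  ((P.V.map fun v => ⟨.nil, P.label v, P.children v, some v⟩) ++ [⟨.nil, ⊤, [P.root], none⟩],
    P.V.map fun v => (v, P.args v))

theorem mem_toFlat {P : TreeProblem L} {c : FClause L} : c ∈ P.toFlat.1 ↔
    (∃ v ∈ P.V, (⟨.nil, P.label v, P.children v, some v⟩ : FClause L) = c) ∨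
      c = ⟨.nil, ⊤, [P.root], none⟩ := by
  simp [toFlat]

theorem keys_toFlat (P : TreeProblem L) : P.toFlat.keys = P.V := by
  simp [toFlat, Flat.keys, Function.comp_def]

theorem vars_toFlat (P : TreeProblem L) {v : Data} (hv : v ∈ P.V) :
    P.toFlat.vars v = P.args v := Flat.vars_map _ _ _ hv

end TreeProblem

variable [Coding L] {α : Type*} [Enc α]

instance : Enc (TreeProblem L) := ⟨fun P => enc (P.nodes, P.edges, P.root)⟩

theorem PT.treeProblem_tuple : PT fun P : TreeProblem L => (P.nodes, P.edges, P.root) :=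
  PT.of_enc fun _ => rfl

@[fun_prop]
theorem PT.treeProblem_nodes {f : α → TreeProblem L} (hf : PT f) : PT fun a => (f a).nodes :=
  PT.fst.comp (PT.treeProblem_tuple.comp hf)

@[fun_prop]
theorem PT.treeProblem_edges {f : α → TreeProblem L} (hf : PT f) : PT fun a => (f a).edges :=
  PT.fst.comp (PT.snd.comp (PT.treeProblem_tuple.comp hf))

@[fun_prop]
theorem PT.treeProblem_root {f : α → TreeProblem L} (hf : PT f) : PT fun a => (f a).root :=
  PT.snd.comp (PT.snd.comp (PT.treeProblem_tuple.comp hf))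

@[fun_prop]
theorem PT.treeProblem_mk {f : α → List (Data × Fml L)} {g : α → List (Data × Data)} {h : α → Data}
    (hf : PT f) (hg : PT g) (hh : PT h) : PT fun a => TreeProblem.mk (f a) (g a) (h a) :=
  PT.of_enc_comp ((hf.prodMk (hg.prodMk hh)).enc_comp) fun _ => rfl

theorem PT.treeProblem_isBelow :
    PT fun a : TreeProblem L × Data × Data => a.1.isBelow a.2.1 a.2.2 := by
  unfold TreeProblem.isBelow
  refine PT.decide_mem (PT.chain (up := fun a : TreeProblem L × Data × Data => a.1.parent)
    (by unfold TreeProblem.parent; fun_prop) (by fun_prop) (by fun_prop) fun a x y h => ?_) (by fun_prop)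
  have h1 : esize (y, x) < esize a.1.edges := esize_le_of_mem (TreeProblem.E_of_parent h)
  have h2 : esize a = esize a.1.nodes + (esize a.1.edges + esize a.1.root + 1) + 1 + esize a.2 + 1 :=
    rfl
  rw [esize_pair] at h1
  omega

theorem PT.treeProblem_toFlat : PT (TreeProblem.toFlat : TreeProblem L → Flat L) := by
  have h1 : PT fun p : (TreeProblem L × Data) × Data => p.1.1.isBelow p.1.2 p.2 :=
    PT.treeProblem_isBelow.comp (f := fun p : (TreeProblem L × Data) × Data => (p.1.1, p.1.2, p.2))
      (by fun_prop)
  have h2 : PT fun p : ((TreeProblem L × Data) × Data) × Data => p.1.1.1.isBelow p.1.1.2 p.2 :=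
    h1.comp (f := fun p : ((TreeProblem L × Data) × Data) × Data => (p.1.1, p.2)) (by fun_prop)
  unfold TreeProblem.toFlat TreeProblem.args TreeProblem.children TreeProblem.label TreeProblem.V
  fun_prop

theorem tree_reduces_flat {S : Set (Interp.{u, v, w} L)} {Con : ConstraintLanguage L} :
    PolyReduces (treeInterpolation Coding.coding S Con)
      (flatSolving S Con fun F => F.Acyclic ∧ F.BodyDisjoint ∧ F.HeadDisjoint) := by
  -- The root must be labelled by `⊥` itself, while a solution only makes it unsatisfiable over `S`.
  let g : TreeProblem L → List (Data × Fml L) → List (Data × Fml L) := fun P J =>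
    P.V.map fun v => (v, if v = P.root then ⊥ else table J v)
  have hg : PT fun a : TreeProblem L × List (Data × Fml L) => g a.1 a.2 := by
    simp only [g, TreeProblem.V]
    fun_prop
  unfold treeInterpolation flatSolving
  refine PolyReduces.intro TreeProblem.toFlat g (PT.treeProblem_toFlat.comp PT.subtype_val)
    (hg.comp PT.subtype_val) ?_
  rintro P ⟨ht, hcon⟩
  obtain ⟨hV, hE, hEV, hroot, hnr, -, -⟩ := id ht
  refine ⟨⟨⟨fun c hc => ?_, fun c hc p hp => ?_, fun p => ?_⟩, ?_, ?_, ?_⟩, ?_, ?_⟩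
  · rcases TreeProblem.mem_toFlat.1 hc with ⟨v, hv, rfl⟩ | rfl
    · exact hcon v hv
    · exact ConstraintLanguage.top_mem
  · rw [TreeProblem.keys_toFlat]
    rcases TreeProblem.mem_toFlat.1 hc with ⟨v, hv, rfl⟩ | rfl
    · simp only [FClause.occ, Option.toList_some, List.mem_append, List.mem_singleton,
        TreeProblem.mem_children] at hp
      rcases hp with hp | rfl
      · exact (hEV _ _ hp).2
      · exact hv
    · have : p = P.root := by simpa [FClause.occ] using hp
      rwa [this]
  · by_cases hp : p ∈ P.toFlat.keys
    · rw [TreeProblem.keys_toFlat] at hp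
      rw [P.vars_toFlat hp]; exact dedupD_nodup _
    · rw [Flat.vars_eq_nil hp]; exact List.nodup_nil
  · have : ∀ p q, P.toFlat.Dep p q → P.E p q := by
      rintro p q ⟨c, hc, hp, hq⟩
      rcases TreeProblem.mem_toFlat.1 hc with ⟨v, hv, rfl⟩ | rfl
      · obtain rfl : v = p := by simpa using hp
        exact TreeProblem.mem_children.1 hq
      · simp at hp
    exact fun p hp => ht.acyclic p (Relation.TransGen.mono this _ _ hp)
  · unfold Flat.BodyDisjoint TreeProblem.toFlat
    simp only [List.flatMap_append, List.flatMap_map, List.flatMap_cons, List.flatMap_nil,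
      List.append_nil]
    rw [List.nodup_append', List.nodup_flatMap]
    refine ⟨⟨fun v _ => ?_, hV.imp_of_mem fun {v v'} _ _ hne w hw hw' => ?_⟩, by simp, ?_⟩
    · refine (hE.filter _).map_on fun e he e' he' h => ?_
      simp only [List.mem_filter, decide_eq_true_iff] at he he'
      exact Prod.ext (he.2.trans he'.2.symm) h
    · exact hne (ht.unique (TreeProblem.mem_children.1 hw) (TreeProblem.mem_children.1 hw'))
    · intro w hw hw'
      obtain ⟨v, -, hv⟩ := List.mem_flatMap.1 hw
      obtain rfl := List.mem_singleton.1 hw'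
      exact hnr v (TreeProblem.mem_children.1 hv)
  · unfold Flat.HeadDisjoint TreeProblem.toFlat
    simp only [List.flatMap_append, List.flatMap_map, List.flatMap_cons, List.flatMap_nil,
      List.append_nil, Option.toList_some, Option.toList_none, List.flatMap_singleton']
    exact hV
  · rintro ⟨I, hI⟩
    refine ⟨I, fun p hp => ?_, fun p hp x hx => ?_, fun c hc M hM a h1 h2 => ?_⟩
    · exact hI.mem p (P.keys_toFlat ▸ hp)
    · rw [TreeProblem.keys_toFlat] at hp
      rw [P.vars_toFlat hp, ht.mem_args]
      exact hI.vars p hp x hx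
    · rcases TreeProblem.mem_toFlat.1 hc with ⟨v, hv, rfl⟩ | rfl
      · refine hI.entails v hv M hM a ?_
        rintro ψ (rfl | ⟨w, hw, rfl⟩)
        · exact h1
        · exact h2 w (TreeProblem.mem_children.2 hw)
      · have := h2 P.root (by simp)
        rwa [hI.root] at this
  · intro J hJ
    have hg' : ∀ v ∈ P.V, table (g P J) v = if v = P.root then ⊥ else table J v := fun v hv =>
      table_map (fun v => if v = P.root then ⊥ else table J v) hv
    refine ⟨fun v hv => ?_, ?_, fun v hv M hM a h => ?_, fun v hv x hx => ?_⟩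
    · rw [hg' v hv]
      split_ifs
      · exact Con.falsum_mem
      · exact hJ.mem v (P.keys_toFlat ▸ hv)
    · rw [hg' _ hroot, if_pos rfl]
    · have hJv : M.Sat (table J v) a := by
        refine hJ.valid ⟨.nil, P.label v, P.children v, some v⟩
          (TreeProblem.mem_toFlat.2 (Or.inl ⟨v, hv, rfl⟩)) M hM a (h _ (Or.inl rfl)) fun w hw => ?_
        -- A child is never the root, so its label has not been replaced.
        have hw' := TreeProblem.mem_children.1 hw
        have := h _ (Or.inr ⟨w, hw', rfl⟩)
        rwa [hg' w (hEV _ _ hw').2, if_neg (by rintro rfl; exact hnr _ hw')] at this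
      rw [hg' v hv]
      split_ifs with e
      · subst e
        exact hJ.valid ⟨.nil, ⊤, [P.root], none⟩ (TreeProblem.mem_toFlat.2 (Or.inr rfl)) M hM a
          sat_top (by simpa using hJv)
      · exact hJv
    · rw [hg' v hv] at hx
      split_ifs at hx
      · simp at hx
      · have := hJ.vars v (P.keys_toFlat ▸ hv) x hx
        rwa [P.vars_toFlat hv, ht.mem_args] at this

end Tree

/-! ### Restricted DAG interpolation to flat clauses -/

section Dag
variable {L : FirstOrder.Language.{u, v}}

namespace DagProblem

theorem labelE_eq {P : DagProblem L} (h : (P.edges.map Prod.fst).Nodup) {e : (Data × Data) × Fml L}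
    (he : e ∈ P.edges) : P.labelE e.1.1 e.1.2 = e.2 := table_eq_of_mem h he

theorem E_iff {P : DagProblem L} (h : (P.edges.map Prod.fst).Nodup) {v w : Data} :
    P.E v w ↔ ((v, w), P.labelE v w) ∈ P.edges := by
  constructor
  · intro he
    obtain ⟨⟨⟨v', w'⟩, φ⟩, he', h1⟩ := List.mem_map.1 he
    simp only [Prod.mk.injEq] at h1
    obtain ⟨rfl, rfl⟩ := h1
    have := labelE_eq h he'
    dsimp only at this
    rw [this]
    exact he'
  · intro he
    exact List.mem_map.2 ⟨_, he, rfl⟩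

variable [Coding L]

def args (P : DagProblem L) (v : Data) : List Data :=
  dedupD (((P.edges.filter fun e => decide (e.1.2 = v)).flatMap fun e => varList e.2).filter fun x =>
    decide (x ∈ (P.edges.filter fun e => decide (e.1.1 = v)).flatMap fun e => varList e.2))

theorem mem_args {P : DagProblem L} (h : (P.edges.map Prod.fst).Nodup) {v x : Data} :
    x ∈ P.args v ↔ (∃ a, P.E a v ∧ x ∈ fv (P.labelE a v)) ∧
      ∃ a, P.E v a ∧ x ∈ fv (P.labelE v a) := by
  simp only [args, mem_dedupD, List.mem_filter, List.mem_flatMap, mem_varList, decide_eq_true_iff]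
  refine and_congr ⟨?_, ?_⟩ ⟨?_, ?_⟩
  · rintro ⟨⟨⟨a, b⟩, φ⟩, ⟨he, rfl⟩, hx⟩
    exact ⟨a, List.mem_map.2 ⟨_, he, rfl⟩, (labelE_eq h he).symm ▸ hx⟩
  · rintro ⟨a, he, hx⟩
    exact ⟨_, ⟨(E_iff h).1 he, rfl⟩, hx⟩
  · rintro ⟨⟨⟨a, b⟩, φ⟩, ⟨he, rfl⟩, hx⟩
    exact ⟨b, List.mem_map.2 ⟨_, he, rfl⟩, (labelE_eq h he).symm ▸ hx⟩
  · rintro ⟨a, he, hx⟩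
    exact ⟨_, ⟨(E_iff h).1 he, rfl⟩, hx⟩

/-- An edge must yield both `I w` and the label of `w`. The second part is not a relation symbol, so
it becomes a clause with head `false` and the negated label in its constraint. All bodies have at
most one symbol. -/
def toFlat (P : DagProblem L) : Flat L :=
  ((P.edges.map fun e => ⟨.nil, P.labelV e.1.1 ⊓ e.2, [e.1.1], some e.1.2⟩) ++
    ((P.edges.map fun e => ⟨.nil, P.labelV e.1.1 ⊓ e.2 ⊓ (P.labelV e.1.2).not, [e.1.1], none⟩) ++
      [⟨.nil, ⊤, [], some P.en⟩, ⟨.nil, ⊤, [P.ex], none⟩]),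
    P.V.map fun v => (v, P.args v))

theorem mem_toFlat {P : DagProblem L} (h : (P.edges.map Prod.fst).Nodup) {c : FClause L} :
    c ∈ P.toFlat.1 ↔
    (∃ v w, P.E v w ∧ c = ⟨.nil, P.labelV v ⊓ P.labelE v w, [v], some w⟩) ∨
    (∃ v w, P.E v w ∧ c = ⟨.nil, P.labelV v ⊓ P.labelE v w ⊓ (P.labelV w).not, [v], none⟩) ∨
    c = ⟨.nil, ⊤, [], some P.en⟩ ∨ c = ⟨.nil, ⊤, [P.ex], none⟩ := by
  simp only [toFlat, List.mem_append, List.mem_map, List.mem_cons, List.not_mem_nil, or_false]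
  refine or_congr ⟨?_, ?_⟩ (or_congr ⟨?_, ?_⟩ Iff.rfl)
  · rintro ⟨⟨⟨a, b⟩, φ⟩, he, rfl⟩
    exact ⟨a, b, List.mem_map.2 ⟨_, he, rfl⟩, by rw [labelE_eq h he]⟩
  · rintro ⟨v, w, he, rfl⟩
    exact ⟨_, (E_iff h).1 he, rfl⟩
  · rintro ⟨⟨⟨a, b⟩, φ⟩, he, rfl⟩
    exact ⟨a, b, List.mem_map.2 ⟨_, he, rfl⟩, by rw [labelE_eq h he]⟩
  · rintro ⟨v, w, he, rfl⟩
    exact ⟨_, (E_iff h).1 he, rfl⟩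

theorem keys_toFlat (P : DagProblem L) : P.toFlat.keys = P.V := by
  simp [toFlat, Flat.keys, Function.comp_def]

theorem vars_toFlat (P : DagProblem L) {v : Data} (hv : v ∈ P.V) :
    P.toFlat.vars v = P.args v := Flat.vars_map _ _ _ hv

end DagProblem

variable [Coding L] {α : Type*} [Enc α]

instance : Enc (DagProblem L) := ⟨fun P => enc (P.nodes, P.edges, P.en, P.ex)⟩

theorem PT.dagProblem_tuple : PT fun P : DagProblem L => (P.nodes, P.edges, P.en, P.ex) :=
  PT.of_enc fun _ => rfl

@[fun_prop]
theorem PT.dagProblem_nodes {f : α → DagProblem L} (hf : PT f) : PT fun a => (f a).nodes :=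
  PT.fst.comp (PT.dagProblem_tuple.comp hf)

@[fun_prop]
theorem PT.dagProblem_edges {f : α → DagProblem L} (hf : PT f) : PT fun a => (f a).edges :=
  PT.fst.comp (PT.snd.comp (PT.dagProblem_tuple.comp hf))

@[fun_prop]
theorem PT.dagProblem_en {f : α → DagProblem L} (hf : PT f) : PT fun a => (f a).en :=
  PT.fst.comp (PT.snd.comp (PT.snd.comp (PT.dagProblem_tuple.comp hf)))

@[fun_prop]
theorem PT.dagProblem_ex {f : α → DagProblem L} (hf : PT f) : PT fun a => (f a).ex :=
  PT.snd.comp (PT.snd.comp (PT.snd.comp (PT.dagProblem_tuple.comp hf)))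

@[fun_prop]
theorem PT.dagProblem_mk {f : α → List (Data × Fml L)} {g : α → List ((Data × Data) × Fml L)}
    {h k : α → Data} (hf : PT f) (hg : PT g) (hh : PT h) (hk : PT k) :
    PT fun a => DagProblem.mk (f a) (g a) (h a) (k a) :=
  PT.of_enc_comp ((hf.prodMk (hg.prodMk (hh.prodMk hk))).enc_comp) fun _ => rfl

theorem PT.dagProblem_toFlat : PT (DagProblem.toFlat : DagProblem L → Flat L) := by
  unfold DagProblem.toFlat DagProblem.args DagProblem.labelV DagProblem.V
  fun_prop

theorem dag_reduces_flat {S : Set (Interp.{u, v, w} L)} (hS : S.Nonempty)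
    {Con : ConstraintLanguage L} :
    PolyReduces (dagInterpolation Coding.coding S Con)
      (flatSolving S Con fun F => F.Acyclic ∧ F.Linear) := by
  let g : DagProblem L → List (Data × Fml L) → List (Data × Fml L) := fun P J =>
    P.V.map fun v => (v, if v = P.en then ⊤ else if v = P.ex then ⊥ else table J v)
  have hg : PT fun a : DagProblem L × List (Data × Fml L) => g a.1 a.2 := by
    simp only [g, DagProblem.V]
    fun_prop
  unfold dagInterpolation flatSolving
  refine PolyReduces.intro DagProblem.toFlat g (PT.dagProblem_toFlat.comp PT.subtype_val)
    (hg.comp PT.subtype_val) ?_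
  rintro P ⟨⟨hV, hE, hEV, hen, hex, hac, -⟩, hconV, hconE⟩
  refine ⟨⟨⟨fun c hc => ?_, fun c hc p hp => ?_, fun p => ?_⟩, ?_, ?_⟩, ?_, ?_⟩
  · rcases (DagProblem.mem_toFlat hE).1 hc with ⟨v, w, he, rfl⟩ | ⟨v, w, he, rfl⟩ | rfl | rfl
    · exact ConstraintLanguage.inf_mem (hconV v (hEV _ _ he).1) (hconE v w he)
    · exact ConstraintLanguage.inf_mem
        (ConstraintLanguage.inf_mem (hconV v (hEV _ _ he).1) (hconE v w he))
        (ConstraintLanguage.not_mem (hconV w (hEV _ _ he).2))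
    all_goals exact ConstraintLanguage.top_mem
  · rw [DagProblem.keys_toFlat]
    rcases (DagProblem.mem_toFlat hE).1 hc with ⟨v, w, he, rfl⟩ | ⟨v, w, he, rfl⟩ | rfl | rfl
    · simp only [FClause.occ, Option.toList_some, List.mem_append, List.mem_singleton] at hp
      rcases hp with rfl | rfl
      · exact (hEV _ _ he).1
      · exact (hEV _ _ he).2
    · obtain rfl : p = v := by simpa [FClause.occ] using hp
      exact (hEV _ _ he).1
    · obtain rfl : p = P.en := by simpa [FClause.occ] using hp
      exact hen
    · obtain rfl : p = P.ex := by simpa [FClause.occ] using hp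
      exact hex
  · by_cases hp : p ∈ P.toFlat.keys
    · rw [DagProblem.keys_toFlat] at hp
      rw [P.vars_toFlat hp]; exact dedupD_nodup _
    · rw [Flat.vars_eq_nil hp]; exact List.nodup_nil
  · have : ∀ p q, P.toFlat.Dep p q → Function.swap P.E p q := by
      rintro p q ⟨c, hc, hp, hq⟩
      rcases (DagProblem.mem_toFlat hE).1 hc with ⟨v, w, he, rfl⟩ | ⟨v, w, he, rfl⟩ | rfl | rfl
      · obtain rfl : w = p := by simpa using hp
        obtain rfl : q = v := by simpa using hq
        exact he
      · simp at hp
      · simp at hq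
      · simp at hp
    intro p hp
    exact hac p (Relation.transGen_swap.1 (Relation.TransGen.mono this _ _ hp))
  · intro c hc
    rcases (DagProblem.mem_toFlat hE).1 hc with ⟨v, w, he, rfl⟩ | ⟨v, w, he, rfl⟩ | rfl | rfl <;>
      simp
  · rintro ⟨I, hI⟩
    refine ⟨I, fun p hp => ?_, fun p hp x hx => ?_, fun c hc M hM a h1 h2 => ?_⟩
    · exact hI.mem p (P.keys_toFlat ▸ hp)
    · rw [DagProblem.keys_toFlat] at hp
      rw [P.vars_toFlat hp, DagProblem.mem_args hE]
      exact hI.vars p hp x hx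
    · have key : ∀ v w, P.E v w → M.Sat (table I v) a → M.Sat (P.labelV v) a →
          M.Sat (P.labelE v w) a → M.Sat (table I w) a ∧ M.Sat (P.labelV w) a := by
        intro v w he h1 h2 h3
        have := hI.entails v w he M hM a (by simpa using ⟨⟨h1, h2⟩, h3⟩)
        simpa using this
      rcases (DagProblem.mem_toFlat hE).1 hc with ⟨v, w, he, rfl⟩ | ⟨v, w, he, rfl⟩ | rfl | rfl
      · simp only [sat_inf] at h1
        exact (key v w he (h2 v (by simp)) h1.1 h1.2).1
      · simp only [sat_inf, sat_not] at h1
        exact absurd (key v w he (h2 v (by simp)) h1.1.1 h1.1.2).2 h1.2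
      · show M.Sat (table I P.en) a
        rw [hI.entry]; exact sat_top
      · have := h2 P.ex (by simp)
        rwa [hI.exit] at this
  · intro J hJ
    have h0 : ∀ M ∈ S, ∀ a : Data → M.U, M.Sat (table J P.en) a := fun M hM a =>
      hJ.valid ⟨.nil, ⊤, [], some P.en⟩ ((DagProblem.mem_toFlat hE).2 (by simp)) M hM a sat_top
        (by simp)
    have h1 : ∀ M ∈ S, ∀ a : Data → M.U, ¬ M.Sat (table J P.ex) a := fun M hM a h =>
      hJ.valid ⟨.nil, ⊤, [P.ex], none⟩ ((DagProblem.mem_toFlat hE).2 (by simp)) M hM a sat_top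
        (by simpa using h)
    -- If entry and exit coincided, their formula would be both true and false in a structure of
    -- `S`. Since they differ, they can receive `⊤` and `⊥` literally.
    have hne : P.ex ≠ P.en := by
      intro h
      obtain ⟨M, hM⟩ := hS
      obtain ⟨m⟩ := M.nonempty
      have := h1 M hM fun _ => m
      rw [h] at this
      exact this (h0 M hM _)
    have hg' : ∀ v ∈ P.V, table (g P J) v =
        if v = P.en then ⊤ else if v = P.ex then ⊥ else table J v := fun v hv =>
      table_map (fun v => if v = P.en then ⊤ else if v = P.ex then ⊥ else table J v) hv
    have hsat : ∀ v ∈ P.V, ∀ M ∈ S, ∀ a : Data → M.U,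
        (M.Sat (table (g P J) v) a ↔ M.Sat (table J v) a) := by
      intro v hv M hM a
      rw [hg' v hv]
      split_ifs with e e'
      · subst e; simp [h0 M hM a]
      · subst e'; simp [h1 M hM a]
      · rfl
    refine ⟨fun v hv => ?_, ?_, ?_, fun v w he M hM a h => ?_, fun v hv x hx => ?_⟩
    · rw [hg' v hv]
      split_ifs
      · exact ConstraintLanguage.top_mem
      · exact Con.falsum_mem
      · exact hJ.mem v (P.keys_toFlat ▸ hv)
    · rw [hg' _ hen, if_pos rfl]
    · rw [hg' _ hex, if_neg hne, if_pos rfl]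
    · obtain ⟨hv, hw⟩ := hEV _ _ he
      have h' := h _ rfl
      rw [sat_inf, sat_inf, hsat v hv M hM] at h'
      rw [sat_inf, hsat w hw M hM]
      refine ⟨hJ.valid ⟨.nil, P.labelV v ⊓ P.labelE v w, [v], some w⟩
        ((DagProblem.mem_toFlat hE).2 (Or.inl ⟨v, w, he, rfl⟩)) M hM a
        (sat_inf.2 ⟨h'.1.2, h'.2⟩) (by simpa using h'.1.1), ?_⟩
      -- If the label of `w` failed, the clause with its negation would derive a contradiction.
      by_contra hn
      exact hJ.valid ⟨.nil, P.labelV v ⊓ P.labelE v w ⊓ (P.labelV w).not, [v], none⟩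
        ((DagProblem.mem_toFlat hE).2 (Or.inr (Or.inl ⟨v, w, he, rfl⟩))) M hM a
        (sat_inf.2 ⟨sat_inf.2 ⟨h'.1.2, h'.2⟩, sat_not.2 hn⟩) (by simpa using h'.1.1)
    · rw [hg' v hv] at hx
      split_ifs at hx
      · simp at hx
      · simp at hx
      · have := hJ.vars v (P.keys_toFlat ▸ hv) x hx
        rwa [P.vars_toFlat hv, DagProblem.mem_args hE] at this

end Dag

/-! ### And/or-trees as data -/

section AndOr
variable {L : FirstOrder.Language.{u, v}}

namespace AndOr

def isLeaf : AndOr L → Bool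
  | leaf _ _ => true
  | _ => false

def isAnd : AndOr L → Bool
  | and _ _ _ => true
  | _ => false

def left : AndOr L → AndOr L
  | leaf m φ => leaf m φ
  | and _ s _ => s
  | or _ s _ => s

def right : AndOr L → AndOr L
  | leaf m φ => leaf m φ
  | and _ _ t => t
  | or _ _ t => t

def leafFml : AndOr L → Option (Fml L)
  | leaf _ φ => some φ
  | _ => none

/-- The positions below a given one, with their subformulae. -/
def pos (p : Data) : AndOr L → List (Data × AndOr L)
  | leaf m φ => [(p, leaf m φ)]
  | and m s t => (p, and m s t) :: (pos (.cons .nil p) s ++ pos (.cons (.cons .nil .nil) p) t)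
  | or m s t => (p, or m s t) :: (pos (.cons .nil p) s ++ pos (.cons (.cons .nil .nil) p) t)

theorem map_snd_pos (p : Data) (t : AndOr L) : (t.pos p).map Prod.snd = t.subs := by
  induction t generalizing p with
  | leaf => rfl
  | and m s t h1 h2 => simp [pos, subs, h1, h2]
  | or m s t h1 h2 => simp [pos, subs, h1, h2]

theorem leaves_eq (t : AndOr L) : t.leaves = t.subs.flatMap fun s => s.leafFml.toList := by
  induction t with
  | leaf => rfl
  | and m s t h1 h2 => simp [leaves, subs, h1, h2, leafFml]
  | or m s t h1 h2 => simp [leaves, subs, h1, h2, leafFml]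

theorem mem_pos_self (p : Data) (t : AndOr L) : (p, t) ∈ t.pos p := by
  cases t <;> simp [pos]

theorem mem_subs_self (t : AndOr L) : t ∈ t.subs := by
  cases t <;> simp [subs]

theorem mem_pos_children {p q : Data} {t u : AndOr L} (h : (q, u) ∈ t.pos p) (hu : u.isLeaf = false) :
    (.cons .nil q, u.left) ∈ t.pos p ∧ (.cons (.cons .nil .nil) q, u.right) ∈ t.pos p := by
  induction t generalizing p with
  | leaf m φ =>
    obtain ⟨rfl, rfl⟩ : q = p ∧ u = leaf m φ := by simpa [pos] using h
    simp [isLeaf] at hu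
  | and m s t h1 h2 =>
    simp only [pos, List.mem_cons, List.mem_append, Prod.mk.injEq] at h ⊢
    rcases h with ⟨rfl, rfl⟩ | h | h
    · simp [left, right, mem_pos_self]
    · have := h1 h; tauto
    · have := h2 h; tauto
  | or m s t h1 h2 =>
    simp only [pos, List.mem_cons, List.mem_append, Prod.mk.injEq] at h ⊢
    rcases h with ⟨rfl, rfl⟩ | h | h
    · simp [left, right, mem_pos_self]
    · have := h1 h; tauto
    · have := h2 h; tauto

/-- Extension of a position. -/
inductive Extends (p : Data) : Data → Prop
  | refl : Extends p p
  | cons (d q) : Extends p q → Extends p (.cons d q)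

theorem Extends.size_le {p q : Data} (h : Extends p q) : p.size ≤ q.size := by
  induction h with
  | refl => exact le_rfl
  | cons d q _ ih => simp only [Data.size]; omega

theorem Extends.trans {p q r : Data} (h : Extends p q) (h' : Extends q r) : Extends p r := by
  induction h' with
  | refl => exact h
  | cons d _ _ ih => exact .cons d _ ih

/-- A position is an outermost-last list of directions. Two extensions of `p` by one direction with
a common extension must agree, as one can see by removing directions from that extension. -/
theorem Extends.eq_of_cons {p q d d' : Data} (h : Extends (.cons d p) q) (h' : Extends (.cons d' p) q) :
    d = d' := by
  induction h with
  | refl =>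
    cases h' with
    | refl => rfl
    | cons _ _ h' => have := h'.size_le; simp only [Data.size] at this; omega
  | cons e q h ih =>
    cases h' with
    | refl => have := h.size_le; simp only [Data.size] at this; omega
    | cons _ _ h' => exact ih h'

theorem extends_of_mem_pos {p q : Data} {t u : AndOr L} (h : (q, u) ∈ t.pos p) : Extends p q := by
  induction t generalizing p with
  | leaf m φ =>
    obtain ⟨rfl, rfl⟩ : q = p ∧ u = leaf m φ := by simpa [pos] using h
    exact .refl
  | and m s t h1 h2 =>
    simp only [pos, List.mem_cons, List.mem_append, Prod.mk.injEq] at h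
    rcases h with ⟨rfl, rfl⟩ | h | h
    · exact .refl
    · exact (Extends.cons _ _ .refl).trans (h1 h)
    · exact (Extends.cons _ _ .refl).trans (h2 h)
  | or m s t h1 h2 =>
    simp only [pos, List.mem_cons, List.mem_append, Prod.mk.injEq] at h
    rcases h with ⟨rfl, rfl⟩ | h | h
    · exact .refl
    · exact (Extends.cons _ _ .refl).trans (h1 h)
    · exact (Extends.cons _ _ .refl).trans (h2 h)

/-- Positions in the two subtrees extend `p` by different first directions, and all of them properly
extend `p`. -/
theorem pos_nodup (p : Data) (t : AndOr L) : ((t.pos p).map Prod.fst).Nodup := by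
  have key : ∀ p (s t : AndOr L), ((s.pos (.cons .nil p)).map Prod.fst).Nodup →
      ((t.pos (.cons (.cons .nil .nil) p)).map Prod.fst).Nodup →
      (p :: ((s.pos (.cons .nil p)).map Prod.fst ++
        (t.pos (.cons (.cons .nil .nil) p)).map Prod.fst)).Nodup := by
    intro p s t h1 h2
    have hs : ∀ (d : Data) (t : AndOr L), ∀ q ∈ (t.pos (.cons d p)).map Prod.fst,
        Extends (.cons d p) q := by
      intro d t q hq
      obtain ⟨⟨q, u⟩, hq', rfl⟩ := List.mem_map.1 hq
      exact extends_of_mem_pos hq'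
    have hn : ∀ d : Data, ¬ Extends (.cons d p) p := fun d h => by
      have := h.size_le; simp only [Data.size] at this; omega
    rw [List.nodup_cons, List.mem_append, List.nodup_append']
    refine ⟨?_, h1, h2, fun q hq hq' => ?_⟩
    · rintro (h | h)
      · exact hn _ (hs _ _ _ h)
      · exact hn _ (hs _ _ _ h)
    · simpa using (hs _ _ _ hq).eq_of_cons (hs _ _ _ hq')
  induction t generalizing p with
  | leaf => simp [pos]
  | and m s t h1 h2 => simpa [pos] using key p s t (h1 _) (h2 _)
  | or m s t h1 h2 => simpa [pos] using key p s t (h1 _) (h2 _)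

theorem length_pos (p : Data) (t : AndOr L) : (t.pos p).length = t.subs.length := by
  rw [← map_snd_pos p, List.length_map]

end AndOr

variable [Coding L] {α : Type*} [Enc α]

instance : Enc (AndOr L) := ⟨AndOr.enc Coding.coding⟩

theorem encMark_eq (m : Option Data) : AndOr.encMark m = enc m := by cases m <;> rfl

theorem enc_leaf (m : Option Data) (φ : Fml L) :
    enc (AndOr.leaf m φ) = .cons .nil (.cons (enc m) (enc φ)) := by rw [← encMark_eq]; rfl

theorem enc_and (m : Option Data) (s t : AndOr L) :
    enc (AndOr.and m s t) = .cons (.ofNat 1) (.cons (enc m) (.cons (enc s) (enc t))) := by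
  rw [← encMark_eq]; rfl

theorem enc_or (m : Option Data) (s t : AndOr L) :
    enc (AndOr.or m s t) = .cons (.ofNat 2) (.cons (enc m) (.cons (enc s) (enc t))) := by
  rw [← encMark_eq]; rfl

theorem esize_leaf (m : Option Data) (φ : Fml L) :
    esize (AndOr.leaf m φ) = esize m + esize φ + 3 := by
  unfold esize; rw [enc_leaf]; simp only [Data.size]; omega

theorem esize_and (m : Option Data) (s t : AndOr L) :
    esize (AndOr.and m s t) = esize m + esize s + esize t + 6 := by
  unfold esize; rw [enc_and]; simp only [Data.size, Data.ofNat]; omega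

theorem esize_or (m : Option Data) (s t : AndOr L) :
    esize (AndOr.or m s t) = esize m + esize s + esize t + 8 := by
  unfold esize; rw [enc_or]; simp only [Data.size, Data.ofNat]; omega

@[fun_prop]
theorem PT.andOr_leaf {m : α → Option Data} {φ : α → Fml L} (hm : PT m) (hφ : PT φ) :
    PT fun a => AndOr.leaf (m a) (φ a) :=
  PT.of_enc_comp (PT.data_cons (PT.const Data.nil) (PT.data_cons hm.enc_comp hφ.enc_comp)) fun _ =>
    enc_leaf _ _

@[fun_prop]
theorem PT.andOr_and {m : α → Option Data} {s t : α → AndOr L} (hm : PT m) (hs : PT s) (ht : PT t) :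
    PT fun a => AndOr.and (m a) (s a) (t a) :=
  PT.of_enc_comp (PT.data_cons (PT.const (.ofNat 1)) (PT.data_cons hm.enc_comp
    (PT.data_cons hs.enc_comp ht.enc_comp))) fun _ => enc_and _ _ _

@[fun_prop]
theorem PT.andOr_or {m : α → Option Data} {s t : α → AndOr L} (hm : PT m) (hs : PT s) (ht : PT t) :
    PT fun a => AndOr.or (m a) (s a) (t a) :=
  PT.of_enc_comp (PT.data_cons (PT.const (.ofNat 2)) (PT.data_cons hm.enc_comp
    (PT.data_cons hs.enc_comp ht.enc_comp))) fun _ => enc_or _ _ _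

@[fun_prop]
theorem PT.andOr_isLeaf {t : α → AndOr L} (ht : PT t) : PT fun a => (t a).isLeaf := by
  have : ∀ a, (t a).isLeaf = decide ((enc (t a)).head = .nil) := fun a => by
    cases t a
    · rw [enc_leaf]; rfl
    · rw [enc_and]; rfl
    · rw [enc_or]; rfl
  simp only [this]
  exact PT.data_eq (PT.data_head ht.enc_comp) (PT.const _)

@[fun_prop]
theorem PT.andOr_isAnd {t : α → AndOr L} (ht : PT t) : PT fun a => (t a).isAnd := by
  have : ∀ a, (t a).isAnd = decide ((enc (t a)).head = .ofNat 1) := fun a => by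
    cases t a
    · rw [enc_leaf]; rfl
    · rw [enc_and]; rfl
    · rw [enc_or]; rfl
  simp only [this]
  exact PT.data_eq (PT.data_head ht.enc_comp) (PT.const _)

@[fun_prop]
theorem PT.andOr_mark {t : α → AndOr L} (ht : PT t) : PT fun a => (t a).mark := by
  refine PT.of_enc_comp (PT.data_head (PT.data_tail ht.enc_comp)) fun a => ?_
  cases t a
  · rw [enc_leaf]; rfl
  · rw [enc_and]; rfl
  · rw [enc_or]; rfl

@[fun_prop]
theorem PT.andOr_left {t : α → AndOr L} (ht : PT t) : PT fun a => (t a).left := by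
  refine PT.of_enc_comp (F := fun a => if (t a).isLeaf = true then enc (t a) else
    (enc (t a)).tail.tail.head) ?_ fun a => ?_
  · have := ht.enc_comp
    fun_prop
  · cases t a
    · rfl
    · rw [enc_and]; rfl
    · rw [enc_or]; rfl

@[fun_prop]
theorem PT.andOr_right {t : α → AndOr L} (ht : PT t) : PT fun a => (t a).right := by
  refine PT.of_enc_comp (F := fun a => if (t a).isLeaf = true then enc (t a) else
    (enc (t a)).tail.tail.tail) ?_ fun a => ?_
  · have := ht.enc_comp
    fun_prop
  · cases t a
    · rfl
    · rw [enc_and]; rfl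
    · rw [enc_or]; rfl

@[fun_prop]
theorem PT.andOr_leafFml {t : α → AndOr L} (ht : PT t) : PT fun a => (t a).leafFml := by
  refine PT.of_enc_comp (F := fun a => if (t a).isLeaf = true then
    .cons (enc (t a)).tail.tail .nil else .nil) ?_ fun a => ?_
  · have := ht.enc_comp
    fun_prop
  · cases t a
    · rw [enc_leaf]; rfl
    · rfl
    · rfl

theorem esize_left_right {t : AndOr L} (h : t.isLeaf = false) :
    esize t.left + esize t.right + 6 ≤ esize t := by
  cases t with
  | leaf => simp [AndOr.isLeaf] at h
  | and m s t => rw [esize_and]; simp only [AndOr.left, AndOr.right]; omega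
  | or m s t => rw [esize_or]; simp only [AndOr.left, AndOr.right]; omega

omit [Coding L] in
theorem AndOr.pos_of_isLeaf {p : Data} {t : AndOr L} (h : t.isLeaf = true) : t.pos p = [(p, t)] := by
  cases t <;> first | rfl | simp [isLeaf] at h

omit [Coding L] in
theorem AndOr.pos_of_not_isLeaf {p : Data} {t : AndOr L} (h : t.isLeaf = false) : t.pos p =
    (p, t) :: (t.left.pos (.cons .nil p) ++ t.right.pos (.cons (.cons .nil .nil) p)) := by
  cases t <;> first | rfl | simp [isLeaf] at h

theorem AndOr.length_subs (t : AndOr L) : t.subs.length ≤ esize t := by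
  induction t with
  | leaf => simp only [subs, List.length_singleton]; exact esize_pos _
  | and m s t h1 h2 => simp only [subs, List.length_cons, List.length_append, esize_and]; omega
  | or m s t h1 h2 => simp only [subs, List.length_cons, List.length_append, esize_or]; omega

/-- One step down lengthens the position by 2 or 4 but shrinks the subtree by at least 6, so the sum
never grows. -/
theorem esize_pos_mem {p : Data} {t : AndOr L} {e : Data × AndOr L} (h : e ∈ t.pos p) :
    esize e.1 + esize e.2 ≤ esize p + esize t := by
  have key : ∀ n p (t : AndOr L), esize t ≤ n → ∀ e ∈ t.pos p,
      esize e.1 + esize e.2 ≤ esize p + esize t := by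
    intro n
    induction n with
    | zero => intro p t h; have := esize_pos t; omega
    | succ n ih =>
      intro p t h e he
      cases hl : t.isLeaf with
      | true =>
        rw [AndOr.pos_of_isLeaf hl, List.mem_singleton] at he
        rw [he]
      | false =>
        have h1 := esize_left_right hl
        have hp : ∀ d : Data, esize (Data.cons d p) = esize d + esize p + 1 := fun _ => rfl
        have hn : esize Data.nil = 1 := rfl
        rw [AndOr.pos_of_not_isLeaf hl, List.mem_cons, List.mem_append] at he
        rcases he with rfl | he | he
        · exact le_rfl
        · have := ih _ _ (by omega) e he
          rw [hp] at this; omega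
        · have := ih _ _ (by omega) e he
          rw [hp] at this
          have : esize (Data.cons .nil .nil) = 3 := rfl
          omega
  exact key _ p t le_rfl e h

-- The size of the subtree serves as measure, and the sum of the sizes of position and subtree as
-- invariant. There are linearly many positions of linear size, so the table is quadratic.
@[fun_prop]
theorem PT.andOr_pos {p : α → Data} {t : α → AndOr L} (hp : PT p) (ht : PT t) :
    PT fun a => (t a).pos (p a) := by
  have hB := (hp.pb_esize.add ht.pb_esize)
  refine PT.binrec (X := Data × AndOr L) (F := fun x => x.2.pos x.1) (halt := fun x => x.2.isLeaf)
    (leaf := fun x => [x.1]) (l := fun x => (.cons .nil x.1.1, x.1.2.left))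
    (r := fun x => (.cons (.cons .nil .nil) x.1.1, x.1.2.right))
    (comb := fun y => y.1.1 :: (y.2.1 ++ y.2.2)) (init := fun a => (p a, t a))
    (by fun_prop) ?_ ?_ ?_ ?_ (fun x => AndOr.pos_of_isLeaf x.2)
    (fun x => AndOr.pos_of_not_isLeaf x.2) (fun x => esize x.2) (fun x => esize_pos _)
    (fun x => by have := esize_left_right x.2; dsimp only; omega) (by fun_prop)
    (fun a x => esize x.1 + esize x.2 ≤ esize (p a) + esize (t a)) (fun a => le_rfl) ?_ ?_
    (fun a => (esize (p a) + esize (t a)) * (esize (p a) + esize (t a) + 2) + 2)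
    ((hB.mul (hB.add (PB.const 2))).add (PB.const 2)) ?_ ht.pb_esize
  · have h := PT.subtype_val (p := fun x : Data × AndOr L => x.2.isLeaf = true)
    fun_prop
  · have h := PT.subtype_val (p := fun x : Data × AndOr L => x.2.isLeaf = false)
    fun_prop
  · have h := PT.subtype_val (p := fun x : Data × AndOr L => x.2.isLeaf = false)
    fun_prop
  · have h := PT.subtype_val (p := fun x : Data × AndOr L => x.2.isLeaf = false)
    fun_prop
  · intro a x hx
    have := esize_left_right x.2
    have h1 : esize (Data.cons .nil x.1.1) = 1 + esize x.1.1 + 1 := rfl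
    dsimp only
    omega
  · intro a x hx
    have := esize_left_right x.2
    have h1 : esize (Data.cons (.cons .nil .nil) x.1.1) = 3 + esize x.1.1 + 1 := rfl
    dsimp only
    omega
  · intro a x hx
    set N := esize (p a) + esize (t a)
    have h1 : esize (x.2.pos x.1) ≤ (x.2.pos x.1).length * (N + 2) + 1 :=
      esize_list_le fun e he => by
      have := esize_pos_mem he
      have h2 : esize e = esize e.1 + esize e.2 + 1 := rfl
      omega
    have h3 := x.2.length_subs
    rw [AndOr.length_pos] at h1
    have h4 := Nat.mul_le_mul_right (N + 2) (show x.2.subs.length ≤ N by omega)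
    have h5 : esize x = esize x.1 + esize x.2 + 1 := rfl
    constructor
    · nlinarith
    · exact h1.trans (by omega)

@[fun_prop]
theorem PT.andOr_subs {t : α → AndOr L} (ht : PT t) : PT fun a => (t a).subs := by
  simp only [← AndOr.map_snd_pos .nil]
  fun_prop

@[fun_prop]
theorem PT.andOr_leaves {t : α → AndOr L} (ht : PT t) : PT fun a => (t a).leaves := by
  simp only [AndOr.leaves_eq]
  fun_prop

/-- The leaf `true` may be larger than the subformula that it replaces, whence the constant factor.
-/
theorem esize_cut (p : Data) (t : AndOr L) :
    esize (t.cut p) ≤ esize (AndOr.leaf none ⊤ : AndOr L) * esize t := by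
  have h0 : 1 ≤ esize (AndOr.leaf none ⊤ : AndOr L) := esize_pos _
  set K := esize (AndOr.leaf none ⊤ : AndOr L) with hK
  have hb : ∀ t : AndOr L, K ≤ K * esize t := fun t => Nat.le_mul_of_pos_right _ (esize_pos t)
  have hm : ∀ n, n ≤ K * n := fun n => Nat.le_mul_of_pos_left _ h0
  induction t with
  | leaf m φ =>
    rw [AndOr.cut]
    split_ifs
    · exact hb _
    · exact hm _
  | and m s t h1 h2 =>
    rw [AndOr.cut]
    split_ifs
    · exact hb _
    · rw [esize_and, esize_and]
      have := hm (esize m); have := hm 6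
      rw [Nat.mul_add, Nat.mul_add, Nat.mul_add]; omega
  | or m s t h1 h2 =>
    rw [AndOr.cut]
    split_ifs
    · exact hb _
    · rw [esize_or, esize_or]
      have := hm (esize m); have := hm 8
      rw [Nat.mul_add, Nat.mul_add, Nat.mul_add]; omega

@[fun_prop]
theorem PT.decide_mark_eq {m : α → Option Data} {p : α → Data} (hm : PT m) (hp : PT p) :
    PT fun a => decide (m a = .some (p a)) := by
  have : ∀ a, decide (m a = .some (p a)) = (m a).elim false fun x => decide (x = p a) := fun a => by
    cases m a <;> simp
  simp only [this]
  fun_prop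

omit [Coding L] in
theorem AndOr.cut_of_stop {q : Data} {t : AndOr L}
    (h : (t.isLeaf || decide (t.mark = .some q)) = true) :
    t.cut q = if t.mark = .some q then .leaf none ⊤ else t := by
  cases t with
  | leaf m φ => rfl
  | and m s t =>
    have h : m = .some q := of_decide_eq_true h
    exact (if_pos h).trans (if_pos h).symm
  | or m s t =>
    have h : m = .some q := of_decide_eq_true h
    exact (if_pos h).trans (if_pos h).symm

omit [Coding L] in
theorem AndOr.cut_of_not_stop {q : Data} {t : AndOr L}
    (h : (t.isLeaf || decide (t.mark = .some q)) = false) :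
    t.cut q = if t.isAnd = true then .and t.mark (t.left.cut q) (t.right.cut q) else
      .or t.mark (t.left.cut q) (t.right.cut q) := by
  cases t with
  | leaf m φ => simp [isLeaf] at h
  | and m s t =>
    have h : m ≠ .some q := of_decide_eq_false h
    exact if_neg h
  | or m s t =>
    have h : m ≠ .some q := of_decide_eq_false h
    exact if_neg h

@[fun_prop]
theorem PT.andOr_cut {p : α → Data} {t : α → AndOr L} (hp : PT p) (ht : PT t) :
    PT fun a => (t a).cut (p a) := by
  have hv := fun b => PT.subtype_val
    (p := fun x : Data × AndOr L => (x.2.isLeaf || decide (x.2.mark = .some x.1)) = b)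
  have hB := (hp.pb_esize.add ht.pb_esize)
  refine PT.binrec (X := Data × AndOr L) (F := fun x => x.2.cut x.1)
    (halt := fun x => x.2.isLeaf || decide (x.2.mark = .some x.1))
    (leaf := fun x => if x.1.2.mark = .some x.1.1 then .leaf none ⊤ else x.1.2)
    (l := fun x => (x.1.1, x.1.2.left)) (r := fun x => (x.1.1, x.1.2.right))
    (comb := fun y => if y.1.1.2.isAnd = true then .and y.1.1.2.mark y.2.1 y.2.2 else
      .or y.1.1.2.mark y.2.1 y.2.2) (init := fun a => (p a, t a))
    (by fun_prop) ?_ ?_ ?_ ?_ ?_ ?_ (fun x => esize x.2) (fun x => esize_pos _) ?_ (by fun_prop)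
    (fun a x => esize x.1 + esize x.2 ≤ esize (p a) + esize (t a)) (fun a => le_rfl) ?_ ?_
    (fun a => (esize (AndOr.leaf none ⊤ : AndOr L) + 2) * (esize (p a) + esize (t a)))
    ((PB.const _).mul hB) ?_ ht.pb_esize
  · have := hv true; fun_prop
  · have := hv false; fun_prop
  · have := hv false; fun_prop
  · have := hv false; fun_prop
  · exact fun x => AndOr.cut_of_stop x.2
  · exact fun x => AndOr.cut_of_not_stop x.2
  · rintro ⟨x, h⟩
    simp only [Bool.or_eq_false_iff] at h
    have := esize_left_right h.1
    dsimp only; omega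
  · rintro a ⟨x, h⟩ hx
    simp only [Bool.or_eq_false_iff] at h
    have := esize_left_right h.1
    dsimp only at hx ⊢; omega
  · rintro a ⟨x, h⟩ hx
    simp only [Bool.or_eq_false_iff] at h
    have := esize_left_right h.1
    dsimp only at hx ⊢; omega
  · intro a x hx
    have h1 := esize_cut x.1 x.2
    have h5 : esize x = esize x.1 + esize x.2 + 1 := rfl
    have h6 := esize_pos x.2
    have h7 := Nat.mul_le_mul_left (esize (AndOr.leaf none ⊤ : AndOr L))
      (show esize x.2 ≤ esize (p a) + esize (t a) by omega)
    rw [Nat.add_mul]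
    constructor <;> omega

end AndOr

/-! ### Disjunctive interpolation to flat clauses -/

section Disjunctive
variable {L : FirstOrder.Language.{u, v}}

namespace AndOr

abbrev leftPos (p : Data) : Data := .cons .nil p
abbrev rightPos (p : Data) : Data := .cons (.cons .nil .nil) p

/-- Every position is a symbol. A conjunction is one clause with two body symbols, a disjunction is
two clauses with the same head; the latter is why heads need not be disjoint in this fragment. -/
def clausesAt (p : Data) (t : AndOr L) : List (FClause L) :=
  t.leafFml.elim (if t.isAnd = true then [⟨.nil, ⊤, [leftPos p, rightPos p], some p⟩] else
    [⟨.nil, ⊤, [leftPos p], some p⟩, ⟨.nil, ⊤, [rightPos p], some p⟩])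
    fun φ => [⟨.nil, φ, [], some p⟩]

theorem mem_clausesAt {p : Data} {t : AndOr L} {c : FClause L} (h : c ∈ t.clausesAt p) :
    c.head = some p ∧ (∀ q ∈ c.body, t.isLeaf = false ∧ (q = leftPos p ∨ q = rightPos p)) ∧
      (c.con = ⊤ ∨ c.con ∈ t.leaves) := by
  cases t with
  | leaf m φ =>
    obtain rfl : c = _ := by simpa [clausesAt, leafFml] using h
    simp [leaves]
  | and m s t =>
    obtain rfl : c = _ := by simpa [clausesAt, leafFml, isAnd] using h
    simp [isLeaf]
  | or m s t =>
    obtain rfl | rfl : c = _ ∨ c = _ := by simpa [clausesAt, leafFml, isAnd] using h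
    all_goals simp [isLeaf]

theorem flatMap_body_clausesAt (p : Data) (t : AndOr L) : (t.clausesAt p).flatMap FClause.body =
    if t.isLeaf = true then [] else [leftPos p, rightPos p] := by
  cases t <;> simp [clausesAt, leafFml, isAnd, isLeaf]

theorem leaves_subset {s t : AndOr L} (h : s ∈ t.subs) {φ : Fml L} (hφ : φ ∈ s.leaves) :
    φ ∈ t.leaves := by
  induction t with
  | leaf m ψ =>
    obtain rfl : s = _ := by simpa [subs] using h
    exact hφ
  | and m t u h1 h2 =>
    simp only [subs, List.mem_cons, List.mem_append] at h
    rcases h with rfl | h | h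
    · exact hφ
    · exact List.mem_append_left _ (h1 h)
    · exact List.mem_append_right _ (h2 h)
  | or m t u h1 h2 =>
    simp only [subs, List.mem_cons, List.mem_append] at h
    rcases h with rfl | h | h
    · exact hφ
    · exact List.mem_append_left _ (h1 h)
    · exact List.mem_append_right _ (h2 h)

theorem subs_trans {r s t : AndOr L} (h : s ∈ t.subs) (hr : r ∈ s.subs) : r ∈ t.subs := by
  induction t with
  | leaf m ψ =>
    obtain rfl : s = _ := by simpa [subs] using h
    exact hr
  | and m t u h1 h2 =>
    simp only [subs, List.mem_cons, List.mem_append] at h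
    rcases h with rfl | h | h
    · exact hr
    · exact List.mem_cons_of_mem _ (List.mem_append_left _ (h1 h))
    · exact List.mem_cons_of_mem _ (List.mem_append_right _ (h2 h))
  | or m t u h1 h2 =>
    simp only [subs, List.mem_cons, List.mem_append] at h
    rcases h with rfl | h | h
    · exact hr
    · exact List.mem_cons_of_mem _ (List.mem_append_left _ (h1 h))
    · exact List.mem_cons_of_mem _ (List.mem_append_right _ (h2 h))

theorem mem_subs_of_mem_pos {p q : Data} {s t : AndOr L} (h : (q, s) ∈ t.pos p) : s ∈ t.subs := by
  rw [← map_snd_pos p]; exact List.mem_map.2 ⟨_, h, rfl⟩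

theorem exists_mem_pos {p : Data} {s t : AndOr L} (h : s ∈ t.subs) : ∃ q, (q, s) ∈ t.pos p := by
  rw [← map_snd_pos p] at h
  obtain ⟨⟨q, s⟩, h', rfl⟩ := List.mem_map.1 h
  exact ⟨q, h'⟩

theorem plug_of_mark {I : Data → Fml L} {t : AndOr L} {m : Data} (h : t.mark = some m) :
    t.plug I = I m := by
  cases t <;> simp_all [mark, plug]

theorem plug_of_not_mark {I : Data → Fml L} {t : AndOr L} (h : t.mark = none) :
    t.plug I = t.plugBelow I := by
  cases t <;> simp_all [mark, plug, plugBelow]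

theorem plug_mem {Con : ConstraintLanguage L} {I : Data → Fml L} {t : AndOr L}
    (hI : ∀ p ∈ t.marks, I p ∈ Con.carrier) (ht : ∀ ψ ∈ t.leaves, ψ ∈ Con.carrier) :
    t.plug I ∈ Con.carrier := by
  cases hm : t.mark with
  | some m =>
    rw [plug_of_mark hm]
    exact hI m (List.mem_filterMap.2 ⟨t, mem_subs_self t, hm⟩)
  | none =>
    rw [plug_of_not_mark hm]
    clear hm
    have key : ∀ s u : AndOr L, (∀ r, r ∈ s.subs ∨ r ∈ u.subs → r ∈ t.subs) →
        (∀ p ∈ s.marks, I p ∈ Con.carrier) ∧ ∀ p ∈ u.marks, I p ∈ Con.carrier := by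
      intro s u h
      constructor <;> intro p hp <;> obtain ⟨r, hr, hrp⟩ := List.mem_filterMap.1 hp
      · exact hI p (List.mem_filterMap.2 ⟨r, h r (Or.inl hr), hrp⟩)
      · exact hI p (List.mem_filterMap.2 ⟨r, h r (Or.inr hr), hrp⟩)
    cases t with
    | leaf m φ => exact ht φ (by simp [leaves])
    | and m s u =>
      obtain ⟨h1, h2⟩ := key s u fun r hr => by simp only [subs, List.mem_cons, List.mem_append]; tauto
      exact ConstraintLanguage.inf_mem (plug_mem h1 fun ψ h => ht ψ (by simp [leaves, h]))
        (plug_mem h2 fun ψ h => ht ψ (by simp [leaves, h]))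
    | or m s u =>
      obtain ⟨h1, h2⟩ := key s u fun r hr => by simp only [subs, List.mem_cons, List.mem_append]; tauto
      exact ConstraintLanguage.sup_mem (plug_mem h1 fun ψ h => ht ψ (by simp [leaves, h]))
        (plug_mem h2 fun ψ h => ht ψ (by simp [leaves, h]))
termination_by t

/-- Labels only use variables of the subformulae that they replace, so replacing adds no variables.
-/
theorem fv_plug {I : Data → Fml L} {t : AndOr L}
    (hI : ∀ s ∈ t.subs, ∀ p, s.mark = some p → fv (I p) ⊆ s.vars) : fv (t.plug I) ⊆ t.vars := by
  cases hm : t.mark with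
  | some m =>
    rw [plug_of_mark hm]
    exact hI t (mem_subs_self t) m hm
  | none =>
    rw [plug_of_not_mark hm]
    clear hm
    cases t with
    | leaf m φ => exact fun x hx => ⟨φ, by simp [leaves], hx⟩
    | and m s u =>
      intro x hx
      rw [plugBelow, fv_inf] at hx
      rcases hx with hx | hx
      · obtain ⟨φ, h1, h2⟩ := fv_plug (fun r hr => hI r (by simp [subs, hr])) hx
        exact ⟨φ, by simp [leaves, h1], h2⟩
      · obtain ⟨φ, h1, h2⟩ := fv_plug (fun r hr => hI r (by simp [subs, hr])) hx
        exact ⟨φ, by simp [leaves, h1], h2⟩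
    | or m s u =>
      intro x hx
      rw [plugBelow, fv_sup] at hx
      rcases hx with hx | hx
      · obtain ⟨φ, h1, h2⟩ := fv_plug (fun r hr => hI r (by simp [subs, hr])) hx
        exact ⟨φ, by simp [leaves, h1], h2⟩
      · obtain ⟨φ, h1, h2⟩ := fv_plug (fun r hr => hI r (by simp [subs, hr])) hx
        exact ⟨φ, by simp [leaves, h1], h2⟩
termination_by t

variable [Coding L]

def varsList (t : AndOr L) : List Data := t.leaves.flatMap varList

theorem mem_varsList {t : AndOr L} {x : Data} : x ∈ t.varsList ↔ x ∈ t.vars := by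
  simp [varsList, vars, fvs]

/-- The variables allowed in a formula in place of the subformula `s` of `φ`. -/
def args (φ s : AndOr L) : List Data :=
  s.mark.elim (dedupD s.varsList) fun m =>
    dedupD (s.varsList.filter fun x => decide (x ∈ (φ.cut m).varsList))

theorem args_nodup (φ s : AndOr L) : (φ.args s).Nodup := by
  unfold args
  cases s.mark <;> exact dedupD_nodup _

theorem mem_args_of_mark {φ s : AndOr L} {m x : Data} (h : s.mark = some m) :
    x ∈ φ.args s ↔ x ∈ s.vars ∩ (φ.cut m).vars := by
  simp [args, h, mem_varsList]

theorem mem_args_of_not_mark {φ s : AndOr L} {x : Data} (h : s.mark = none) :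
    x ∈ φ.args s ↔ x ∈ s.vars := by
  simp [args, h, mem_varsList]

def toFlat (φ : AndOr L) : Flat L :=
  ((φ.pos .nil).flatMap (fun e => e.2.clausesAt e.1) ++ [⟨.nil, ⊤, [.nil], none⟩],
    (φ.pos .nil).map fun e => (e.1, φ.args e.2))

theorem mem_toFlat {φ : AndOr L} {c : FClause L} : c ∈ φ.toFlat.1 ↔
    (∃ p s, (p, s) ∈ φ.pos .nil ∧ c ∈ s.clausesAt p) ∨ c = ⟨.nil, ⊤, [.nil], none⟩ := by
  simp [toFlat]

theorem mem_keys_toFlat {φ : AndOr L} {p : Data} : p ∈ φ.toFlat.keys ↔ ∃ s, (p, s) ∈ φ.pos .nil := by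
  simp [toFlat, Flat.keys]

theorem keys_toFlat_nodup (φ : AndOr L) : φ.toFlat.keys.Nodup := by
  have := φ.pos_nodup .nil
  simpa [toFlat, Flat.keys, Function.comp_def] using this

theorem vars_toFlat {φ : AndOr L} {p : Data} {s : AndOr L} (h : (p, s) ∈ φ.pos .nil) :
    φ.toFlat.vars p = φ.args s :=
  Flat.vars_eq_of_mem φ.keys_toFlat_nodup (List.mem_map.2 ⟨_, h, rfl⟩)

/-- Positions get strictly larger from head to body. -/
theorem toFlat_acyclic (φ : AndOr L) : φ.toFlat.Acyclic := by
  have : ∀ p q, φ.toFlat.Dep p q → p.size < q.size := by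
    rintro p q ⟨c, hc, hp, hq⟩
    rcases mem_toFlat.1 hc with ⟨r, s, -, hcs⟩ | rfl
    · obtain ⟨h1, h2, -⟩ := mem_clausesAt hcs
      obtain rfl : r = p := by rw [h1] at hp; simpa using hp
      rcases (h2 q hq).2 with rfl | rfl <;> simp only [Data.size] <;> omega
    · simp at hp
  intro p hp
  have key : ∀ p q, Relation.TransGen φ.toFlat.Dep p q → p.size < q.size := by
    intro p q h
    induction h with
    | single h => exact this _ _ h
    | tail _ h ih => exact ih.trans (this _ _ h)
  exact lt_irrefl _ (key p p hp)

theorem toFlat_bodyDisjoint (φ : AndOr L) : φ.toFlat.BodyDisjoint := by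
  unfold Flat.BodyDisjoint toFlat
  simp only [List.flatMap_append, List.flatMap_assoc, flatMap_body_clausesAt, List.flatMap_cons,
    List.flatMap_nil, List.append_nil]
  rw [List.nodup_append', List.nodup_flatMap]
  refine ⟨⟨fun e _ => ?_, ?_⟩, by simp, ?_⟩
  · split_ifs <;> simp
  · have := φ.pos_nodup .nil
    rw [List.Nodup, List.pairwise_map] at this
    refine this.imp fun {e e'} hne x hx hx' => ?_
    dsimp only at hx hx'
    split_ifs at hx with h1
    · simp at hx
    · split_ifs at hx' with h2
      · simp at hx'
      · simp only [List.mem_cons, List.not_mem_nil, or_false] at hx hx'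
        rcases hx with rfl | rfl <;> rcases hx' with h | h <;> simp at h <;> exact hne h
  · intro x hx hx'
    obtain ⟨e, -, he⟩ := List.mem_flatMap.1 hx
    obtain rfl := List.mem_singleton.1 hx'
    split_ifs at he <;> simp at he

end AndOr

variable [Coding L] {α : Type*} [Enc α]

theorem PT.andOr_toFlat : PT (AndOr.toFlat : AndOr L → Flat L) := by
  unfold AndOr.toFlat AndOr.args AndOr.clausesAt AndOr.varsList
  fun_prop

/-- There is a symbol for every position, selected or not. The unselected ones carry all variables
of their subformula, so they may take that subformula with its labels plugged in. Conversely,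
restricting a solution to the selected positions gives an interpolant. -/
theorem disjunctive_reduces_flat {S : Set (Interp.{u, v, w} L)} {Con : ConstraintLanguage L} :
    PolyReduces (disjunctiveInterpolation Coding.coding S Con)
      (flatSolving S Con fun F => F.Acyclic ∧ F.BodyDisjoint) := by
  let g : AndOr L → List (Data × Fml L) → List (Data × Fml L) := fun φ J =>
    (φ.pos .nil).flatMap fun e => (e.2.mark.map fun m => (m, table J e.1)).toList
  have hg : PT fun a : AndOr L × List (Data × Fml L) => g a.1 a.2 := by
    simp only [g]
    fun_prop
  unfold disjunctiveInterpolation flatSolving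
  refine PolyReduces.intro AndOr.toFlat g (PT.andOr_toFlat.comp PT.subtype_val)
    (hg.comp PT.subtype_val) ?_
  rintro φ ⟨hnd, hcon⟩
  refine ⟨⟨⟨fun c hc => ?_, fun c hc p hp => ?_, fun p => ?_⟩, φ.toFlat_acyclic,
    φ.toFlat_bodyDisjoint⟩, ?_, ?_⟩
  · rcases AndOr.mem_toFlat.1 hc with ⟨p, s, hs, hcs⟩ | rfl
    · rcases (AndOr.mem_clausesAt hcs).2.2 with h | h
      · rw [h]; exact ConstraintLanguage.top_mem
      · exact hcon _ (AndOr.leaves_subset (AndOr.mem_subs_of_mem_pos hs) h)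
    · exact ConstraintLanguage.top_mem
  · rw [AndOr.mem_keys_toFlat]
    rcases AndOr.mem_toFlat.1 hc with ⟨q, s, hs, hcs⟩ | rfl
    · obtain ⟨h1, h2, -⟩ := AndOr.mem_clausesAt hcs
      simp only [FClause.occ, h1, Option.toList_some, List.mem_append, List.mem_singleton] at hp
      rcases hp with hp | rfl
      · obtain ⟨h3, h4⟩ := h2 p hp
        have := AndOr.mem_pos_children hs h3
        rcases h4 with rfl | rfl
        · exact ⟨_, this.1⟩
        · exact ⟨_, this.2⟩
      · exact ⟨s, hs⟩
    · obtain rfl : p = .nil := by simpa [FClause.occ] using hp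
      exact ⟨φ, AndOr.mem_pos_self _ _⟩
  · by_cases hp : p ∈ φ.toFlat.keys
    · obtain ⟨s, hs⟩ := AndOr.mem_keys_toFlat.1 hp
      rw [AndOr.vars_toFlat hs]; exact AndOr.args_nodup _ _
    · rw [Flat.vars_eq_nil hp]; exact List.nodup_nil
  · rintro ⟨I, hI⟩
    have hJ : ∀ p s, (p, s) ∈ φ.pos .nil →
        table ((φ.pos .nil).map fun e => (e.1, e.2.plug (table I))) p = s.plug (table I) := by
      intro p s hs
      refine table_eq_of_mem ?_ (List.mem_map.2 ⟨_, hs, rfl⟩)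
      have := φ.pos_nodup .nil
      simpa [Function.comp_def] using this
    have hplug : ∀ s ∈ φ.subs, ∀ M ∈ S, ∀ a : Data → M.U, M.Sat (s.plugBelow (table I)) a →
        M.Sat (s.plug (table I)) a := by
      intro s hs M hM a h
      cases hm : s.mark with
      | none => rwa [AndOr.plug_of_not_mark hm]
      | some m =>
        rw [AndOr.plug_of_mark hm]
        exact hI.entails s hs m hm M hM a (by simpa using h)
    refine ⟨(φ.pos .nil).map fun e => (e.1, e.2.plug (table I)), fun p hp => ?_,
      fun p hp x hx => ?_, fun c hc M hM a h1 h2 => ?_⟩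
    · obtain ⟨s, hs⟩ := AndOr.mem_keys_toFlat.1 hp
      have hs' := AndOr.mem_subs_of_mem_pos hs
      rw [hJ p s hs]
      refine AndOr.plug_mem (fun q hq => ?_) fun ψ hψ => hcon ψ (AndOr.leaves_subset hs' hψ)
      obtain ⟨r, hr, hrq⟩ := List.mem_filterMap.1 hq
      exact hI.mem q (List.mem_filterMap.2 ⟨r, AndOr.subs_trans hs' hr, hrq⟩)
    · obtain ⟨s, hs⟩ := AndOr.mem_keys_toFlat.1 hp
      have hs' := AndOr.mem_subs_of_mem_pos hs
      rw [hJ p s hs] at hx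
      rw [AndOr.vars_toFlat hs]
      cases hm : s.mark with
      | none =>
        rw [AndOr.mem_args_of_not_mark hm]
        exact AndOr.fv_plug (fun r hr q hq x hx =>
          (hI.vars r (AndOr.subs_trans hs' hr) q hq hx).1) hx
      | some m =>
        rw [AndOr.mem_args_of_mark hm]
        rw [AndOr.plug_of_mark hm] at hx
        exact hI.vars s hs' m hm hx
    · rcases AndOr.mem_toFlat.1 hc with ⟨p, s, hs, hcs⟩ | rfl
      · have h3 := hplug s (AndOr.mem_subs_of_mem_pos hs) M hM a
        have hch := AndOr.mem_pos_children hs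
        cases s with
        | leaf m ψ =>
          obtain rfl : c = _ := by simpa [AndOr.clausesAt, AndOr.leafFml] using hcs
          show M.Sat (table _ p) a
          rw [hJ p _ hs]
          exact h3 h1
        | and m s t =>
          obtain rfl : c = _ := by
            simpa [AndOr.clausesAt, AndOr.leafFml, AndOr.isAnd] using hcs
          show M.Sat (table _ p) a
          rw [hJ p _ hs]
          refine h3 (sat_inf.2 ⟨?_, ?_⟩)
          · have := h2 (AndOr.leftPos p) (by simp)
            rwa [hJ _ _ (hch rfl).1] at this
          · have := h2 (AndOr.rightPos p) (by simp)
            rwa [hJ _ _ (hch rfl).2] at this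
        | or m s t =>
          obtain rfl | rfl : c = _ ∨ c = _ := by
            simpa [AndOr.clausesAt, AndOr.leafFml, AndOr.isAnd] using hcs
          · show M.Sat (table _ p) a
            rw [hJ p _ hs]
            have := h2 (AndOr.leftPos p) (by simp)
            rw [hJ _ _ (hch rfl).1] at this
            exact h3 (sat_sup.2 (Or.inl this))
          · show M.Sat (table _ p) a
            rw [hJ p _ hs]
            have := h2 (AndOr.rightPos p) (by simp)
            rw [hJ _ _ (hch rfl).2] at this
            exact h3 (sat_sup.2 (Or.inr this))
      · have := h2 .nil (by simp)
        rw [hJ _ _ (AndOr.mem_pos_self _ _)] at this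
        exact hI.top M hM a (by simpa using this)
  · intro J hJ
    have hg' : ∀ p s m, (p, s) ∈ φ.pos .nil → s.mark = some m → table (g φ J) m = table J p := by
      intro p s m hs hm
      refine table_eq_of_mem ?_ (List.mem_flatMap.2 ⟨_, hs, by simp [hm]⟩)
      -- The selected positions have distinct names, so the collected table has no conflicting
      -- entries.
      have : (g φ J).map Prod.fst = φ.marks := by
        simp only [g, AndOr.marks, ← AndOr.map_snd_pos .nil, List.filterMap_map]
        rw [List.map_flatMap, List.filterMap_eq_flatMap_toList]
        congr 1
        funext e
        cases h : e.2.mark <;> simp [h]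
      rwa [this]
    -- At a selected position `plug` is the value of `J` itself, at the others it is `plugBelow`. So
    -- it suffices to treat `plugBelow`.
    have step : ∀ (s : AndOr L) p, (p, s) ∈ φ.pos .nil → ∀ (M : Interp.{u, v, w} L) (a : Data → M.U),
        (M.Sat (s.plugBelow (table (g φ J))) a → M.Sat (table J p) a) →
        (M.Sat (s.plugBelow (table (g φ J))) a → M.Sat (table J p) a) ∧
        (M.Sat (s.plug (table (g φ J))) a → M.Sat (table J p) a) := by
      intro s p hs M a h
      refine ⟨h, ?_⟩
      cases hm : s.mark with
      | none => rwa [AndOr.plug_of_not_mark hm]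
      | some m => rw [AndOr.plug_of_mark hm, hg' p s m hs hm]; exact _root_.id
    have hv : ∀ (s : AndOr L) p, (p, s) ∈ φ.pos .nil → ∀ c ∈ s.clausesAt p, ∀ M ∈ S,
        ∀ a : Data → M.U, M.Sat c.con a → (∀ b ∈ c.body, M.Sat (table J b) a) →
        M.Sat (table J p) a := by
      intro s p hs c hc M hM a h1 h2
      have := hJ.valid c (AndOr.mem_toFlat.2 (Or.inl ⟨p, s, hs, hc⟩)) M hM a h1 h2
      rwa [(AndOr.mem_clausesAt hc).1] at this
    -- Induction over the subformula: the clauses at `p` lead from the values at the children to the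
    -- value at `p`.
    have key : ∀ (s : AndOr L) p, (p, s) ∈ φ.pos .nil → ∀ M ∈ S, ∀ a : Data → M.U,
        (M.Sat (s.plugBelow (table (g φ J))) a → M.Sat (table J p) a) ∧
        (M.Sat (s.plug (table (g φ J))) a → M.Sat (table J p) a) := by
      intro s
      induction s with
      | leaf m ψ =>
        intro p hs M hM a
        exact step _ p hs M a fun h => hv _ p hs ⟨.nil, ψ, [], some p⟩
          (by simp [AndOr.clausesAt, AndOr.leafFml]) M hM a h (by simp)
      | and m s t ihs iht =>
        intro p hs M hM a
        obtain ⟨hl, hr⟩ := AndOr.mem_pos_children hs rfl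
        refine step _ p hs M a fun h => hv _ p hs
          ⟨.nil, ⊤, [AndOr.leftPos p, AndOr.rightPos p], some p⟩
          (by simp [AndOr.clausesAt, AndOr.leafFml, AndOr.isAnd]) M hM a sat_top ?_
        obtain ⟨h1, h2⟩ := sat_inf.1 h
        simp only [List.mem_cons, List.not_mem_nil, or_false, forall_eq_or_imp, forall_eq]
        exact ⟨(ihs _ hl M hM a).2 h1, (iht _ hr M hM a).2 h2⟩
      | or m s t ihs iht =>
        intro p hs M hM a
        obtain ⟨hl, hr⟩ := AndOr.mem_pos_children hs rfl
        refine step _ p hs M a fun h => ?_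
        rcases sat_sup.1 h with h | h
        · exact hv _ p hs ⟨.nil, ⊤, [AndOr.leftPos p], some p⟩
            (by simp [AndOr.clausesAt, AndOr.leafFml, AndOr.isAnd]) M hM a sat_top
            (by simpa using (ihs _ hl M hM a).2 h)
        · exact hv _ p hs ⟨.nil, ⊤, [AndOr.rightPos p], some p⟩
            (by simp [AndOr.clausesAt, AndOr.leafFml, AndOr.isAnd]) M hM a sat_top
            (by simpa using (iht _ hr M hM a).2 h)
    refine ⟨fun m hm => ?_, fun s hs m hm M hM a h => ?_, fun M hM a h => ?_, fun s hs m hm x hx => ?_⟩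
    · obtain ⟨s, hs, hsm⟩ := List.mem_filterMap.1 hm
      obtain ⟨p, hp⟩ := AndOr.exists_mem_pos (p := .nil) hs
      rw [hg' p s m hp hsm]
      exact hJ.mem p (AndOr.mem_keys_toFlat.2 ⟨s, hp⟩)
    · obtain ⟨p, hp⟩ := AndOr.exists_mem_pos (p := .nil) hs
      rw [hg' p s m hp hm]
      exact (key s p hp M hM a).1 (h _ rfl)
    · exact hJ.valid ⟨.nil, ⊤, [.nil], none⟩ (AndOr.mem_toFlat.2 (Or.inr rfl)) M hM a sat_top
        (by simpa using (key φ .nil (AndOr.mem_pos_self _ _) M hM a).2 (h _ rfl))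
    · obtain ⟨p, hp⟩ := AndOr.exists_mem_pos (p := .nil) hs
      rw [hg' p s m hp hm] at hx
      have := hJ.vars p (AndOr.mem_keys_toFlat.2 ⟨s, hp⟩) x hx
      rwa [AndOr.vars_toFlat hp, AndOr.mem_args_of_mark hm] at this

end Disjunctive

/-! ### Body-disjoint normal clauses -/

theorem eq_of_nodup_flatMap {α β : Type*} {f : α → List β} {l : List α} (h : (l.flatMap f).Nodup) {a b : α}
    (ha : a ∈ l) (hb : b ∈ l) {x : β} (hx : x ∈ f a) (hy : x ∈ f b) : a = b := by
  by_contra hne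
  have h1 := (List.nodup_flatMap.1 h).2
  have : Std.Symm (Function.onFun List.Disjoint f) := ⟨fun _ _ h => List.Disjoint.symm h⟩
  exact h1.forall ha hb hne hx hy

/-- Tables assembled from several answers may list a key repeatedly; look-up is still determined if
all entries agree. -/
theorem table_eq_of_unique {L : FirstOrder.Language.{u, v}} {κ : Type*} [DecidableEq κ]
    {l : List (κ × Fml L)} {k : κ} {φ : Fml L} (h : (k, φ) ∈ l) (hu : ∀ ψ, (k, ψ) ∈ l → ψ = φ) :
    table l k = φ := by
  unfold table
  induction l with
  | nil => simp at h
  | cons a l ih =>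
    by_cases hk : k = a.1
    · subst hk
      simpa [List.lookup] using hu a.2 (by simp)
    · have h1 : (k == a.1) = false := by simpa using hk
      simp only [List.lookup, h1]
      refine ih ((List.mem_cons.1 h).resolve_left fun e => hk (by rw [← e])) fun ψ hψ =>
        hu ψ (List.mem_cons_of_mem _ hψ)

theorem exists_mem_zip {α β : Type*} {l : List α} {l' : List β} (h : l.length = l'.length) {a : α}
    (ha : a ∈ l) : ∃ b, (a, b) ∈ l.zip l' := by
  obtain ⟨i, hi, rfl⟩ := List.getElem_of_mem ha
  exact ⟨l'[i], List.mem_iff_getElem.2 ⟨i, by simp; omega, by simp⟩⟩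

theorem zip_unique {α β : Type*} {l : List α} {l' : List β} (h : l.Nodup) {a : α} {b b' : β}
    (h1 : (a, b) ∈ l.zip l') (h2 : (a, b') ∈ l.zip l') : b = b' := by
  obtain ⟨i, hi⟩ := List.mem_iff_getElem?.1 h1
  obtain ⟨j, hj⟩ := List.mem_iff_getElem?.1 h2
  rw [List.getElem?_zip_eq_some] at hi hj
  obtain rfl := (List.getElem?_inj (List.getElem?_eq_some_iff.1 hi.1).1 h).1 (hi.1.trans hj.1.symm)
  exact Option.some_inj.1 (hi.2.symm.trans hj.2)

/-- With enough steps the chain ends only where `up` is undefined, so the formula also holds past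
its end. -/
theorem chain_getElem?_succ {α : Type*} {up : α → Option α} {r : α → ℕ}
    (hr : ∀ a b, up a = some b → r b < r a) {n : ℕ} {a : α} (ha : r a ≤ n) (i : ℕ) :
    (chain up n a)[i + 1]? = (chain up n a)[i]?.bind up := by
  induction n generalizing a i with
  | zero =>
    have : up a = none := by
      cases h : up a with
      | none => rfl
      | some b => have := hr a b h; omega
    cases i <;> simp [chain, this]
  | succ n ih =>
    simp only [chain, List.getElem?_cons_succ]
    cases h : up a with
    | none => cases i <;> simp [h]
    | some b =>
      have := hr a b h
      cases i with
      | zero => cases n <;> simp [h, chain]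
      | succ i => simpa using ih (by omega) i

namespace Flat
variable {L : FirstOrder.Language.{u, v}}

/-- The clause whose body contains the head of the given clause. -/
def up (F : Flat L) (c : FClause L) : Option (FClause L) :=
  c.head.bind fun p => F.1.find? fun d => decide (p ∈ d.body)

variable {F : Flat L} {c d : FClause L}

theorem of_up (h : F.up c = some d) : d ∈ F.1 ∧ ∃ p, c.head = some p ∧ p ∈ d.body := by
  obtain ⟨p, hp, hd⟩ := Option.bind_eq_some_iff.1 h
  exact ⟨List.mem_of_find?_eq_some hd, p, hp, by simpa using List.find?_some hd⟩

theorem BodyDisjoint.eq (hb : F.BodyDisjoint) (hc : c ∈ F.1) (hd : d ∈ F.1) {q : Data}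
    (h : q ∈ c.body) (h' : q ∈ d.body) : c = d := eq_of_nodup_flatMap hb hc hd h h'

theorem HeadDisjoint.eq (hh : F.HeadDisjoint) (hc : c ∈ F.1) (hd : d ∈ F.1) {q : Data}
    (h : c.head = some q) (h' : d.head = some q) : c = d :=
  eq_of_nodup_flatMap hh hc hd (by simpa using h) (by simpa using h')

theorem Apart.eq (ha : F.Apart) (hc : c ∈ F.1) (hd : d ∈ F.1) (h : c.id = d.id) : c = d :=
  List.inj_on_of_nodup_map ha.ids hc hd h

theorem BodyDisjoint.up_eq (hb : F.BodyDisjoint) (hd : d ∈ F.1) {p : Data} (hp : c.head = some p)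
    (h : p ∈ d.body) : F.up c = some d := by
  have h1 : F.up c = F.1.find? fun d => decide (p ∈ d.body) := by simp [up, hp]
  cases h2 : F.up c with
  | none =>
    rw [h1, List.find?_eq_none] at h2
    exact absurd (decide_eq_true h) (h2 d hd)
  | some e =>
    obtain ⟨he, q, hq, hqe⟩ := of_up h2
    obtain rfl : p = q := by rw [hp] at hq; simpa using hq
    rw [hb.eq hd he h hqe]

/-- Going up from `c` to `d` makes the head of `d` depend on the head of `c`, so a cycle of clauses
would give a cycle of symbols. -/
theorem Acyclic.up (hF : F.Acyclic) (c : FClause L) :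
    ¬ Relation.TransGen (fun c d => F.up c = some d) c c := by
  have key : ∀ d, Relation.TransGen (fun c d => F.up c = some d) c d → ∀ q, d.head = some q →
      ∃ p, c.head = some p ∧ Relation.TransGen F.Dep q p := by
    intro d h
    induction h with
    | single h =>
      intro q hq
      obtain ⟨hd, p, hp, hpd⟩ := of_up h
      exact ⟨p, hp, .single ⟨_, hd, hq, hpd⟩⟩
    | tail _ h ih =>
      intro q hq
      obtain ⟨hd, p, hp, hpd⟩ := of_up h
      obtain ⟨p', hp', h'⟩ := ih p hp
      exact ⟨p', hp', .head ⟨_, hd, hq, hpd⟩ h'⟩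
  intro h
  obtain ⟨d, hd, -⟩ := Relation.TransGen.head'_iff.1 h
  obtain ⟨-, p, hp, -⟩ := of_up hd
  obtain ⟨p', hp', hT⟩ := key c h p hp
  obtain rfl : p = p' := by rw [hp] at hp'; simpa using hp'
  exact hF p hT

/-- The clauses above a given one. -/
def links (F : Flat L) (c : FClause L) : List (FClause L) := chain F.up F.1.length c

/-- A clause is below itself and below the clauses above it. -/
def Below (F : Flat L) (d c : FClause L) : Prop :=
  Relation.ReflTransGen (fun c d => F.up c = some d) c d

theorem Acyclic.exists_rank (hF : F.Acyclic) : ∃ r : FClause L → ℕ, (∀ c, r c ≤ F.1.length) ∧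
    ∀ c d, F.up c = some d → r d < r c :=
  HornInterp.exists_rank hF.up fun _ _ h => (of_up h).1

theorem Acyclic.mem_links (hF : F.Acyclic) : d ∈ F.links c ↔ F.Below d c := by
  obtain ⟨r, h1, h2⟩ := hF.exists_rank
  exact mem_chain h2 (h1 c)

theorem Acyclic.links_succ (hF : F.Acyclic) (c : FClause L) (i : ℕ) :
    (F.links c)[i + 1]? = (F.links c)[i]?.bind F.up := by
  obtain ⟨r, h1, h2⟩ := hF.exists_rank
  exact chain_getElem?_succ h2 (h1 c) i

theorem links_zero (F : Flat L) (c : FClause L) : (F.links c)[0]? = some c := by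
  unfold links
  cases F.1.length <;> rfl

theorem mem_of_below (hc : c ∈ F.1) (h : F.Below d c) : d ∈ F.1 := by
  rcases h.cases_tail with rfl | ⟨e, -, he⟩
  · exact hc
  · exact (of_up he).1

theorem Acyclic.not_below_up (hF : F.Acyclic) (h : F.up c = some d) : ¬ F.Below c d := fun h' =>
  hF.up c (.head' h h')

/-- A variable shared by two clauses is an argument of a relation symbol that occurs in both. -/
theorem Apart.local (hA : F.Apart) (hc : c ∈ F.1) (hd : d ∈ F.1) (hne : c ≠ d) {x : Data}
    (hx : x ∈ fv c.con) (hx' : x ∈ fv d.con) : ∃ q ∈ F.keys, q ∈ c.occ ∧ q ∈ d.occ ∧ x ∈ F.vars q := by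
  obtain ⟨q, hq, hxq⟩ := hA.shared c hc d hd (fun h => hne (hA.eq hc hd h)) x hx hx'
  exact ⟨q, hq, hA.own c hc q hq x hxq hx, hA.own d hd q hq x hxq hx', hxq⟩

theorem mem_occ {q : Data} : q ∈ c.occ ↔ q ∈ c.body ∨ c.head = some q := by
  simp [FClause.occ]

/-- By completeness every head occurs in some body, so going up stops only at clauses with head
`false`. -/
theorem up_isSome {Con : ConstraintLanguage L} (hW : F.WF Con) (hC : F.Complete) (hb : F.BodyDisjoint)
    (hc : c ∈ F.1) {p : Data} (hp : c.head = some p) : ∃ d ∈ F.1, F.up c = some d ∧ p ∈ d.body := by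
  obtain ⟨d, hd, hpd⟩ := hC.body p (hW.occ c hc p (mem_occ.2 (Or.inr hp)))
  exact ⟨d, hd, hb.up_eq hd hp hpd, hpd⟩

end Flat

/-! ### Computation of the chains of clauses -/

section
variable {L : FirstOrder.Language.{u, v}} [Coding L] {α : Type*} [Enc α]

@[fun_prop]
theorem PT.flat_up {f : α → Flat L} {g : α → FClause L} (hf : PT f) (hg : PT g) :
    PT fun a => (f a).up (g a) := by
  unfold Flat.up; fun_prop

@[fun_prop]
theorem PT.flat_links {f : α → Flat L} {g : α → FClause L} (hf : PT f) (hg : PT g) :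
    PT fun a => (f a).links (g a) := by
  refine PT.comp (g := fun p : Flat L × FClause L => p.1.links p.2) ?_ (hf.prodMk hg)
  unfold Flat.links
  refine PT.chain (up := fun p : Flat L × FClause L => p.1.up) (by fun_prop) (by fun_prop)
    (by fun_prop) fun a x y h => ?_
  have h1 := esize_le_of_mem (Flat.of_up h).1
  have h2 : esize a = esize a.1.1 + esize a.1.2 + 1 + esize a.2 + 1 := rfl
  omega

end

/-! ### Linear tree-like clauses to inductive sequences -/

section
variable {L : FirstOrder.Language.{u, v}}

namespace Flat

/-- The clauses without body, from which the chains of clauses start. -/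
def starts (F : Flat L) : List (FClause L) := F.1.filter fun c => c.body.isEmpty

/-- The first formula of a sequence is `true` and is dropped: the head of the clause with index `i`
in a chain receives the formula with index `i + 1`. -/
def chainEntries (F : Flat L) (Is : List (List (Fml L))) : List (Data × Fml L) :=
  (F.starts.zip Is).flatMap fun e => ((F.links e.1).zip e.2.tail).flatMap fun e' =>
    (e'.1.head.map fun p => (p, e'.2)).toList

variable {F : Flat L} {c d s s' : FClause L}

theorem mem_starts : s ∈ F.starts ↔ s ∈ F.1 ∧ s.body = [] := by
  simp [starts]

theorem mem_chainEntries {Is : List (List (Fml L))} {p : Data} {φ : Fml L} :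
    (p, φ) ∈ F.chainEntries Is ↔ ∃ s I, ∃ (i : ℕ) (c : FClause L), (s, I) ∈ F.starts.zip Is ∧ (F.links s)[i]? = some c ∧
      I[i + 1]? = some φ ∧ c.head = some p := by
  simp only [chainEntries, List.mem_flatMap, Option.mem_toList, Option.map_eq_some_iff, Prod.exists]
  constructor
  · rintro ⟨s, I, hsI, c, φ', hc, q, hq, h⟩
    simp only [Prod.mk.injEq] at h
    obtain ⟨rfl, rfl⟩ := h
    obtain ⟨i, hi⟩ := List.mem_iff_getElem?.1 hc
    rw [List.getElem?_zip_eq_some, List.getElem?_tail] at hi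
    exact ⟨s, I, i, c, hsI, hi.1, hi.2, hq⟩
  · rintro ⟨s, I, i, c, hsI, h1, h2, h3⟩
    refine ⟨s, I, hsI, c, φ, List.mem_iff_getElem?.2 ⟨i, ?_⟩, p, h3, rfl⟩
    rw [List.getElem?_zip_eq_some, List.getElem?_tail]
    exact ⟨h1, h2⟩

theorem Linear.body_eq (hl : F.Linear) (hc : c ∈ F.1) {p : Data} (hp : p ∈ c.body) : c.body = [p] := by
  have h1 : c.body.length = 1 := le_antisymm (hl c hc) (List.length_pos_of_mem hp)
  obtain ⟨q, hq⟩ := List.length_eq_one_iff.1 h1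
  rw [hq, List.mem_singleton] at hp
  rw [hq, hp]

/-- A chain can be traced back: the body of a clause has only one symbol, and only one clause has it
as head. Tracing back stops exactly at the start, whose body is empty. -/
theorem Acyclic.links_unique (hF : F.Acyclic) (hl : F.Linear) (hh : F.HeadDisjoint) (hs : s ∈ F.starts)
    (hs' : s' ∈ F.starts) {i j : ℕ} (h : (F.links s)[i]? = some c) (h' : (F.links s')[j]? = some c) :
    s = s' ∧ i = j := by
  rw [mem_starts] at hs hs'
  have hmem : ∀ {s : FClause L}, s ∈ F.1 → ∀ {i : ℕ} {d}, (F.links s)[i]? = some d → d ∈ F.1 := by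
    intro s hs i d hd
    exact mem_of_below hs (hF.mem_links.1 (List.mem_of_getElem? hd))
  have hpred : ∀ {s : FClause L} {i : ℕ} {c}, s ∈ F.1 → (F.links s)[i + 1]? = some c →
      ∃ d ∈ F.1, (F.links s)[i]? = some d ∧ c ∈ F.1 ∧ ∃ p, d.head = some p ∧ p ∈ c.body := by
    intro s i c hs h
    rw [hF.links_succ, Option.bind_eq_some_iff] at h
    obtain ⟨d, hd, hdc⟩ := h
    obtain ⟨h1, h2⟩ := of_up hdc
    exact ⟨d, hmem hs hd, hd, h1, h2⟩
  induction i generalizing j c with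
  | zero =>
    rw [links_zero, Option.some_inj] at h
    subst h
    cases j with
    | zero =>
      rw [links_zero, Option.some_inj] at h'
      exact ⟨h'.symm, rfl⟩
    | succ j =>
      obtain ⟨d, -, -, -, p, -, hp⟩ := hpred hs'.1 h'
      rw [hs.2] at hp
      simp at hp
  | succ i ih =>
    obtain ⟨d, hd, hd', hc, p, hp, hpc⟩ := hpred hs.1 h
    cases j with
    | zero =>
      rw [links_zero, Option.some_inj] at h'
      subst h'
      rw [hs'.2] at hpc
      simp at hpc
    | succ j =>
      obtain ⟨e, he, he', -, q, hq, hqc⟩ := hpred hs'.1 h'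
      have h1 := hl.body_eq hc hpc
      obtain rfl : q = p := by rw [h1] at hqc; simpa using hqc
      obtain rfl := hh.eq hd he hp hq
      obtain ⟨h2, h3⟩ := ih hd' he'
      exact ⟨h2, by rw [h3]⟩

/-- As long as the body is non-empty, one steps down to the clause whose head is in it. The rank
grows on the way down and is bounded by the number of clauses. -/
theorem Acyclic.exists_start (hF : F.Acyclic) {Con : ConstraintLanguage L} (hW : F.WF Con)
    (hC : F.Complete) (hb : F.BodyDisjoint) (hc : c ∈ F.1) :
    ∃ s ∈ F.starts, ∃ i : ℕ, (F.links s)[i]? = some c := by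
  obtain ⟨r, h1, h2⟩ := hF.exists_rank
  induction h : F.1.length - r c using Nat.strong_induction_on generalizing c with
  | _ n ih =>
    subst h
    by_cases he : c.body = []
    · exact ⟨c, mem_starts.2 ⟨hc, he⟩, 0, links_zero _ _⟩
    · obtain ⟨q, hq⟩ := List.exists_mem_of_ne_nil _ he
      obtain ⟨d, hd, hdq⟩ := hC.head q (hW.occ c hc q (mem_occ.2 (Or.inl hq)))
      have hu := hb.up_eq hc hdq hq
      have h3 := h2 _ _ hu
      have h4 := h1 d
      obtain ⟨s, hs, i, hi⟩ := ih _ (by omega) hd rfl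
      exact ⟨s, hs, i + 1, by rw [hF.links_succ, hi]; exact hu⟩

/-- In tree-like sets of clauses a symbol that occurs in two clauses links them. -/
theorem BodyDisjoint.up_of_occ (hb : F.BodyDisjoint) (hh : F.HeadDisjoint) (hc : c ∈ F.1) (hd : d ∈ F.1)
    (hne : c ≠ d) {q : Data} (h : q ∈ c.occ) (h' : q ∈ d.occ) :
    (c.head = some q ∧ F.up c = some d) ∨ (d.head = some q ∧ F.up d = some c) := by
  rw [mem_occ] at h h'
  rcases h with h | h <;> rcases h' with h' | h'
  · exact absurd (hb.eq hc hd h h') hne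
  · exact Or.inr ⟨h', hb.up_eq hc h' h⟩
  · exact Or.inl ⟨h, hb.up_eq hd h h'⟩
  · exact absurd (hh.eq hc hd h h') hne

end Flat

variable [Coding L]

/-- The clauses split into disjoint chains, each from a clause without body to one with head
`false`. The constraints along a chain form a sequence problem. -/
theorem flat_reduces_sequence {S : Set (Interp.{u, v, w} L)} {Con : ConstraintLanguage L} :
    PolyReducesToSeq
      (flatSolving S Con fun F => F.Normal ∧ F.Linear ∧ F.BodyDisjoint ∧ F.HeadDisjoint)
      (sequenceInterpolation Coding.coding S Con) := by
  let f : Flat L → List (List (Fml L)) := fun F => F.starts.map fun s => (F.links s).map FClause.con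
  have hf : PT f := by simp only [f, Flat.starts]; fun_prop
  have hg : PT fun a : Flat L × List (List (Fml L)) => a.1.chainEntries a.2 := by
    unfold Flat.chainEntries Flat.starts; fun_prop
  unfold sequenceInterpolation flatSolving
  refine PolyReducesToSeq.intro f Flat.chainEntries (hf.comp PT.subtype_val)
    (hg.comp PT.subtype_val) ?_
  rintro F ⟨hW, ⟨hA, hC, hF⟩, hl, hb, hh⟩
  have hmem : ∀ {s : FClause L}, s ∈ F.starts → ∀ {i : ℕ} {d}, (F.links s)[i]? = some d → d ∈ F.1 := by
    intro s hs i d hd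
    exact Flat.mem_of_below (Flat.mem_starts.1 hs).1 (hF.mem_links.1 (List.mem_of_getElem? hd))
  -- A chain ends exactly with a clause of head `false`; for this, every head must occur in a body.
  have hlast : ∀ {s : FClause L}, s ∈ F.starts → ∀ {i : ℕ} {d}, (F.links s)[i]? = some d →
      (d.head = none ↔ i + 1 = (F.links s).length) := by
    intro s hs i d hd
    have h1 := (List.getElem?_eq_some_iff.1 hd).1
    constructor
    · intro h
      have : (F.links s)[i + 1]? = none := by rw [hF.links_succ, hd]; simp [Flat.up, h]
      rw [List.getElem?_eq_none_iff] at this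
      omega
    · intro h
      have h2 : (F.links s)[i + 1]? = none := List.getElem?_eq_none_iff.2 (by omega)
      cases hp : d.head with
      | none => rfl
      | some p =>
        obtain ⟨e, -, he, -⟩ := Flat.up_isSome hW hC hb (hmem hs hd) hp
        rw [hF.links_succ, hd, Option.bind_some, he] at h2
        simp at h2
  refine ⟨?_, ?_, ?_⟩
  · intro T hT φ hφ
    obtain ⟨s, hs, rfl⟩ := List.mem_map.1 hT
    obtain ⟨c, hc, rfl⟩ := List.mem_map.1 hφ
    exact hW.mem c (Flat.mem_of_below (Flat.mem_starts.1 hs).1 (hF.mem_links.1 hc))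
  · rintro ⟨J, hJ⟩ T hT
    obtain ⟨s, hs, rfl⟩ := List.mem_map.1 hT
    -- After the initial `true`, each clause contributes the value of its head, and the last one
    -- contributes `⊥`.
    let I : List (Fml L) := ⊤ :: (F.links s).map fun c => c.head.elim ⊥ (table J)
    have hI : ∀ {i : ℕ} {c}, (F.links s)[i]? = some c → I.getD (i + 1) ⊥ = c.head.elim ⊥ (table J) := by
      intro i c hc
      simp [I, hc]
    have hbot : ∀ {c : FClause L}, c.head.elim ⊥ (table J) = (⊥ : Fml L) ∨
        ∃ p, c.head = some p ∧ c.head.elim ⊥ (table J) = table J p := by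
      intro c
      cases h : c.head with
      | none => exact Or.inl rfl
      | some p => exact Or.inr ⟨p, rfl, rfl⟩
    have hpos : 0 < (F.links s).length := (List.getElem?_eq_some_iff.1 (Flat.links_zero F s)).1
    refine ⟨I, by simp [I], fun φ hφ => ?_, rfl, ?_, fun i hi M hM a h => ?_, fun i hi x hx => ?_⟩
    · rcases List.mem_cons.1 hφ with rfl | hφ
      · exact ConstraintLanguage.top_mem
      · obtain ⟨c, hc, rfl⟩ := List.mem_map.1 hφ
        have hc' := Flat.mem_of_below (Flat.mem_starts.1 hs).1 (hF.mem_links.1 hc)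
        rcases hbot (c := c) with h | ⟨p, hp, h⟩
        · rw [h]; exact Con.falsum_mem
        · rw [h]; exact hJ.mem p (hW.occ c hc' p (Flat.mem_occ.2 (Or.inr hp)))
    · obtain ⟨k, hk⟩ := Nat.exists_eq_succ_of_ne_zero hpos.ne'
      have hc : (F.links s)[k]? = some (F.links s)[k] := List.getElem?_eq_getElem (by omega)
      rw [List.length_map, hk, hI hc, (hlast hs hc).2 (by omega)]
      rfl
    · rw [List.length_map] at hi
      have hc : (F.links s)[i]? = some (F.links s)[i] := List.getElem?_eq_getElem hi
      rw [hI hc]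
      refine hJ.valid _ (hmem hs hc) M hM a (h _ (Or.inr (by simp [hi]))) fun b hb' => ?_
      have h0 := h _ (Or.inl rfl)
      cases i with
      | zero =>
        rw [Flat.links_zero, Option.some_inj] at hc
        rw [← hc, (Flat.mem_starts.1 hs).2] at hb'
        simp at hb'
      | succ i =>
        have hd := hc
        rw [hF.links_succ, Option.bind_eq_some_iff] at hd
        obtain ⟨d, hd, hu⟩ := hd
        obtain ⟨h1, p, hp, hpc⟩ := Flat.of_up hu
        rw [hl.body_eq h1 hpc, List.mem_singleton] at hb'
        rw [hI hd, hp] at h0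
        rw [hb']
        exact h0
    · cases i with
      | zero => simp [I] at hx
      | succ i =>
        rw [List.length_map] at hi
        have hc : (F.links s)[i]? = some (F.links s)[i] := List.getElem?_eq_getElem (by omega)
        have hcF := hmem hs hc
        rw [hI hc] at hx
        rcases hbot (c := (F.links s)[i]) with h | ⟨p, hp, h⟩
        · rw [h] at hx; simp at hx
        · rw [h] at hx
          have hxp := hJ.vars p (hW.occ _ hcF p (Flat.mem_occ.2 (Or.inr hp))) x hx
          obtain ⟨d, hd, hu, hpd⟩ := Flat.up_isSome hW hC hb hcF hp
          have hd' : (F.links s)[i + 1]? = some d := by rw [hF.links_succ, hc]; exact hu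
          refine ⟨⟨(F.links s)[i].con, ?_, hA.con_vars _ hcF p (Flat.mem_occ.2 (Or.inr hp)) x hxp⟩,
            ⟨d.con, ?_, hA.con_vars _ hd p (Flat.mem_occ.2 (Or.inl hpd)) x hxp⟩⟩
          · exact List.mem_iff_getElem?.2 ⟨i, by simp [hc]⟩
          · exact List.mem_iff_getElem?.2 ⟨0, by simp [hd']⟩
  · intro Is hIs
    rw [show f F = F.starts.map fun s => (F.links s).map FClause.con from rfl,
      List.forall₂_map_left_iff, List.forall₂_iff_zip] at hIs
    obtain ⟨hlen, hIs⟩ := hIs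
    have hnd : F.starts.Nodup := (hA.ids.of_map _).filter _
    have hstart : ∀ c ∈ F.1, ∃ s ∈ F.starts, ∃ I, ∃ i : ℕ, (s, I) ∈ F.starts.zip Is ∧
        (F.links s)[i]? = some c := by
      intro c hc
      obtain ⟨s, hs, i, hi⟩ := hF.exists_start hW hC hb hc
      obtain ⟨I, hI⟩ := exists_mem_zip hlen hs
      exact ⟨s, hs, I, i, hI, hi⟩
    have hzs : ∀ {s I}, (s, I) ∈ F.starts.zip Is → s ∈ F.starts := fun h => (List.of_mem_zip h).1
    have hJ : ∀ {s I}, (s, I) ∈ F.starts.zip Is → ∀ {i : ℕ} {c}, (F.links s)[i]? = some c →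
        ∀ {p}, c.head = some p → table (F.chainEntries Is) p = I.getD (i + 1) ⊥ := by
      intro s I hsI i c hc p hp
      have hi := (List.getElem?_eq_some_iff.1 hc).1
      have hIl : I.length = (F.links s).length + 1 := by
        have := (hIs hsI).1
        rwa [List.length_map] at this
      refine table_eq_of_unique (Flat.mem_chainEntries.2 ⟨s, I, i, c, hsI, hc, ?_, hp⟩) ?_
      · rw [List.getD_eq_getElem _ _ (by omega), List.getElem?_eq_getElem]
      · intro φ hφ
        obtain ⟨s', I', i', c', hsI', hc', hφ, hp'⟩ := Flat.mem_chainEntries.1 hφ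
        obtain rfl := hh.eq (hmem (hzs hsI) hc) (hmem (hzs hsI') hc') hp hp'
        obtain ⟨rfl, rfl⟩ := hF.links_unique hl hh (hzs hsI) (hzs hsI') hc hc'
        obtain rfl := zip_unique hnd hsI hsI'
        rw [List.getD_eq_getElem?_getD, hφ]
        rfl
    refine ⟨fun p hp => ?_, fun p hp x hx => ?_, fun c hc M hM a h1 h2 => ?_⟩
    · obtain ⟨c, hc, hcp⟩ := hC.head p hp
      obtain ⟨s, hs, I, i, hsI, hi⟩ := hstart c hc
      rw [hJ hsI hi hcp]
      have h3 := hIs hsI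
      have h4 := h3.1
      rw [List.length_map] at h4
      rw [List.getD_eq_getElem _ _ (by have := (List.getElem?_eq_some_iff.1 hi).1; omega)]
      exact h3.2.1 _ (List.getElem_mem _)
    · obtain ⟨c, hc, hcp⟩ := hC.head p hp
      obtain ⟨s, hs, I, i, hsI, hi⟩ := hstart c hc
      rw [hJ hsI hi hcp] at hx
      have hi' := (List.getElem?_eq_some_iff.1 hi).1
      obtain ⟨⟨φ, hφ, hxφ⟩, ψ, hψ, hxψ⟩ := (hIs hsI).2.2.2.2.2 (i + 1) (by rw [List.length_map]; omega) hx
      rw [← List.map_take, List.mem_map] at hφ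
      rw [← List.map_drop, List.mem_map] at hψ
      obtain ⟨d, hd, rfl⟩ := hφ
      obtain ⟨e, he, rfl⟩ := hψ
      obtain ⟨j, hj⟩ := List.mem_iff_getElem?.1 hd
      obtain ⟨k, hk⟩ := List.mem_iff_getElem?.1 he
      rw [List.getElem?_drop] at hk
      have hji : j < i + 1 := by
        by_contra h
        simp [h] at hj
      rw [List.getElem?_take_of_lt hji] at hj
      have hdF := hmem hs hj
      have heF := hmem hs hk
      have hne : d ≠ e := by
        rintro rfl
        have := (hF.links_unique hl hh hs hs hj hk).2
        omega
      -- The shared variable belongs to a symbol of both `d`, at a place up to `i`, and `e`, at a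
      -- later place. Two clauses with a common symbol are consecutive, so `d` is at place `i` and
      -- the symbol is the head of `c`.
      obtain ⟨q, hq, hqd, hqe, hxq⟩ := hA.local hdF heF hne hxφ hxψ
      rcases hb.up_of_occ hh hdF heF hne hqd hqe with ⟨h1, h2⟩ | ⟨h1, h2⟩
      · have h3 : (F.links s)[j + 1]? = some e := by rw [hF.links_succ, hj]; exact h2
        have := (hF.links_unique hl hh hs hs h3 hk).2
        obtain rfl : j = i := by omega
        rw [hj, Option.some_inj] at hi
        subst hi
        rw [h1, Option.some_inj] at hcp
        rwa [← hcp]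
      · have h3 : (F.links s)[i + 1 + k + 1]? = some d := by rw [hF.links_succ, hk]; exact h2
        have := (hF.links_unique hl hh hs hs h3 hj).2
        omega
    · obtain ⟨s, hs, I, i, hsI, hi⟩ := hstart c hc
      have hi' := (List.getElem?_eq_some_iff.1 hi).1
      have h3 := hIs hsI
      have h5 : M.Sat (I.getD (i + 1) ⊥) a := by
        refine h3.2.2.2.2.1 i (by rwa [List.length_map]) M hM a ?_
        rintro ψ (rfl | rfl)
        · cases i with
          | zero => rw [h3.2.2.1]; exact sat_top
          | succ i =>
            rw [hF.links_succ, Option.bind_eq_some_iff] at hi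
            obtain ⟨d, hd, hu⟩ := hi
            obtain ⟨-, q, hq, hqc⟩ := Flat.of_up hu
            have := h2 q hqc
            rwa [hJ hsI hd hq] at this
        · have : ((F.links s).map FClause.con).getD i ⊥ = c.con := by simp [hi]
          rwa [this]
      cases hp : c.head with
      | none =>
        have h6 := (hlast hs hi).1 hp
        have h7 := h3.2.2.2.1
        rw [List.length_map, ← h6] at h7
        rwa [h7] at h5
      | some p =>
        show M.Sat (table _ p) a
        rwa [hJ hsI hi hp]

end

/-! ### Tree-like clauses to trees -/

section
variable {L : FirstOrder.Language.{u, v}}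

namespace Flat

/-- The clauses with head `false`. -/
def roots (F : Flat L) : List (FClause L) := F.1.filter fun c => c.head.isNone

/-- The clauses below a given one. -/
def nodesBelow (F : Flat L) (h : FClause L) : List (FClause L) :=
  F.1.filter fun c => decide (h.id ∈ (F.links c).map FClause.id)

/-- Nodes are clauses, named by their identifiers. The formula at a node will be the value of the
head of its clause. -/
def tree (F : Flat L) (h : FClause L) : TreeProblem L where
  nodes := (F.nodesBelow h).map fun c => (c.id, c.con)
  edges := (F.nodesBelow h).flatMap fun c => ((F.up c).map fun d => (d.id, c.id)).toList
  root := h.id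

def treeEntries (F : Flat L) (Is : List (List (Data × Fml L))) : List (Data × Fml L) :=
  (F.roots.zip Is).flatMap fun e => (F.nodesBelow e.1).flatMap fun c =>
    (c.head.map fun p => (p, table e.2 c.id)).toList

variable {F : Flat L} {c d h h' : FClause L}

theorem mem_roots : h ∈ F.roots ↔ h ∈ F.1 ∧ h.head = none := by
  simp [roots]

theorem mem_nodesBelow (hA : F.Apart) (hF : F.Acyclic) (hh : h ∈ F.1) :
    c ∈ F.nodesBelow h ↔ c ∈ F.1 ∧ F.Below h c := by
  simp only [nodesBelow, List.mem_filter, decide_eq_true_iff, List.mem_map]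
  refine and_congr_right fun hc => ?_
  constructor
  · rintro ⟨d, hd, he⟩
    rw [hF.mem_links] at hd
    rwa [← hA.eq (mem_of_below hc hd) hh he]
  · intro hb
    exact ⟨h, hF.mem_links.2 hb, rfl⟩

theorem mem_treeEntries {Is : List (List (Data × Fml L))} {p : Data} {φ : Fml L} :
    (p, φ) ∈ F.treeEntries Is ↔ ∃ h I, ∃ c ∈ F.nodesBelow h, (h, I) ∈ F.roots.zip Is ∧
      table I c.id = φ ∧ c.head = some p := by
  simp only [treeEntries, List.mem_flatMap, Option.mem_toList, Option.map_eq_some_iff, Prod.exists,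
    Prod.mk.injEq]
  constructor
  · rintro ⟨h, I, hI, c, hc, q, hq, rfl, e⟩
    exact ⟨h, I, c, hc, hI, e, hq⟩
  · rintro ⟨h, I, c, hc, hI, e, hq⟩
    exact ⟨h, I, hI, c, hc, p, hq, rfl, e⟩

theorem up_root (hh : h.head = none) : F.up h = none := by simp [up, hh]

theorem eq_of_below_root (hh : h.head = none) (hb : F.Below d h) : d = h := by
  rcases hb.cases_head with rfl | ⟨e, he, -⟩
  · rfl
  · rw [up_root hh] at he; simp at he

/-- `up` is a partial function, so the clauses above `c` are linearly ordered, and nothing lies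
above a clause with head `false`. -/
theorem root_unique (hh : h.head = none) (hh' : h'.head = none) (hc : F.Below h c)
    (hc' : F.Below h' c) : h = h' := by
  rcases Relation.ReflTransGen.total_of_right_unique
    (fun a b b' h1 h2 => by rw [h1] at h2; exact Option.some_inj.1 h2) hc hc' with h1 | h1
  · exact (eq_of_below_root hh h1).symm
  · exact eq_of_below_root hh' h1

/-- Going up lowers the rank, and it can only stop at a clause with head `false`. -/
theorem Acyclic.exists_root (hF : F.Acyclic) {Con : ConstraintLanguage L} (hW : F.WF Con)
    (hC : F.Complete) (hb : F.BodyDisjoint) (hc : c ∈ F.1) : ∃ h ∈ F.roots, F.Below h c := by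
  obtain ⟨r, h1, h2⟩ := hF.exists_rank
  induction hn : r c using Nat.strong_induction_on generalizing c with
  | _ n ih =>
    subst hn
    cases hp : c.head with
    | none => exact ⟨c, mem_roots.2 ⟨hc, hp⟩, .refl⟩
    | some p =>
      obtain ⟨d, hd, hu, -⟩ := up_isSome hW hC hb hc hp
      obtain ⟨h, hh, hdh⟩ := ih _ (h2 _ _ hu) hd rfl
      exact ⟨h, hh, .head hu hdh⟩

section
variable (hA : F.Apart) (hF : F.Acyclic) (hh : h ∈ F.roots)
include hA hF hh

theorem mem_nodesBelow_root : c ∈ F.nodesBelow h ↔ c ∈ F.1 ∧ F.Below h c :=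
  mem_nodesBelow hA hF (mem_roots.1 hh).1

theorem up_mem_nodesBelow (hc : c ∈ F.nodesBelow h) (hu : F.up c = some d) :
    d ∈ F.nodesBelow h := by
  rw [mem_nodesBelow_root hA hF hh] at hc ⊢
  refine ⟨(of_up hu).1, ?_⟩
  rcases hc.2.cases_head with rfl | ⟨e, he, h1⟩
  · rw [up_root (mem_roots.1 hh).2] at hu; simp at hu
  · rw [he, Option.some_inj] at hu
    rwa [← hu]

omit hA hF hh in
theorem mem_tree_V {v : Data} : v ∈ (F.tree h).V ↔ ∃ c ∈ F.nodesBelow h, c.id = v := by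
  simp [TreeProblem.V, tree]

omit hA hF hh in
theorem tree_E {v w : Data} : (F.tree h).E v w ↔
    ∃ c ∈ F.nodesBelow h, ∃ d, F.up c = some d ∧ d.id = v ∧ c.id = w := by
  simp [TreeProblem.E, tree]

theorem id_inj_nodesBelow (hc : c ∈ F.nodesBelow h) (hd : d ∈ F.nodesBelow h) (he : c.id = d.id) :
    c = d :=
  hA.eq ((mem_nodesBelow_root hA hF hh).1 hc).1 ((mem_nodesBelow_root hA hF hh).1 hd).1 he

omit hF hh in
theorem tree_V_nodup : (F.tree h).V.Nodup := by
  have : (F.tree h).V = (F.nodesBelow h).map FClause.id := by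
    simp [TreeProblem.V, tree, Function.comp_def]
  rw [this]
  exact hA.ids.sublist ((List.filter_sublist).map _)

omit hF hh in
theorem tree_label (hc : c ∈ F.nodesBelow h) : (F.tree h).label c.id = c.con :=
  table_eq_of_mem (tree_V_nodup hA) (List.mem_map.2 ⟨c, hc, rfl⟩)

theorem tree_below (hc : c ∈ F.nodesBelow h) {w : Data} :
    (F.tree h).Below c.id w ↔ ∃ d ∈ F.nodesBelow h, d.id = w ∧ F.Below c d := by
  constructor
  · intro hb
    induction hb with
    | refl => exact ⟨c, hc, rfl, .refl⟩
    | tail _ hE ih =>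
      obtain ⟨d, hd, rfl, hcd⟩ := ih
      obtain ⟨e, he, d', hu, h1, rfl⟩ := tree_E.1 hE
      obtain rfl := id_inj_nodesBelow hA hF hh (up_mem_nodesBelow hA hF hh he hu) hd h1
      exact ⟨e, he, rfl, .head hu hcd⟩
  · rintro ⟨d, hd, rfl, hb⟩
    revert hd
    refine Relation.ReflTransGen.head_induction_on hb (fun _ => .refl) fun {a e} hu _ ih ha => ?_
    exact .tail (ih (up_mem_nodesBelow hA hF hh ha hu)) (tree_E.2 ⟨a, ha, e, hu, rfl, rfl⟩)

theorem tree_isTree : (F.tree h).IsTree := by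
  have hr := mem_roots.1 hh
  have hroot : h ∈ F.nodesBelow h := (mem_nodesBelow_root hA hF hh).2 ⟨hr.1, .refl⟩
  refine ⟨tree_V_nodup hA, ?_, fun v w hE => ?_, mem_tree_V.2 ⟨h, hroot, rfl⟩, fun v hE => ?_,
    fun w hw hne => ?_, fun w hw => ?_⟩
  · have : ((F.tree h).edges.map Prod.snd).Sublist (F.tree h).V := by
      simp only [TreeProblem.V, tree, List.map_flatMap, List.map_map, Function.comp_def]
      generalize F.nodesBelow h = l
      induction l with
      | nil => simp
      | cons a l ih =>
        cases hu : F.up a with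
        | none => simpa [hu] using ih.cons _
        | some b => simpa [hu] using ih
    exact ((tree_V_nodup hA).sublist this).of_map _
  · obtain ⟨c, hc, d, hu, rfl, rfl⟩ := tree_E.1 hE
    exact ⟨mem_tree_V.2 ⟨d, up_mem_nodesBelow hA hF hh hc hu, rfl⟩, mem_tree_V.2 ⟨c, hc, rfl⟩⟩
  · obtain ⟨c, hc, d, hu, rfl, h1⟩ := tree_E.1 hE
    rw [id_inj_nodesBelow hA hF hh hc hroot h1, up_root hr.2] at hu
    simp at hu
  · obtain ⟨c, hc, rfl⟩ := mem_tree_V.1 hw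
    have hb := ((mem_nodesBelow_root hA hF hh).1 hc).2
    rcases hb.cases_head with rfl | ⟨d, hu, -⟩
    · exact absurd rfl hne
    · refine ⟨d.id, tree_E.2 ⟨c, hc, d, hu, rfl, rfl⟩, fun v hE => ?_⟩
      obtain ⟨c', hc', d', hu', rfl, h1⟩ := tree_E.1 hE
      rw [id_inj_nodesBelow hA hF hh hc' hc h1, hu, Option.some_inj] at hu'
      rw [hu']
  · obtain ⟨c, hc, rfl⟩ := mem_tree_V.1 hw
    exact (tree_below hA hF hh hroot).2 ⟨c, hc, rfl, ((mem_nodesBelow_root hA hF hh).1 hc).2⟩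

end

end Flat

variable [Coding L]

/-- The trees below the clauses with head `false` partition the clauses, and since heads are
disjoint, each symbol obtains its value at a single node. -/
theorem flat_reduces_tree {S : Set (Interp.{u, v, w} L)} {Con : ConstraintLanguage L} :
    PolyReducesToSeq (flatSolving S Con fun F => F.Normal ∧ F.BodyDisjoint ∧ F.HeadDisjoint)
      (treeInterpolation Coding.coding S Con) := by
  have hf : PT fun F : Flat L => F.roots.map F.tree := by
    unfold Flat.tree Flat.roots Flat.nodesBelow; fun_prop
  have hg : PT fun a : Flat L × List (List (Data × Fml L)) => a.1.treeEntries a.2 := by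
    unfold Flat.treeEntries Flat.roots Flat.nodesBelow; fun_prop
  unfold treeInterpolation flatSolving
  refine PolyReducesToSeq.intro (fun F : Flat L => F.roots.map F.tree) Flat.treeEntries
    (hf.comp PT.subtype_val) (hg.comp PT.subtype_val) ?_
  rintro F ⟨hW, ⟨hA, hC, hF⟩, hb, hh⟩
  refine ⟨?_, ?_, ?_⟩
  · intro P hP
    obtain ⟨h, hr, rfl⟩ := List.mem_map.1 hP
    refine ⟨Flat.tree_isTree hA hF hr, fun v hv => ?_⟩
    obtain ⟨c, hc, rfl⟩ := Flat.mem_tree_V.1 hv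
    rw [Flat.tree_label hA hc]
    exact hW.mem c ((Flat.mem_nodesBelow_root hA hF hr).1 hc).1
  · rintro ⟨J, hJ⟩ P hP
    obtain ⟨h, hr, rfl⟩ := List.mem_map.1 hP
    have hroot : h ∈ F.nodesBelow h :=
      (Flat.mem_nodesBelow_root hA hF hr).2 ⟨(Flat.mem_roots.1 hr).1, .refl⟩
    have hI : ∀ c ∈ F.nodesBelow h,
        table ((F.nodesBelow h).map fun c => (c.id, c.head.elim ⊥ (table J))) c.id =
          c.head.elim ⊥ (table J) := by
      intro c hc
      refine table_eq_of_mem ?_ (List.mem_map.2 ⟨c, hc, rfl⟩)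
      have := Flat.tree_V_nodup (h := h) hA
      simpa [TreeProblem.V, Flat.tree, Function.comp_def] using this
    refine ⟨(F.nodesBelow h).map fun c => (c.id, c.head.elim ⊥ (table J)), fun v hv => ?_, ?_,
      fun v hv M hM a h1 => ?_, fun v hv x hx => ?_⟩
    · obtain ⟨c, hc, rfl⟩ := Flat.mem_tree_V.1 hv
      have hcF := ((Flat.mem_nodesBelow_root hA hF hr).1 hc).1
      rw [hI c hc]
      cases hp : c.head with
      | none => exact Con.falsum_mem
      | some p => exact hJ.mem p (hW.occ c hcF p (Flat.mem_occ.2 (Or.inr hp)))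
    · have := hI h hroot
      rwa [(Flat.mem_roots.1 hr).2] at this
    · obtain ⟨c, hc, rfl⟩ := Flat.mem_tree_V.1 hv
      have hcF := ((Flat.mem_nodesBelow_root hA hF hr).1 hc).1
      rw [hI c hc]
      refine hJ.valid c hcF M hM a ?_ fun b hbc => ?_
      · have := h1 _ (Or.inl rfl)
        rwa [Flat.tree_label hA hc] at this
      · obtain ⟨d, hd, hdb⟩ := hC.head b (hW.occ c hcF b (Flat.mem_occ.2 (Or.inl hbc)))
        have hu := hb.up_eq hcF hdb hbc
        have hd' : d ∈ F.nodesBelow h := (Flat.mem_nodesBelow_root hA hF hr).2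
          ⟨hd, .head hu ((Flat.mem_nodesBelow_root hA hF hr).1 hc).2⟩
        have := h1 _ (Or.inr ⟨d.id, Flat.tree_E.2 ⟨d, hd', c, hu, rfl, rfl⟩, rfl⟩)
        rwa [hI d hd', hdb] at this
    · obtain ⟨c, hc, rfl⟩ := Flat.mem_tree_V.1 hv
      have hcF := ((Flat.mem_nodesBelow_root hA hF hr).1 hc).1
      rw [hI c hc] at hx
      cases hp : c.head with
      | none => rw [hp] at hx; simp at hx
      | some p =>
        rw [hp] at hx
        have hpc := Flat.mem_occ.2 (Or.inr hp)
        have hxp := hJ.vars p (hW.occ c hcF p hpc) x hx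
        obtain ⟨d, hd, hu, hpd⟩ := Flat.up_isSome hW hC hb hcF hp
        have hd' := Flat.up_mem_nodesBelow hA hF hr hc hu
        refine ⟨⟨c.id, hv, .refl, ?_⟩, d.id, Flat.mem_tree_V.2 ⟨d, hd', rfl⟩, fun hbel => ?_, ?_⟩
        · rw [Flat.tree_label hA hc]
          exact hA.con_vars c hcF p hpc x hxp
        · obtain ⟨e, he, h1, h2⟩ := (Flat.tree_below hA hF hr hc).1 hbel
          obtain rfl := Flat.id_inj_nodesBelow hA hF hr he hd' h1
          exact hF.not_below_up hu h2
        · rw [Flat.tree_label hA hd']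
          exact hA.con_vars d hd p (Flat.mem_occ.2 (Or.inl hpd)) x hxp
  · intro Is hIs
    rw [List.forall₂_map_left_iff, List.forall₂_iff_zip] at hIs
    obtain ⟨hlen, hIs⟩ := hIs
    have hnd : F.roots.Nodup := (hA.ids.of_map _).filter _
    have hroot : ∀ c ∈ F.1, ∃ h ∈ F.roots, ∃ I, (h, I) ∈ F.roots.zip Is ∧ c ∈ F.nodesBelow h := by
      intro c hc
      obtain ⟨h, hr, hbel⟩ := hF.exists_root hW hC hb hc
      obtain ⟨I, hI⟩ := exists_mem_zip hlen hr
      exact ⟨h, hr, I, hI, (Flat.mem_nodesBelow_root hA hF hr).2 ⟨hc, hbel⟩⟩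
    have hzs : ∀ {h I}, (h, I) ∈ F.roots.zip Is → h ∈ F.roots := fun h => (List.of_mem_zip h).1
    have hJ : ∀ {h I}, (h, I) ∈ F.roots.zip Is → ∀ {c}, c ∈ F.nodesBelow h →
        ∀ {p}, c.head = some p → table (F.treeEntries Is) p = table I c.id := by
      intro h I hI c hc p hp
      refine table_eq_of_unique (Flat.mem_treeEntries.2 ⟨h, I, c, hc, hI, rfl, hp⟩) ?_
      intro φ hφ
      obtain ⟨h', I', c', hc', hI', rfl, hp'⟩ := Flat.mem_treeEntries.1 hφ
      have h1 := (Flat.mem_nodesBelow_root hA hF (hzs hI)).1 hc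
      have h2 := (Flat.mem_nodesBelow_root hA hF (hzs hI')).1 hc'
      obtain rfl := hh.eq h1.1 h2.1 hp hp'
      obtain rfl := Flat.root_unique (Flat.mem_roots.1 (hzs hI)).2 (Flat.mem_roots.1 (hzs hI')).2
        h1.2 h2.2
      rw [zip_unique hnd hI hI']
    refine ⟨fun p hp => ?_, fun p hp x hx => ?_, fun c hc M hM a h1 h2 => ?_⟩
    · obtain ⟨c, hc, hcp⟩ := hC.head p hp
      obtain ⟨h, hr, I, hI, hch⟩ := hroot c hc
      rw [hJ hI hch hcp]
      exact (hIs hI).mem c.id (Flat.mem_tree_V.2 ⟨c, hch, rfl⟩)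
    · obtain ⟨c, hc, hcp⟩ := hC.head p hp
      obtain ⟨h, hr, I, hI, hch⟩ := hroot c hc
      rw [hJ hI hch hcp] at hx
      obtain ⟨⟨v, hv, hcv, hxv⟩, w, hw, hcw, hxw⟩ :=
        (hIs hI).vars c.id (Flat.mem_tree_V.2 ⟨c, hch, rfl⟩) x hx
      obtain ⟨d, hd, rfl, hcd⟩ := (Flat.tree_below hA hF hr hch).1 hcv
      obtain ⟨e, he, rfl⟩ := Flat.mem_tree_V.1 hw
      have hce : ¬ F.Below c e := fun h3 => hcw ((Flat.tree_below hA hF hr hch).2 ⟨e, he, rfl, h3⟩)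
      rw [Flat.tree_label hA hd] at hxv
      rw [Flat.tree_label hA he] at hxw
      have hdF := ((Flat.mem_nodesBelow_root hA hF hr).1 hd).1
      have heF := ((Flat.mem_nodesBelow_root hA hF hr).1 he).1
      -- Here `d` lies below `c` and `e` does not, and the two share a symbol, so one is the parent
      -- of the other. The only edge leaving the subtree of `c` is the one from `c` upwards, so the
      -- symbol is the head of `c`.
      obtain ⟨q, hq, hqd, hqe, hxq⟩ := hA.local hdF heF (by rintro rfl; exact hce hcd) hxv hxw
      rcases hb.up_of_occ hh hdF heF (by rintro rfl; exact hce hcd) hqd hqe with ⟨h3, h4⟩ | ⟨h3, h4⟩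
      · rcases hcd.cases_head with rfl | ⟨e', he', h5⟩
        · rw [h3, Option.some_inj] at hcp
          rwa [← hcp]
        · rw [h4, Option.some_inj] at he'
          rw [← he'] at h5
          exact absurd h5 hce
      · exact absurd (.head h4 hcd) hce
    · obtain ⟨h, hr, I, hI, hch⟩ := hroot c hc
      have h3 : M.Sat (table I c.id) a := by
        refine (hIs hI).entails c.id (Flat.mem_tree_V.2 ⟨c, hch, rfl⟩) M hM a ?_
        rintro ψ (rfl | ⟨w, hw, rfl⟩)
        · rwa [Flat.tree_label hA hch]
        · obtain ⟨d, hd, e, hu, h4, rfl⟩ := Flat.tree_E.1 hw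
          obtain rfl := Flat.id_inj_nodesBelow hA hF hr (Flat.up_mem_nodesBelow hA hF hr hd hu) hch h4
          obtain ⟨-, q, hq, hqe⟩ := Flat.of_up hu
          rw [← hJ hI hd hq]
          exact h2 q hqe
      cases hp : c.head with
      | none =>
        have h4 := ((Flat.mem_nodesBelow_root hA hF hr).1 hch).2
        rw [← Flat.eq_of_below_root hp h4] at h3
        have h5 : table I h.id = ⊥ := (hIs hI).root
        rwa [h5] at h3
      | some p =>
        show M.Sat (table _ p) a
        rwa [hJ hI hch hp]

end

/-! ### Linear clauses to restricted DAGs -/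

section
variable {L : FirstOrder.Language.{u, v}}

/-- The entry node. -/
def enNode : Data := .cons .nil .nil

/-- The exit node. -/
def exNode : Data := .cons .nil (.cons .nil .nil)

/-- The node of a relation symbol. -/
def symNode (q : Data) : Data := .cons (.ofNat 1) q

namespace FClause

def source (c : FClause L) : Data := c.body.head?.elim enNode symNode

def target (c : FClause L) : Data := c.head.elim exNode symNode

/-- The identifier keeps the clauses apart. The source is recorded so that the rank in the proof of
acyclicity can be read off the node. -/
def node (c : FClause L) : Data := .cons (.ofNat 2) (.cons c.id c.source)

theorem source_cases (c : FClause L) :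
    (c.body = [] ∧ c.source = enNode) ∨ ∃ q ∈ c.body, c.source = symNode q := by
  unfold source
  cases h : c.body with
  | nil => exact Or.inl ⟨rfl, rfl⟩
  | cons q l => exact Or.inr ⟨q, by simp, rfl⟩

theorem target_cases (c : FClause L) :
    (c.head = none ∧ c.target = exNode) ∨ ∃ p, c.head = some p ∧ c.target = symNode p := by
  unfold target
  cases h : c.head with
  | none => exact Or.inl ⟨rfl, rfl⟩
  | some p => exact Or.inr ⟨p, rfl, rfl⟩

theorem source_head (c : FClause L) : c.source.head ≠ .ofNat 2 := by
  rcases c.source_cases with ⟨-, h⟩ | ⟨q, -, h⟩ <;> rw [h] <;> simp [enNode, symNode, Data.head, Data.ofNat]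

theorem source_ne_exNode (c : FClause L) : c.source ≠ exNode := by
  rcases c.source_cases with ⟨-, h⟩ | ⟨q, -, h⟩ <;> rw [h] <;> simp [exNode, enNode, symNode, Data.ofNat]

end FClause

namespace Flat

/-- Clauses with the same body and head would give parallel edges, so each clause has a node of its
own between source and target. Both edges at it carry the constraint, which permits any variable of
the constraint there. The edges labelled `⊥` only make the graph connected: they entail everything
and have no variables. -/
def dag (F : Flat L) : DagProblem L where
  nodes := (enNode, ⊤) :: (exNode, ⊤) :: (F.keys.map (fun q => (symNode q, ⊤)) ++
    F.1.map fun c => (c.node, ⊤))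
  edges := ((enNode, exNode), ⊥) :: (F.keys.map (fun q => ((enNode, symNode q), ⊥)) ++
    (F.1.map (fun c => ((c.source, c.node), c.con)) ++ F.1.map fun c => ((c.node, c.target), c.con)))
  en := enNode
  ex := exNode

/-- The table of the labels of the nodes that belongs to a solution of the clauses. -/
def dagAnswer (F : Flat L) (J : Data → Fml L) : List (Data × Fml L) :=
  (enNode, ⊤) :: (exNode, ⊥) :: (F.keys.map (fun q => (symNode q, J q)) ++
    F.1.map fun c => (c.node, c.head.elim ⊥ J))

variable {F : Flat L}

theorem dag_V (F : Flat L) : F.dag.V = enNode :: exNode :: (F.keys.map symNode ++ F.1.map FClause.node) := by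
  simp [DagProblem.V, dag, Function.comp_def]

theorem mem_dag_V {v : Data} : v ∈ F.dag.V ↔
    v = enNode ∨ v = exNode ∨ (∃ q ∈ F.keys, symNode q = v) ∨ ∃ c ∈ F.1, c.node = v := by
  simp [dag_V]

theorem Apart.dag_V_nodup (hA : F.Apart) : F.dag.V.Nodup := by
  rw [dag_V, List.nodup_cons, List.nodup_cons, List.nodup_append']
  refine ⟨?_, ?_, hA.keys_nodup.map fun p q h => by simpa [symNode] using h, ?_, ?_⟩
  · simp [enNode, exNode, symNode, FClause.node, Data.ofNat]
  · simp [exNode, symNode, FClause.node, Data.ofNat]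
  · refine List.Nodup.of_map (fun v => v.tail.head) ?_
    rw [List.map_map]
    exact hA.ids
  · intro x hx hx'
    obtain ⟨q, -, rfl⟩ := List.mem_map.1 hx
    obtain ⟨c, -, h⟩ := List.mem_map.1 hx'
    simp [symNode, FClause.node, Data.ofNat] at h

theorem mem_dag_edges {e : (Data × Data) × Fml L} : e ∈ F.dag.edges ↔
    e = ((enNode, exNode), ⊥) ∨ (∃ q ∈ F.keys, ((enNode, symNode q), (⊥ : Fml L)) = e) ∨
    (∃ c ∈ F.1, ((c.source, c.node), c.con) = e) ∨ ∃ c ∈ F.1, ((c.node, c.target), c.con) = e := by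
  simp [dag]

theorem Apart.dag_edges_nodup (hA : F.Apart) : (F.dag.edges.map Prod.fst).Nodup := by
  have h1 : F.dag.edges.map Prod.fst = (enNode, exNode) :: (F.keys.map (fun q => (enNode, symNode q)) ++
    (F.1.map (fun c => (c.source, c.node)) ++ F.1.map fun c => (c.node, c.target))) := by
    simp [dag, Function.comp_def]
  rw [h1, List.nodup_cons, List.nodup_append', List.nodup_append']
  refine ⟨?_, hA.keys_nodup.map fun p q h => by simpa [symNode] using h, ⟨?_, ?_, ?_⟩, ?_⟩
  · simp [enNode, exNode, symNode, FClause.node, Data.ofNat]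
  · refine List.Nodup.of_map (fun v : Data × Data => v.2.tail.head) ?_
    rw [List.map_map]
    exact hA.ids
  · refine List.Nodup.of_map (fun v : Data × Data => v.1.tail.head) ?_
    rw [List.map_map]
    exact hA.ids
  · intro x hx hx'
    obtain ⟨c, -, rfl⟩ := List.mem_map.1 hx
    obtain ⟨d, -, h⟩ := List.mem_map.1 hx'
    exact c.source_head (by rw [← (Prod.mk.inj h).1]; rfl)
  · intro x hx hx'
    obtain ⟨q, -, rfl⟩ := List.mem_map.1 hx
    simp [enNode, symNode, FClause.node, Data.ofNat] at hx'

theorem Acyclic.exists_symbol_rank (hF : F.Acyclic) {Con : ConstraintLanguage L} (hW : F.WF Con) :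
    ∃ r : Data → ℕ, (∀ p, r p ≤ F.keys.length) ∧ ∀ p q, F.Dep p q → r q < r p :=
  HornInterp.exists_rank hF fun _ q ⟨c, hc, _, hq⟩ => hW.occ c hc q (mem_occ.2 (Or.inl hq))

/-- All edges increase a rank built from a rank of the symbols in which bodies are below heads. -/
theorem dag_acyclic {Con : ConstraintLanguage L} (hW : F.WF Con) (hF : F.Acyclic)
    (v : Data) : ¬ Relation.TransGen F.dag.E v v := by
  obtain ⟨r, h1, h2⟩ := hF.exists_symbol_rank hW
  -- Ranks of symbols are doubled to leave room for the clause nodes, which come one above their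
  -- source. The entry has rank 0; symbols reach at most `2 * F.keys.length + 2` and clause nodes
  -- one more, so the exit is above all.
  let ρ₀ : Data → ℕ := fun v => if v.head = .ofNat 1 then 2 * r v.tail + 2 else 0
  let ρ : Data → ℕ := fun v => if v = exNode then 2 * F.keys.length + 4 else
    if v.head = .ofNat 2 then ρ₀ v.tail.tail + 1 else ρ₀ v
  have hen : ρ enNode = 0 := by simp [ρ, ρ₀, enNode, exNode, Data.head, Data.ofNat]
  have hex : ρ exNode = 2 * F.keys.length + 4 := by simp [ρ]
  have hsym : ∀ q, ρ (symNode q) = 2 * r q + 2 := fun q => by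
    simp [ρ, ρ₀, symNode, exNode, Data.head, Data.tail, Data.ofNat]
  have hsrc : ∀ c : FClause L, ρ c.source = ρ₀ c.source := fun c => by
    simp [ρ, c.source_head, c.source_ne_exNode]
  have hcl : ∀ c : FClause L, ρ c.node = ρ c.source + 1 := fun c => by
    rw [hsrc]
    simp [ρ, FClause.node, exNode, Data.head, Data.tail, Data.ofNat]
  have key : ∀ v w, F.dag.E v w → ρ v < ρ w := by
    intro v w hE
    obtain ⟨⟨⟨v, w⟩, φ⟩, he, h⟩ := List.mem_map.1 hE
    simp only [Prod.mk.injEq] at h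
    obtain ⟨rfl, rfl⟩ := h
    rcases mem_dag_edges.1 he with h | ⟨q, -, h⟩ | ⟨c, -, h⟩ | ⟨c, hc, h⟩ <;>
      simp only [Prod.mk.injEq] at h <;> obtain ⟨⟨rfl, rfl⟩, -⟩ := h
    · omega
    · have := hsym q; omega
    · have := hcl c; omega
    · rcases c.target_cases with ⟨-, h⟩ | ⟨p, hp, h⟩
      · rcases c.source_cases with ⟨-, h'⟩ | ⟨q, -, h'⟩
        · rw [hcl, h, h', hen, hex]; omega
        · have := h1 q
          rw [hcl, h, h', hsym, hex]; omega
      · rcases c.source_cases with ⟨-, h'⟩ | ⟨q, hq, h'⟩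
        · rw [hcl, h, h', hen, hsym]; omega
        · have := h2 p q ⟨c, hc, hp, hq⟩
          rw [hcl, h, h', hsym, hsym]; omega
  have key' : ∀ v w, Relation.TransGen F.dag.E v w → ρ v < ρ w := by
    intro v w h
    induction h with
    | single h => exact key _ _ h
    | tail _ h ih => exact ih.trans (key _ _ h)
  exact fun h => lt_irrefl _ (key' _ _ h)

theorem source_mem {Con : ConstraintLanguage L} (hW : F.WF Con) {c : FClause L} (hc : c ∈ F.1) :
    c.source = enNode ∨ ∃ q ∈ F.keys, symNode q = c.source := by
  rcases c.source_cases with ⟨-, h⟩ | ⟨q, hq, h⟩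
  · exact Or.inl h
  · exact Or.inr ⟨q, hW.occ c hc q (mem_occ.2 (Or.inl hq)), h.symm⟩

theorem target_mem {Con : ConstraintLanguage L} (hW : F.WF Con) {c : FClause L} (hc : c ∈ F.1) :
    c.target = exNode ∨ ∃ q ∈ F.keys, symNode q = c.target := by
  rcases c.target_cases with ⟨-, h⟩ | ⟨q, hq, h⟩
  · exact Or.inl h
  · exact Or.inr ⟨q, hW.occ c hc q (mem_occ.2 (Or.inr hq)), h.symm⟩

/-- Every node is connected to the entry: symbols and the exit by the edges labelled `⊥`, clause
nodes through their source. -/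
theorem dag_isConnectedDag {Con : ConstraintLanguage L} (hW : F.WF Con) (hA : F.Apart)
    (hF : F.Acyclic) : F.dag.IsConnectedDag := by
  have hE : ∀ {e}, e ∈ F.dag.edges → F.dag.E e.1.1 e.1.2 := fun {e} he => List.mem_map.2 ⟨e, he, rfl⟩
  have hconn : ∀ v ∈ F.dag.V, Relation.EqvGen F.dag.E enNode v := by
    have hsym : ∀ q ∈ F.keys, Relation.EqvGen F.dag.E enNode (symNode q) := fun q hq =>
      .rel _ _ (hE (mem_dag_edges.2 (Or.inr (Or.inl ⟨q, hq, rfl⟩))))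
    intro v hv
    rcases mem_dag_V.1 hv with rfl | rfl | ⟨q, hq, rfl⟩ | ⟨c, hc, rfl⟩
    · exact .refl _
    · exact .rel _ _ (hE (mem_dag_edges.2 (Or.inl rfl)))
    · exact hsym q hq
    · refine .trans _ c.source _ ?_ (.rel _ _ (hE (mem_dag_edges.2 (Or.inr (Or.inr (Or.inl ⟨c, hc, rfl⟩))))))
      rcases source_mem hW hc with h | ⟨q, hq, h⟩
      · rw [h]; exact .refl _
      · rw [← h]; exact hsym q hq
  refine ⟨hA.dag_V_nodup, hA.dag_edges_nodup, fun v w hE => ?_, mem_dag_V.2 (Or.inl rfl),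
    mem_dag_V.2 (Or.inr (Or.inl rfl)), dag_acyclic hW hF, fun v hv w hw =>
      .trans _ _ _ (.symm _ _ (hconn v hv)) (hconn w hw)⟩
  obtain ⟨⟨⟨v, w⟩, φ⟩, he, h⟩ := List.mem_map.1 hE
  simp only [Prod.mk.injEq] at h
  obtain ⟨rfl, rfl⟩ := h
  simp only [mem_dag_V]
  rcases mem_dag_edges.1 he with h | ⟨q, hq, h⟩ | ⟨c, hc, h⟩ | ⟨c, hc, h⟩ <;>
    simp only [Prod.mk.injEq] at h <;> obtain ⟨⟨rfl, rfl⟩, -⟩ := h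
  · simp
  · exact ⟨Or.inl rfl, Or.inr (Or.inr (Or.inl ⟨q, hq, rfl⟩))⟩
  · have := source_mem hW hc
    exact ⟨this.imp_right fun h => Or.inr (Or.inl h), Or.inr (Or.inr (Or.inr ⟨c, hc, rfl⟩))⟩
  · have := target_mem hW hc
    exact ⟨Or.inr (Or.inr (Or.inr ⟨c, hc, rfl⟩)), Or.inr (this.imp_right Or.inl)⟩

theorem dag_labelV {v : Data} (hA : F.Apart) (hv : v ∈ F.dag.V) : F.dag.labelV v = ⊤ := by
  refine table_eq_of_mem hA.dag_V_nodup ?_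
  rcases mem_dag_V.1 hv with rfl | rfl | ⟨q, hq, rfl⟩ | ⟨c, hc, rfl⟩
  · simp [dag]
  · simp [dag]
  · exact List.mem_cons_of_mem _ (List.mem_cons_of_mem _ (List.mem_append_left _
      (List.mem_map.2 ⟨q, hq, rfl⟩)))
  · exact List.mem_cons_of_mem _ (List.mem_cons_of_mem _ (List.mem_append_right _
      (List.mem_map.2 ⟨c, hc, rfl⟩)))

theorem dag_E_iff (hA : F.Apart) {v w : Data} : F.dag.E v w ↔
    (v = enNode ∧ w = exNode ∧ F.dag.labelE v w = ⊥) ∨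
    (∃ q ∈ F.keys, v = enNode ∧ w = symNode q ∧ F.dag.labelE v w = ⊥) ∨
    (∃ c ∈ F.1, v = c.source ∧ w = c.node ∧ F.dag.labelE v w = c.con) ∨
    ∃ c ∈ F.1, v = c.node ∧ w = c.target ∧ F.dag.labelE v w = c.con := by
  rw [DagProblem.E_iff hA.dag_edges_nodup, mem_dag_edges]
  simp only [Prod.mk.injEq, and_assoc, eq_comm]

theorem dagAnswer_eq (hA : F.Apart) (J : Data → Fml L) :
    table (F.dagAnswer J) enNode = ⊤ ∧ table (F.dagAnswer J) exNode = ⊥ ∧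
    (∀ q ∈ F.keys, table (F.dagAnswer J) (symNode q) = J q) ∧
    ∀ c ∈ F.1, table (F.dagAnswer J) c.node = c.head.elim ⊥ J := by
  have h : ((F.dagAnswer J).map Prod.fst).Nodup := by
    have : (F.dagAnswer J).map Prod.fst = F.dag.V := by
      rw [dag_V]; simp [dagAnswer, Function.comp_def]
    rw [this]
    exact hA.dag_V_nodup
  refine ⟨table_eq_of_mem h (by simp [dagAnswer]), table_eq_of_mem h (by simp [dagAnswer]),
    fun q hq => table_eq_of_mem h ?_, fun c hc => table_eq_of_mem h ?_⟩
  · exact List.mem_cons_of_mem _ (List.mem_cons_of_mem _ (List.mem_append_left _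
      (List.mem_map.2 ⟨q, hq, rfl⟩)))
  · exact List.mem_cons_of_mem _ (List.mem_cons_of_mem _ (List.mem_append_right _
      (List.mem_map.2 ⟨c, hc, rfl⟩)))

end Flat

variable [Coding L]

/-- At the node of a symbol stands its value, at the node of a clause the value of its head. The
edge into a clause node then expresses the clause, and the edge out of it is trivial. -/
theorem flat_reduces_dag {S : Set (Interp.{u, v, w} L)} {Con : ConstraintLanguage L} :
    PolyReducesToSeq (flatSolving S Con fun F => F.Normal ∧ F.Linear)
      (dagInterpolation Coding.coding S Con) := by
  let g : Flat L → List (List (Data × Fml L)) → List (Data × Fml L) := fun F Is =>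
    F.keys.map fun q => (q, table (Is.head?.getD []) (symNode q))
  have hf : PT fun F : Flat L => [F.dag] := by
    unfold Flat.dag FClause.node FClause.source FClause.target symNode; fun_prop
  have hg : PT fun a : Flat L × List (List (Data × Fml L)) => g a.1 a.2 := by
    simp only [g, symNode]; fun_prop
  unfold dagInterpolation flatSolving
  refine PolyReducesToSeq.intro (fun F : Flat L => [F.dag]) g (hf.comp PT.subtype_val)
    (hg.comp PT.subtype_val) ?_
  rintro F ⟨hW, ⟨hA, hC, hF⟩, hl⟩
  have hD := Flat.dag_isConnectedDag hW hA hF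
  simp only [List.mem_singleton, forall_eq, List.forall₂_cons_left_iff, List.forall₂_nil_left_iff,
    exists_and_left]
  refine ⟨⟨hD, fun v hv => ?_, fun v w hE => ?_⟩, ?_, ?_⟩
  · rw [Flat.dag_labelV hA hv]; exact ConstraintLanguage.top_mem
  · rcases (Flat.dag_E_iff hA).1 hE with ⟨-, -, h⟩ | ⟨q, hq, -, -, h⟩ | ⟨c, hc, -, -, h⟩ |
      ⟨c, hc, -, -, h⟩ <;> rw [h]
    · exact Con.falsum_mem
    · exact Con.falsum_mem
    · exact hW.mem c hc
    · exact hW.mem c hc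
  · rintro ⟨J, hJ⟩
    obtain ⟨hen, hex, hsym, hnode⟩ := Flat.dagAnswer_eq hA (table J)
    refine ⟨F.dagAnswer (table J), fun v hv => ?_, hen, hex, fun v w hE M hM a h => ?_,
      fun v hv x hx => ?_⟩
    · rcases Flat.mem_dag_V.1 hv with rfl | rfl | ⟨q, hq, rfl⟩ | ⟨c, hc, rfl⟩
      · rw [hen]; exact ConstraintLanguage.top_mem
      · rw [hex]; exact Con.falsum_mem
      · rw [hsym q hq]; exact hJ.mem q hq
      · rw [hnode c hc]
        cases hp : c.head with
        | none => exact Con.falsum_mem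
        | some p => exact hJ.mem p (hW.occ c hc p (Flat.mem_occ.2 (Or.inr hp)))
    · rw [sat_inf, Flat.dag_labelV hA (hD.2.2.1 v w hE).2]
      refine ⟨?_, sat_top⟩
      have h' := h _ rfl
      simp only [sat_inf] at h'
      obtain ⟨⟨h1, -⟩, h2⟩ := h'
      rcases (Flat.dag_E_iff hA).1 hE with ⟨-, -, h⟩ | ⟨q, hq, -, -, h⟩ | ⟨c, hc, rfl, rfl, h⟩ |
        ⟨c, hc, rfl, rfl, h⟩ <;> rw [h] at h2
      · exact absurd h2 (by simp)
      · exact absurd h2 (by simp)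
      · rw [hnode c hc]
        refine hJ.valid c hc M hM a h2 fun b hb => ?_
        have hbo := hl.body_eq hc hb
        have : c.source = symNode b := by simp [FClause.source, hbo]
        rwa [this, hsym b (hW.occ c hc b (Flat.mem_occ.2 (Or.inl hb)))] at h1
      · rw [hnode c hc] at h1
        rcases c.target_cases with ⟨hp, ht⟩ | ⟨p, hp, ht⟩
        · rw [ht, hex]; rwa [hp] at h1
        · rw [ht, hsym p (hW.occ c hc p (Flat.mem_occ.2 (Or.inr hp)))]; rwa [hp] at h1
    · have hin : ∀ c ∈ F.1, F.dag.E c.source c.node ∧ F.dag.labelE c.source c.node = c.con := by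
        intro c hc
        have : ((c.source, c.node), c.con) ∈ F.dag.edges :=
          Flat.mem_dag_edges.2 (Or.inr (Or.inr (Or.inl ⟨c, hc, rfl⟩)))
        exact ⟨List.mem_map.2 ⟨_, this, rfl⟩, DagProblem.labelE_eq hA.dag_edges_nodup this⟩
      have hout : ∀ c ∈ F.1, F.dag.E c.node c.target ∧ F.dag.labelE c.node c.target = c.con := by
        intro c hc
        have : ((c.node, c.target), c.con) ∈ F.dag.edges :=
          Flat.mem_dag_edges.2 (Or.inr (Or.inr (Or.inr ⟨c, hc, rfl⟩)))
        exact ⟨List.mem_map.2 ⟨_, this, rfl⟩, DagProblem.labelE_eq hA.dag_edges_nodup this⟩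
      rcases Flat.mem_dag_V.1 hv with rfl | rfl | ⟨q, hq, rfl⟩ | ⟨c, hc, rfl⟩
      · rw [hen] at hx; simp at hx
      · rw [hex] at hx; simp at hx
      · rw [hsym q hq] at hx
        have hxq := hJ.vars q hq x hx
        obtain ⟨c, hc, hcq⟩ := hC.head q hq
        obtain ⟨d, hd, hdq⟩ := hC.body q hq
        have h1 : c.target = symNode q := by simp [FClause.target, hcq]
        have h2 : d.source = symNode q := by simp [FClause.source, hl.body_eq hd hdq]
        have h3 := hout c hc
        have h4 := hin d hd
        rw [h1] at h3
        rw [h2] at h4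
        refine ⟨⟨c.node, h3.1, ?_⟩, d.node, h4.1, ?_⟩
        · rw [h3.2]
          exact hA.con_vars c hc q (Flat.mem_occ.2 (Or.inr hcq)) x hxq
        · rw [h4.2]
          exact hA.con_vars d hd q (Flat.mem_occ.2 (Or.inl hdq)) x hxq
      · rw [hnode c hc] at hx
        cases hp : c.head with
        | none => rw [hp] at hx; simp at hx
        | some p =>
          rw [hp] at hx
          have hpo := Flat.mem_occ.2 (Or.inr hp)
          have hxc := hA.con_vars c hc p hpo x (hJ.vars p (hW.occ c hc p hpo) x hx)
          exact ⟨⟨c.source, (hin c hc).1, (hin c hc).2 ▸ hxc⟩, c.target, (hout c hc).1,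
            (hout c hc).2 ▸ hxc⟩
  · rintro _ ⟨I, hI, _, rfl, rfl⟩
    have hJ : ∀ q ∈ F.keys, table (g F [I]) q = table I (symNode q) := fun q hq =>
      table_map (fun q => table I (symNode q)) hq
    have hent : ∀ e ∈ F.dag.edges, ∀ M ∈ S, ∀ a : Data → M.U, M.Sat (table I e.1.1) a →
        M.Sat e.2 a → M.Sat (table I e.1.2) a := by
      intro e he M hM a h1 h2
      have hE : F.dag.E e.1.1 e.1.2 := List.mem_map.2 ⟨e, he, rfl⟩
      refine (sat_inf.1 (hI.entails _ _ hE M hM a ?_)).1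
      rintro ψ rfl
      rw [sat_inf, sat_inf, Flat.dag_labelV hA (hD.2.2.1 _ _ hE).1,
        DagProblem.labelE_eq hA.dag_edges_nodup he]
      exact ⟨⟨h1, sat_top⟩, h2⟩
    refine ⟨fun q hq => ?_, fun q hq x hx => ?_, fun c hc M hM a h1 h2 => ?_⟩
    · rw [hJ q hq]
      exact hI.mem _ (Flat.mem_dag_V.2 (Or.inr (Or.inr (Or.inl ⟨q, hq, rfl⟩))))
    · rw [hJ q hq] at hx
      obtain ⟨⟨v, hv, hxv⟩, w, hw, hxw⟩ :=
        hI.vars _ (Flat.mem_dag_V.2 (Or.inr (Or.inr (Or.inl ⟨q, hq, rfl⟩)))) x hx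
      have hc : ∃ c ∈ F.1, c.head = some q ∧ x ∈ fv c.con := by
        rcases (Flat.dag_E_iff hA).1 hv with ⟨-, -, h⟩ | ⟨_, _, -, -, h⟩ | ⟨c, hc, -, h', h⟩ |
          ⟨c, hc, -, h', h⟩ <;> rw [h] at hxv
        · simp at hxv
        · simp at hxv
        · simp [symNode, FClause.node, Data.ofNat] at h'
        · refine ⟨c, hc, ?_, hxv⟩
          rcases c.target_cases with ⟨-, ht⟩ | ⟨p, hp, ht⟩
          · rw [ht] at h'; simp [symNode, exNode, Data.ofNat] at h'
          · rw [ht] at h'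
            rw [hp, (Data.cons.inj h').2]
      have hd : ∃ d ∈ F.1, q ∈ d.body ∧ x ∈ fv d.con := by
        rcases (Flat.dag_E_iff hA).1 hw with ⟨-, -, h⟩ | ⟨_, _, -, -, h⟩ | ⟨c, hc, h', -, h⟩ |
          ⟨c, hc, h', -, h⟩ <;> rw [h] at hxw
        · simp at hxw
        · simp at hxw
        · refine ⟨c, hc, ?_, hxw⟩
          rcases c.source_cases with ⟨-, ht⟩ | ⟨p, hp, ht⟩
          · rw [ht] at h'; simp [symNode, enNode, Data.ofNat] at h'
          · rw [ht] at h'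
            rwa [(Data.cons.inj h').2]
        · simp [symNode, FClause.node, Data.ofNat] at h'
      obtain ⟨c, hc, hcq, hxc⟩ := hc
      obtain ⟨d, hd, hdq, hxd⟩ := hd
      have hne : c ≠ d := by
        rintro rfl
        exact hF q (.single ⟨c, hc, hcq, hdq⟩)
      -- The clause `c` has head `q` and `d` has body `q`. A symbol common to both is `q`: in the
      -- body of `d` there is no other, in the head of `c` neither, and from the head of `d` to the
      -- body of `c` there would be a cycle through `q`.
      obtain ⟨p, hp, hpc, hpd, hxp⟩ := hA.local hc hd hne hxc hxd
      rw [Flat.mem_occ] at hpc hpd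
      have hpq : p = q := by
        rcases hpc with hpc | hpc
        · rcases hpd with hpd | hpd
          · rw [hl.body_eq hd hdq] at hpd
            exact List.mem_singleton.1 hpd
          · exact absurd (.tail (.single ⟨c, hc, hcq, hpc⟩) ⟨d, hd, hpd, hdq⟩) (hF q)
        · rw [hcq] at hpc
          exact (Option.some_inj.1 hpc).symm
      rwa [← hpq]
    · have h3 : M.Sat (table I c.source) a := by
        rcases c.source_cases with ⟨-, h⟩ | ⟨q, hq, h⟩
        · rw [h]
          have : table I enNode = ⊤ := hI.entry
          rw [this]; exact sat_top
        · rw [h, ← hJ q (hW.occ c hc q (Flat.mem_occ.2 (Or.inl hq)))]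
          exact h2 q hq
      -- The constraint is used twice, once for each half of the path through the clause node.
      have h4 := hent _ (Flat.mem_dag_edges.2 (Or.inr (Or.inr (Or.inl ⟨c, hc, rfl⟩)))) M hM a h3 h1
      have h5 := hent _ (Flat.mem_dag_edges.2 (Or.inr (Or.inr (Or.inr ⟨c, hc, rfl⟩)))) M hM a h4 h1
      rcases c.target_cases with ⟨hp, ht⟩ | ⟨p, hp, ht⟩
      · rw [hp]
        have : table I exNode = ⊥ := hI.exit
        dsimp only at h5
        rwa [ht, this] at h5
      · rw [hp]
        show M.Sat (table _ p) a
        rw [hJ p (hW.occ c hc p (Flat.mem_occ.2 (Or.inr hp)))]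
        dsimp only at h5
        rwa [ht] at h5

end

/-! ### Body-disjoint clauses to and/or-trees -/

section
variable {L : FirstOrder.Language.{u, v}}

namespace AndOr

/-- A disjunction of and/or-trees. -/
def ors (l : List (AndOr L)) : AndOr L := l.foldr (or none) (leaf none ⊥)

/-- The conjunction of a constraint and a list of and/or-trees. -/
def ands (φ : Fml L) (l : List (AndOr L)) : AndOr L := l.foldr (and none) (leaf none φ)

theorem mem_leaves_ors {l : List (AndOr L)} {ψ : Fml L} :
    ψ ∈ (ors l).leaves ↔ ψ = ⊥ ∨ ∃ t ∈ l, ψ ∈ t.leaves := by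
  induction l with
  | nil => simp [ors, leaves]
  | cons t l ih =>
    change ψ ∈ t.leaves ++ (ors l).leaves ↔ _
    simp only [List.mem_append, ih, List.mem_cons, exists_eq_or_imp]
    tauto

theorem mem_leaves_ands {l : List (AndOr L)} {φ ψ : Fml L} :
    ψ ∈ (ands φ l).leaves ↔ ψ = φ ∨ ∃ t ∈ l, ψ ∈ t.leaves := by
  induction l with
  | nil => simp [ands, leaves]
  | cons t l ih =>
    change ψ ∈ t.leaves ++ (ands φ l).leaves ↔ _
    simp only [List.mem_append, ih, List.mem_cons, exists_eq_or_imp]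
    tauto

theorem marks_ors (l : List (AndOr L)) : (ors l).marks = l.flatMap marks := by
  induction l with
  | nil => rfl
  | cons t l ih =>
    rw [List.flatMap_cons, ← ih]
    simp [ors, marks, subs, mark, List.filterMap_cons]

theorem marks_ands (φ : Fml L) (l : List (AndOr L)) : (ands φ l).marks = l.flatMap marks := by
  induction l with
  | nil => rfl
  | cons t l ih =>
    rw [List.flatMap_cons, ← ih]
    simp [ands, marks, subs, mark, List.filterMap_cons]

/-- The spine of the disjunction has no selected positions, so selected subformulae lie inside the
members. -/
theorem mem_subs_ors {l : List (AndOr L)} {s : AndOr L} {p : Data} (hs : s.mark = some p) :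
    s ∈ (ors l).subs ↔ ∃ t ∈ l, s ∈ t.subs := by
  induction l with
  | nil =>
    simp only [ors, List.foldr_nil, subs, List.mem_singleton, List.not_mem_nil, false_and,
      exists_false, iff_false]
    rintro rfl
    simp [mark] at hs
  | cons t l ih =>
    change s ∈ (or none t (ors l)) :: (t.subs ++ (ors l).subs) ↔ _
    simp only [List.mem_cons, List.mem_append, ih, exists_eq_or_imp, or_iff_right_iff_imp]
    rintro rfl
    simp [mark] at hs

theorem mem_subs_ands {l : List (AndOr L)} {φ : Fml L} {s : AndOr L} {p : Data}
    (hs : s.mark = some p) : s ∈ (ands φ l).subs ↔ ∃ t ∈ l, s ∈ t.subs := by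
  induction l with
  | nil =>
    simp only [ands, List.foldr_nil, subs, List.mem_singleton, List.not_mem_nil, false_and,
      exists_false, iff_false]
    rintro rfl
    simp [mark] at hs
  | cons t l ih =>
    change s ∈ (and none t (ands φ l)) :: (t.subs ++ (ands φ l).subs) ↔ _
    simp only [List.mem_cons, List.mem_append, ih, exists_eq_or_imp, or_iff_right_iff_imp]
    rintro rfl
    simp [mark] at hs

theorem cut_ors (p : Data) (l : List (AndOr L)) : (ors l).cut p = ors (l.map (cut p)) := by
  induction l with
  | nil => simp [ors, cut]
  | cons t l ih =>
    change cut p (or none t (ors l)) = or none (t.cut p) (ors (l.map (cut p)))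
    simp [cut, ih]

theorem cut_ands (p : Data) (φ : Fml L) (l : List (AndOr L)) :
    (ands φ l).cut p = ands φ (l.map (cut p)) := by
  induction l with
  | nil => simp [ands, cut]
  | cons t l ih =>
    change cut p (and none t (ands φ l)) = and none (t.cut p) (ands φ (l.map (cut p)))
    simp [cut, ih]

theorem sat_plug_ors {M : Interp.{u, v, w} L} {I : Data → Fml L} {a : Data → M.U}
    {l : List (AndOr L)} : M.Sat ((ors l).plug I) a ↔ ∃ t ∈ l, M.Sat (t.plug I) a := by
  induction l with
  | nil => simp [ors, plug]
  | cons t l ih =>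
    change M.Sat (t.plug I ⊔ (ors l).plug I) a ↔ _
    simp [ih]

theorem sat_plug_ands {M : Interp.{u, v, w} L} {I : Data → Fml L} {a : Data → M.U} {φ : Fml L}
    {l : List (AndOr L)} :
    M.Sat ((ands φ l).plug I) a ↔ M.Sat φ a ∧ ∀ t ∈ l, M.Sat (t.plug I) a := by
  induction l with
  | nil => simp [ands, plug]
  | cons t l ih =>
    change M.Sat (t.plug I ⊓ (ands φ l).plug I) a ↔ _
    simp only [sat_inf, ih, List.forall_mem_cons]
    tauto

end AndOr

namespace Flat

/-- The clauses with a given head. -/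
def withHead (F : Flat L) (p : Option Data) : List (FClause L) :=
  F.1.filter fun c => decide (c.head = p)

/-- The alternatives for a relation symbol, given and/or-trees for the clauses. -/
def alternatives (F : Flat L) (T : FClause L → AndOr L) (b : Data) : AndOr L :=
  .or (some b) (.ors ((F.withHead (some b)).map T)) (.leaf none ⊥)

/-- The unfolding of a clause to a given depth. -/
def unfolding (F : Flat L) : ℕ → FClause L → AndOr L
  | 0, _ => .leaf none ⊥
  | k + 1, c => .ands c.con (c.body.map (F.alternatives (F.unfolding k)))

def disjunction (F : Flat L) : AndOr L :=
  .ors ((F.withHead none).map (F.unfolding (F.1.length + 1)))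

variable {F : Flat L} {c d e h : FClause L} {b p : Data} {k : ℕ}

theorem mem_withHead {p : Option Data} : c ∈ F.withHead p ↔ c ∈ F.1 ∧ c.head = p := by
  simp [withHead]

theorem mem_leaves_alternatives {T : FClause L → AndOr L} {ψ : Fml L} :
    ψ ∈ (F.alternatives T b).leaves ↔ ψ = ⊥ ∨ ∃ c ∈ F.1, c.head = some b ∧ ψ ∈ (T c).leaves := by
  simp only [alternatives, AndOr.leaves, List.mem_append, AndOr.mem_leaves_ors, List.mem_map,
    mem_withHead, List.mem_singleton]
  constructor
  · rintro ((h | ⟨_, ⟨c, ⟨h1, h2⟩, rfl⟩, h3⟩) | h)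
    exacts [.inl h, .inr ⟨c, h1, h2, h3⟩, .inl h]
  · rintro (h | ⟨c, h1, h2, h3⟩)
    exacts [.inr h, .inl (.inr ⟨_, ⟨c, ⟨h1, h2⟩, rfl⟩, h3⟩)]

theorem cut_alternatives_self {T : FClause L → AndOr L} :
    (F.alternatives T b).cut b = .leaf none ⊤ := by
  simp [alternatives, AndOr.cut]

theorem cut_alternatives {T : FClause L → AndOr L} (h : b ≠ p) :
    (F.alternatives T b).cut p = F.alternatives (fun c => (T c).cut p) b := by
  simp [alternatives, AndOr.cut, h, AndOr.cut_ors, Function.comp_def]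

theorem mem_subs_alternatives {T : FClause L → AndOr L} {s : AndOr L} (hs : s.mark = some p) :
    s ∈ (F.alternatives T b).subs ↔
      s = F.alternatives T b ∨ ∃ c ∈ F.1, c.head = some b ∧ s ∈ (T c).subs := by
  have : s ≠ .leaf none ⊥ := by rintro rfl; simp [AndOr.mark] at hs
  simp only [alternatives, AndOr.subs, List.mem_cons, List.mem_append, AndOr.mem_subs_ors hs,
    List.mem_map, mem_withHead, List.not_mem_nil, or_false, this]
  refine or_congr_right ⟨?_, ?_⟩
  · rintro ⟨_, ⟨c, ⟨h1, h2⟩, rfl⟩, h3⟩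
    exact ⟨c, h1, h2, h3⟩
  · rintro ⟨c, h1, h2, h3⟩
    exact ⟨_, ⟨c, ⟨h1, h2⟩, rfl⟩, h3⟩

theorem mark_alternatives {T : FClause L → AndOr L} : (F.alternatives T b).mark = some b := rfl

/-- The clauses below a relation symbol. -/
def BelowSym (F : Flat L) (b : Data) (d : FClause L) : Prop :=
  ∃ c, c.head = some b ∧ F.Below c d

/-- The parent of `d` is the only clause with `p` in its body. Hence one can only get from `b` to
`d` directly or through that parent. -/
theorem belowSym_iff (hb : F.BodyDisjoint) (hc : c ∈ F.1) (hpc : p ∈ c.body) (hd : d.head = some p) :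
    F.BelowSym b d ↔ p = b ∨ F.BelowSym b c := by
  have hu := hb.up_eq hc hd hpc
  constructor
  · rintro ⟨e, he, hed⟩
    rcases hed.cases_head with rfl | ⟨f, hf, hef⟩
    · left; rw [hd] at he; simpa using he
    · rw [hu, Option.some_inj] at hf
      subst hf
      exact .inr ⟨e, he, hef⟩
  · rintro (rfl | ⟨e, he, hec⟩)
    · exact ⟨d, hd, .refl⟩
    · exact ⟨e, he, .head hu hec⟩

theorem not_belowSym_root (hh : h.head = none) : ¬ F.BelowSym b h := by
  rintro ⟨c, hc, hch⟩
  rw [eq_of_below_root hh hch, hh] at hc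
  simp at hc

theorem mem_leaves_unfolding (hb : F.BodyDisjoint) (hc : c ∈ F.1) {ψ : Fml L}
    (h : ψ ∈ (F.unfolding k c).leaves) : ψ = ⊥ ∨ ∃ d ∈ F.1, F.Below c d ∧ ψ = d.con := by
  induction k generalizing c with
  | zero => left; simpa [unfolding, AndOr.leaves] using h
  | succ k ih =>
    simp only [unfolding, AndOr.mem_leaves_ands, List.mem_map] at h
    rcases h with h | ⟨_, ⟨b, hbc, rfl⟩, h⟩
    · exact .inr ⟨c, hc, .refl, h⟩
    · rcases mem_leaves_alternatives.1 h with h | ⟨d, hd, hdb, h⟩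
      · exact .inl h
      · refine (ih hd h).imp_right ?_
        rintro ⟨e, he, hde, h⟩
        exact ⟨e, he, .tail hde (hb.up_eq hc hdb hbc), h⟩

/-- Cutting at `p` removes everything that is reached through `p` and inserts only the closed
formula `⊤`. The remaining constraints come from clauses reached without passing `p`. -/
theorem mem_leaves_cut_unfolding (hb : F.BodyDisjoint) (hc : c ∈ F.1) (hcp : ¬ F.BelowSym p c)
    {ψ : Fml L} (h : ψ ∈ ((F.unfolding k c).cut p).leaves) :
    fv ψ = ∅ ∨ ∃ d ∈ F.1, ¬ F.BelowSym p d ∧ ψ = d.con := by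
  induction k generalizing c with
  | zero =>
    obtain rfl : ψ = ⊥ := by simpa [unfolding, AndOr.leaves, AndOr.cut] using h
    simp
  | succ k ih =>
    simp only [unfolding, AndOr.cut_ands, List.map_map, AndOr.mem_leaves_ands, List.mem_map,
      Function.comp_apply] at h
    rcases h with h | ⟨_, ⟨b, hbc, rfl⟩, h⟩
    · exact .inr ⟨c, hc, hcp, h⟩
    · by_cases hbp : b = p
      · subst hbp
        rw [cut_alternatives_self] at h
        obtain rfl : ψ = ⊤ := by simpa [AndOr.leaves] using h
        simp
      · rw [cut_alternatives hbp] at h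
        rcases mem_leaves_alternatives.1 h with rfl | ⟨d, hd, hdb, h⟩
        · simp
        · refine ih hd ?_ h
          rw [belowSym_iff hb hc hbc hdb]
          tauto

theorem con_mem_leaves_unfolding : c.con ∈ (F.unfolding (k + 1) c).leaves := by
  simp [unfolding, AndOr.mem_leaves_ands]

section
variable {r : FClause L → ℕ} (h1 : ∀ c, r c ≤ F.1.length) (h2 : ∀ c d, F.up c = some d → r d < r c)
include h1 h2

/-- The condition `hk` means that enough depth is left: each step down costs one unit of depth and
raises the rank by at least one, and ranks are bounded by the number of clauses. The path from `c`
to `d` avoids the cut, because `p` is in the body of `d` only. -/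
theorem con_mem_leaves_cut_unfolding (hb : F.BodyDisjoint) (hc : c ∈ F.1) (hd : d ∈ F.1)
    (hk : F.1.length < r c + k) (hcd : F.Below c d) (hp : p ∈ d.body) :
    d.con ∈ ((F.unfolding k c).cut p).leaves := by
  induction k generalizing c with
  | zero => have := h1 c; omega
  | succ k ih =>
    simp only [unfolding, AndOr.cut_ands, List.map_map, AndOr.mem_leaves_ands, List.mem_map,
      Function.comp_apply]
    by_cases hne : c = d
    · exact .inl (by rw [hne])
    · rcases hcd.cases_tail with h | ⟨e, hde, hu⟩
      · exact absurd h hne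
      · obtain ⟨-, b, heb, hbc⟩ := of_up hu
        have he := mem_of_below hd hde
        have hlt := h2 _ _ hu
        refine .inr ⟨_, ⟨b, hbc, rfl⟩, ?_⟩
        rw [cut_alternatives (by rintro rfl; exact hne (hb.eq hc hd hbc hp))]
        exact mem_leaves_alternatives.2 (.inr ⟨e, he, heb, ih he (by omega) hde⟩)

theorem alternatives_mem_subs (hd : d ∈ F.1)
    (hk : F.1.length < r c + k) (hcd : F.Below c d) (hp : p ∈ d.body) (hu : F.up e = some d) :
    ∃ j, F.alternatives (F.unfolding (j + 1)) p ∈ (F.unfolding k c).subs := by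
  induction k generalizing c with
  | zero => have := h1 c; omega
  | succ k ih =>
    simp only [unfolding, AndOr.mem_subs_ands (mark_alternatives (b := p)), List.mem_map]
    rcases hcd.cases_tail with rfl | ⟨f, hdf, huf⟩
    · cases k with
      | zero => have := h1 e; have := h2 _ _ hu; omega
      | succ k => exact ⟨k, _, ⟨p, hp, rfl⟩, AndOr.mem_subs_self _⟩
    · obtain ⟨-, b, hfb, hbc⟩ := of_up huf
      have hlt := h2 _ _ huf
      obtain ⟨j, hj⟩ := ih (by omega) hdf
      exact ⟨j, _, ⟨b, hbc, rfl⟩, (mem_subs_alternatives mark_alternatives).2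
        (.inr ⟨f, mem_of_below hd hdf, hfb, hj⟩)⟩

/-- The point is the depth `j + 1`: below each selected position the clauses are really unfolded and
not cut off by exhausted depth. Completeness supplies a clause for the symbol, and its larger rank
shows that depth remains. -/
theorem eq_alternatives_of_mem_subs (hC : F.Complete) {Con : ConstraintLanguage L} (hW : F.WF Con)
    (hb : F.BodyDisjoint) (hc : c ∈ F.1) (hk : F.1.length < r c + k) {s : AndOr L}
    (hs : s ∈ (F.unfolding k c).subs) (hm : s.mark = some p) :
    ∃ d ∈ F.1, F.Below c d ∧ p ∈ d.body ∧ ∃ j, s = F.alternatives (F.unfolding (j + 1)) p := by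
  induction k generalizing c with
  | zero => have := h1 c; omega
  | succ k ih =>
    simp only [unfolding, AndOr.mem_subs_ands hm, List.mem_map] at hs
    obtain ⟨_, ⟨b, hbc, rfl⟩, hs⟩ := hs
    rcases (mem_subs_alternatives hm).1 hs with rfl | ⟨e, he, heb, hs⟩
    · obtain rfl : b = p := by simpa [mark_alternatives] using hm
      obtain ⟨e, he, heb⟩ := hC.head b (hW.occ c hc b (mem_occ.2 (.inl hbc)))
      have := h2 _ _ (hb.up_eq hc heb hbc)
      have := h1 e
      cases k with
      | zero => omega
      | succ k => exact ⟨c, hc, .refl, hbc, k, rfl⟩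
    · have hu := hb.up_eq hc heb hbc
      have hlt := h2 _ _ hu
      obtain ⟨d, hd, hed, hpd, hj⟩ := ih he (by omega) hs
      exact ⟨d, hd, .tail hed hu, hpd, hj⟩

end

theorem mem_marks_unfolding (hb : F.BodyDisjoint) (hc : c ∈ F.1)
    (hp : p ∈ (F.unfolding k c).marks) : ∃ d ∈ F.1, F.Below c d ∧ p ∈ d.body := by
  induction k generalizing c with
  | zero => simp [unfolding, AndOr.marks, AndOr.subs, AndOr.mark] at hp
  | succ k ih =>
    obtain ⟨s, hs, hm⟩ := List.mem_filterMap.1 hp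
    simp only [unfolding, AndOr.mem_subs_ands hm, List.mem_map] at hs
    obtain ⟨_, ⟨b, hbc, rfl⟩, hs⟩ := hs
    rcases (mem_subs_alternatives hm).1 hs with rfl | ⟨e, he, heb, hs⟩
    · obtain rfl : b = p := by simpa [mark_alternatives] using hm
      exact ⟨c, hc, .refl, hbc⟩
    · obtain ⟨d, hd, hed, hpd⟩ := ih he (List.mem_filterMap.2 ⟨s, hs, hm⟩)
      exact ⟨d, hd, .tail hed (hb.up_eq hc heb hbc), hpd⟩

/-- The clauses above `e` are linearly ordered, so one of the siblings would lie above the other and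
hence above their common parent. -/
theorem Acyclic.eq_of_siblings (hF : F.Acyclic) (hu : F.up c = some h) (hu' : F.up d = some h)
    (hce : F.Below c e) (hde : F.Below d e) : c = d := by
  have key : ∀ {c d}, F.up c = some h → F.up d = some h → F.Below c d → c = d := by
    intro c d hu hu' hcd
    rcases hcd.cases_head with rfl | ⟨f, hf, h'⟩
    · rfl
    · rw [hu', Option.some_inj] at hf
      subst hf
      exact absurd h' (hF.not_below_up hu)
  rcases Relation.ReflTransGen.total_of_right_unique
    (fun a b b' h1 h2 => by rw [h1] at h2; exact Option.some_inj.1 h2) hce hde with h1 | h1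
  · exact (key hu' hu h1).symm
  · exact key hu hu' h1

theorem marks_alternatives {T : FClause L → AndOr L} : (F.alternatives T b).marks =
    b :: (F.withHead (some b)).flatMap fun c => (T c).marks := by
  rw [← List.flatMap_map, ← AndOr.marks_ors]
  simp [alternatives, AndOr.marks, AndOr.subs, AndOr.mark]

theorem marks_unfolding_nodup (hA : F.Apart) (hF : F.Acyclic) (hb : F.BodyDisjoint) (hc : c ∈ F.1) :
    (F.unfolding k c).marks.Nodup := by
  have hnd : F.1.Nodup := hA.ids.of_map _
  induction k generalizing c with
  | zero => simp [unfolding, AndOr.marks, AndOr.subs, AndOr.mark, List.filterMap_cons]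
  | succ k ih =>
    have hup : ∀ {b d}, b ∈ c.body → d ∈ F.withHead (some b) → d ∈ F.1 ∧ F.up d = some c :=
      fun hbc hd => ⟨(mem_withHead.1 hd).1, hb.up_eq hc (mem_withHead.1 hd).2 hbc⟩
    -- A name in the unfoldings of two children points to the one clause with that symbol in its
    -- body, which can only lie below one of them.
    have hdis : ∀ {d d' p}, d ∈ F.1 → d' ∈ F.1 → F.up d = some c → F.up d' = some c →
        p ∈ (F.unfolding k d).marks → p ∈ (F.unfolding k d').marks → d = d' := by
      intro d d' p hd hd' hu hu' hp hp'
      obtain ⟨e, he, hde, hpe⟩ := mem_marks_unfolding hb hd hp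
      obtain ⟨e', he', hde', hpe'⟩ := mem_marks_unfolding hb hd' hp'
      obtain rfl := hb.eq he he' hpe hpe'
      exact hF.eq_of_siblings hu hu' hde hde'
    -- A body symbol of `c` cannot reappear further down, since its unique clause is `c` itself.
    have hself : ∀ {d p}, d ∈ F.1 → F.up d = some c → p ∈ c.body →
        p ∉ (F.unfolding k d).marks := by
      intro d p hd hu hpc hp
      obtain ⟨e, he, hde, hpe⟩ := mem_marks_unfolding hb hd hp
      obtain rfl := hb.eq hc he hpc hpe
      exact hF.not_below_up hu hde
    simp only [unfolding, AndOr.marks_ands, List.flatMap_map, marks_alternatives]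
    refine List.nodup_flatMap.2 ⟨fun b hbc => List.nodup_cons.2 ⟨fun h => ?_, ?_⟩, ?_⟩
    · obtain ⟨d, hd, hp⟩ := List.mem_flatMap.1 h
      exact hself (hup hbc hd).1 (hup hbc hd).2 hbc hp
    · refine List.nodup_flatMap.2 ⟨fun d hd => ih (hup hbc hd).1, ?_⟩
      refine (hnd.filter _).imp_of_mem fun {d d'} hd hd' hne p hp hp' => hne ?_
      exact hdis (hup hbc hd).1 (hup hbc hd').1 (hup hbc hd).2 (hup hbc hd').2 hp hp'
    · refine ((List.nodup_flatMap.1 hb).1 c hc).imp_of_mem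
        fun {b b'} hbc hbc' hne p hp hp' => ?_
      rw [List.mem_cons, List.mem_flatMap] at hp hp'
      rcases hp with rfl | ⟨d, hd, hp⟩ <;> rcases hp' with rfl | ⟨d', hd', hp'⟩
      · exact hne rfl
      · exact hself (hup hbc' hd').1 (hup hbc' hd').2 hbc hp'
      · exact hself (hup hbc hd).1 (hup hbc hd).2 hbc' hp
      · obtain rfl := hdis (hup hbc hd).1 (hup hbc' hd').1 (hup hbc hd).2 (hup hbc' hd').2 hp hp'
        have := (mem_withHead.1 hd').2
        rw [(mem_withHead.1 hd).2] at this
        exact hne (Option.some_inj.1 this)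

theorem marks_disjunction_nodup (hA : F.Apart) (hF : F.Acyclic) (hb : F.BodyDisjoint) :
    F.disjunction.marks.Nodup := by
  have hnd : F.1.Nodup := hA.ids.of_map _
  rw [disjunction, AndOr.marks_ors, List.flatMap_map]
  refine List.nodup_flatMap.2
    ⟨fun d hd => marks_unfolding_nodup hA hF hb (mem_withHead.1 hd).1, ?_⟩
  refine (hnd.filter _).imp_of_mem fun {d d'} hd hd' hne p hp hp' => hne ?_
  have hd := mem_withHead.1 hd
  have hd' := mem_withHead.1 hd'
  obtain ⟨e, he, hde, hpe⟩ := mem_marks_unfolding hb hd.1 hp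
  obtain ⟨e', he', hde', hpe'⟩ := mem_marks_unfolding hb hd'.1 hp'
  obtain rfl := hb.eq he he' hpe hpe'
  exact root_unique hd.2 hd'.2 hde hde'

/-- The clauses with heads in a list without repetitions. -/
theorem withHead_subperm (hA : F.Apart) {l : List Data} (hl : l.Nodup) :
    (l.flatMap fun b => F.withHead (some b)).Subperm F.1 := by
  have hnd : F.1.Nodup := hA.ids.of_map _
  refine List.subperm_of_subset ?_ fun c hc => ?_
  · refine List.nodup_flatMap.2 ⟨fun b _ => hnd.filter _, hl.imp fun {b b'} hne c hc hc' => ?_⟩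
    have := (mem_withHead.1 hc).2
    rw [(mem_withHead.1 hc').2] at this
    exact hne (Option.some_inj.1 this).symm
  · obtain ⟨b, -, h⟩ := List.mem_flatMap.1 hc
    exact (mem_withHead.1 h).1

end Flat
end

/-! ### Size and computation of the unfolding -/

section
variable {L : FirstOrder.Language.{u, v}} [Coding L] {α : Type*} [Enc α]

theorem esize_list {β : Type*} [Enc β] (l : List β) :
    esize l = (l.map fun a => esize a + 1).sum + 1 := by
  induction l with
  | nil => rfl
  | cons a l ih => rw [esize_cons, ih, List.map_cons, List.sum_cons]; omega

omit [Coding L] [Enc α] in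
theorem sum_map_flatMap {β : Type*} (f : β → ℕ) (g : α → List β) (l : List α) :
    ((l.flatMap g).map f).sum = (l.map fun a => ((g a).map f).sum).sum := by
  induction l with
  | nil => rfl
  | cons a l ih => simp [ih]

theorem AndOr.esize_ors (l : List (AndOr L)) :
    esize (ors l) = (l.map fun t => esize t + 9).sum + esize (leaf none ⊥ : AndOr L) := by
  induction l with
  | nil => simp [ors]
  | cons t l ih =>
    rw [List.map_cons, List.sum_cons]
    have : esize (ors (t :: l)) = _ := esize_or none t (ors l)
    have h1 : esize (none : Option Data) = 1 := rfl
    omega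

theorem AndOr.esize_ands (φ : Fml L) (l : List (AndOr L)) :
    esize (ands φ l) = (l.map fun t => esize t + 7).sum + (esize φ + 4) := by
  have h1 : esize (none : Option Data) = 1 := rfl
  induction l with
  | nil =>
    have : esize (ands φ []) = _ := esize_leaf none φ
    rw [List.map_nil, List.sum_nil]
    omega
  | cons t l ih =>
    rw [List.map_cons, List.sum_cons]
    have : esize (ands φ (t :: l)) = _ := esize_and none t (ands φ l)
    omega

@[fun_prop]
theorem PT.andOr_ors {l : α → List (AndOr L)} (hl : PT l) : PT fun a => AndOr.ors (l a) := by
  have key : ∀ l : List (AndOr L), esize (AndOr.ors l) ≤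
      (9 + esize (AndOr.leaf none ⊥ : AndOr L)) * esize l := by
    intro l
    rw [AndOr.esize_ors, esize_list]
    have h : (l.map fun t => esize t + 9).sum ≤ 9 * (l.map fun t => esize t + 1).sum := by
      rw [← List.sum_map_mul_left]
      exact List.sum_le_sum fun t _ => by omega
    calc _ ≤ 9 * (l.map fun t => esize t + 1).sum + esize (AndOr.leaf none ⊥ : AndOr L) := by omega
      _ ≤ _ := by ring_nf; omega
  refine (PT.foldl (step := fun _ s t => AndOr.or none t s) (init := fun _ => AndOr.leaf none ⊥)
    (l := fun a => (l a).reverse) (by fun_prop) (by fun_prop) (by fun_prop)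
    ((PB.const (9 + esize (AndOr.leaf none ⊥ : AndOr L))).mul hl.pb_esize) ?_).of_enc_eq
    _root_.id (fun _ => rfl) fun a => by simp [AndOr.ors, List.foldl_reverse]
  intro a l₁ h
  have h1 : l₁.foldl (fun s t => AndOr.or none t s) (AndOr.leaf none ⊥) = AndOr.ors l₁.reverse := by
    simp [AndOr.ors]
  rw [h1]
  refine (key _).trans (Nat.mul_le_mul_left _ ?_)
  rw [esize_reverse, ← esize_reverse (l a)]
  exact esize_sublist h.sublist

@[fun_prop]
theorem PT.andOr_ands {φ : α → Fml L} {l : α → List (AndOr L)} (hφ : PT φ) (hl : PT l) :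
    PT fun a => AndOr.ands (φ a) (l a) := by
  have key : ∀ (φ : Fml L) (l : List (AndOr L)), esize (AndOr.ands φ l) ≤
      7 * esize l + (esize φ + 4) := by
    intro φ l
    rw [AndOr.esize_ands, esize_list]
    have h : (l.map fun t => esize t + 7).sum ≤ 7 * (l.map fun t => esize t + 1).sum := by
      rw [← List.sum_map_mul_left]
      exact List.sum_le_sum fun t _ => by omega
    omega
  refine (PT.foldl (step := fun _ s t => AndOr.and none t s)
    (init := fun a => AndOr.leaf none (φ a))
    (l := fun a => (l a).reverse) (by fun_prop) (by fun_prop) (by fun_prop)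
    (((PB.const 7).mul hl.pb_esize).add (hφ.pb_esize.add (PB.const 4))) ?_).of_enc_eq
    _root_.id (fun _ => rfl) fun a => by simp [AndOr.ands, List.foldl_reverse]
  intro a l₁ h
  have h1 : l₁.foldl (fun s t => AndOr.and none t s) (AndOr.leaf none (φ a)) =
      AndOr.ands (φ a) l₁.reverse := by
    simp [AndOr.ands]
  rw [h1]
  refine (key _ _).trans ?_
  have : esize l₁.reverse ≤ esize (l a) := by
    rw [esize_reverse, ← esize_reverse (l a)]
    exact esize_sublist h.sublist
  omega

namespace Flat
variable {F : Flat L}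

theorem esize_fclause (c : FClause L) :
    esize c = esize c.id + (esize c.con + (esize c.body + esize c.head + 1) + 1) + 1 := rfl

/-- The total size of the unfoldings of all clauses is linear in the depth. -/
theorem esize_unfolding_le (hA : F.Apart) (hb : F.BodyDisjoint) (k : ℕ) :
    (F.1.map fun c => esize (F.unfolding k c)).sum ≤
      (k + 1) * ((40 + 2 * esize (AndOr.leaf none ⊥ : AndOr L)) * esize F.1) := by
  set K := esize (AndOr.leaf none ⊥ : AndOr L) with hK
  have hF1 : ∀ m, (F.1.map fun c => m * esize c).sum ≤ m * esize F.1 := by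
    intro m
    rw [List.sum_map_mul_left]
    refine Nat.mul_le_mul_left _ ?_
    rw [esize_list]
    exact (List.sum_le_sum fun c _ => Nat.le_succ _).trans (Nat.le_succ _)
  induction k with
  | zero =>
    refine (List.sum_le_sum fun c _ => ?_).trans ((hF1 (40 + 2 * K)).trans (by simp))
    have : K ≤ 2 * K := by omega
    exact (show esize (F.unfolding 0 c) = K from rfl) ▸
      this.trans ((Nat.le_add_left _ _).trans (Nat.le_mul_of_pos_right _ (esize_pos c)))
  | succ k ih =>
    -- The share of one alternative in the size of a disjunction, with the 9 for its connective.
    set f : FClause L → ℕ := fun c => esize (F.unfolding k c) + 9 with hf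
    have h1 : ∀ c, esize (F.unfolding (k + 1) c) ≤ (31 + 2 * K) * esize c +
        ((c.body.flatMap fun b => F.withHead (some b)).map f).sum := by
      intro c
      -- The 17 consists of 8 for the selected disjunction, 2 for wrapping its name and 7 for the
      -- conjunction that holds it; the two leaves `⊥` give `2 * K`.
      have h2 : ∀ b : Data, esize (F.alternatives (F.unfolding k) b) + 7 =
          ((F.withHead (some b)).map f).sum + (esize b + (2 * K + 17)) := by
        intro b
        have h3 : esize (some b) = esize b + 1 + 1 := rfl
        rw [alternatives, esize_or, AndOr.esize_ors, List.map_map, h3]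
        simp only [hf, Function.comp_def, ← hK]
        omega
      have h4 : (c.body.map fun b => esize b + (2 * K + 17)).sum ≤ (18 + 2 * K) * esize c.body := by
        rw [esize_list c.body]
        calc _ ≤ (c.body.map fun b => (18 + 2 * K) * (esize b + 1)).sum := by
              refine List.sum_le_sum fun b _ => ?_
              have : esize b ≤ (18 + 2 * K) * esize b := Nat.le_mul_of_pos_left _ (by omega)
              rw [Nat.mul_add]; omega
          _ = (18 + 2 * K) * (c.body.map fun b => esize b + 1).sum := List.sum_map_mul_left ..
          _ ≤ _ := Nat.mul_le_mul_left _ (Nat.le_succ _)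
      have h5 : ((c.body.flatMap fun b => F.withHead (some b)).map f).sum =
          (c.body.map fun b => ((F.withHead (some b)).map f).sum).sum := sum_map_flatMap ..
      rw [unfolding, AndOr.esize_ands, List.map_map, h5]
      simp only [Function.comp_def, h2, List.sum_map_add] at h4 ⊢
      have h6 := esize_fclause c
      have h7 : (18 + 2 * K) * esize c.body + esize c.con + 4 ≤ (31 + 2 * K) * esize c := by
        have : (18 + 2 * K) * (esize c.body + esize c.con + 1) ≤ (18 + 2 * K) * esize c :=
          Nat.mul_le_mul_left _ (by omega)
        have h8 : esize c.con ≤ (18 + 2 * K) * esize c.con := Nat.le_mul_of_pos_left _ (by omega)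
        have h9 : (31 + 2 * K) * esize c = (18 + 2 * K) * esize c + 13 * esize c := by ring
        rw [Nat.mul_add, Nat.mul_add] at this
        omega
      omega
    -- Over all clauses the body symbols are distinct, so each clause is charged at most once as a
    -- child. Increasing the depth therefore adds only a linear amount instead of multiplying the
    -- size.
    have h2 : (F.1.map fun c => ((c.body.flatMap fun b => F.withHead (some b)).map f).sum).sum ≤
        (F.1.map f).sum := by
      obtain ⟨l, hl, hs⟩ := withHead_subperm hA hb
      refine le_trans (le_of_eq ?_) ((hs.map f).sum_le_sum fun _ _ => Nat.zero_le _)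
      rw [(hl.map f).sum_eq, List.flatMap_assoc, sum_map_flatMap]
    have h3 : (F.1.map f).sum ≤ (F.1.map fun c => esize (F.unfolding k c)).sum + 9 * esize F.1 := by
      simp only [hf, List.sum_map_add]
      refine Nat.add_le_add_left ?_ _
      refine (List.sum_le_sum fun c _ => ?_).trans (hF1 9)
      exact Nat.le_mul_of_pos_right _ (esize_pos c)
    have h4 := (List.sum_le_sum fun c (_ : c ∈ F.1) => h1 c)
    rw [List.sum_map_add] at h4
    have h5 := hF1 (31 + 2 * K)
    have h6 : (k + 1 + 1) * ((40 + 2 * K) * esize F.1) =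
      (k + 1) * ((40 + 2 * K) * esize F.1) + ((31 + 2 * K) * esize F.1 + 9 * esize F.1) := by ring
    omega

/-- One step of the simultaneous unfolding of all clauses. -/
def unfoldStep (F : Flat L) (E : List (FClause L × AndOr L)) : List (FClause L × AndOr L) :=
  F.1.map fun c => (c, .ands c.con (c.body.map fun b =>
    .or (some b) (.ors ((E.filter fun e => decide (e.1.head = some b)).map Prod.snd))
      (.leaf none ⊥)))

omit [Coding L] in
theorem iterate_unfoldStep (F : Flat L) (k : ℕ) :
    F.unfoldStep^[k] (F.1.map fun c => (c, .leaf none ⊥)) =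
      F.1.map fun c => (c, F.unfolding k c) := by
  induction k with
  | zero => rfl
  | succ k ih =>
    rw [Function.iterate_succ_apply', ih]
    simp only [unfoldStep, List.filter_map, List.map_map, Function.comp_def]
    rfl

end Flat

/-- Instead of following the recursion of a single unfolding, the table of the unfoldings of all
clauses is advanced level by level. Its size is polynomial at every level by
`Flat.esize_unfolding_le`. -/
theorem PT.flat_disjunction {P : Flat L → Prop} (hP : ∀ F, P F → F.Apart ∧ F.BodyDisjoint) :
    PT fun F : {F // P F} => F.1.disjunction := by
  have h : PT fun F : {F // P F} =>
      F.1.unfoldStep^[F.1.1.length + 1] (F.1.1.map fun c => (c, .leaf none ⊥)) := by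
    refine PT.iterate (f := fun F : {F // P F} => F.1.unfoldStep) (n := fun F => F.1.1.length + 1)
      (B := fun F => (esize F + 2 + 1) * ((40 + 2 * esize (AndOr.leaf none ⊥ : AndOr L)) * esize F)
        + 2 * esize F + 1) ?_ (by fun_prop) (by fun_prop) ?_ ?_
    · unfold Flat.unfoldStep
      fun_prop
    · exact ((((PB.esize.add (PB.const 2)).add (PB.const 1)).mul ((PB.const _).mul PB.esize)).add
        ((PB.const 2).mul PB.esize)).add (PB.const 1)
    · rintro ⟨F, hF⟩ k hk
      have h1 := Flat.esize_unfolding_le (hP F hF).1 (hP F hF).2 k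
      have h2 : esize F.1 ≤ esize F := by
        have : esize F = esize F.1 + esize F.2 + 1 := rfl
        omega
      have h3 : k ≤ esize F + 2 := by
        have := length_lt_esize F.1
        dsimp only at hk
        omega
      dsimp only
      rw [Flat.iterate_unfoldStep, esize_list, List.map_map]
      have h4 : (F.1.map fun c => esize c + 2).sum ≤ 2 * esize F.1 := by
        rw [esize_list, Nat.mul_add, ← List.sum_map_mul_left]
        refine (List.sum_le_sum fun c _ => ?_).trans (Nat.le_add_right _ _)
        omega
      have h5 : (F.1.map ((fun a => esize a + 1) ∘ fun c => (c, F.unfolding k c))).sum =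
          (F.1.map fun c => esize (F.unfolding k c)).sum + (F.1.map fun c => esize c + 2).sum := by
        rw [← List.sum_map_add]
        congr 1
        refine List.map_congr_left fun c _ => ?_
        simp only [Function.comp_apply, esize_pair]
        omega
      have h6 : (k + 1) * ((40 + 2 * esize (AndOr.leaf none ⊥ : AndOr L)) * esize F.1) ≤
          (esize F + 2 + 1) * ((40 + 2 * esize (AndOr.leaf none ⊥ : AndOr L)) * esize F) :=
        Nat.mul_le_mul (by omega) (Nat.mul_le_mul_left _ h2)
      have h7 : esize (⟨F, hF⟩ : {F // P F}) = esize F := rfl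
      rw [h5, h7]
      omega
  have h' : PT fun F : {F // P F} => AndOr.ors ((((F.1.unfoldStep^[F.1.1.length + 1]
      (F.1.1.map fun c => (c, .leaf none ⊥))).filter fun e => e.1.head.isNone).map Prod.snd)) := by
    fun_prop
  refine h'.of_enc_eq _root_.id (fun _ => rfl) fun F => ?_
  rw [Flat.iterate_unfoldStep]
  have : ∀ o : Option Data, o.isNone = decide (o = none) := fun o => by cases o <;> simp
  simp only [List.filter_map, List.map_map, Function.comp_def, this]
  rfl

end

/-! ### Interpolants of the unfolded formula -/

section
variable {L : FirstOrder.Language.{u, v}}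

namespace Flat
variable {F : Flat L} {c d : FClause L} {p : Data}

theorem mem_leaves_disjunction (hb : F.BodyDisjoint) {ψ : Fml L} (h : ψ ∈ F.disjunction.leaves) :
    ψ = ⊥ ∨ ∃ d ∈ F.1, ψ = d.con := by
  rw [disjunction, AndOr.mem_leaves_ors] at h
  rcases h with h | ⟨_, ht, h⟩
  · exact .inl h
  · obtain ⟨c, hc, rfl⟩ := List.mem_map.1 ht
    refine (mem_leaves_unfolding hb (mem_withHead.1 hc).1 h).imp_right ?_
    rintro ⟨d, hd, -, rfl⟩
    exact ⟨d, hd, rfl⟩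

section
variable (hF : F.Acyclic) {Con : ConstraintLanguage L} (hW : F.WF Con) (hC : F.Complete)
  (hb : F.BodyDisjoint)
include hF hW hC hb

theorem eq_alternatives_of_mem_disjunction {s : AndOr L} (hs : s ∈ F.disjunction.subs)
    (hm : s.mark = some p) :
    ∃ d ∈ F.1, p ∈ d.body ∧ ∃ j, s = F.alternatives (F.unfolding (j + 1)) p := by
  obtain ⟨r, h1, h2⟩ := hF.exists_rank
  rw [disjunction, AndOr.mem_subs_ors hm] at hs
  obtain ⟨_, ht, hs⟩ := hs
  obtain ⟨c, hc, rfl⟩ := List.mem_map.1 ht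
  obtain ⟨d, hd, -, hpd, h⟩ := eq_alternatives_of_mem_subs h1 h2 hC hW hb (mem_withHead.1 hc).1
    (by omega) hs hm
  exact ⟨d, hd, hpd, h⟩

theorem alternatives_mem_disjunction (hc : c ∈ F.1) (hp : c.head = some p) :
    ∃ j, F.alternatives (F.unfolding (j + 1)) p ∈ F.disjunction.subs := by
  obtain ⟨r, h1, h2⟩ := hF.exists_rank
  obtain ⟨d, hd, hu, hpd⟩ := up_isSome hW hC hb hc hp
  obtain ⟨h, hh, hhd⟩ := hF.exists_root hW hC hb hd
  obtain ⟨j, hj⟩ := alternatives_mem_subs (c := h) (k := F.1.length + 1) h1 h2 hd (by omega)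
    hhd hpd hu
  exact ⟨j, (AndOr.mem_subs_ors mark_alternatives).2
    ⟨_, List.mem_map.2 ⟨h, mem_withHead.2 (mem_roots.1 hh), rfl⟩, hj⟩⟩

/-- This puts the arguments of `p` outside the subformula at `p`, as the constraint of the clause
using `p` survives the cut. -/
theorem con_mem_leaves_cut_disjunction (hd : d ∈ F.1) (hp : p ∈ d.body) :
    d.con ∈ (F.disjunction.cut p).leaves := by
  obtain ⟨r, h1, h2⟩ := hF.exists_rank
  obtain ⟨h, hh, hhd⟩ := hF.exists_root hW hC hb hd
  rw [disjunction, AndOr.cut_ors, AndOr.mem_leaves_ors]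
  exact .inr ⟨_, List.mem_map.2 ⟨_, List.mem_map.2 ⟨h, mem_withHead.2 (mem_roots.1 hh), rfl⟩, rfl⟩,
    con_mem_leaves_cut_unfolding h1 h2 hb (mem_roots.1 hh).1 hd (by omega) hhd hp⟩

end

theorem mem_leaves_cut_disjunction (hb : F.BodyDisjoint) {ψ : Fml L}
    (h : ψ ∈ (F.disjunction.cut p).leaves) :
    fv ψ = ∅ ∨ ∃ d ∈ F.1, ¬ F.BelowSym p d ∧ ψ = d.con := by
  rw [disjunction, AndOr.cut_ors, AndOr.mem_leaves_ors] at h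
  rcases h with rfl | ⟨_, ht, h⟩
  · simp
  · simp only [List.mem_map, exists_exists_and_eq_and, mem_withHead] at ht
    obtain ⟨c, ⟨hc, hcn⟩, rfl⟩ := ht
    exact mem_leaves_cut_unfolding hb hc (not_belowSym_root hcn) h

/-- A variable shared by clauses inside and outside the part below a relation symbol is an argument
of that symbol. -/
theorem Apart.mem_vars_of_belowSym (hA : F.Apart) (hC : F.Complete) (hb : F.BodyDisjoint) (hc : c ∈ F.1) (hd : d ∈ F.1) (hcp : F.BelowSym p c)
    (hdp : ¬ F.BelowSym p d) {x : Data} (hx : x ∈ fv c.con) (hx' : x ∈ fv d.con) :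
    x ∈ F.vars p := by
  obtain ⟨q, hq, hqc, hqd, hxq⟩ := hA.local hc hd (by rintro rfl; exact hdp hcp) hx hx'
  -- A common symbol in the body of `c` would put `d` on the same side as `c`. If it is the head of
  -- `c`, the parent of `c` decides: either the symbol is `p`, or `d` is again on the same side.
  rcases mem_occ.1 hqc with hqc | hqc
  · rcases mem_occ.1 hqd with hqd | hqd
    · obtain rfl := hb.eq hc hd hqc hqd
      exact absurd hcp hdp
    · exact absurd ((belowSym_iff hb hc hqc hqd).2 (.inr hcp)) hdp
  · obtain ⟨e, he, hqe⟩ := hC.body q hq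
    rcases (belowSym_iff hb he hqe hqc).1 hcp with rfl | hep
    · exact hxq
    · rcases mem_occ.1 hqd with hqd | hqd
      · obtain rfl := hb.eq he hd hqe hqd
        exact absurd hep hdp
      · exact absurd ((belowSym_iff hb he hqe hqd).2 (.inr hep)) hdp

theorem plug_alternatives {T : FClause L → AndOr L} {I : Data → Fml L} :
    (F.alternatives T p).plug I = I p := rfl

/-- One level of unfolding is visible above the next selected positions, and it shows precisely the
clauses with head `p`. -/
theorem sat_plug_alternatives {M : Interp.{u, v, w} L} {I : Data → Fml L} {a : Data → M.U} {j : ℕ} :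
    M.Sat ((F.alternatives (F.unfolding (j + 1)) p).plugBelow I) a ↔
      ∃ c ∈ F.1, c.head = some p ∧ M.Sat c.con a ∧ ∀ b ∈ c.body, M.Sat (I b) a := by
  change M.Sat ((AndOr.ors _).plug I ⊔ ⊥) a ↔ _
  simp only [sat_sup, sat_bot, or_false,
    AndOr.sat_plug_ors, List.mem_map, exists_exists_and_eq_and, mem_withHead, unfolding,
    AndOr.sat_plug_ands, forall_exists_index, and_imp, forall_apply_eq_imp_iff₂, plug_alternatives]
  simp only [and_assoc]

theorem sat_plug_disjunction {M : Interp.{u, v, w} L} {I : Data → Fml L} {a : Data → M.U} :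
    M.Sat (F.disjunction.plug I) a ↔
      ∃ c ∈ F.1, c.head = none ∧ M.Sat c.con a ∧ ∀ b ∈ c.body, M.Sat (I b) a := by
  simp only [disjunction, AndOr.sat_plug_ors, List.mem_map,
    exists_exists_and_eq_and, mem_withHead, unfolding, AndOr.sat_plug_ands, forall_exists_index,
    and_imp, forall_apply_eq_imp_iff₂, plug_alternatives]
  simp only [and_assoc]

end Flat

variable [Coding L]

/-- Selected positions are named by the relation symbols, so the same table serves as solution and
as interpolant. -/
theorem flat_reduces_disjunctive {S : Set (Interp.{u, v, w} L)} {Con : ConstraintLanguage L} :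
    PolyReducesToSeq (flatSolving S Con fun F => F.Normal ∧ F.BodyDisjoint)
      (disjunctiveInterpolation Coding.coding S Con) := by
  unfold disjunctiveInterpolation flatSolving
  refine PolyReducesToSeq.intro (fun F : Flat L => [F.disjunction])
    (fun _ Is => Is.head?.getD []) ?_ (by fun_prop) ?_
  · have := PT.flat_disjunction (L := L)
      (P := fun F => F.WF Con ∧ F.Normal ∧ F.BodyDisjoint) fun F h => ⟨h.2.1.1, h.2.2⟩
    fun_prop
  rintro F ⟨hW, ⟨hA, hC, hF⟩, hb⟩
  refine ⟨?_, ?_, ?_⟩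
  · simp only [List.mem_singleton, forall_eq]
    refine ⟨Flat.marks_disjunction_nodup hA hF hb, fun ψ hψ => ?_⟩
    rcases Flat.mem_leaves_disjunction hb hψ with rfl | ⟨d, hd, rfl⟩
    · exact Con.falsum_mem
    · exact hW.mem d hd
  · rintro ⟨J, hJ⟩
    simp only [List.mem_singleton, forall_eq]
    refine ⟨J, fun p hp => ?_, fun s hs p hm M hM a h => ?_, fun M hM a h => ?_,
      fun s hs p hm x hx => ?_⟩
    · obtain ⟨s, hs, hm⟩ := List.mem_filterMap.1 hp
      obtain ⟨d, hd, hpd, -⟩ := Flat.eq_alternatives_of_mem_disjunction hF hW hC hb hs hm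
      exact hJ.mem p (hW.occ d hd p (Flat.mem_occ.2 (.inl hpd)))
    · obtain ⟨d, hd, hpd, j, rfl⟩ := Flat.eq_alternatives_of_mem_disjunction hF hW hC hb hs hm
      obtain ⟨c, hc, hcp, h1, h2⟩ := Flat.sat_plug_alternatives.1 (h _ rfl)
      have := hJ.valid c hc M hM a h1 h2
      rwa [hcp] at this
    · obtain ⟨c, hc, hcp, h1, h2⟩ := Flat.sat_plug_disjunction.1 (h _ rfl)
      have := hJ.valid c hc M hM a h1 h2
      rwa [hcp] at this
    · obtain ⟨d, hd, hpd, j, rfl⟩ := Flat.eq_alternatives_of_mem_disjunction hF hW hC hb hs hm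
      have hp := hW.occ d hd p (Flat.mem_occ.2 (.inl hpd))
      have hxp := hJ.vars p hp x hx
      obtain ⟨c, hc, hcp⟩ := hC.head p hp
      refine ⟨⟨c.con, Flat.mem_leaves_alternatives.2 (.inr ⟨c, hc, hcp,
        Flat.con_mem_leaves_unfolding⟩), ?_⟩, d.con,
        Flat.con_mem_leaves_cut_disjunction hF hW hC hb hd hpd, ?_⟩
      · exact hA.con_vars c hc p (Flat.mem_occ.2 (.inr hcp)) x hxp
      · exact hA.con_vars d hd p (Flat.mem_occ.2 (.inl hpd)) x hxp
  · intro Is hIs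
    obtain ⟨I, hI, rfl⟩ : ∃ I, F.disjunction.IsInterpolant S Con (table I) ∧ Is = [I] := by
      cases hIs with
      | cons h h' => cases h'; exact ⟨_, h, rfl⟩
    have hkey : ∀ p ∈ F.keys, ∃ j, F.alternatives (F.unfolding (j + 1)) p ∈ F.disjunction.subs :=
      fun p hp => by
        obtain ⟨c, hc, hcp⟩ := hC.head p hp
        exact Flat.alternatives_mem_disjunction hF hW hC hb hc hcp
    refine ⟨fun p hp => ?_, fun p hp x hx => ?_, fun c hc M hM a h1 h2 => ?_⟩
    · obtain ⟨j, hj⟩ := hkey p hp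
      exact hI.mem p (List.mem_filterMap.2 ⟨_, hj, rfl⟩)
    · obtain ⟨j, hj⟩ := hkey p hp
      obtain ⟨⟨ψ, hψ, hx1⟩, χ, hχ, hx2⟩ := hI.vars _ hj p rfl hx
      rcases Flat.mem_leaves_alternatives.1 hψ with rfl | ⟨c, hc, hcp, hψ⟩
      · simp at hx1
      rcases Flat.mem_leaves_unfolding hb hc hψ with rfl | ⟨d, hd, hcd, rfl⟩
      · simp at hx1
      rcases Flat.mem_leaves_cut_disjunction hb hχ with h | ⟨e, he, hep, rfl⟩
      · rw [h] at hx2; simp at hx2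
      exact hA.mem_vars_of_belowSym hC hb hd he ⟨c, hcp, hcd⟩ hep hx1 hx2
    · cases hcp : c.head with
      | none =>
        exact hI.top M hM a fun ψ hψ => by
          rw [Set.mem_singleton_iff.1 hψ]
          exact Flat.sat_plug_disjunction.2 ⟨c, hc, hcp, h1, h2⟩
      | some p =>
        obtain ⟨j, hj⟩ := hkey p (hW.occ c hc p (Flat.mem_occ.2 (.inr hcp)))
        exact hI.entails _ hj p rfl M hM a fun ψ hψ => by
          rw [Set.mem_singleton_iff.1 hψ]
          exact Flat.sat_plug_alternatives.2 ⟨c, hc, hcp, h1, h2⟩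

end

/-! ### Clauses without repeated symbols -/

section
variable {L : FirstOrder.Language.{u, v}} {HC : List (Clause L)} {h : Clause L}

/-- A linear clause has at most two atoms, and if head and body had the same symbol, it would depend
on itself. -/
theorem nodup_atoms_of_isLinear (hr : RecursionFree HC) (hl : IsLinear HC) (hh : h ∈ HC) :
    (h.atoms.map Atom.sym).Nodup := by
  have h1 := hl h hh
  rw [Clause.atoms, List.map_append, List.nodup_append']
  refine ⟨?_, by cases h.head <;> simp, fun p hp hp' => ?_⟩
  · cases hb : h.body with
    | nil => simp
    | cons A l =>
      rw [hb, List.length_cons] at h1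
      obtain rfl : l = [] := List.eq_nil_of_length_eq_zero (by omega)
      simp
  · exact hr p (.single ⟨h, hh, hp', hp⟩)

theorem nodup_atoms_of_isBodyDisjoint (hb : IsBodyDisjoint HC) (hh : h ∈ HC) :
    (h.atoms.map Atom.sym).Nodup := by
  rw [Clause.atoms, List.map_append]
  exact List.nodup_append_comm.1 (hb.2 h hh)

end
end HornInterp

/-! ### Composition of the reductions -/

theorem mainTheorem1 (L : FirstOrder.Language.{u, v}) (c : SymbolCoding L)
    (S : Set (Interp.{u, v, w} L)) (hS : S.Nonempty) (Con : ConstraintLanguage L) :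
    (PolyReduces (binaryInterpolation c S Con) (hornSolving c S Con IsInterpolationPair) ∧
      PolyReducesToSeq (hornSolving c S Con IsInterpolationPair) (binaryInterpolation c S Con)) ∧
    (PolyReduces (sequenceInterpolation c S Con) (hornSolving c S Con IsLinearTreeLike) ∧
      PolyReducesToSeq (hornSolving c S Con IsLinearTreeLike) (sequenceInterpolation c S Con)) ∧
    (PolyReduces (treeInterpolation c S Con) (hornSolving c S Con IsTreeLike) ∧
      PolyReducesToSeq (hornSolving c S Con IsTreeLike) (treeInterpolation c S Con)) ∧
    (PolyReduces (dagInterpolation c S Con) (hornSolving c S Con IsLinear) ∧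
      PolyReducesToSeq (hornSolving c S Con IsLinear) (dagInterpolation c S Con)) ∧
    (PolyReduces (disjunctiveInterpolation c S Con) (hornSolving c S Con IsBodyDisjoint) ∧
      PolyReducesToSeq (hornSolving c S Con IsBodyDisjoint) (disjunctiveInterpolation c S Con)) := by
  let : Coding L := ⟨c⟩
  have hlin : ∀ HC : List (Clause L), RecursionFree HC → IsLinear HC →
      ∀ h ∈ HC, (h.atoms.map Atom.sym).Nodup := fun HC hr hl h hh => nodup_atoms_of_isLinear hr hl hh
  have hbd : ∀ HC : List (Clause L), IsBodyDisjoint HC →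
      ∀ h ∈ HC, (h.atoms.map Atom.sym).Nodup := fun HC hb h hh => nodup_atoms_of_isBodyDisjoint hb hh
  refine ⟨⟨binary_reduces_horn, horn_reduces_binary⟩, ⟨?_, ?_⟩, ⟨?_, ?_⟩, ⟨?_, ?_⟩, ?_, ?_⟩
  · exact (sequence_reduces_flat hS).trans (flat_reduces_horn fun F _ ⟨ha, hl, hb, hh⟩ =>
      ⟨F.acyclic_toHorn ha, F.linear_toHorn hl, F.bodyDisjoint_toHorn ha hb, F.headDisjoint_toHorn hh⟩)
  · exact (horn_reduces_normal (fun HC _ h => hbd HC h.2.1)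
      (fun HC h => ⟨toFlat_linear h.1, toFlat_bodyDisjoint h.2.1, toFlat_headDisjoint h.2.2⟩)
      fun F hA h => ⟨Flat.complete_linear h.1, Flat.complete_bodyDisjoint hA.keys_nodup h.2.1,
        Flat.complete_headDisjoint hA.keys_nodup h.2.2⟩).trans_seq flat_reduces_sequence
  · exact tree_reduces_flat.trans (flat_reduces_horn fun F _ ⟨ha, hb, hh⟩ =>
      ⟨F.acyclic_toHorn ha, F.bodyDisjoint_toHorn ha hb, F.headDisjoint_toHorn hh⟩)
  · exact (horn_reduces_normal (fun HC _ h => hbd HC h.1)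
      (fun HC h => ⟨toFlat_bodyDisjoint h.1, toFlat_headDisjoint h.2⟩)
      fun F hA h => ⟨Flat.complete_bodyDisjoint hA.keys_nodup h.1,
        Flat.complete_headDisjoint hA.keys_nodup h.2⟩).trans_seq flat_reduces_tree
  · exact (dag_reduces_flat hS).trans (flat_reduces_horn fun F _ ⟨ha, hl⟩ =>
      ⟨F.acyclic_toHorn ha, F.linear_toHorn hl⟩)
  · exact (horn_reduces_normal hlin (fun HC h => toFlat_linear h)
      fun F _ h => Flat.complete_linear h).trans_seq flat_reduces_dag
  · exact disjunctive_reduces_flat.trans (flat_reduces_horn fun F _ ⟨ha, hb⟩ =>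
      ⟨F.acyclic_toHorn ha, F.bodyDisjoint_toHorn ha hb⟩)
  · exact (horn_reduces_normal (fun HC _ h => hbd HC h) (fun HC h => toFlat_bodyDisjoint h)
      fun F hA h => Flat.complete_bodyDisjoint hA.keys_nodup h).trans_seq flat_reduces_disjunctive
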